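/- Let $\tau=u+iv$ with $v>0$, $q=e^{2\pi i\tau}$, and let $\eta$ be the Dedekind eta function. Let $\mathcal Q(q)=Q(8\tau)$ be the $q$-series $$\mathcal Q(q)=\frac{E^*(4\tau)}{\eta(8\tau)^3}-\frac{4\,\mathcal F_0(q)}{\Theta_4(\tau)},$$ where $E^*(\tau)=1+24\sum_{n\ge1}\sigma_{\rm odd}(n)q^n$ ($\sigma_{\rm odd}(n)$ is the sum of the positive odd divisors of $n$), $\mathcal F_0(q)=\sum_{\beta\ge0}\sum_{\alpha\ge\beta+1}(-1)^{\alpha+\beta}q^{4\alpha^2-(2\beta+1)^2}$ and $\Theta_4(\tau)=\eta(4\tau)^2/\eta(8\tau)$. Let $$A(\tau)=\frac{\eta(4\tau)^8}{\eta(8\tau)^7}=\sum_{n\ge-1}a(n)q^n,\qquad A_{r,8}(\tau)=\sum_{n\equiv r\ (8)}a(n)q^n,\qquad B(\tau)=\frac{\eta(8\tau)^5}{\eta(16\tau)^4},$$ $$M(q)=q^{-1}\sum_{n\ge0}\frac{(-1)^{n+1}q^{8(n+1)^2}\prod_{k=1}^{n}(1-q^{16k-8})}{\prod_{k=1}^{n+1}(1+q^{16k-8})^2},$$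 and, with $a=e^{2\pi iw}$, $a^{1/2}=e^{\pi iw}$ and $b^\nu=e^{2\pi i\nu z}$, $$\mu(w,z;\tau)=\frac{a^{1/2}}{\theta(z;\tau)}\sum_{n\in\mathbb Z}\frac{(-b)^nq^{n(n+1)/2}}{1-aq^n},\qquad \theta(z;\tau)=\sum_{\nu\in\mathbb Z+1/2}(-1)^{\nu-1/2}b^\nu q^{\nu^2/2}.$$ Then the following hold. (1) $\mathcal Q(q)=\sum_{\alpha\ge0}H_\alpha q^{4\alpha-1}$ with integers $H_\alpha$, and $\mathcal Q(q)=q^{-1}+28q^3+39q^7+196q^{11}+161q^{15}+756q^{19}+\cdots$. (2) For all $\tau$ in the upper half-plane, $$\mathcal Q(q)=-\tfrac72A_{3,8}(\tau)+\tfrac32A_{7,8}(\tau)-\tfrac12B(\tau)-2iq^{-1}\mu\!\left(-16\tau,-8\tau-\tfrac12;32\tau\right)+2iq^{-1}\mu\!\left(-16\tau,-24\tau-\tfrac12;32\tau\right).$$ (3) $\mathcal Q$ is the holomorphic part of a weight $1/2$ harmonic weak Maass form $f$ on $\Gamma_1(N)$, for some $N$ divisible by $4$ (weight $1/2$ theta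 multiplier; at each cusp $f$ is, up to an exponentially decaying error, a polynomial in $q^{-1/w}$ for some $w\ge1$), that is, $f=\mathcal Q+f^-$ with $f^-=\sum_{n<0}c^-(n)\Gamma(\tfrac12,4\pi|n|v)q^n$. Its non-holomorphic part is a multiple of the period integral of $\eta(8\tau)^3$, $$f^-(\tau)=-2\sqrt2\,i\int_{-\bar\tau}^{i\infty}\frac{\eta(8z)^3}{(-i(\tau+z))^{1/2}}\,dz,$$ and its shadow is proportional to $\eta(8\tau)^3$: with $\xi_{1/2}=2iv^{1/2}\,\overline{\partial/\partial\bar\tau}$ one has $\xi_{1/2}(f)=-4\,\eta(8\tau)^3$. (4) $\mathcal Q(q)-4M(q)$ is a weakly holomorphic modular form of weight $1/2$ on $\Gamma_1(N)$ for some $N$ divisible by $4$. -/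

import Mathlib

open scoped ContDiff
open UpperHalfPlane (atImInfty)

namespace MockQ

noncomputable section

/-- `q ^ n = exp (2 π i n τ)`. -/
def qpow (τ : ℂ) (n : ℤ) : ℂ := Complex.exp (2 * Real.pi * Complex.I * n * τ)

/-! ### Harmonic weak Maass forms of weight 1/2 -/

/-- The extended quadratic residue symbol `(c/d)` for odd `d` of either sign:
`(c/d) = (c/|d|)`, with the opposite sign if both `c` and `d` are negative; `(0/±1) = 1`. -/
def extLegendre (c d : ℤ) : ℤ :=
  (if c < 0 ∧ d < 0 then -1 else 1) * jacobiSym c d.natAbs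

/-- `ε_d` for odd `d`. -/
def epsOdd (d : ℤ) : ℂ := if d % 4 = 1 then 1 else Complex.I

/-- The weight `1/2` transformation law
`f (γ τ) = (c/d) ε_d⁻¹ (c τ + d)^{1/2} f τ` for `γ ∈ Γ₁(N)`, principal branch. -/
def TransformsHalf (N : ℕ) (f : UpperHalfPlane → ℂ) : Prop :=
  ∀ γ ∈ CongruenceSubgroup.Gamma1 N, ∀ τ : UpperHalfPlane,
    f (γ • τ) = (extLegendre (γ 1 0) (γ 1 1) : ℂ) * (epsOdd (γ 1 1))⁻¹ *
      (((γ 1 0 : ℤ) : ℂ) * (τ : ℂ) + ((γ 1 1 : ℤ) : ℂ)) ^ (1 / 2 : ℂ) * f τ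

/-- `(c τ + d)^{-1/2} f (γ τ)`, the expansion of `f` at the cusp `γ ∞`. -/
def slashHalf (f : UpperHalfPlane → ℂ) (γ : Matrix.SpecialLinearGroup (Fin 2) ℤ)
    (τ : UpperHalfPlane) : ℂ :=
  (((γ 1 0 : ℤ) : ℂ) * (τ : ℂ) + ((γ 1 1 : ℤ) : ℂ)) ^ (-(1 / 2) : ℂ) * f (γ • τ)

/-- `∂/∂u` with `τ = u + i v`. -/
def dU (g : ℂ → ℂ) (z : ℂ) : ℂ := deriv (fun t : ℝ => g (z + (t : ℂ))) 0

/-- `∂/∂v` with `τ = u + i v`. -/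
def dV (g : ℂ → ℂ) (z : ℂ) : ℂ := deriv (fun t : ℝ => g (z + (t : ℂ) * Complex.I)) 0

/-- The weight `k` hyperbolic Laplacian
`-v² (∂²/∂u² + ∂²/∂v²) + i k v (∂/∂u + i ∂/∂v)`. -/
def hypLaplacian (k : ℝ) (f : UpperHalfPlane → ℂ) (τ : UpperHalfPlane) : ℂ :=
  let g : ℂ → ℂ := f ∘ UpperHalfPlane.ofComplex;
  -((τ.im : ℂ) ^ 2) * (dU (dU g) τ + dV (dV g) τ) +
    Complex.I * (k : ℂ) * (τ.im : ℂ) * (dU g τ + Complex.I * dV g τ)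

/-- `ξ_w f = 2 i v^w · conj (∂f/∂τ̄)`, where `∂/∂τ̄ = (∂/∂u + i ∂/∂v) / 2`. -/
def xiOp (w : ℝ) (f : UpperHalfPlane → ℂ) (τ : UpperHalfPlane) : ℂ :=
  let g : ℂ → ℂ := f ∘ UpperHalfPlane.ofComplex
  2 * Complex.I * ((τ.im ^ w : ℝ) : ℂ) *
    (starRingEnd ℂ) ((dU g τ + Complex.I * dV g τ) / 2)

/-- Weight `1/2` harmonic weak Maass forms on `Γ₁(N)`, `4 ∣ N`. The last two fields say that
at `∞`, and at every cusp, `f` is a polynomial in `q^{-1}` (in `q^{-1/w}` for some `w ≥ 1`)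
up to an exponentially small error. -/
structure IsHarmonicWeakMaassFormHalf (N : ℕ) (f : UpperHalfPlane → ℂ) : Prop where
  level_pos : 0 < N
  four_dvd : 4 ∣ N
  smooth : ContDiffOn ℝ ∞ (f ∘ UpperHalfPlane.ofComplex) {z : ℂ | 0 < z.im}
  transforms : TransformsHalf N f
  harmonic : ∀ τ : UpperHalfPlane, hypLaplacian (1 / 2) f τ = 0
  at_infty : ∃ P : Polynomial ℂ, ∃ ε : ℝ, 0 < ε ∧
    (fun τ : UpperHalfPlane => f τ - P.eval (qpow τ (-1))) =O[atImInfty]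
      fun τ : UpperHalfPlane => Real.exp (-ε * τ.im)
  at_cusps : ∀ γ : Matrix.SpecialLinearGroup (Fin 2) ℤ,
    ∃ w : ℕ, 0 < w ∧ ∃ P : Polynomial ℂ, ∃ ε : ℝ, 0 < ε ∧
      (fun τ : UpperHalfPlane => slashHalf f γ τ - P.eval (qpow ((τ : ℂ) / (w : ℂ)) (-1)))
        =O[atImInfty] fun τ : UpperHalfPlane => Real.exp (-ε * τ.im)

/-- Weight `1/2` weakly holomorphic modular forms on `Γ₁(N)`, `4 ∣ N`: holomorphic on the upper
half-plane with at most poles at the cusps, i.e. at most exponential growth there. -/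
structure IsWeaklyHolomorphicHalf (N : ℕ) (f : UpperHalfPlane → ℂ) : Prop where
  level_pos : 0 < N
  four_dvd : 4 ∣ N
  holomorphic : DifferentiableOn ℂ (f ∘ UpperHalfPlane.ofComplex) {z : ℂ | 0 < z.im}
  transforms : TransformsHalf N f
  at_cusps : ∀ γ : Matrix.SpecialLinearGroup (Fin 2) ℤ, ∃ C : ℝ,
    slashHalf f γ =O[atImInfty] fun τ : UpperHalfPlane => Real.exp (C * τ.im)

/-- The incomplete Gamma function `Γ(α; x) = ∫_x^∞ e^{-t} t^{α-1} dt`. -/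
def incGamma (α x : ℝ) : ℝ := ∫ t in Set.Ioi x, Real.exp (-t) * t ^ (α - 1)

/-- `f = f⁺ + f⁻` is the decomposition of `f` into its holomorphic part
`f⁺ = ∑_{n ≫ -∞} c⁺(n) q^n` and its non-holomorphic part
`f⁻ = ∑_{n < 0} c⁻(n) Γ(1/2, 4π|n|v) q^n`. -/
def HasParts (f fPlus fMinus : UpperHalfPlane → ℂ) : Prop :=
  (∀ τ, f τ = fPlus τ + fMinus τ) ∧
  (∃ c : ℤ → ℂ, (∃ n₀ : ℤ, ∀ n < n₀, c n = 0) ∧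
    ∀ τ : UpperHalfPlane, HasSum (fun n : ℤ => c n * qpow τ n) (fPlus τ)) ∧
  (∃ c : ℤ → ℂ, (∀ n : ℤ, 0 ≤ n → c n = 0) ∧
    ∀ τ : UpperHalfPlane, HasSum
      (fun n : ℤ => c n * (incGamma (1 / 2) (4 * Real.pi * |(n : ℝ)| * τ.im) : ℂ) * qpow τ n)
      (fMinus τ))

/-- The period integral `∫_{-τ̄}^{i∞} g(z) (-i (τ + z))^{-1/2} dz`, along the vertical ray
`z = -τ̄ + i t`, `t > 0`. -/
def periodIntegral (g : ℂ → ℂ) (τ : UpperHalfPlane) : ℂ :=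
  ∫ t in Set.Ioi (0 : ℝ),
    g (-(starRingEnd ℂ) (τ : ℂ) + Complex.I * t) /
      (-Complex.I * ((τ : ℂ) + (-(starRingEnd ℂ) (τ : ℂ) + Complex.I * t))) ^ (1 / 2 : ℂ) *
      Complex.I

/-! ### The Appell-Lerch function `μ` -/

/-- `θ(v;τ) = ∑_{ν ∈ ℤ + 1/2} (-1)^{ν - 1/2} b^ν q^{ν²/2}` with `b^ν = e^{2πiνv}`; here
`ν = n + 1/2`. -/
def theta (v τ : ℂ) : ℂ :=
  ∑' n : ℤ, (-1 : ℂ) ^ n * Complex.exp (2 * Real.pi * Complex.I * ((n : ℂ) + 1 / 2) * v) *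
    Complex.exp (Real.pi * Complex.I * ((n : ℂ) + 1 / 2) ^ 2 * τ)

/-- `μ(u,v;τ) = a^{1/2} / θ(v;τ) · ∑_{n ∈ ℤ} (-b)^n q^{n(n+1)/2} / (1 - a q^n)`, with
`a^{1/2} = e^{πiu}` and `b = e^{2πiv}`. -/
def mu (u v τ : ℂ) : ℂ :=
  Complex.exp (Real.pi * Complex.I * u) / theta v τ *
    ∑' n : ℤ, (-Complex.exp (2 * Real.pi * Complex.I * v)) ^ n *
      Complex.exp (Real.pi * Complex.I * ((n : ℂ) * ((n : ℂ) + 1)) * τ) /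
        (1 - Complex.exp (2 * Real.pi * Complex.I * u) * qpow τ n)

/-! ### The modular forms `A`, `A_{3,8}`, `A_{7,8}`, `B` -/

/-- `A(τ) = η(4τ)^8 / η(8τ)^7`. -/
def formA (τ : ℂ) : ℂ := ModularForm.eta (4 * τ) ^ 8 / ModularForm.eta (8 * τ) ^ 7

/-- `B(τ) = η(8τ)^5 / η(16τ)^4`. -/
def formB (τ : ℂ) : ℂ := ModularForm.eta (8 * τ) ^ 5 / ModularForm.eta (16 * τ) ^ 4

/-- The Fourier coefficient `a(n)` of `A(τ) = ∑ a(n) q^n`, computed on the line `Im τ = 1`. -/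
def coeffA (n : ℤ) : ℂ :=
  ∫ u in (0 : ℝ)..1, formA ((u : ℂ) + Complex.I) * qpow ((u : ℂ) + Complex.I) (-n)

/-- The sieved form `A_{r,8}(τ) = ∑_{n ≡ r mod 8} a(n) q^n`. -/
def sieveA (r : ℤ) (τ : ℂ) : ℂ :=
  ∑' n : ℤ, if n ≡ r [ZMOD 8] then coeffA n * qpow τ n else 0

/-! ### The mock theta function `M` -/

/-- `M(q) = q⁻¹ ∑_{n ≥ 0} (-1)^{n+1} q^{8(n+1)²} ∏_{k=1}^{n} (1 - q^{16k-8})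
/ ∏_{k=1}^{n+1} (1 + q^{16k-8})²`. -/
def mockM (τ : ℂ) : ℂ :=
  qpow τ (-1) * ∑' n : ℕ, (-1 : ℂ) ^ (n + 1) * qpow τ (8 * ((n : ℤ) + 1) ^ 2) *
    (∏ k ∈ Finset.Icc 1 n, (1 - qpow τ (16 * (k : ℤ) - 8))) /
    (∏ k ∈ Finset.Icc 1 (n + 1), (1 + qpow τ (16 * (k : ℤ) - 8)) ^ 2)

/-! ### The `q`-series `𝒬` -/

/-- `E*(τ) = 1 + 24 ∑_{n ≥ 1} σ_odd(n) q^n`, with `σ_odd(n)` the sum of the positive odd divisors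
of `n` (the term `n = 0` of the sum below is zero). -/
def eisenStar (τ : ℂ) : ℂ :=
  1 + 24 * ∑' n : ℕ, ((∑ d ∈ n.divisors with Odd d, d : ℕ) : ℂ) * qpow τ n

/-- `ℱ₀(q) = ∑_{β ≥ 0} ∑_{α ≥ β+1} (-1)^{α+β} q^{4α² - (2β+1)²}`; here `α = β + 1 + k`. -/
def seriesF0 (τ : ℂ) : ℂ :=
  ∑' β : ℕ, ∑' k : ℕ, (-1 : ℂ) ^ ((β + 1 + k) + β) *
    qpow τ (4 * ((β : ℤ) + 1 + k) ^ 2 - (2 * (β : ℤ) + 1) ^ 2)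

/-- `Θ₄(τ) = η(4τ)² / η(8τ)`. -/
def theta4 (τ : ℂ) : ℂ := ModularForm.eta (4 * τ) ^ 2 / ModularForm.eta (8 * τ)

/-- `𝒬(q) = Q(8τ)`, the series with `𝒬 + 4 ℱ₀ / Θ₄ = E*(4τ) / η(8τ)³`. -/
def calQ (τ : ℂ) : ℂ :=
  eisenStar (4 * τ) / ModularForm.eta (8 * τ) ^ 3 - 4 * seriesF0 τ / theta4 τ

end

end MockQ

set_option autoImplicit false
open Complex Filter Topology MeasureTheory Set
open scoped Real UpperHalfPlane ModularForm MatrixGroups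

namespace MockQ

local notation "ℍₒ" => UpperHalfPlane.upperHalfPlaneSet

/-! Let θ₂, θ₃, θ₄ denote the theta constants. After multiplication by η(8τ)³ = θ₂θ₃θ₄/2 (everything
at 8τ) all the objects become forms of weight two. Here A gives θ₄⁴, B gives θ₃²θ₄², and E*(4τ) is
itself 2θ₃⁴ − θ₄⁴, while ℱ₀/Θ₄ and M bring in the Appell sums `appellFour` and `appellTwo`
(`calQ_eq`, `mockM_eq`, `oddAppell_eq`). The quartics in the theta constants are stable under
SL₂(ℤ), so only the two Appell sums carry mock behaviour.

That behaviour comes from one integral on the imaginary axis. Integrating a Gaussian times a theta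
series against 1/cosh(πy) in two ways gives Watson's identity `watson_axis`: S exchanges the two
Appell sums up to a Mordell integral. The Laplace transform of η(iu)³ is 1/cosh(πy), so this Mordell
integral is the period integral of η³ plus its S-transform (`period_axis`). Hence appellTwo/θ₂ and
appellFour/θ₄, both corrected by the same term `etaPeriod`/2, are exchanged by S on the axis. The
antiholomorphic derivatives cancel in that relation, so the identity theorem carries it to the whole
half-plane (`ratio_S`).

Times η³, the corrected quotients are `compTwo` and `compFour`. Together with the translate of
`compFour` by 1 they are permuted by S and T in weight two. Their sum `compSum` is therefore modular
of level one. All three have the same non-holomorphic part, so each differs from the average by a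
holomorphic form, which `comp_pair` identifies with a quartic in the thetas. Thus 𝒬 plus its
correction is (quartic − (2/3)·`compSum`)/η³ at 8τ, and in 𝒬 − 4M the terms in `compSum` cancel.
Both are instances of `quotForm`, for which the modular properties are proved once. The theta
multiplier comes from the transformation law of ∑ q^{n²} (`thetaQ_moebius`), since each θⱼ(8τ) is a
combination of its dilates. At a cusp the form becomes a constant times another such quotient at (Aτ
+ B)/D (`exists_slashHalf_quotForm`). Harmonicity, the shadow and the incomplete Gamma expansion are
computed directly from the period integral.

The relation of M to `appellTwo` is of Bailey type: finite partial fractions for a squared inverse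
product, an exchange of summations and a summable confluent series (`hasSum_mock`). The two μ-values
share a theta denominator and their difference collapses to the same odd-index sum
(`mu_difference`). Sieving A is the eigenspace decomposition of θ₄⁴ under T. Integrality and the
first coefficients of 𝒬 follow from an identity of integral power series whose divisor has constant
term 1.

Identities among holomorphic forms rest on two facts: cusp forms of level one and weight below 12
vanish, and those of weight 12 are multiples of η²⁴. `eq_zero_of_pair` extends the first to
index-three families. -/

/-! ### Vanishing criteria for holomorphic forms of level one and for families permuted by S and T
-/

theorem im_neg_one_div_pos {τ : ℂ} (hτ : 0 < τ.im) : 0 < (-1 / τ).im := by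
  have := UpperHalfPlane.im_inv_neg_coe_pos ⟨τ, hτ⟩
  rw [neg_div, one_div, ← inv_neg]; exact this

theorem coe_S_smul (τ : ℍ) : ((ModularGroup.S • τ : ℍ) : ℂ) = -1 / (τ : ℂ) := by
  rw [UpperHalfPlane.modular_S_smul]
  simp [neg_div, inv_neg]

theorem coe_T_smul (τ : ℍ) : ((ModularGroup.T • τ : ℍ) : ℂ) = (τ : ℂ) + 1 := by
  rw [UpperHalfPlane.modular_T_smul]
  simp [add_comm]

theorem slash_SL_of_ST {k : ℤ} {F : ℂ → ℂ}
    (hS : ∀ τ : ℂ, 0 < τ.im → F (-1 / τ) = τ ^ k * F τ)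
    (hT : ∀ τ : ℂ, 0 < τ.im → F (τ + 1) = F τ) (γ : SL(2, ℤ)) :
    (fun τ : ℍ => F τ) ∣[k] γ = fun τ : ℍ => F τ := by
  refine SlashInvariantForm.slash_action_generators_SL2Z ?_ ?_ γ
  · ext τ
    rw [ModularForm.SL_slash_apply]
    simp only [coe_S_smul, ModularGroup.denom_S]
    rw [hS τ τ.im_pos, zpow_neg]
    field_simp [zpow_ne_zero k τ.ne_zero]
  · ext τ
    rw [ModularForm.SL_slash_apply]
    simp only [coe_T_smul]
    rw [hT τ τ.im_pos, ModularGroup.denom_apply]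
    simp [ModularGroup.T]

theorem apply_SL_of_ST {k : ℤ} {F : ℂ → ℂ}
    (hS : ∀ τ : ℂ, 0 < τ.im → F (-1 / τ) = τ ^ k * F τ)
    (hT : ∀ τ : ℂ, 0 < τ.im → F (τ + 1) = F τ) (γ : SL(2, ℤ)) (τ : ℍ) :
    F ((γ • τ : ℍ) : ℂ) = UpperHalfPlane.denom γ τ ^ k * F τ := by
  have := congrFun (slash_SL_of_ST hS hT γ) τ
  rw [ModularForm.SL_slash_apply, zpow_neg] at this
  rw [← this]
  field_simp [zpow_ne_zero k (UpperHalfPlane.denom_ne_zero (γ : GL (Fin 2) ℝ) τ)]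

/-- A cusp form of level one attached to a function on the upper half-plane. -/
def cuspFormOfST {k : ℤ} (F : ℂ → ℂ) (hol : DifferentiableOn ℂ F ℍₒ)
    (hS : ∀ τ : ℂ, 0 < τ.im → F (-1 / τ) = τ ^ k * F τ)
    (hT : ∀ τ : ℂ, 0 < τ.im → F (τ + 1) = F τ)
    (h0 : Tendsto (fun τ : ℍ => F τ) atImInfty (𝓝 0)) : CuspForm 𝒮ℒ k where
  toFun := fun τ => F τ
  slash_action_eq' A hA := by
    obtain ⟨A, rfl⟩ := hA
    exact slash_SL_of_ST hS hT A
  holo' := by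
    rw [UpperHalfPlane.mdifferentiable_iff]
    refine hol.congr fun z hz => ?_
    simp [UpperHalfPlane.ofComplex_apply_of_im_pos hz]
  zero_at_cusps' hc := by
    rw [Subgroup.IsArithmetic.isCusp_iff_isCusp_SL2Z] at hc
    rw [OnePoint.isZeroAt_iff_forall_SL2Z hc]
    intro γ _
    rw [slash_SL_of_ST hS hT]
    exact h0

theorem eq_zero_of_level_one {k : ℤ} (hk : k < 12) {F : ℂ → ℂ} (hol : DifferentiableOn ℂ F ℍₒ)
    (hS : ∀ τ : ℂ, 0 < τ.im → F (-1 / τ) = τ ^ k * F τ)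
    (hT : ∀ τ : ℂ, 0 < τ.im → F (τ + 1) = F τ)
    (h0 : Tendsto (fun τ : ℍ => F τ) atImInfty (𝓝 0)) {τ : ℂ} (hτ : 0 < τ.im) : F τ = 0 := by
  have := rank_zero_iff_forall_zero.mp (CuspForm.rank_eq_zero_of_weight_lt_twelve hk)
    (cuspFormOfST F hol hS hT h0)
  exact DFunLike.congr_fun this (⟨τ, hτ⟩ : ℍ)

theorem eq_smul_eta_of_level_one {F : ℂ → ℂ} (hol : DifferentiableOn ℂ F ℍₒ)
    (hS : ∀ τ : ℂ, 0 < τ.im → F (-1 / τ) = τ ^ 12 * F τ)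
    (hT : ∀ τ : ℂ, 0 < τ.im → F (τ + 1) = F τ)
    (h0 : Tendsto (fun τ : ℍ => F τ) atImInfty (𝓝 0)) :
    ∃ c : ℂ, ∀ τ : ℂ, 0 < τ.im → F τ = c * ModularForm.eta τ ^ 24 := by
  obtain ⟨c, hc⟩ := CuspForm.exists_smul_discriminant_of_weight_eq_twelve
    (cuspFormOfST (k := 12) F hol (by exact_mod_cast hS) hT h0)
  refine ⟨c, fun τ hτ => ?_⟩
  have := DFunLike.congr_fun hc (⟨τ, hτ⟩ : ℍ)
  exact this.symm

/-- The upper half-plane is connected, so its ring of holomorphic functions has no zero divisors. -/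
theorem eqOn_zero_or_of_mul {F G : ℂ → ℂ} (hF : DifferentiableOn ℂ F ℍₒ)
    (hG : DifferentiableOn ℂ G ℍₒ) (h : ∀ τ : ℂ, 0 < τ.im → F τ * G τ = 0) :
    (∀ τ : ℂ, 0 < τ.im → F τ = 0) ∨ (∀ τ : ℂ, 0 < τ.im → G τ = 0) := by
  have o : IsOpen ℍₒ := UpperHalfPlane.isOpen_upperHalfPlaneSet
  have c : IsPreconnected ℍₒ := Convex.isPreconnected (convex_halfSpace_im_gt 0)
  exact AnalyticOnNhd.eq_zero_or_eq_zero_of_smul_eq_zero (hF.analyticOnNhd o)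
    (hG.analyticOnNhd o) (fun z hz => h z hz) c

theorem pair_comp_S {k : ℤ} (hk2 : Even k) {F G : ℂ → ℂ}
    (hS : ∀ τ : ℂ, 0 < τ.im → F (-1 / τ) = τ ^ k * G τ) (τ : ℂ) (hτ : 0 < τ.im) :
    G (-1 / τ) = τ ^ k * F τ := by
  have h0 : τ ≠ 0 := fun h => by simp [h] at hτ
  have h := hS (-1 / τ) (im_neg_one_div_pos hτ)
  rw [show -1 / (-1 / τ) = τ by field_simp, neg_div, hk2.neg_zpow, one_div, inv_zpow] at h
  rw [h, neg_div, one_div]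
  field_simp [zpow_ne_zero k h0]

/-- As Möbius maps STS = T⁻¹ST⁻¹. Evaluating `hS` at y = −1/τ + 1 and at τ − 1, with F of period 1
and G of period 2, leaves the factor ((τ − 1)/y)^k, and τ·y = τ − 1. -/
theorem pair_shift_comp_S {k : ℤ} {F G : ℂ → ℂ}
    (hS : ∀ τ : ℂ, 0 < τ.im → F (-1 / τ) = τ ^ k * G τ)
    (hFT : ∀ τ : ℂ, 0 < τ.im → F (τ + 1) = F τ)
    (hGT : ∀ τ : ℂ, 0 < τ.im → G (τ + 2) = G τ) (τ : ℂ) (hτ : 0 < τ.im) :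
    G (-1 / τ + 1) = τ ^ k * G (τ + 1) := by
  have h0 : τ ≠ 0 := fun h => by simp [h] at hτ
  have hm : 0 < (τ - 1).im := by simpa using hτ
  have h1 : τ - 1 ≠ 0 := fun h => by simp [h] at hm
  have hy : 0 < (-1 / τ + 1).im := by simpa using im_neg_one_div_pos hτ
  have hy0 : -1 / τ + 1 ≠ 0 := fun h => by simp [h] at hy
  have e1 := hS _ hy
  have e2 : -1 / (-1 / τ + 1) = -1 / (τ - 1) - 1 := by
    have : -1 + τ ≠ 0 := by rwa [neg_add_eq_sub]
    field_simp
    ring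
  have e3 : F (-1 / (τ - 1) - 1) = F (-1 / (τ - 1)) := by
    have := hFT (-1 / (τ - 1) - 1) (by simpa using im_neg_one_div_pos hm)
    rw [← this]; ring_nf
  have e4 := hGT (τ - 1) hm
  rw [show τ - 1 + 2 = τ + 1 by ring] at e4
  rw [e2, e3, hS _ hm, ← e4, show τ - 1 = τ * (-1 / τ + 1) by field_simp; ring, mul_zpow] at e1
  have hne := zpow_ne_zero k hy0
  apply mul_left_cancel₀ hne
  rw [← e1]; ring

theorem tendsto_add_one_atImInfty {G : ℂ → ℂ} {l : Filter ℂ}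
    (h : Tendsto (fun τ : ℍ => G τ) atImInfty l) :
    Tendsto (fun τ : ℍ => G (τ + 1)) atImInfty l := by
  have h2 : Tendsto (fun τ : ℍ => ((1 : ℝ) +ᵥ τ : ℍ)) atImInfty atImInfty := by
    simp only [atImInfty, tendsto_comap_iff]
    refine tendsto_comap.congr fun τ => ?_
    simp
  refine (h.comp h2).congr fun τ => ?_
  simp [add_comm]

/-- The functions F, G and G(· + 1) are permuted by S and T up to automorphy factors. Their product
is a level-one cusp form of weight 3k < 12, hence zero, so one of the three vanishes and S or T
transports this to the others. -/
theorem eq_zero_of_pair {k : ℤ} (hk : 3 * k < 12) (hk2 : Even k) {F G : ℂ → ℂ}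
    (hF : DifferentiableOn ℂ F ℍₒ) (hG : DifferentiableOn ℂ G ℍₒ)
    (hS : ∀ τ : ℂ, 0 < τ.im → F (-1 / τ) = τ ^ k * G τ)
    (hFT : ∀ τ : ℂ, 0 < τ.im → F (τ + 1) = F τ)
    (hGT : ∀ τ : ℂ, 0 < τ.im → G (τ + 2) = G τ)
    (hF0 : Tendsto (fun τ : ℍ => F τ) atImInfty (𝓝 0))
    (hG0 : Tendsto (fun τ : ℍ => G τ) atImInfty (𝓝 0)) :
    ∀ τ : ℂ, 0 < τ.im → F τ = 0 ∧ G τ = 0 := by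
  have hS' := pair_comp_S hk2 hS
  have hG1 : DifferentiableOn ℂ (fun τ => G (τ + 1)) ℍₒ :=
    hG.comp (by fun_prop) fun z hz => by
      simpa [UpperHalfPlane.upperHalfPlaneSet] using hz
  have key : ∀ τ : ℂ, 0 < τ.im → F τ * (G τ * G (τ + 1)) = 0 := fun τ hτ => by
    refine eq_zero_of_level_one (F := fun τ => F τ * (G τ * G (τ + 1))) hk
      (hF.mul (hG.mul hG1)) (fun τ hτ => ?_) (fun τ hτ => ?_) ?_ hτ
    · have h0 : τ ≠ 0 := fun h => by simp [h] at hτ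
      rw [hS τ hτ, hS' τ hτ, pair_shift_comp_S hS hFT hGT τ hτ, show 3 * k = k + k + k by ring,
        zpow_add₀ h0, zpow_add₀ h0]
      ring
    · rw [hFT τ hτ, show τ + 1 + 1 = τ + 2 by ring, hGT τ hτ]
      ring
    · simpa using hF0.mul (hG0.mul (tendsto_add_one_atImInfty hG0))
  have hFG : (∀ τ : ℂ, 0 < τ.im → F τ = 0) → (∀ τ : ℂ, 0 < τ.im → G τ = 0) := fun h τ hτ => by
    have h0 : τ ≠ 0 := fun h => by simp [h] at hτ
    have := hS τ hτ
    rw [h _ (im_neg_one_div_pos hτ)] at this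
    exact (mul_eq_zero.mp this.symm).resolve_left (zpow_ne_zero k h0)
  have hGF : (∀ τ : ℂ, 0 < τ.im → G τ = 0) → (∀ τ : ℂ, 0 < τ.im → F τ = 0) := fun h τ hτ => by
    have h0 : τ ≠ 0 := fun h => by simp [h] at hτ
    have := hS' τ hτ
    rw [h _ (im_neg_one_div_pos hτ)] at this
    exact (mul_eq_zero.mp this.symm).resolve_left (zpow_ne_zero k h0)
  rcases eqOn_zero_or_of_mul hF (hG.mul hG1) key with h | h
  · exact fun τ hτ => ⟨h τ hτ, hFG h τ hτ⟩
  rcases eqOn_zero_or_of_mul hG hG1 h with h | h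
  · exact fun τ hτ => ⟨hGF h τ hτ, h τ hτ⟩
  · have h' : ∀ τ : ℂ, 0 < τ.im → G τ = 0 := fun τ hτ => by
      have := h (τ - 1) (by simpa using hτ)
      rwa [sub_add_cancel] at this
    exact fun τ hτ => ⟨hGF h' τ hτ, h' τ hτ⟩

/-- A continuous map from a connected set into the finite set of n-th roots of a number is constant.
This is how undetermined roots of unity are removed throughout. -/
theorem eq_of_pow_eq_const {r : ℂ → ℂ} (hr : ContinuousOn r ℍₒ) {n : ℕ} (hn : n ≠ 0) {c : ℂ}
    (h : ∀ τ : ℂ, 0 < τ.im → r τ ^ n = c) {τ τ' : ℂ} (hτ : 0 < τ.im) (hτ' : 0 < τ'.im) :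
    r τ = r τ' := by
  have hc : IsPreconnected ℍₒ := Convex.isPreconnected (convex_halfSpace_im_gt 0)
  have hfin : {z : ℂ | z ^ n = c}.Finite := by
    have hp : (Polynomial.X ^ n - Polynomial.C c) ≠ 0 := Polynomial.X_pow_sub_C_ne_zero (by omega) c
    refine ((Polynomial.X ^ n - Polynomial.C c).rootSet_finite ℂ).subset fun z hz => ?_
    rw [Polynomial.mem_rootSet]
    refine ⟨hp, ?_⟩
    simp only [mem_ofPred_eq] at hz
    simp [hz]
  exact hc.constant_of_mapsTo hfin.isDiscrete hr (fun z hz => h z hz) hτ hτ'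

theorem ne_zero_of_im_pos {τ : ℂ} (hτ : 0 < τ.im) : τ ≠ 0 := fun h => by simp [h] at hτ

/-! ### The square root of the automorphy factor -/

/-- `(-iτ)^{1/2}` -/
noncomputable def rootS (τ : ℂ) : ℂ := (-I * τ) ^ (1 / 2 : ℂ)

theorem neg_I_mul_re_pos {τ : ℂ} (hτ : 0 < τ.im) : 0 < (-I * τ).re := by simpa using hτ

theorem rootS_sq (τ : ℂ) : rootS τ ^ 2 = -I * τ := by
  rw [rootS, ← cpow_nat_mul]
  norm_num

theorem rootS_ne_zero {τ : ℂ} (hτ : 0 < τ.im) : rootS τ ≠ 0 := fun h => by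
  have := rootS_sq τ
  rw [h] at this
  simp [ne_zero_of_im_pos hτ] at this

theorem rootS_pow_four (τ : ℂ) : rootS τ ^ 4 = -τ ^ 2 := by
  rw [show rootS τ ^ 4 = (rootS τ ^ 2) ^ 2 by ring, rootS_sq]
  ring_nf; simp

theorem differentiableAt_rootS {τ : ℂ} (hτ : 0 < τ.im) : DifferentiableAt ℂ rootS τ := by
  have : -I * τ ∈ slitPlane := Or.inl (neg_I_mul_re_pos hτ)
  unfold rootS
  exact (DifferentiableAt.cpow_const (by fun_prop) this)

theorem rootS_mul_comp_S {τ : ℂ} (hτ : 0 < τ.im) : rootS τ * rootS (-1 / τ) = 1 := by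
  have h0 := ne_zero_of_im_pos hτ
  have h1 : -I * (-1 / τ) = (-I * τ)⁻¹ := by
    rw [mul_inv, inv_neg, inv_I]
    field_simp
  unfold rootS
  rw [h1, inv_cpow, mul_inv_cancel₀]
  · exact rootS_ne_zero hτ
  · intro h
    have h2 := neg_I_mul_re_pos hτ
    rw [arg_eq_pi_iff] at h
    linarith [h.1]

/-! ### Theta constants -/

/-- The theta constant `θ₃`. -/
noncomputable def th3 (τ : ℂ) : ℂ := jacobiTheta₂ 0 τ

/-- The theta constant `θ₄`. -/
noncomputable def th4 (τ : ℂ) : ℂ := jacobiTheta₂ (1 / 2) τ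

/-- The theta constant `θ₂`. -/
noncomputable def th2 (τ : ℂ) : ℂ := cexp (π * I * τ / 4) * jacobiTheta₂ (τ / 2) τ

/-- Since n² ≡ n mod 2, the factor e^{πin²} equals e^{πin}, which is a shift of z by one half. -/
theorem jacobiTheta₂_add_one_right (z τ : ℂ) :
    jacobiTheta₂ z (τ + 1) = jacobiTheta₂ (z + 1 / 2) τ := by
  refine tsum_congr fun n => ?_
  simp only [jacobiTheta₂_term]
  obtain ⟨k, hk⟩ := Int.even_mul_pred_self n
  have hk' : (n : ℂ) * (n - 1) = k + k := by exact_mod_cast hk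
  rw [Complex.exp_eq_exp_iff_exists_int]
  exact ⟨k, by linear_combination (π * I) * hk'⟩

theorem th3_add_one (τ : ℂ) : th3 (τ + 1) = th4 τ := by
  rw [th3, jacobiTheta₂_add_one_right, zero_add, th4]

theorem th4_add_one (τ : ℂ) : th4 (τ + 1) = th3 τ := by
  rw [th4, jacobiTheta₂_add_one_right, th3, show (1 / 2 + 1 / 2 : ℂ) = 0 + 1 by norm_num,
    jacobiTheta₂_add_left]

theorem th2_add_one (τ : ℂ) : th2 (τ + 1) = cexp (π * I / 4) * th2 τ := by
  rw [th2, jacobiTheta₂_add_one_right, show (τ + 1) / 2 + 1 / 2 = τ / 2 + 1 by ring,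
    jacobiTheta₂_add_left, th2, ← mul_assoc, ← Complex.exp_add]
  ring_nf

theorem th3_S {τ : ℂ} (hτ : 0 < τ.im) : th3 (-1 / τ) = rootS τ * th3 τ := by
  have h := jacobiTheta₂_functional_equation 0 τ
  have h1 := rootS_ne_zero hτ
  simp only [ne_eq, OfNat.ofNat_ne_zero, not_false_eq_true, zero_pow, mul_zero, zero_div,
    Complex.exp_zero, mul_one] at h
  rw [th3, th3, h]
  change _ = rootS τ * (1 / rootS τ * _)
  field_simp

theorem th2_S {τ : ℂ} (hτ : 0 < τ.im) : th2 (-1 / τ) = rootS τ * th4 τ := by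
  have h := jacobiTheta₂_functional_equation (1 / 2) τ
  have h1 := rootS_ne_zero hτ
  rw [th4, h, th2]
  change _ = rootS τ * (1 / rootS τ * _ * _)
  rw [← jacobiTheta₂_neg_left (1 / 2 / τ)]
  field_simp
  ring_nf

theorem th4_S {τ : ℂ} (hτ : 0 < τ.im) : th4 (-1 / τ) = rootS τ * th2 τ := by
  have h := th2_S (im_neg_one_div_pos hτ)
  have h0 := ne_zero_of_im_pos hτ
  rw [show -1 / (-1 / τ) = τ by field_simp] at h
  rw [h, ← mul_assoc, rootS_mul_comp_S hτ, one_mul]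

theorem differentiableAt_th3 {τ : ℂ} (hτ : 0 < τ.im) : DifferentiableAt ℂ th3 τ :=
  differentiableAt_jacobiTheta₂_snd 0 hτ

theorem differentiableAt_th4 {τ : ℂ} (hτ : 0 < τ.im) : DifferentiableAt ℂ th4 τ :=
  differentiableAt_jacobiTheta₂_snd _ hτ

theorem differentiableAt_jacobiTheta₂_comp {f : ℂ → ℂ} {τ : ℂ} (hf : DifferentiableAt ℂ f τ)
    (hτ : 0 < τ.im) : DifferentiableAt ℂ (fun τ => jacobiTheta₂ (f τ) τ) τ :=
  (hasFDerivAt_jacobiTheta₂ (f τ) hτ).differentiableAt.comp (f := fun τ => (f τ, τ)) τ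
    (hf.prodMk differentiableAt_id)

theorem differentiableAt_th2 {τ : ℂ} (hτ : 0 < τ.im) : DifferentiableAt ℂ th2 τ := by
  unfold th2
  exact DifferentiableAt.mul (by fun_prop)
    (differentiableAt_jacobiTheta₂_comp (f := fun τ => τ / 2) (by fun_prop) hτ)

theorem norm_cexp_mul_I (a : ℝ) (τ : ℂ) : ‖cexp (a * I * τ)‖ = Real.exp (-a * τ.im) := by
  rw [Complex.norm_exp]
  simp

theorem tendsto_cexp_atImInfty {a : ℝ} (ha : 0 < a) :
    Tendsto (fun τ : ℍ => cexp (a * I * τ)) atImInfty (𝓝 0) := by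
  rw [tendsto_zero_iff_norm_tendsto_zero]
  simp only [norm_cexp_mul_I]
  have h1 : Tendsto (fun τ : ℍ => τ.im) atImInfty atTop := tendsto_comap
  refine Real.tendsto_exp_atBot.comp ?_
  simpa only [UpperHalfPlane.coe_im, neg_mul, Function.comp_def, tendsto_neg_atBot_iff] using
    h1.const_mul_atTop ha

/-- Termwise limits at `i∞` of series dominated by a theta series. -/
theorem tendsto_tsum_atImInfty {ι : Type*} {f : ι → ℂ → ℂ} {g : ι → ℂ} {b : ι → ℝ} (hb : Summable b)
    (hlim : ∀ n, Tendsto (fun τ : ℍ => f n τ) atImInfty (𝓝 (g n)))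
    (hbd : ∀ n, ∀ τ : ℂ, 1 ≤ τ.im → ‖f n τ‖ ≤ b n) :
    Tendsto (fun τ : ℍ => ∑' n, f n τ) atImInfty (𝓝 (∑' n, g n)) := by
  refine tendsto_tsum_of_dominated_convergence hb hlim ?_
  have h1 : Tendsto (fun τ : ℍ => τ.im) atImInfty atTop := tendsto_comap
  filter_upwards [h1.eventually_ge_atTop 1] with τ hτ n
  exact hbd n τ (by simpa using hτ)

theorem summable_exp_neg_quadratic {c : ℝ} (hc : 0 < c) (d : ℝ) :
    Summable fun n : ℤ => Real.exp (-c * n ^ 2 + d * n) := by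
  have := (summable_jacobiTheta₂_term_iff (-(d / (2 * π)) * I) ((c / π : ℝ) * I)).mpr
    (by simp; positivity)
  refine this.norm.congr fun n => ?_
  rw [norm_jacobiTheta₂_term]
  congr 1
  rw [show (-(d / (2 * π)) * I : ℂ) = ((-(d / (2 * π)) : ℝ) : ℂ) * I by push_cast; ring]
  simp only [mul_im, ofReal_re, ofReal_im, I_im, I_re]
  field_simp
  ring

theorem tendsto_th3_atImInfty : Tendsto (fun τ : ℍ => th3 τ) atImInfty (𝓝 1) := by
  have := tendsto_tsum_atImInfty (f := fun n τ => jacobiTheta₂_term n 0 τ)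
    (g := fun n => if n = 0 then 1 else 0) (b := fun n => Real.exp (-π * n ^ 2 + 0 * n))
    (summable_exp_neg_quadratic Real.pi_pos 0) (fun n => ?_) (fun n τ hτ => ?_)
  · simpa [th3, jacobiTheta₂] using this
  · split_ifs with h
    · subst h; simp [jacobiTheta₂_term]
    · have h1 : 0 < π * (n : ℝ) ^ 2 := by positivity
      refine (tendsto_cexp_atImInfty h1).congr fun τ => ?_
      simp only [jacobiTheta₂_term]
      push_cast; ring_nf
  · rw [norm_jacobiTheta₂_term]
    apply Real.exp_le_exp.mpr
    have : 0 ≤ π * (n : ℝ) ^ 2 := by positivity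
    simp
    nlinarith

theorem tendsto_th4_atImInfty : Tendsto (fun τ : ℍ => th4 τ) atImInfty (𝓝 1) :=
  (tendsto_add_one_atImInfty tendsto_th3_atImInfty).congr fun τ => th3_add_one τ

theorem tendsto_th2_mul_atImInfty :
    Tendsto (fun τ : ℍ => jacobiTheta₂ ((τ : ℂ) / 2) τ) atImInfty (𝓝 2) := by
  have := tendsto_tsum_atImInfty (f := fun n τ => jacobiTheta₂_term n (τ / 2) τ)
    -- The exponent is proportional to n(n + 1), which is zero exactly for n = 0 and n = −1. These
    -- two terms produce the limit 2.
    (g := fun n => if n = 0 ∨ n = -1 then 1 else 0)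
    (b := fun n => Real.exp (-π * n ^ 2 + (-π) * n))
    (summable_exp_neg_quadratic Real.pi_pos _) (fun n => ?_) (fun n τ hτ => ?_)
  · rw [tsum_eq_sum (s := {0, -1}) (by simp)] at this
    rw [Finset.sum_pair (by norm_num)] at this
    norm_num at this
    simpa [jacobiTheta₂] using this
  · have e : ∀ τ : ℂ, jacobiTheta₂_term n (τ / 2) τ = cexp ((π * (n * (n + 1)) : ℝ) * I * τ) := by
      intro τ
      rw [jacobiTheta₂_term]; push_cast; ring_nf
    simp only [e]
    split_ifs with h
    · rcases h with rfl | rfl <;> simp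
    · refine tendsto_cexp_atImInfty ?_
      have : 0 < n * (n + 1) := by
        rw [not_or] at h
        rcases lt_or_ge n 0 with h1 | h1
        · have : n + 1 < 0 := by omega
          nlinarith
        · have : 0 < n := by omega
          positivity
      have : (0 : ℝ) < n * (n + 1) := by exact_mod_cast this
      positivity
  · rw [norm_jacobiTheta₂_term]
    apply Real.exp_le_exp.mpr
    have : 0 ≤ n * (n + 1) := by
      rcases lt_or_ge n 0 with h1 | h1
      · nlinarith
      · positivity
    have : (0 : ℝ) ≤ n * (n + 1) := by exact_mod_cast this
    have := mul_nonneg Real.pi_pos.le this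
    simp
    nlinarith

theorem tendsto_th2_atImInfty : Tendsto (fun τ : ℍ => th2 τ) atImInfty (𝓝 0) := by
  have := (tendsto_cexp_atImInfty (a := π / 4) (by positivity)).mul tendsto_th2_mul_atImInfty
  rw [zero_mul] at this
  refine this.congr fun τ => ?_
  rw [th2]; push_cast; ring_nf

/-! ### Jacobi's identity -/

theorem cexp_pi_I_div_four_pow_four : cexp (π * I / 4) ^ 4 = -1 := by
  rw [← Complex.exp_nat_mul, show ((4 : ℕ) : ℂ) * (π * I / 4) = π * I by push_cast; ring,
    Complex.exp_pi_mul_I]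

/-- The combination θ₃⁴ − θ₄⁴ − θ₂⁴ transforms under S and T in weight two up to a sign. Its square
is a level-one form of weight four vanishing at i∞, hence zero. -/
theorem th3_pow_four {τ : ℂ} (hτ : 0 < τ.im) : th3 τ ^ 4 = th2 τ ^ 4 + th4 τ ^ 4 := by
  have := eq_zero_of_level_one (k := 4) (by norm_num)
    (F := fun τ => (th3 τ ^ 4 - th4 τ ^ 4 - th2 τ ^ 4) ^ 2) ?_ ?_ ?_ ?_ hτ
  · have := pow_eq_zero_iff (two_ne_zero) |>.mp this
    linear_combination this
  · intro z hz
    have h3 := differentiableAt_th3 hz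
    have h4 := differentiableAt_th4 hz
    have h2 := differentiableAt_th2 hz
    exact DifferentiableAt.differentiableWithinAt (by fun_prop)
  · intro τ hτ
    rw [th3_S hτ, th4_S hτ, th2_S hτ]
    simp only [mul_pow, rootS_pow_four]
    norm_cast
    ring
  · intro τ hτ
    rw [th3_add_one, th4_add_one, th2_add_one, mul_pow, cexp_pi_I_div_four_pow_four]
    ring
  · simpa using (((tendsto_th3_atImInfty.pow 4).sub (tendsto_th4_atImInfty.pow 4)).sub
      (tendsto_th2_atImInfty.pow 4)).pow 2

/-! ### The Dedekind eta function -/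

theorem eta_eq (τ : ℂ) : η τ = cexp (π / 12 * I * τ) * ∏' n : ℕ, (1 - cexp (2 * π * I * τ) ^ (n + 1)) := by
  rw [ModularForm.eta]
  congr 1
  · rw [Function.Periodic.qParam]; push_cast; ring_nf
  · simp only [ModularForm.eta_q_eq_pow]

theorem norm_cexp_two_pi_I_lt_one {τ : ℂ} (hτ : 0 < τ.im) : ‖cexp (2 * π * I * τ)‖ < 1 :=
  UpperHalfPlane.norm_exp_two_pi_I_lt_one ⟨τ, hτ⟩

theorem eta_ne_zero {τ : ℂ} (hτ : 0 < τ.im) : η τ ≠ 0 := ModularForm.eta_ne_zero hτ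

theorem differentiableAt_eta {τ : ℂ} (hτ : 0 < τ.im) : DifferentiableAt ℂ η τ :=
  ModularForm.differentiableAt_eta_of_mem_upperHalfPlaneSet hτ

theorem tendsto_eta_mul_atImInfty :
    Tendsto (fun τ : ℍ => ∏' n : ℕ, (1 - cexp (2 * π * I * τ) ^ (n + 1))) atImInfty (𝓝 1) := by
  have h1 : Tendsto (fun q : ℂ => ∏' n : ℕ, (1 - q ^ (n + 1))) (𝓝 0) (𝓝 1) := by
    have := (ModularForm.differentiableOn_tprod_one_sub_pow.differentiableAt
      (Metric.ball_mem_nhds (0 : ℂ) one_pos)).continuousAt.tendsto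
    simpa using this
  refine h1.comp ?_
  refine (tendsto_cexp_atImInfty (a := 2 * π) (by positivity)).congr fun τ => ?_
  push_cast; ring_nf

theorem eta_add_one (τ : ℂ) : η (τ + 1) = cexp (π * I / 12) * η τ := by
  rw [eta_eq, eta_eq]
  rw [show π / 12 * I * (τ + 1) = π * I / 12 + π / 12 * I * τ by ring, Complex.exp_add,
    show 2 * π * I * (τ + 1) = 2 * π * I * τ + 2 * π * I by ring, Complex.exp_periodic _]
  ring

theorem continuousOn_of_differentiableAt {f : ℂ → ℂ}
    (h : ∀ τ : ℂ, 0 < τ.im → DifferentiableAt ℂ f τ) : ContinuousOn f ℍₒ :=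
  fun τ hτ => (h τ hτ).continuousAt.continuousWithinAt

theorem differentiableOn_of_differentiableAt {f : ℂ → ℂ}
    (h : ∀ τ : ℂ, 0 < τ.im → DifferentiableAt ℂ f τ) : DifferentiableOn ℂ f ℍₒ :=
  fun τ hτ => (h τ hτ).differentiableWithinAt

/-- A function on the upper half-plane whose eighth power is a cusp form of weight `12` is a
multiple of `η³`. -/
theorem eq_smul_eta_pow_three {F : ℂ → ℂ} (hol : ∀ τ : ℂ, 0 < τ.im → DifferentiableAt ℂ F τ)
    (hS : ∀ τ : ℂ, 0 < τ.im → F (-1 / τ) ^ 8 = τ ^ 12 * F τ ^ 8)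
    (hT : ∀ τ : ℂ, 0 < τ.im → F (τ + 1) ^ 8 = F τ ^ 8) {c : ℂ}
    (h0 : Tendsto (fun τ : ℍ => F τ * cexp (-(π / 4 * I * τ))) atImInfty (𝓝 c)) {τ : ℂ}
    (hτ : 0 < τ.im) : F τ = c * η τ ^ 3 := by
  have hF0 : Tendsto (fun τ : ℍ => F τ) atImInfty (𝓝 0) := by
    have := h0.mul (tendsto_cexp_atImInfty (a := π / 4) (by positivity))
    rw [mul_zero] at this
    refine this.congr fun τ => ?_
    rw [mul_assoc, ← Complex.exp_add]
    push_cast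
    simp
  obtain ⟨d, hd⟩ := eq_smul_eta_of_level_one (F := fun τ => F τ ^ 8)
    (differentiableOn_of_differentiableAt fun τ hτ => (hol τ hτ).pow 8) hS hT
    (by simpa using hF0.pow 8)
  have hr : ContinuousOn (fun τ => F τ / η τ ^ 3) ℍₒ :=
    continuousOn_of_differentiableAt fun τ hτ =>
      (hol τ hτ).div ((differentiableAt_eta hτ).pow 3) (pow_ne_zero 3 (eta_ne_zero hτ))
  -- The eighth power of F/η³ is the constant d, so the quotient itself is constant, and its limit
  -- at i∞ identifies it as c.
  have hc : ∀ τ : ℂ, 0 < τ.im → (F τ / η τ ^ 3) ^ 8 = d := fun τ hτ => by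
    have := eta_ne_zero hτ
    rw [div_pow, hd τ hτ]
    field_simp
  have hlim : Tendsto (fun τ : ℍ => F τ / η τ ^ 3) atImInfty (𝓝 c) := by
    have := h0.div (tendsto_eta_mul_atImInfty.pow 3) (by simp)
    rw [one_pow, div_one] at this
    refine this.congr fun τ => ?_
    change F τ * cexp (-(π / 4 * I * τ)) /
      (∏' n : ℕ, (1 - cexp (2 * π * I * τ) ^ (n + 1))) ^ 3 = _
    have e : cexp (π / 12 * I * τ) ^ 3 * cexp (-(π / 4 * I * τ)) = 1 := by
      rw [← Complex.exp_nat_mul, ← Complex.exp_add]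
      convert Complex.exp_zero using 2
      push_cast; ring
    rw [eta_eq]
    have e0 : cexp (π / 12 * I * τ) ≠ 0 := Complex.exp_ne_zero _
    rw [mul_pow]
    rw [← mul_div_mul_left _ _ (pow_ne_zero 3 e0)]
    congr 1
    linear_combination F τ * e
  have hcst : ∀ τ' : ℍ, F τ' / η τ' ^ 3 = F τ / η τ ^ 3 := fun τ' =>
    eq_of_pow_eq_const hr (n := 8) (by norm_num) hc τ'.im_pos hτ
  have h1 : F τ / η τ ^ 3 = c := by
    refine tendsto_nhds_unique ?_ hlim
    exact tendsto_const_nhds.congr fun τ' => (hcst τ').symm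
  have := eta_ne_zero hτ
  rw [← h1]
  field_simp

theorem rootS_pow_eight (τ : ℂ) : rootS τ ^ 8 = τ ^ 4 := by
  rw [show rootS τ ^ 8 = (rootS τ ^ 4) ^ 2 by ring, rootS_pow_four]; ring

theorem cexp_pow_eq_one {z : ℂ} {n : ℕ} (m : ℤ) (h : n * z = m * (2 * π * I)) : cexp z ^ n = 1 := by
  rw [← Complex.exp_nat_mul, h, Complex.exp_int_mul_two_pi_mul_I]

/-- S permutes the three thetas and T permutes them up to an eighth root of unity, so the eighth
power of the product is a cusp form of weight 12. The constant 2 is the leading coefficient of θ₂.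
-/
theorem two_mul_eta_pow_three {τ : ℂ} (hτ : 0 < τ.im) :
    2 * η τ ^ 3 = th2 τ * th3 τ * th4 τ := by
  refine (eq_smul_eta_pow_three (F := fun τ => th2 τ * th3 τ * th4 τ) (fun τ hτ => ?_)
    (fun τ hτ => ?_) (fun τ hτ => ?_) ?_ hτ).symm
  · have h3 := differentiableAt_th3 hτ
    have h4 := differentiableAt_th4 hτ
    have h2 := differentiableAt_th2 hτ
    fun_prop
  · rw [th3_S hτ, th4_S hτ, th2_S hτ]
    simp only [mul_pow, rootS_pow_eight]
    ring
  · rw [th3_add_one, th4_add_one, th2_add_one]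
    simp only [mul_pow]
    rw [cexp_pow_eq_one 1 (by push_cast; ring)]
    ring
  · have := (tendsto_th2_mul_atImInfty.mul tendsto_th3_atImInfty).mul tendsto_th4_atImInfty
    simp only [mul_one] at this
    refine this.congr fun τ => ?_
    rw [th2]
    have e : cexp (π * I * τ / 4) * cexp (-(π / 4 * I * τ)) = 1 := by
      rw [← Complex.exp_add]
      convert Complex.exp_zero using 2
      ring
    linear_combination (-jacobiTheta₂ (↑τ / 2) ↑τ * th3 ↑τ * th4 ↑τ) * e

theorem th2_ne_zero {τ : ℂ} (hτ : 0 < τ.im) : th2 τ ≠ 0 := fun h => by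
  have := two_mul_eta_pow_three hτ
  simp [h, eta_ne_zero hτ] at this

theorem th4_ne_zero {τ : ℂ} (hτ : 0 < τ.im) : th4 τ ≠ 0 := fun h => by
  have := two_mul_eta_pow_three hτ
  simp [h, eta_ne_zero hτ] at this

theorem eta_pow_three_S {τ : ℂ} (hτ : 0 < τ.im) :
    η (-1 / τ) ^ 3 = rootS τ ^ 3 * η τ ^ 3 := by
  have h1 := two_mul_eta_pow_three hτ
  have h2 := two_mul_eta_pow_three (im_neg_one_div_pos hτ)
  rw [th3_S hτ, th4_S hτ, th2_S hτ] at h2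
  linear_combination h2 / 2 - rootS τ ^ 3 / 2 * h1

theorem eta_pow_24_S {τ : ℂ} (hτ : 0 < τ.im) : η (-1 / τ) ^ 24 = τ ^ 12 * η τ ^ 24 := by
  rw [show η (-1 / τ) ^ 24 = (η (-1 / τ) ^ 3) ^ 8 by ring, eta_pow_three_S hτ,
    show (rootS τ ^ 3 * η τ ^ 3) ^ 8 = (rootS τ ^ 4) ^ 6 * η τ ^ 24 by ring, rootS_pow_four]
  ring

theorem eta_pow_24_add_one (τ : ℂ) : η (τ + 1) ^ 24 = η τ ^ 24 := by
  rw [eta_add_one, mul_pow, cexp_pow_eq_one 1 (by push_cast; ring), one_mul]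

/-! ### `η³` as a theta series -/

/-- The unary theta series `∑ (-1)ⁿ (n + 1/2) q^{(n+1/2)²/2}`. -/
noncomputable def thEta (τ : ℂ) : ℂ :=
  cexp (π * I * τ / 4) * jacobiTheta₂' ((1 + τ) / 2) τ / (2 * π * I)

/-- Evenness and quasi-periodicity in z both relate the value at (1 + τ)/2 to itself, with opposite
signs. -/
theorem jacobiTheta₂_half_period (τ : ℂ) : jacobiTheta₂ ((1 + τ) / 2) τ = 0 := by
  have h := jacobiTheta₂_add_left' ((1 - τ) / 2) τ
  rw [show (1 - τ) / 2 + τ = (1 + τ) / 2 by ring, show (1 - τ) / 2 = -((1 + τ) / 2) + 1 by ring,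
    jacobiTheta₂_add_left, jacobiTheta₂_neg_left,
    show -π * I * (τ + 2 * (-((1 + τ) / 2) + 1)) = -(π * I) by ring, Complex.exp_neg,
    Complex.exp_pi_mul_I] at h
  have h2 : (2 : ℂ) * jacobiTheta₂ ((1 + τ) / 2) τ = 0 := by
    norm_num at h
    linear_combination h
  simpa using h2

/-- The z-derivative of the theta series has coefficients n. Adding πi times the theta series
itself, which vanishes at this half period, turns n into n + 1/2. -/
theorem hasSum_thEta {τ : ℂ} (hτ : 0 < τ.im) :
    HasSum (fun n : ℤ => (-1) ^ n * (n + 1 / 2) * cexp (π * I * (n + 1 / 2) ^ 2 * τ))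
      (thEta τ) := by
  have h1 := hasSum_jacobiTheta₂'_term ((1 + τ) / 2) hτ
  have h2 := hasSum_jacobiTheta₂_term ((1 + τ) / 2) hτ
  rw [jacobiTheta₂_half_period] at h2
  have h3 := ((h1.add (h2.mul_left (π * I))).mul_left (cexp (π * I * τ / 4))).div_const (2 * π * I)
  rw [mul_zero, add_zero] at h3
  refine h3.congr_fun fun n => ?_
  have e : cexp (π * I * τ / 4) * jacobiTheta₂_term n ((1 + τ) / 2) τ =
      (-1) ^ n * cexp (π * I * (n + 1 / 2) ^ 2 * τ) := by
    rw [jacobiTheta₂_term, ← Complex.exp_pi_mul_I, ← Complex.exp_int_mul, ← Complex.exp_add,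
      ← Complex.exp_add]
    ring_nf
  have hpi : (π : ℂ) ≠ 0 := by exact_mod_cast Real.pi_ne_zero
  rw [jacobiTheta₂'_term]
  have : cexp (π * I * τ / 4) * (2 * π * I * n * jacobiTheta₂_term n ((1 + τ) / 2) τ +
      π * I * jacobiTheta₂_term n ((1 + τ) / 2) τ) = (2 * π * I * n + π * I) *
      ((-1) ^ n * cexp (π * I * (n + 1 / 2) ^ 2 * τ)) := by rw [← e]; ring
  rw [this]
  field_simp

/-- This is the functional equation of the z-derivative at the half period. Its extra term is
proportional to the theta value there and drops out. -/
theorem thEta_S {τ : ℂ} (hτ : 0 < τ.im) : thEta (-1 / τ) = rootS τ ^ 3 * thEta τ := by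
  have h := jacobiTheta₂'_functional_equation ((1 + τ) / 2) τ
  have h0 := ne_zero_of_im_pos hτ
  have e1 : (1 + τ) / 2 / τ = -((1 + -1 / τ) / 2) + 1 := by field_simp; ring
  rw [e1, jacobiTheta₂_add_left, jacobiTheta₂'_add_left, jacobiTheta₂_neg_left,
    jacobiTheta₂'_neg_left, jacobiTheta₂_half_period, mul_zero, sub_zero] at h
  have hr := rootS_ne_zero hτ
  have hr2 := rootS_sq τ
  rw [thEta, thEta, h]
  change _ = _ * (_ * (1 / rootS τ * _ / _ * _) / _)
  have e2 : cexp (π * I * (-1 / τ) / 4) = cexp (π * I / 2) * (cexp (π * I * τ / 4) *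
      cexp (-π * I * ((1 + τ) / 2) ^ 2 / τ)) := by
    rw [← Complex.exp_add, ← Complex.exp_add]
    congr 1
    field_simp
    ring
  rw [e2, show π * I / 2 = π / 2 * I by ring, Complex.exp_pi_div_two_mul_I]
  have hpi : (π : ℂ) ≠ 0 := by exact_mod_cast Real.pi_ne_zero
  have h3 : rootS τ ^ 3 = rootS τ * (-I * τ) := by rw [← hr2]; ring
  rw [h3]
  field_simp

theorem thEta_add_one {τ : ℂ} (hτ : 0 < τ.im) :
    thEta (τ + 1) = cexp (π * I / 4) * thEta τ := by
  have h1 := hasSum_thEta (τ := τ + 1) (by simpa using hτ)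
  have h2 := (hasSum_thEta hτ).mul_left (cexp (π * I / 4))
  refine h1.unique (h2.congr_fun fun n => ?_)
  obtain ⟨k, hk⟩ := Int.even_mul_succ_self n
  have hk' : (n : ℂ) * (n + 1) = k + k := by exact_mod_cast hk
  have : cexp (π * I * (n + 1 / 2) ^ 2 * (τ + 1)) =
      cexp (π * I / 4) * cexp (π * I * (n + 1 / 2) ^ 2 * τ) := by
    rw [← Complex.exp_add, Complex.exp_eq_exp_iff_exists_int]
    exact ⟨k, by linear_combination (π * I) * hk'⟩
  rw [this]
  ring

theorem tendsto_thEta_mul_atImInfty :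
    Tendsto (fun τ : ℍ => thEta τ * cexp (-(π / 4 * I * τ))) atImInfty (𝓝 1) := by
  have e : ∀ (n : ℤ) (τ : ℂ), (-1 : ℂ) ^ n * (n + 1 / 2) * cexp (π * I * (n + 1 / 2) ^ 2 * τ) *
      cexp (-(π / 4 * I * τ)) =
      (-1) ^ n * (n + 1 / 2) * cexp ((π * (n * (n + 1)) : ℝ) * I * τ) := fun n τ => by
    rw [mul_assoc, ← Complex.exp_add]
    push_cast
    ring_nf
  have h0 : ∀ n : ℤ, (0 : ℝ) ≤ n * (n + 1) := fun n => by
    have : 0 ≤ n * (n + 1) := by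
      rcases lt_or_ge n 0 with h1 | h1
      · nlinarith
      · positivity
    exact_mod_cast this
  have := tendsto_tsum_atImInfty (ι := ℤ)
    (f := fun n τ => (-1 : ℂ) ^ n * (n + 1 / 2) * cexp ((π * (n * (n + 1)) : ℝ) * I * τ))
    (g := fun n => if n = 0 ∨ n = -1 then 1 / 2 else 0)
    (b := fun n => ‖(-1 : ℂ) ^ n * (n + 1 / 2) * cexp ((π * (n * (n + 1)) : ℝ) * I * I)‖)
    ?_ (fun n => ?_) (fun n τ hτ => ?_)
  · rw [tsum_eq_sum (s := {0, -1}) (by simp)] at this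
    rw [Finset.sum_pair (by norm_num)] at this
    norm_num at this
    refine this.congr fun τ => ?_
    rw [← (hasSum_thEta τ.im_pos).tsum_eq, ← tsum_mul_right]
    refine tsum_congr fun n => ?_
    rw [e]; push_cast; norm_num
  · have := ((hasSum_thEta (τ := I) (by simp)).mul_right (cexp (-(π / 4 * I * I)))).summable.norm
    refine this.congr fun n => ?_
    rw [e]
  · split_ifs with h
    · rcases h with rfl | rfl <;> norm_num
    · have h1 : (0 : ℝ) < n * (n + 1) := by
        refine lt_of_le_of_ne (h0 n) fun h2 => h ?_
        rcases mul_eq_zero.mp h2.symm with h3 | h3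
        · left; exact_mod_cast h3
        · right
          have : n + 1 = 0 := by exact_mod_cast h3
          omega
      simpa using (tendsto_cexp_atImInfty (mul_pos Real.pi_pos h1)).const_mul
        ((-1 : ℂ) ^ n * (n + 1 / 2))
  · rw [norm_mul, norm_mul _ (cexp _), norm_cexp_mul_I, norm_cexp_mul_I]
    refine mul_le_mul_of_nonneg_left (Real.exp_le_exp.mpr ?_) (norm_nonneg _)
    have := mul_nonneg Real.pi_pos.le (h0 n)
    simp only [I_im]
    nlinarith

theorem differentiableAt_tsum {f : ℤ → ℂ → ℂ}
    (hf : ∀ n, ∀ τ : ℂ, 0 < τ.im → DifferentiableAt ℂ (f n) τ) {b : ℝ → ℤ → ℝ}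
    (hb : ∀ T, 0 < T → Summable (b T))
    (h : ∀ T, 0 < T → ∀ n, ∀ τ : ℂ, T < τ.im → ‖f n τ‖ ≤ b T n) {τ : ℂ} (hτ : 0 < τ.im) :
    DifferentiableAt ℂ (fun τ => ∑' n, f n τ) τ := by
  obtain ⟨T, hT, hT'⟩ := exists_between hτ
  have ho : IsOpen {τ : ℂ | T < τ.im} := continuous_im.isOpen_preimage _ isOpen_Ioi
  exact (differentiableOn_tsum_of_summable_norm (hb T hT)
    (fun n z hz => (hf n z (hT.trans hz)).differentiableWithinAt) ho
    (fun n z hz => h T hT n z hz)).differentiableAt (ho.mem_nhds hT')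

theorem norm_thEta_term_le {T : ℝ} {τ : ℂ} (h : T ≤ τ.im) (n : ℤ) :
    ‖(-1 : ℂ) ^ n * (n + 1 / 2) * cexp (π * I * (n + 1 / 2) ^ 2 * τ)‖ ≤
      ‖(-1 : ℂ) ^ n * (n + 1 / 2) * cexp (π * I * (n + 1 / 2) ^ 2 * (T * I))‖ := by
  have e : ∀ τ : ℂ, cexp (π * I * (n + 1 / 2) ^ 2 * τ) =
      cexp ((π * (n + 1 / 2) ^ 2 : ℝ) * I * τ) := fun τ => by push_cast; ring_nf
  rw [norm_mul, norm_mul _ (cexp _), e, e, norm_cexp_mul_I, norm_cexp_mul_I]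
  refine mul_le_mul_of_nonneg_left (Real.exp_le_exp.mpr ?_) (norm_nonneg _)
  have : 0 ≤ π * ((n : ℝ) + 1 / 2) ^ 2 := by positivity
  simp only [mul_im, ofReal_re, I_im, mul_one, ofReal_im, I_re, mul_zero, add_zero]
  nlinarith

theorem differentiableAt_thEta {τ : ℂ} (hτ : 0 < τ.im) : DifferentiableAt ℂ thEta τ := by
  have := differentiableAt_tsum
    (f := fun n τ => (-1 : ℂ) ^ n * (n + 1 / 2) * cexp (π * I * (n + 1 / 2) ^ 2 * τ))
    (fun n τ _ => by fun_prop)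
    (fun T hT => (hasSum_thEta (τ := T * I) (by simpa using hT)).summable.norm)
    (fun T _ n τ h => norm_thEta_term_le h.le n) hτ
  refine this.congr_of_eventuallyEq ?_
  filter_upwards [(continuous_im.isOpen_preimage _ isOpen_Ioi).mem_nhds hτ] with z hz
  exact (hasSum_thEta hz).tsum_eq.symm

theorem eta_pow_three_eq {τ : ℂ} (hτ : 0 < τ.im) : η τ ^ 3 = thEta τ := by
  have := eq_smul_eta_pow_three (fun τ hτ => differentiableAt_thEta hτ)
    (fun τ hτ => ?_) (fun τ hτ => ?_) tendsto_thEta_mul_atImInfty hτ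
  · rw [this, one_mul]
  · rw [thEta_S hτ, show (rootS τ ^ 3 * thEta τ) ^ 8 = (rootS τ ^ 4) ^ 6 * thEta τ ^ 8 by ring,
      rootS_pow_four]
    ring
  · rw [thEta_add_one hτ, mul_pow, cexp_pow_eq_one 1 (by push_cast; ring), one_mul]

/-! ### Eta quotients -/

theorem tendsto_mul_atImInfty {c : ℝ} (hc : 0 < c) {F : ℂ → ℂ} {l : Filter ℂ}
    (h : Tendsto (fun τ : ℍ => F τ) atImInfty l) :
    Tendsto (fun τ : ℍ => F (c * τ)) atImInfty l := by
  have h2 : Tendsto (fun τ : ℍ => ((⟨c, hc⟩ : {x : ℝ // 0 < x}) • τ : ℍ)) atImInfty atImInfty := by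
    simp only [atImInfty, tendsto_comap_iff]
    have h1 : Tendsto (fun τ : ℍ => τ.im) atImInfty atTop := tendsto_comap
    refine (h1.const_mul_atTop hc).congr fun τ => ?_
    simp
  refine (h.comp h2).congr fun τ => ?_
  simp

theorem eq_one_of_pow_eq_one {r : ℂ → ℂ} (hr : ContinuousOn r ℍₒ) {n : ℕ} (hn : n ≠ 0)
    (h : ∀ τ : ℂ, 0 < τ.im → r τ ^ n = 1) {c : ℂ}
    (h1 : Tendsto (fun τ : ℍ => r τ) atImInfty (𝓝 c)) {τ : ℂ} (hτ : 0 < τ.im) : r τ = c := by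
  refine tendsto_nhds_unique ?_ h1
  exact tendsto_const_nhds.congr fun τ' => eq_of_pow_eq_const hr hn h hτ τ'.im_pos

theorem tendsto_th4_eta_quotient :
    Tendsto (fun τ : ℍ => th4 τ * η τ / η ((τ : ℂ) / 2) ^ 2) atImInfty (𝓝 1) := by
  have := (tendsto_th4_atImInfty.mul tendsto_eta_mul_atImInfty).div
    ((tendsto_mul_atImInfty (c := 1 / 2) (by norm_num)
      (F := fun τ => ∏' n : ℕ, (1 - cexp (2 * π * I * τ) ^ (n + 1)))
      tendsto_eta_mul_atImInfty).pow 2) (by simp)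
  rw [one_pow, mul_one, div_one] at this
  refine this.congr fun τ => ?_
  change th4 τ * (∏' n : ℕ, (1 - cexp (2 * π * I * τ) ^ (n + 1))) /
    (∏' n : ℕ, (1 - cexp (2 * π * I * ((1 / 2 : ℝ) * τ)) ^ (n + 1))) ^ 2 = _
  rw [eta_eq, eta_eq, show (((1 / 2 : ℝ) : ℂ) * τ) = (τ : ℂ) / 2 by push_cast; ring, mul_pow,
    ← Complex.exp_nat_mul, show ((2 : ℕ) : ℂ) * (π / 12 * I * (τ / 2)) = π / 12 * I * τ by
      push_cast; ring]
  rw [← mul_div_mul_left _ _ (Complex.exp_ne_zero (π / 12 * I * τ))]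
  ring

theorem tendsto_th2_eta_quotient :
    Tendsto (fun τ : ℍ => th2 τ * η τ / (2 * η (2 * τ) ^ 2)) atImInfty (𝓝 1) := by
  have := (tendsto_th2_mul_atImInfty.mul tendsto_eta_mul_atImInfty).div
    (((tendsto_mul_atImInfty (c := 2) (by norm_num)
      (F := fun τ => ∏' n : ℕ, (1 - cexp (2 * π * I * τ) ^ (n + 1)))
      tendsto_eta_mul_atImInfty).pow 2).const_mul 2) (by simp)
  rw [one_pow, mul_one, div_self two_ne_zero] at this
  refine this.congr fun τ => ?_
  change jacobiTheta₂ (τ / 2) τ * (∏' n : ℕ, (1 - cexp (2 * π * I * τ) ^ (n + 1))) /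
    (2 * (∏' n : ℕ, (1 - cexp (2 * π * I * ((2 : ℝ) * τ)) ^ (n + 1))) ^ 2) = _
  rw [eta_eq, eta_eq, th2, show (((2 : ℝ) : ℂ) * τ) = 2 * τ by push_cast; ring, mul_pow,
    ← Complex.exp_nat_mul, show ((2 : ℕ) : ℂ) * (π / 12 * I * (2 * τ)) =
      π * I * τ / 4 + π / 12 * I * τ by push_cast; ring, Complex.exp_add]
  rw [← mul_div_mul_left _ _ (mul_ne_zero (Complex.exp_ne_zero (π * I * τ / 4))
    (Complex.exp_ne_zero (π / 12 * I * τ)))]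
  ring

/-- At this stage the S-law of η is available only for η³ and η²⁴. Raising both quotients to the
24th power makes them an S-exchanged pair of weight 0, and subtracting the limit 1 at i∞ makes
`eq_zero_of_pair` apply. -/
theorem th_eta_quotient_pow (τ : ℂ) (hτ : 0 < τ.im) :
    (th2 τ * η τ / (2 * η (2 * τ) ^ 2)) ^ 24 - 1 = 0 ∧
      (th4 τ * η τ / η (τ / 2) ^ 2) ^ 24 - 1 = 0 := by
  have h2im : ∀ τ : ℂ, 0 < τ.im → 0 < (2 * τ).im := fun τ hτ => by simpa using hτ
  have h2im' : ∀ τ : ℂ, 0 < τ.im → 0 < (τ / 2).im := fun τ hτ => by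
    rw [show (τ / 2).im = τ.im / 2 by simp]; positivity
  refine eq_zero_of_pair (k := 0) (by norm_num) (by norm_num)
    (F := fun τ => (th2 τ * η τ / (2 * η (2 * τ) ^ 2)) ^ 24 - 1)
    (G := fun τ => (th4 τ * η τ / η (τ / 2) ^ 2) ^ 24 - 1) ?_ ?_ (fun τ hτ => ?_) (fun τ hτ => ?_)
    (fun τ hτ => ?_) ?_ ?_ τ hτ
  · refine differentiableOn_of_differentiableAt fun τ hτ => ?_
    have h1 := differentiableAt_th2 hτ
    have h2 := differentiableAt_eta hτ
    have h3 : DifferentiableAt ℂ (fun τ => η (2 * τ)) τ :=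
      (differentiableAt_eta (h2im τ hτ)).comp (f := fun τ => 2 * τ) τ (by fun_prop)
    have h4 := eta_ne_zero (h2im τ hτ)
    exact (((h1.mul h2).div ((h3.pow 2).const_mul 2) (by simpa using h4)).pow 24).sub_const 1
  · refine differentiableOn_of_differentiableAt fun τ hτ => ?_
    have h1 := differentiableAt_th4 hτ
    have h2 := differentiableAt_eta hτ
    have h3 : DifferentiableAt ℂ (fun τ => η (τ / 2)) τ :=
      (differentiableAt_eta (h2im' τ hτ)).comp (f := fun τ => τ / 2) τ (by fun_prop)
    have h4 := eta_ne_zero (h2im' τ hτ)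
    exact (((h1.mul h2).div (h3.pow 2) (by simpa using h4)).pow 24).sub_const 1
  · have h0 := ne_zero_of_im_pos hτ
    have h1 := eta_ne_zero (h2im' τ hτ)
    have e1 := eta_pow_24_S (h2im' τ hτ)
    rw [show -1 / (τ / 2) = 2 * (-1 / τ) by field_simp] at e1
    have e2 : rootS τ ^ 24 = τ ^ 12 := by
      rw [show rootS τ ^ 24 = (rootS τ ^ 4) ^ 6 by ring, rootS_pow_four]; ring
    rw [zpow_zero, one_mul, div_pow, div_pow, mul_pow, mul_pow, mul_pow, th2_S hτ, mul_pow,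
      eta_pow_24_S hτ, e2, show (η (2 * (-1 / τ)) ^ 2) ^ 24 = (η (2 * (-1 / τ)) ^ 24) ^ 2 by ring, e1]
    field_simp
  · rw [div_pow, div_pow, mul_pow, mul_pow, mul_pow, mul_pow, th2_add_one, mul_pow,
      cexp_pow_eq_one 3 (by push_cast; ring), eta_pow_24_add_one,
      show (η (2 * (τ + 1)) ^ 2) ^ 24 = (η (2 * τ + 1 + 1) ^ 24) ^ 2 by ring_nf,
      eta_pow_24_add_one, eta_pow_24_add_one]
    ring
  · rw [div_pow, div_pow, mul_pow, mul_pow, show τ + 2 = τ + 1 + 1 by ring, th4_add_one,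
      th3_add_one, eta_pow_24_add_one, eta_pow_24_add_one,
      show (η ((τ + 1 + 1) / 2) ^ 2) ^ 24 = (η (τ / 2 + 1) ^ 24) ^ 2 by ring_nf,
      eta_pow_24_add_one]
    ring
  · simpa using (tendsto_th2_eta_quotient.pow 24).sub_const 1
  · simpa using (tendsto_th4_eta_quotient.pow 24).sub_const 1

theorem th4_mul_eta {τ : ℂ} (hτ : 0 < τ.im) : th4 τ * η τ = η (τ / 2) ^ 2 := by
  have h2im' : ∀ τ : ℂ, 0 < τ.im → 0 < (τ / 2).im := fun τ hτ => by
    rw [show (τ / 2).im = τ.im / 2 by simp]; positivity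
  have := eq_one_of_pow_eq_one (r := fun τ => th4 τ * η τ / η (τ / 2) ^ 2) (n := 24)
    (continuousOn_of_differentiableAt fun τ hτ => ?_) (by norm_num)
    (fun τ hτ => sub_eq_zero.mp (th_eta_quotient_pow τ hτ).2) tendsto_th4_eta_quotient hτ
  · have h4 := eta_ne_zero (h2im' τ hτ)
    field_simp at this
    exact this
  · have h3 : DifferentiableAt ℂ (fun τ => η (τ / 2)) τ :=
      (differentiableAt_eta (h2im' τ hτ)).comp (f := fun τ => τ / 2) τ (by fun_prop)
    have h4 := eta_ne_zero (h2im' τ hτ)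
    exact ((differentiableAt_th4 hτ).mul (differentiableAt_eta hτ)).div (h3.pow 2) (by simpa using h4)

theorem th2_mul_eta {τ : ℂ} (hτ : 0 < τ.im) : th2 τ * η τ = 2 * η (2 * τ) ^ 2 := by
  have h2im : ∀ τ : ℂ, 0 < τ.im → 0 < (2 * τ).im := fun τ hτ => by simpa using hτ
  have := eq_one_of_pow_eq_one (r := fun τ => th2 τ * η τ / (2 * η (2 * τ) ^ 2)) (n := 24)
    (continuousOn_of_differentiableAt fun τ hτ => ?_) (by norm_num)
    (fun τ hτ => sub_eq_zero.mp (th_eta_quotient_pow τ hτ).1) tendsto_th2_eta_quotient hτ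
  · have h4 := eta_ne_zero (h2im τ hτ)
    field_simp at this
    linear_combination this
  · have h3 : DifferentiableAt ℂ (fun τ => η (2 * τ)) τ :=
      (differentiableAt_eta (h2im τ hτ)).comp (f := fun τ => 2 * τ) τ (by fun_prop)
    have h4 := eta_ne_zero (h2im τ hτ)
    exact ((differentiableAt_th2 hτ).mul (differentiableAt_eta hτ)).div ((h3.pow 2).const_mul 2)
      (by simpa using h4)

theorem th3_mul_th4 {τ : ℂ} (hτ : 0 < τ.im) : th3 τ * th4 τ = th4 (2 * τ) ^ 2 := by
  have h2 : 0 < (2 * τ).im := by simpa using hτ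
  have e1 := th4_mul_eta h2
  have e2 := th2_mul_eta hτ
  have e3 := two_mul_eta_pow_three hτ
  rw [show 2 * τ / 2 = τ by ring] at e1
  have n1 := eta_ne_zero hτ
  have n2 := eta_ne_zero h2
  have key : (th3 τ * th4 τ - th4 (2 * τ) ^ 2) * (2 * η (2 * τ) ^ 2) = 0 := by
    have : (th4 (2 * τ) * η (2 * τ)) ^ 2 = η τ ^ 4 := by rw [e1]; ring
    linear_combination (-th3 τ * th4 τ) * e2 - 2 * this - η τ * e3
  rcases mul_eq_zero.mp key with h | h
  · linear_combination h
  · simp [n2] at h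

/-! ### The Eisenstein series of weight two -/

/-- The quasimodular Eisenstein series `E₂` as a function on `ℂ`. -/
noncomputable def eisenTwo (τ : ℂ) : ℂ := EisensteinSeries.E2 (UpperHalfPlane.ofComplex τ)

theorem qpow_eq (τ : ℂ) (n : ℤ) : qpow τ n = cexp (2 * π * I * τ) ^ n := by
  rw [qpow, ← Complex.exp_int_mul]; ring_nf

theorem eisenTwo_coe {τ : ℂ} (hτ : 0 < τ.im) : eisenTwo τ = EisensteinSeries.E2 ⟨τ, hτ⟩ := by
  rw [eisenTwo, UpperHalfPlane.ofComplex_apply_of_im_pos hτ]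

theorem hasSum_eisenTwo {τ : ℂ} (hτ : 0 < τ.im) :
    HasSum (fun m : ℕ => (if m = 0 then 1 else -24 * (ArithmeticFunction.sigma 1 m : ℂ)) *
      qpow τ m) (eisenTwo τ) := by
  rw [eisenTwo_coe hτ]
  refine (EisensteinSeries.hasSum_qExpansion_E2 (z := ⟨τ, hτ⟩)).congr_fun fun n => ?_
  rw [smul_eq_mul, qpow_eq, zpow_natCast]

theorem differentiableAt_eisenTwo {τ : ℂ} (hτ : 0 < τ.im) : DifferentiableAt ℂ eisenTwo τ :=
  (UpperHalfPlane.mdifferentiable_iff.mp E2_mdifferentiable).differentiableAt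
    (UpperHalfPlane.isOpen_upperHalfPlaneSet.mem_nhds hτ)

theorem eisenTwo_S {τ : ℂ} (hτ : 0 < τ.im) :
    eisenTwo (-1 / τ) = τ ^ 2 * eisenTwo τ - 6 * I * τ / π := by
  obtain ⟨z, rfl⟩ : ∃ z : ℍ, (z : ℂ) = τ := ⟨⟨τ, hτ⟩, rfl⟩
  have h := congrFun (EisensteinSeries.E2_slash_action ModularGroup.S) z
  rw [ModularForm.SL_slash_apply, ModularGroup.denom_S] at h
  simp only [Pi.sub_apply, Pi.smul_apply, EisensteinSeries.D2_S, riemannZeta_two, smul_eq_mul] at h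
  rw [eisenTwo, eisenTwo, UpperHalfPlane.ofComplex_apply, ← coe_S_smul,
    UpperHalfPlane.ofComplex_apply]
  have h0 := z.ne_zero
  have hpi : (π : ℂ) ≠ 0 := by exact_mod_cast Real.pi_ne_zero
  rw [zpow_neg, show (z : ℂ) ^ (2 : ℤ) = z ^ 2 by norm_cast] at h
  field_simp at h
  field_simp
  linear_combination h

theorem eisenTwo_add_one {τ : ℂ} (hτ : 0 < τ.im) : eisenTwo (τ + 1) = eisenTwo τ := by
  refine (hasSum_eisenTwo (τ := τ + 1) (by simpa using hτ)).unique
    ((hasSum_eisenTwo hτ).congr_fun fun n => ?_)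
  rw [qpow_eq, qpow_eq, show 2 * π * I * (τ + 1) = 2 * π * I * τ + 2 * π * I by ring,
    Complex.exp_periodic _]

theorem tendsto_eisenTwo : Tendsto (fun τ : ℍ => eisenTwo τ) atImInfty (𝓝 1) := by
  have := tendsto_tsum_atImInfty
    (f := fun (m : ℕ) τ => (if m = 0 then 1 else -24 * (ArithmeticFunction.sigma 1 m : ℂ)) *
      qpow τ m) (g := fun m => if m = 0 then 1 else 0)
    (b := fun m => ‖(if m = 0 then 1 else -24 * (ArithmeticFunction.sigma 1 m : ℂ)) *
      qpow I m‖) (hasSum_eisenTwo (τ := I) (by simp)).summable.norm (fun m => ?_)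
      (fun m τ hτ => ?_)
  · rw [tsum_ite_eq] at this
    exact this.congr fun τ => (hasSum_eisenTwo τ.im_pos).tsum_eq
  · split_ifs with h
    · subst h; simp [qpow]
    · have h1 : (0 : ℝ) < 2 * π * m := by positivity
      simpa [qpow, mul_assoc, mul_comm, mul_left_comm] using (tendsto_cexp_atImInfty h1).const_mul
        (-24 * (ArithmeticFunction.sigma 1 m : ℂ))
  · have e : ∀ τ : ℂ, qpow τ m = cexp ((2 * π * m : ℝ) * I * τ) := fun τ => by
      rw [qpow]; push_cast; ring_nf
    rw [norm_mul, norm_mul, e, e, norm_cexp_mul_I, norm_cexp_mul_I]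
    refine mul_le_mul_of_nonneg_left (Real.exp_le_exp.mpr ?_) (norm_nonneg _)
    have : 0 ≤ 2 * π * (m : ℝ) := by positivity
    simp only [I_im]
    nlinarith

/-- The even divisors of n are the doubles of the divisors of n/2. -/
theorem sum_divisors_odd (n : ℕ) :
    ((∑ d ∈ n.divisors with Odd d, d : ℕ) : ℂ) = ArithmeticFunction.sigma 1 n -
      2 * if Even n then (ArithmeticFunction.sigma 1 (n / 2) : ℂ) else 0 := by
  rw [ArithmeticFunction.sigma_one_apply, ← Finset.sum_filter_add_sum_filter_not n.divisors Odd]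
  have : ∑ d ∈ n.divisors with ¬ Odd d, d =
      2 * if Even n then ArithmeticFunction.sigma 1 (n / 2) else 0 := by
    split_ifs with h
    · obtain ⟨m, rfl⟩ := h
      rw [ArithmeticFunction.sigma_one_apply, Finset.mul_sum]
      symm
      refine Finset.sum_bij (fun d _ => 2 * d) ?_ ?_ ?_ ?_
      · intro d hd
        rw [show (m + m) / 2 = m by omega, Nat.mem_divisors] at hd
        rw [Finset.mem_filter, Nat.mem_divisors]
        refine ⟨⟨by rw [← two_mul]; exact Nat.mul_dvd_mul_left 2 hd.1, by omega⟩, by simp⟩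
      · intro a _ b _ h; simpa using h
      · intro d hd
        rw [Finset.mem_filter, Nat.mem_divisors, Nat.not_odd_iff_even] at hd
        obtain ⟨⟨h1, h2⟩, e, rfl⟩ := hd
        refine ⟨e, ?_, by ring⟩
        rw [show (m + m) / 2 = m by omega, Nat.mem_divisors]
        refine ⟨?_, by omega⟩
        rw [← two_mul, ← two_mul] at h1
        exact Nat.dvd_of_mul_dvd_mul_left two_pos h1
      · intro d _; rfl
    · rw [mul_zero, Finset.sum_eq_zero]
      intro d hd
      rw [Finset.mem_filter, Nat.mem_divisors, Nat.not_odd_iff_even] at hd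
      exact absurd (hd.2.trans_dvd hd.1.1) h
  rw [this]
  push_cast
  ring

theorem eisenStar_eq {τ : ℂ} (hτ : 0 < τ.im) :
    eisenStar τ = 2 * eisenTwo (2 * τ) - eisenTwo τ := by
  have h2 : 0 < (2 * τ).im := by simpa using hτ
  have h1 := hasSum_eisenTwo hτ
  have h3 : HasSum (fun n : ℕ => if Even n then
      (if n = 0 then 1 else -24 * (ArithmeticFunction.sigma 1 (n / 2) : ℂ)) * qpow τ n else 0)
      (eisenTwo (2 * τ)) := by
    have hinj : Function.Injective fun m : ℕ => 2 * m := fun a b h => by simpa using h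
    rw [← hinj.hasSum_iff]
    · refine (hasSum_eisenTwo h2).congr_fun fun n => ?_
      simp only [Function.comp_apply, even_two, Even.mul_right, if_true, mul_eq_zero,
        OfNat.ofNat_ne_zero, false_or]
      rw [show 2 * n / 2 = n by omega]
      congr 1
      rw [qpow, qpow]; push_cast; ring_nf
    · intro n hn
      rw [if_neg]
      rintro ⟨m, rfl⟩
      exact hn ⟨m, by ring⟩
  have h4 := ((h3.mul_left 2).sub h1).sub (hasSum_ite_eq (0 : ℕ) (1 : ℂ))
  have h5 : HasSum (fun n : ℕ => 24 * (((∑ d ∈ n.divisors with Odd d, d : ℕ) : ℂ) * qpow τ n))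
      (2 * eisenTwo (2 * τ) - eisenTwo τ - 1) := by
    refine h4.congr_fun fun n => ?_
    rw [sum_divisors_odd]
    by_cases h0 : n = 0
    · subst h0; simp [qpow]; ring
    · simp only [h0, if_false]
      split_ifs <;> ring
  rw [eisenStar, ← tsum_mul_left, h5.tsum_eq]
  ring

/-- The anomalous terms of E₂ under S cancel in 2E₂(τ) − 4E₂(2τ) and 2E₂(τ) − E₂(τ/2), which S
exchanges in weight two. Jacobi's identity makes the theta quartics transform in the same way, and
the constant terms agree. -/
theorem eisenStar_half {τ : ℂ} (hτ : 0 < τ.im) :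
    eisenStar (τ / 2) = 2 * th3 τ ^ 4 - th4 τ ^ 4 := by
  have h2im : ∀ τ : ℂ, 0 < τ.im → 0 < (2 * τ).im := fun τ hτ => by simpa using hτ
  have h2im' : ∀ τ : ℂ, 0 < τ.im → 0 < (τ / 2).im := fun τ hτ => by
    rw [show (τ / 2).im = τ.im / 2 by simp]; positivity
  have key := eq_zero_of_pair (k := 2) (by norm_num) (by norm_num)
    (F := fun τ => (2 * eisenTwo τ - 4 * eisenTwo (2 * τ)) + (th3 τ ^ 4 + th4 τ ^ 4))
    (G := fun τ => (2 * eisenTwo τ - eisenTwo (τ / 2)) - (2 * th3 τ ^ 4 - th4 τ ^ 4))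
    (differentiableOn_of_differentiableAt fun τ hτ => ?_)
    (differentiableOn_of_differentiableAt fun τ hτ => ?_) (fun τ hτ => ?_) (fun τ hτ => ?_)
    (fun τ hτ => ?_) ?_ ?_ τ hτ
  · rw [eisenStar_eq (h2im' τ hτ), show 2 * (τ / 2) = τ by ring]
    linear_combination key.2
  · have h1 := differentiableAt_th3 hτ
    have h2 := differentiableAt_th4 hτ
    have h3 := differentiableAt_eisenTwo hτ
    have h4 := (differentiableAt_eisenTwo (h2im τ hτ)).comp (f := fun τ => 2 * τ) τ (by fun_prop)
    exact ((h3.const_mul 2).sub (h4.const_mul 4)).add ((h1.pow 4).add (h2.pow 4))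
  · have h1 := differentiableAt_th3 hτ
    have h2 := differentiableAt_th4 hτ
    have h3 := differentiableAt_eisenTwo hτ
    have h4 := (differentiableAt_eisenTwo (h2im' τ hτ)).comp (f := fun τ => τ / 2) τ (by fun_prop)
    exact ((h3.const_mul 2).sub h4).sub (((h1.pow 4).const_mul 2).sub (h2.pow 4))
  · have h0 := ne_zero_of_im_pos hτ
    have e1 := eisenTwo_S (h2im' τ hτ)
    rw [show -1 / (τ / 2) = 2 * (-1 / τ) by field_simp] at e1
    rw [e1, eisenTwo_S hτ, th3_S hτ, th4_S hτ, mul_pow, mul_pow, rootS_pow_four,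
      show τ ^ (2 : ℤ) = τ ^ 2 by norm_cast]
    linear_combination (τ ^ 2) * th3_pow_four hτ
  · rw [show 2 * (τ + 1) = 2 * τ + 1 + 1 by ring, eisenTwo_add_one hτ, eisenTwo_add_one,
      eisenTwo_add_one (h2im τ hτ), th3_add_one, th4_add_one]
    · ring
    · simpa using hτ
  · have hτ' : 0 < (τ + 1).im := by simpa using hτ
    rw [show (τ + 2) / 2 = τ / 2 + 1 by ring, eisenTwo_add_one (h2im' τ hτ),
      show τ + 2 = τ + 1 + 1 by ring, eisenTwo_add_one hτ', eisenTwo_add_one hτ, th3_add_one,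
      th4_add_one, th4_add_one, th3_add_one]
  · have h := ((tendsto_eisenTwo.const_mul 2).sub ((tendsto_mul_atImInfty (c := 2) (by norm_num)
      tendsto_eisenTwo).const_mul 4)).add ((tendsto_th3_atImInfty.pow 4).add
      (tendsto_th4_atImInfty.pow 4))
    norm_num at h
    exact h
  · have h := ((tendsto_eisenTwo.const_mul 2).sub (tendsto_mul_atImInfty (c := 1 / 2) (by norm_num)
      tendsto_eisenTwo)).sub (((tendsto_th3_atImInfty.pow 4).const_mul 2).sub
      (tendsto_th4_atImInfty.pow 4))
    norm_num at h
    refine h.congr fun τ => ?_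
    ring_nf

/-! ### Appell sums -/

/-- The Appell sum with even denominators. -/
noncomputable def appellTwo (τ : ℂ) : ℂ :=
  ∑' n : ℤ, cexp (π * I * n ^ 2 * τ) / (cexp (π * I * n * τ) + cexp (-(π * I * n * τ)))

/-- The Appell sum with odd denominators. -/
noncomputable def appellFour (τ : ℂ) : ℂ :=
  ∑' n : ℤ, (-1 : ℂ) ^ (n + 1) * cexp (π * I * (n + 1 / 2) ^ 2 * τ) /
    (cexp (-(π * I * (n + 1 / 2) * τ)) - cexp (π * I * (n + 1 / 2) * τ))

/-- Because |sinh a| ≥ |a|, the Appell denominators are bounded below linearly in Im τ. This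
controls the series on each half-plane Im τ ≥ T. -/
theorem two_mul_abs_le_abs_exp_sub (a : ℝ) : 2 * |a| ≤ |Real.exp a - Real.exp (-a)| := by
  have h : Real.exp a - Real.exp (-a) = 2 * Real.sinh a := by rw [Real.sinh_eq]; ring
  rw [h, abs_mul, abs_two, Real.abs_sinh]
  exact mul_le_mul_of_nonneg_left (Real.self_le_sinh_iff.mpr (abs_nonneg a)) two_pos.le

theorem two_mul_abs_re_le_norm_add (w : ℂ) : 2 * |w.re| ≤ ‖cexp w + cexp (-w)‖ := by
  refine (two_mul_abs_le_abs_exp_sub _).trans ?_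
  have := abs_norm_sub_norm_le (cexp w) (-cexp (-w))
  rwa [norm_neg, Complex.norm_exp, Complex.norm_exp, neg_re, sub_neg_eq_add] at this

theorem two_mul_abs_re_le_norm_sub (w : ℂ) : 2 * |w.re| ≤ ‖cexp (-w) - cexp w‖ := by
  refine (two_mul_abs_le_abs_exp_sub _).trans ?_
  have := abs_norm_sub_norm_le (cexp w) (cexp (-w))
  rwa [Complex.norm_exp, Complex.norm_exp, neg_re, norm_sub_rev] at this

theorem pi_I_mul_re (a : ℝ) (τ : ℂ) : (π * I * a * τ).re = -(π * a * τ.im) := by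
  simp

theorem appellTwo_denom_ne_zero {τ : ℂ} (hτ : 0 < τ.im) (n : ℤ) :
    cexp (π * I * n * τ) + cexp (-(π * I * n * τ)) ≠ 0 := by
  rcases eq_or_ne n 0 with rfl | hn
  · simp
  · have h := two_mul_abs_re_le_norm_add (π * I * n * τ)
    rw [← ofReal_intCast, pi_I_mul_re, abs_neg, abs_mul, abs_mul] at h
    intro h0
    rw [← ofReal_intCast] at h0
    rw [h0, norm_zero] at h
    have : 0 < |π| * |(n : ℝ)| * |τ.im| :=
      mul_pos (mul_pos (abs_pos.mpr Real.pi_ne_zero) (abs_pos.mpr (by exact_mod_cast hn)))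
        (abs_pos.mpr hτ.ne')
    linarith

theorem half_le_abs_int_add_half (n : ℤ) : (1 / 2 : ℝ) ≤ |(n : ℝ) + 1 / 2| := by
  rcases le_or_gt 0 n with h | h
  · have : (0 : ℝ) ≤ n := by exact_mod_cast h
    exact (by linarith : (1 / 2 : ℝ) ≤ n + 1 / 2).trans (le_abs_self _)
  · have : (n : ℝ) ≤ -1 := by exact_mod_cast Int.le_sub_one_of_lt h
    exact (by linarith : (1 / 2 : ℝ) ≤ -(n + 1 / 2)).trans (neg_le_abs _)

theorem appellFour_denom_norm {τ : ℂ} (hτ : 0 < τ.im) (n : ℤ) :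
    π * τ.im ≤ ‖cexp (-(π * I * (n + 1 / 2) * τ)) - cexp (π * I * (n + 1 / 2) * τ)‖ := by
  have h := two_mul_abs_re_le_norm_sub (π * I * (n + 1 / 2) * τ)
  have e : (n : ℂ) + 1 / 2 = ((n + 1 / 2 : ℝ) : ℂ) := by push_cast; ring
  rw [e, pi_I_mul_re, abs_neg, abs_mul, abs_mul, abs_of_pos hτ, abs_of_pos Real.pi_pos] at h
  rw [e]
  refine le_trans ?_ h
  have := half_le_abs_int_add_half n
  have h2 : 0 < π * τ.im := mul_pos Real.pi_pos hτ
  nlinarith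

theorem appellFour_denom_ne_zero {τ : ℂ} (hτ : 0 < τ.im) (n : ℤ) :
    cexp (-(π * I * (n + 1 / 2) * τ)) - cexp (π * I * (n + 1 / 2) * τ) ≠ 0 := fun h => by
  have := appellFour_denom_norm hτ n
  rw [h, norm_zero] at this
  nlinarith [mul_pos Real.pi_pos hτ]

theorem norm_appellTwo_term_le {T : ℝ} (hT : 0 < T) {τ : ℂ} (h : T ≤ τ.im) (n : ℤ) :
    ‖cexp (π * I * n ^ 2 * τ) / (cexp (π * I * n * τ) + cexp (-(π * I * n * τ)))‖ ≤
      (1 / 2 + 1 / (2 * (π * T))) * Real.exp (-(π * T) * n ^ 2 + 0 * n) := by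
  rw [norm_div, div_eq_mul_inv, mul_comm]
  have hπ := Real.pi_pos
  refine mul_le_mul ?_ ?_ (norm_nonneg _) (by positivity)
  · rcases eq_or_ne n 0 with rfl | hn
    · norm_num
      positivity
    · have h1 := two_mul_abs_re_le_norm_add (π * I * n * τ)
      rw [← ofReal_intCast, pi_I_mul_re, abs_neg, abs_mul, abs_mul, abs_of_pos hπ,
        abs_of_pos (hT.trans_le h)] at h1
      have h2 : (1 : ℝ) ≤ |(n : ℝ)| := by exact_mod_cast Int.one_le_abs hn
      have h3 : 2 * (π * T) ≤ 2 * (π * |(n : ℝ)| * τ.im) := by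
        have : 1 * T ≤ |(n : ℝ)| * τ.im := mul_le_mul h2 h hT.le (by positivity)
        nlinarith
      have h4 := inv_anti₀ (by positivity) (h3.trans h1)
      rw [← ofReal_intCast, one_div (2 * (π * T))]
      linarith
  · rw [show (π : ℂ) * I * n ^ 2 * τ = (π * n ^ 2 : ℝ) * I * τ by push_cast; ring, norm_cexp_mul_I]
    refine Real.exp_le_exp.mpr ?_
    have : 0 ≤ π * (n : ℝ) ^ 2 := by positivity
    nlinarith

theorem norm_appellFour_term_le {T : ℝ} (hT : 0 < T) {τ : ℂ} (h : T ≤ τ.im) (n : ℤ) :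
    ‖(-1 : ℂ) ^ (n + 1) * cexp (π * I * (n + 1 / 2) ^ 2 * τ) /
      (cexp (-(π * I * (n + 1 / 2) * τ)) - cexp (π * I * (n + 1 / 2) * τ))‖ ≤
      (1 / (π * T)) * Real.exp (-(π * T) * n ^ 2 + (-(π * T)) * n) := by
  rw [norm_div, div_eq_mul_inv, mul_comm, norm_mul, norm_zpow, norm_neg, norm_one, one_zpow,
    one_mul, one_div (π * T)]
  have hπ := Real.pi_pos
  refine mul_le_mul ?_ ?_ (norm_nonneg _) (by positivity)
  · exact inv_anti₀ (by positivity) ((mul_le_mul_of_nonneg_left h hπ.le).trans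
      (appellFour_denom_norm (hT.trans_le h) n))
  · rw [show (π : ℂ) * I * (n + 1 / 2) ^ 2 * τ = (π * (n + 1 / 2) ^ 2 : ℝ) * I * τ by
      push_cast; ring, norm_cexp_mul_I]
    refine Real.exp_le_exp.mpr ?_
    have : 0 ≤ π * ((n : ℝ) + 1 / 2) ^ 2 := by positivity
    nlinarith [mul_pos hπ hT]

theorem differentiableAt_appellTwo {τ : ℂ} (hτ : 0 < τ.im) : DifferentiableAt ℂ appellTwo τ := by
  have hπ := Real.pi_pos
  refine differentiableAt_tsum (f := fun (n : ℤ) (τ : ℂ) =>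
    cexp (π * I * n ^ 2 * τ) / (cexp (π * I * n * τ) + cexp (-(π * I * n * τ))))
    (fun n τ hτ => ?_) (b := fun T n => (1 / 2 + 1 / (2 * (π * T))) *
      Real.exp (-(π * T) * n ^ 2 + 0 * n)) (fun T hT => ?_) (fun T hT n τ h => ?_) hτ
  · exact DifferentiableAt.div (by fun_prop) (by fun_prop) (appellTwo_denom_ne_zero hτ n)
  · exact (summable_exp_neg_quadratic (by positivity) 0).mul_left _
  · exact norm_appellTwo_term_le hT h.le n

theorem differentiableAt_appellFour {τ : ℂ} (hτ : 0 < τ.im) :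
    DifferentiableAt ℂ appellFour τ := by
  have hπ := Real.pi_pos
  refine differentiableAt_tsum (f := fun (n : ℤ) (τ : ℂ) =>
    (-1 : ℂ) ^ (n + 1) * cexp (π * I * (n + 1 / 2) ^ 2 * τ) /
      (cexp (-(π * I * (n + 1 / 2) * τ)) - cexp (π * I * (n + 1 / 2) * τ)))
    (fun n τ hτ => ?_) (b := fun T n => (1 / (π * T)) *
      Real.exp (-(π * T) * n ^ 2 + (-(π * T)) * n)) (fun T hT => ?_) (fun T hT n τ h => ?_) hτ
  · exact DifferentiableAt.div (by fun_prop) (by fun_prop) (appellFour_denom_ne_zero hτ n)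
  · exact (summable_exp_neg_quadratic (by positivity) _).mul_left _
  · exact norm_appellFour_term_le hT h.le n

theorem summable_appellFour {τ : ℂ} (hτ : 0 < τ.im) :
    Summable fun n : ℤ => (-1 : ℂ) ^ (n + 1) * cexp (π * I * (n + 1 / 2) ^ 2 * τ) /
      (cexp (-(π * I * (n + 1 / 2) * τ)) - cexp (π * I * (n + 1 / 2) * τ)) :=
  .of_norm_bounded ((summable_exp_neg_quadratic (mul_pos Real.pi_pos hτ) _).mul_left _)
    (norm_appellFour_term_le hτ le_rfl)

theorem tendsto_appellTwo : Tendsto (fun τ : ℍ => appellTwo τ) atImInfty (𝓝 (1 / 2)) := by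
  have hπ := Real.pi_pos
  have := tendsto_tsum_atImInfty (ι := ℤ) (f := fun n τ =>
    cexp (π * I * n ^ 2 * τ) / (cexp (π * I * n * τ) + cexp (-(π * I * n * τ))))
    (g := fun n => if n = 0 then 1 / 2 else 0)
    ((summable_exp_neg_quadratic (c := π * 1) (by positivity) 0).mul_left
      (1 / 2 + 1 / (2 * (π * 1)))) (fun n => ?_)
    (fun n τ hτ => norm_appellTwo_term_le one_pos hτ n)
  · rwa [tsum_ite_eq] at this
  · split_ifs with h
    · subst h; norm_num
    · rw [tendsto_zero_iff_norm_tendsto_zero]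
      have hn : 0 < π * (n : ℝ) ^ 2 := by positivity
      have h1 := (tendsto_cexp_atImInfty hn).norm.const_mul (1 / (2 * π))
      rw [norm_zero, mul_zero] at h1
      have him : Tendsto (fun τ : ℍ => τ.im) atImInfty atTop := tendsto_comap
      refine squeeze_zero' (.of_forall fun _ => norm_nonneg _) ?_ h1
      filter_upwards [him.eventually_ge_atTop 1] with τ hτ
      rw [norm_div, div_eq_mul_inv, mul_comm, show (π : ℂ) * I * n ^ 2 * τ =
        (π * n ^ 2 : ℝ) * I * τ by push_cast; ring]
      refine mul_le_mul_of_nonneg_right ?_ (norm_nonneg _)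
      have h1 := two_mul_abs_re_le_norm_add (π * I * n * τ)
      rw [← ofReal_intCast, pi_I_mul_re, abs_neg, abs_mul, abs_mul, abs_of_pos hπ,
        UpperHalfPlane.coe_im, abs_of_pos τ.im_pos] at h1
      have h2 : (1 : ℝ) ≤ |(n : ℝ)| := by exact_mod_cast Int.one_le_abs h
      rw [one_div, ← ofReal_intCast]
      refine inv_anti₀ (by positivity) (le_trans ?_ h1)
      have : (1 : ℝ) * 1 ≤ |(n : ℝ)| * τ.im := mul_le_mul h2 hτ one_pos.le (by positivity)
      nlinarith

theorem tendsto_appellFour : Tendsto (fun τ : ℍ => appellFour τ) atImInfty (𝓝 0) := by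
  have hπ := Real.pi_pos
  have := tendsto_tsum_atImInfty (ι := ℤ) (f := fun n τ =>
    (-1 : ℂ) ^ (n + 1) * cexp (π * I * (n + 1 / 2) ^ 2 * τ) /
      (cexp (-(π * I * (n + 1 / 2) * τ)) - cexp (π * I * (n + 1 / 2) * τ)))
    (g := fun n => 0)
    ((summable_exp_neg_quadratic (c := π * 1) (by positivity) (-(π * 1))).mul_left
      (1 / (π * 1))) (fun n => ?_)
    (fun n τ hτ => norm_appellFour_term_le one_pos hτ n)
  · rwa [tsum_zero] at this
  · rw [tendsto_zero_iff_norm_tendsto_zero]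
    have h2 := half_le_abs_int_add_half n
    have hn : 0 < π * ((n : ℝ) + 1 / 2) ^ 2 := by
      have : 0 < ((n : ℝ) + 1 / 2) ^ 2 := by rw [← sq_abs]; positivity
      positivity
    have h1 := (tendsto_cexp_atImInfty hn).norm.const_mul (1 / π)
    rw [norm_zero, mul_zero] at h1
    have him : Tendsto (fun τ : ℍ => τ.im) atImInfty atTop := tendsto_comap
    refine squeeze_zero' (.of_forall fun _ => norm_nonneg _) ?_ h1
    filter_upwards [him.eventually_ge_atTop 1] with τ hτ
    rw [norm_div, norm_mul, norm_zpow, norm_neg, norm_one, one_zpow, one_mul, div_eq_mul_inv,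
      mul_comm, show (π : ℂ) * I * (n + 1 / 2) ^ 2 * τ =
      (π * (n + 1 / 2) ^ 2 : ℝ) * I * τ by push_cast; ring]
    refine mul_le_mul_of_nonneg_right ?_ (norm_nonneg _)
    rw [one_div π]
    refine inv_anti₀ (by positivity) (le_trans ?_ (appellFour_denom_norm τ.im_pos n))
    rw [UpperHalfPlane.coe_im]
    nlinarith

theorem cexp_int_mul_pi_I (n : ℤ) : cexp (π * I * n) = (-1) ^ n := by
  rw [mul_comm, Complex.exp_int_mul, Complex.exp_pi_mul_I]

theorem appellTwo_add_one (τ : ℂ) : appellTwo (τ + 1) = appellTwo τ := by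
  refine tsum_congr fun n => ?_
  have e1 : cexp (π * I * n ^ 2 * (τ + 1)) = (-1) ^ n * cexp (π * I * n ^ 2 * τ) := by
    rw [← cexp_int_mul_pi_I, ← Complex.exp_add, Complex.exp_eq_exp_iff_exists_int]
    obtain ⟨k, hk⟩ := Int.even_mul_pred_self n
    have hk' : (n : ℂ) * (n - 1) = k + k := by exact_mod_cast hk
    exact ⟨k, by linear_combination (π * I) * hk'⟩
  have e2 : cexp (π * I * n * (τ + 1)) = (-1) ^ n * cexp (π * I * n * τ) := by
    rw [← cexp_int_mul_pi_I, ← Complex.exp_add]; ring_nf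
  have hs : ((-1 : ℂ) ^ n)⁻¹ = (-1) ^ n := by rw [← inv_zpow]; norm_num
  rw [e1, Complex.exp_neg, e2, mul_inv, hs, ← Complex.exp_neg, ← mul_add, mul_div_mul_left]
  exact zpow_ne_zero _ (by norm_num)

theorem appellFour_add_two (τ : ℂ) : appellFour (τ + 2) = -I * appellFour τ := by
  rw [appellFour, appellFour, ← tsum_mul_left]
  refine tsum_congr fun n => ?_
  have e1 : cexp (π * I * (n + 1 / 2) ^ 2 * (τ + 2)) = I * cexp (π * I * (n + 1 / 2) ^ 2 * τ) := by
    nth_rw 2 [← Complex.exp_pi_div_two_mul_I]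
    rw [← Complex.exp_add, Complex.exp_eq_exp_iff_exists_int]
    exact ⟨n * (n + 1), by push_cast; ring⟩
  have e2 : cexp (π * I * (n + 1 / 2) * (τ + 2)) = - cexp (π * I * (n + 1 / 2) * τ) := by
    rw [← neg_one_mul, ← Complex.exp_pi_mul_I, ← Complex.exp_add,
      Complex.exp_eq_exp_iff_exists_int]
    exact ⟨n, by ring⟩
  rw [e1, Complex.exp_neg, e2, inv_neg, ← Complex.exp_neg,
    show ∀ a b : ℂ, -a - -b = -(a - b) by intros; ring]
  simp only [div_neg]
  ring

theorem neg_one_zpow_mul_self (n : ℤ) : (-1 : ℂ) ^ n * (-1) ^ n = 1 := by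
  rw [← mul_zpow]; norm_num

/-- Under n ↦ −1 − n both the sign and the denominator change sign, so the two halves of the
bilateral sum agree. -/
theorem hasSum_nat_appellFour {τ : ℂ} (hτ : 0 < τ.im) :
    HasSum (fun n : ℕ => (-1 : ℂ) ^ (n + 1) * cexp (π * I * (n + 1 / 2) ^ 2 * τ) /
      (cexp (-(π * I * (n + 1 / 2) * τ)) - cexp (π * I * (n + 1 / 2) * τ)))
      (appellFour τ / 2) := by
  have h := (summable_appellFour hτ).hasSum.nat_add_neg_add_one
  have h2 := h.div_const 2
  refine h2.congr_fun fun n => ?_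
  have e : (-1 : ℂ) ^ (-((n : ℤ) + 1) + 1) = - (-1) ^ ((n : ℤ) + 1) := by
    rw [show -((n : ℤ) + 1) + 1 = -n by ring, zpow_neg, ← inv_zpow, zpow_add₀ (by norm_num)]
    norm_num
  rw [e]
  push_cast
  rw [show (-((n : ℂ) + 1) + 1 / 2) = -(n + 1 / 2) by ring]
  rw [show (π : ℂ) * I * (-(n + 1 / 2)) * τ = -(π * I * (n + 1 / 2) * τ) by ring, neg_neg,
    neg_sq, ← neg_sub (cexp (-(π * I * (n + 1 / 2) * τ))), div_neg, neg_mul, neg_div, neg_neg,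
    show (-1 : ℂ) ^ ((n : ℤ) + 1) = (-1) ^ (n + 1) by exact_mod_cast zpow_natCast (-1 : ℂ) (n + 1)]
  ring

/-- The indefinite theta series attached to `appellFour`. -/
theorem hasSum_indefinite {τ : ℂ} (hτ : 0 < τ.im) :
    HasSum (fun p : ℕ × ℕ => (-1 : ℂ) ^ (p.2 + 1) *
      cexp (π * I * ((p.1 + 1 + p.2) ^ 2 - (p.1 + 1 / 2) ^ 2) * τ)) (appellFour τ / 2) := by
  set r : ℝ := Real.exp (-π * τ.im)
  have hr : r < 1 := by
    rw [Real.exp_lt_one_iff, neg_mul, neg_lt_zero]; exact mul_pos Real.pi_pos hτ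
  have hg := summable_geometric_of_lt_one (Real.exp_pos _).le hr
  have hs : Summable (fun p : ℕ × ℕ => (-1 : ℂ) ^ (p.2 + 1) *
      cexp (π * I * ((p.1 + 1 + p.2) ^ 2 - (p.1 + 1 / 2) ^ 2) * τ)) := by
    refine .of_norm_bounded (hg.mul_of_nonneg hg (fun _ => pow_nonneg (Real.exp_pos _).le _)
      fun _ => pow_nonneg (Real.exp_pos _).le _) fun p => ?_
    rw [norm_mul, norm_pow, norm_neg, norm_one, one_pow, one_mul,
      show (π : ℂ) * I * ((p.1 + 1 + p.2) ^ 2 - (p.1 + 1 / 2) ^ 2) * τ =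
        (π * ((p.1 + 1 + p.2) ^ 2 - (p.1 + 1 / 2) ^ 2) : ℝ) * I * τ by push_cast; ring,
      norm_cexp_mul_I, ← Real.exp_nat_mul, ← Real.exp_nat_mul, ← Real.exp_add]
    refine Real.exp_le_exp.mpr ?_
    have h0 : 0 ≤ π * τ.im := mul_nonneg Real.pi_pos.le hτ.le
    have h1 : (0 : ℝ) ≤ p.1 := Nat.cast_nonneg _
    have h2 : (0 : ℝ) ≤ p.2 := Nat.cast_nonneg _
    have : ((p.1 : ℝ) + p.2) ≤ ((p.1 + 1 + p.2) ^ 2 - (p.1 + 1 / 2) ^ 2) := by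
      nlinarith [mul_nonneg h1 h2]
    nlinarith [mul_le_mul_of_nonneg_left this h0]
  -- The summation is made over the first index with the second one fixed, which is a geometric
  -- series.
  have hs' := (Equiv.prodComm ℕ ℕ).summable_iff.mpr hs
  have h1 := hs'.hasSum.prod_fiberwise (g := fun n : ℕ => (-1 : ℂ) ^ (n + 1) *
    cexp (π * I * (n + 1 / 2) ^ 2 * τ) /
      (cexp (-(π * I * (n + 1 / 2) * τ)) - cexp (π * I * (n + 1 / 2) * τ))) (fun k => ?_)
  · have h2 := h1.unique (hasSum_nat_appellFour hτ)
    rw [← h2]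
    exact (Equiv.prodComm ℕ ℕ).hasSum_iff.mp hs'.hasSum
  -- The exponent factors as (b + 1 + k)² − (b + 1/2)² = (k + 1/2)² + (2b + 1)(k + 1/2), so the
  -- ratio in b is e^{2x}.
  · set x := π * I * (k + 1 / 2) * τ with hx
    have hx1 : ‖cexp (2 * x)‖ < 1 := by
      rw [Complex.norm_exp, Real.exp_lt_one_iff]
      rw [hx, show (2 : ℂ) * (π * I * (k + 1 / 2) * τ) = π * I * ((2 * k + 1 : ℝ) : ℂ) * τ by
        push_cast; ring, pi_I_mul_re, neg_lt_zero]
      have := Real.pi_pos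
      positivity
    have hne : cexp (-x) - cexp x ≠ 0 := by
      have := appellFour_denom_ne_zero hτ k
      push_cast at this
      exact this
    have h3 := (hasSum_geometric_of_norm_lt_one hx1).mul_left
      ((-1 : ℂ) ^ (k + 1) * cexp (π * I * (k + 1 / 2) ^ 2 * τ) * cexp x)
    rw [show (-1 : ℂ) ^ (k + 1) * cexp (π * I * (k + 1 / 2) ^ 2 * τ) / (cexp (-x) - cexp x) =
      (-1 : ℂ) ^ (k + 1) * cexp (π * I * (k + 1 / 2) ^ 2 * τ) * cexp x * (1 - cexp (2 * x))⁻¹ from ?_]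
    · refine h3.congr_fun fun b => ?_
      simp only [Function.comp, Equiv.prodComm_apply, Prod.swap_prod_mk]
      have e : cexp (π * I * ((b + 1 + k) ^ 2 - (b + 1 / 2) ^ 2) * τ) =
          cexp (π * I * (k + 1 / 2) ^ 2 * τ) * cexp x * cexp (2 * x) ^ b := by
        rw [← Complex.exp_nat_mul, ← Complex.exp_add, ← Complex.exp_add, hx]
        congr 1
        ring
      rw [e]
      ring
    · have : 1 - cexp (2 * x) = (cexp (-x) - cexp x) * cexp x := by
        rw [sub_mul, ← Complex.exp_add, ← Complex.exp_add]
        simp [two_mul]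
      rw [this]
      have := Complex.exp_ne_zero x
      field_simp

/-! ### The Fourier transform of the hyperbolic secant -/

/-- Substituting t = σ(u), with σ′ = σ(1 − σ), turns the beta integrand at (1/2 + ix, 1/2 − ix) into
a Fourier kernel over a hyperbolic cosine. -/
theorem sigmoid_integrand (x u : ℝ) :
    |Real.sigmoid u * (1 - Real.sigmoid u)| •
      ((Real.sigmoid u : ℂ) ^ ((1 / 2 + I * x : ℂ) - 1) *
        (1 - (Real.sigmoid u : ℂ)) ^ ((1 / 2 - I * x : ℂ) - 1)) =
      cexp (I * x * u) / (2 * Real.cosh (u / 2) : ℝ) := by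
  have hp := Real.sigmoid_pos u
  have h1 : 1 - Real.sigmoid u = Real.exp (Real.log (Real.sigmoid u) - u) := by
    rw [← Real.sigmoid_neg, ← Real.sigmoid_mul_rexp_neg, sub_eq_add_neg, Real.exp_add,
      Real.exp_log hp]
  have h2 : (Real.sigmoid u : ℂ) = cexp (Real.log (Real.sigmoid u)) := by
    rw [← Complex.ofReal_exp, Real.exp_log hp]
  have h3 : Real.log (Real.sigmoid u) = - Real.log (1 + Real.exp (-u)) := by
    rw [Real.sigmoid_def, Real.log_inv]
  have h5 : (1 - (Real.sigmoid u : ℂ)) = cexp (Real.log (Real.sigmoid u) - u) := by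
    rw [← ofReal_one, ← ofReal_sub, h1]; push_cast; rfl
  have h4 : Real.exp (Real.log (Real.sigmoid u) - u / 2) = (2 * Real.cosh (u / 2))⁻¹ := by
    have e : 2 * Real.cosh (u / 2) = Real.exp (u / 2) * (1 + Real.exp (-u)) := by
      rw [Real.cosh_eq, mul_add, ← Real.exp_add]; ring_nf
    rw [e, h3, sub_eq_add_neg, Real.exp_add, Real.exp_neg (Real.log _), Real.exp_log (by positivity),
      Real.exp_neg (u / 2), mul_inv, mul_comm]
  have e2 : (cexp (Real.log (Real.sigmoid u))) ^ ((1 / 2 + I * x : ℂ) - 1) =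
      cexp (Real.log (Real.sigmoid u) * ((1 / 2 + I * x : ℂ) - 1)) := by
    rw [← ofReal_exp, cpow_def_of_ne_zero (by exact_mod_cast (Real.exp_ne_zero _)), ← ofReal_log
      (Real.exp_pos _).le, Real.log_exp]
  have e3 : (cexp (Real.log (Real.sigmoid u) - u)) ^ ((1 / 2 - I * x : ℂ) - 1) =
      cexp ((Real.log (Real.sigmoid u) - u) * ((1 / 2 - I * x : ℂ) - 1)) := by
    rw [← ofReal_sub, ← ofReal_exp, cpow_def_of_ne_zero (by exact_mod_cast (Real.exp_ne_zero _)),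
      ← ofReal_log (Real.exp_pos _).le, Real.log_exp]
  have h6 : |Real.sigmoid u * (1 - Real.sigmoid u)| =
      Real.exp (2 * Real.log (Real.sigmoid u) - u) := by
    rw [abs_of_pos (mul_pos hp (by linarith [Real.sigmoid_lt_one u])), h1]
    nth_rw 1 [← Real.exp_log hp]
    rw [← Real.exp_add]; ring_nf
  rw [h5, h6, h2, e2, e3, div_eq_mul_inv (cexp (I * x * u)), ← ofReal_inv, ← h4, real_smul]
  push_cast
  rw [← Complex.exp_add, ← Complex.exp_add, ← Complex.exp_add]
  congr 1
  ring

/-- The integral is B(1/2 + ix, 1/2 − ix) = Γ(1/2 + ix)Γ(1/2 − ix), which the reflection formula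
evaluates as π/sin(π/2 + πix). -/
theorem integral_cexp_div_cosh_half (x : ℝ) :
    ∫ u : ℝ, cexp (I * x * u) / (2 * Real.cosh (u / 2) : ℝ) = π / (Real.cosh (π * x) : ℂ) := by
  have h1 := integral_image_eq_integral_abs_deriv_smul (s := univ) MeasurableSet.univ
    (fun u _ => (Real.hasDerivAt_sigmoid u).hasDerivWithinAt) Real.sigmoid_injective.injOn
    (fun t : ℝ => (t : ℂ) ^ ((1 / 2 + I * x : ℂ) - 1) * (1 - (t : ℂ)) ^ ((1 / 2 - I * x : ℂ) - 1))
  rw [image_univ, Real.range_sigmoid, Measure.restrict_univ, ← integral_Ioc_eq_integral_Ioo,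
    ← intervalIntegral.integral_of_le zero_le_one] at h1
  simp only [sigmoid_integrand] at h1
  rw [← h1]
  change betaIntegral _ _ = _
  have h2 := Complex.Gamma_mul_Gamma_eq_betaIntegral (s := 1 / 2 + I * x) (t := 1 / 2 - I * x)
    (by simp) (by simp)
  have h3 := Complex.Gamma_mul_Gamma_one_sub (1 / 2 + I * x)
  rw [show (1 : ℂ) - (1 / 2 + I * x) = 1 / 2 - I * x by ring] at h3
  rw [show (1 / 2 + I * x : ℂ) + (1 / 2 - I * x) = 1 by ring, Complex.Gamma_one, one_mul, h3,
    show (π : ℂ) * (1 / 2 + I * x) = (π * x : ℂ) * I + π / 2 by ring, Complex.sin_add_pi_div_two,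
    Complex.cos_mul_I] at h2
  rw [← h2]
  push_cast
  rfl

theorem integral_cexp_div_cosh (x : ℝ) :
    ∫ y : ℝ, cexp (2 * π * I * x * y) / (Real.cosh (π * y) : ℂ) = 1 / (Real.cosh (π * x) : ℂ) := by
  have h := integral_cexp_div_cosh_half x
  have h1 := Measure.integral_comp_mul_left
    (fun u : ℝ => cexp (I * x * u) / (2 * Real.cosh (u / 2) : ℝ)) (2 * π)
  rw [h] at h1
  have hπ : (π : ℂ) ≠ 0 := by exact_mod_cast Real.pi_ne_zero
  have e : ∀ y : ℝ, cexp (I * x * ((2 * π * y : ℝ) : ℂ)) / (2 * Real.cosh ((2 * π * y) / 2) : ℝ) =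
      (1 / 2) * (cexp (2 * π * I * x * y) / (Real.cosh (π * y) : ℂ)) := fun y => by
    rw [show (2 * π * y) / 2 = π * y by ring]
    push_cast
    rw [show I * x * (2 * π * y) = 2 * π * I * x * y by ring]
    field_simp
  simp only [e] at h1
  rw [integral_const_mul, real_smul, abs_of_pos (by positivity [Real.pi_pos])] at h1
  have hc : (Real.cosh (π * x) : ℂ) ≠ 0 := by exact_mod_cast (Real.cosh_pos _).ne'
  push_cast at h1 hc ⊢
  field_simp at h1 ⊢
  linear_combination h1

/-- The integral of a non-integrable function is 0 by convention, whereas the Fourier formula at x =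
0 gives 1. -/
theorem integrable_inv_cosh : Integrable fun y : ℝ => (Real.cosh (π * y))⁻¹ := by
  by_contra h
  have h1 := integral_cexp_div_cosh 0
  have : ∀ y : ℝ, cexp (2 * π * I * (0 : ℝ) * y) / (Real.cosh (π * y) : ℂ) =
      (((Real.cosh (π * y))⁻¹ : ℝ) : ℂ) := fun y => by simp
  simp only [this] at h1
  rw [integral_complex_ofReal, integral_undef h] at h1
  simp at h1

/-! ### Watson's identity for the Mordell integral on the imaginary axis -/

/-- The integral `∫ e^{-πsy²+2πmy} / cosh (πy) dy`. -/
noncomputable def mordellShift (s : ℝ) (m : ℤ) : ℝ :=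
  ∫ y : ℝ, Real.exp (-π * s * y ^ 2 + 2 * π * m * y) * (Real.cosh (π * y))⁻¹

/-- The Mordell integral `∫ e^{-πsy²} / cosh (πy) dy`. -/
noncomputable def mordell (s : ℝ) : ℝ := ∫ y : ℝ, Real.exp (-π * s * y ^ 2) * (Real.cosh (π * y))⁻¹

theorem inv_cosh_le_one (y : ℝ) : (Real.cosh y)⁻¹ ≤ 1 := inv_le_one_of_one_le₀ (Real.one_le_cosh y)

theorem integrable_exp_quadratic {s : ℝ} (hs : 0 < s) (c : ℝ) :
    Integrable fun y : ℝ => Real.exp (-π * s * y ^ 2 + c * y) := by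
  have := (integrable_cexp_quadratic (b := (π * s : ℝ))
    (by rw [ofReal_re]; exact mul_pos Real.pi_pos hs) c 0).norm
  refine this.congr (.of_forall fun y => ?_)
  simp only [Complex.norm_exp]
  congr 1
  rw [show (-((π * s : ℝ) : ℂ) * (y : ℂ) ^ 2 + c * y + 0) = ((-π * s * y ^ 2 + c * y : ℝ) : ℂ) by
    push_cast; ring, ofReal_re]

theorem integrable_mordellShift {s : ℝ} (hs : 0 < s) (m : ℤ) :
    Integrable fun y : ℝ => Real.exp (-π * s * y ^ 2 + 2 * π * m * y) * (Real.cosh (π * y))⁻¹ := by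
  refine (integrable_exp_quadratic hs (2 * π * m)).mul_bdd (c := 1)
    (by fun_prop (disch := exact fun _ => (Real.cosh_pos _).ne')) (.of_forall fun y => ?_)
  rw [Real.norm_of_nonneg (inv_nonneg.mpr (Real.cosh_pos _).le)]
  exact inv_cosh_le_one _

theorem integral_exp_quadratic {s : ℝ} (hs : 0 < s) (c : ℝ) :
    ∫ y : ℝ, Real.exp (-π * s * y ^ 2 + 2 * π * c * y) =
      (√s)⁻¹ * Real.exp (π * c ^ 2 / s) := by
  have h := integral_cexp_quadratic (b := (-(π * s) : ℝ))
    (by rw [ofReal_re]; linarith [mul_pos Real.pi_pos hs]) (2 * π * c) 0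
  have hπ := Real.pi_ne_zero
  have e1 : (π : ℂ) / -((-(π * s) : ℝ) : ℂ) = ((s⁻¹ : ℝ) : ℂ) := by
    have : (π : ℂ) ≠ 0 := by exact_mod_cast hπ
    have : (s : ℂ) ≠ 0 := by exact_mod_cast hs.ne'
    push_cast; field_simp
  have e2 : (0 : ℂ) - (2 * π * c) ^ 2 / (4 * ((-(π * s) : ℝ) : ℂ)) =
      ((π * c ^ 2 / s : ℝ) : ℂ) := by
    have : (π : ℂ) ≠ 0 := by exact_mod_cast hπ
    have : (s : ℂ) ≠ 0 := by exact_mod_cast hs.ne'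
    push_cast; field_simp; ring
  rw [e1, e2, show (1 / 2 : ℂ) = ((1 / 2 : ℝ) : ℂ) by push_cast; rfl,
    ← ofReal_cpow (by positivity), ← ofReal_exp, ← ofReal_mul, ← Real.sqrt_eq_rpow,
    Real.sqrt_inv] at h
  rw [← ofReal_inj, ← h, ← integral_complex_ofReal]
  congr 1
  funext y
  push_cast
  ring_nf

/-- The sum of the two exponentials is 2cosh(πy) times the exponential with parameter m + 1/2. The
denominator cancels and a Gaussian integral remains. -/
theorem mordellShift_add {s : ℝ} (hs : 0 < s) (m : ℤ) :
    mordellShift s m + mordellShift s (m + 1) =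
      2 * (√s)⁻¹ * Real.exp (π * (m + 1 / 2) ^ 2 / s) := by
  rw [mordellShift, mordellShift, ← integral_add (integrable_mordellShift hs m)
    (integrable_mordellShift hs (m + 1)), mul_assoc 2 _ (Real.exp _), ← integral_exp_quadratic hs,
    ← integral_const_mul]
  congr 1
  funext y
  have hc := (Real.cosh_pos (π * y)).ne'
  rw [← add_mul, ← div_eq_mul_inv, div_eq_iff hc, Real.cosh_eq]
  have e1 : Real.exp (-π * s * y ^ 2 + 2 * π * (m + 1 / 2) * y) * Real.exp (π * y) =
      Real.exp (-π * s * y ^ 2 + 2 * π * ((m + 1 : ℤ) : ℝ) * y) := by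
    rw [← Real.exp_add]; push_cast; ring_nf
  have e2 : Real.exp (-π * s * y ^ 2 + 2 * π * (m + 1 / 2) * y) * Real.exp (-(π * y)) =
      Real.exp (-π * s * y ^ 2 + 2 * π * m * y) := by
    rw [← Real.exp_add]; ring_nf
  rw [← e1, ← e2]
  ring

theorem mordellShift_neg (s : ℝ) (m : ℤ) : mordellShift s (-m) = mordellShift s m := by
  rw [mordellShift, ← integral_neg_eq_self, mordellShift]
  congr 1
  funext y
  rw [show π * -y = -(π * y) by ring, Real.cosh_neg]
  push_cast
  ring_nf

theorem mordellShift_nonneg (s : ℝ) (m : ℤ) : 0 ≤ mordellShift s m :=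
  integral_nonneg fun _ => mul_nonneg (Real.exp_pos _).le (inv_nonneg.mpr (Real.cosh_pos _).le)

theorem mordellShift_zero (s : ℝ) : mordellShift s 0 = mordell s := by
  simp [mordellShift, mordell]

theorem mordellShift_nat {s : ℝ} (hs : 0 < s) (m : ℕ) :
    mordellShift s m = (-1) ^ m * (mordell s - 2 * (√s)⁻¹ *
      ∑ j ∈ Finset.range m, (-1) ^ j * Real.exp (π * (j + 1 / 2) ^ 2 / s)) := by
  induction m with
  | zero => simp [mordellShift_zero]
  | succ m ih =>
    have h := mordellShift_add hs m
    rw [Finset.sum_range_succ]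
    have h1 : ((-1 : ℝ) ^ m) * (-1) ^ m = 1 := by rw [← mul_pow]; norm_num
    push_cast at h ⊢
    rw [pow_succ]
    linear_combination h - ih - (2 * (√s)⁻¹ * Real.exp (π * (m + 1 / 2) ^ 2 / s)) * h1

/-- Both terms in the recurrence are nonnegative, so each is at most its Gaussian right side. Then
(m + 1/2)² − (m + 1)² ≤ −m leaves geometric decay, and evenness in m handles the negative half. -/
theorem summable_mordellShift {s : ℝ} (hs : 0 < s) :
    Summable fun m : ℤ => Real.exp (-π * m ^ 2 / s) * mordellShift s m := by
  have hπ := Real.pi_pos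
  have key : Summable fun m : ℕ => Real.exp (-π * (m : ℝ) ^ 2 / s) * mordellShift s m := by
    rw [← summable_nat_add_iff 1]
    have hr : Real.exp (-π / s) < 1 := by
      rw [Real.exp_lt_one_iff]; exact div_neg_of_neg_of_pos (by linarith) hs
    refine .of_nonneg_of_le (fun m => mul_nonneg (Real.exp_pos _).le (mordellShift_nonneg _ _))
      (fun m => ?_) ((summable_geometric_of_lt_one (Real.exp_pos _).le hr).mul_left (2 * (√s)⁻¹))
    have h := mordellShift_add hs m
    have h2 := mordellShift_nonneg s m
    have h3 : mordellShift s ((m + 1 : ℕ) : ℤ) ≤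
        2 * (√s)⁻¹ * Real.exp (π * (m + 1 / 2) ^ 2 / s) := by
      push_cast at h ⊢; linarith
    refine (mul_le_mul_of_nonneg_left h3 (Real.exp_pos _).le).trans ?_
    rw [mul_left_comm, ← Real.exp_add, ← Real.exp_nat_mul]
    refine mul_le_mul_of_nonneg_left (Real.exp_le_exp.mpr ?_) (by positivity)
    rw [← add_div, mul_div_assoc', div_le_div_iff_of_pos_right hs]
    push_cast
    have : (0 : ℝ) ≤ m := Nat.cast_nonneg m
    nlinarith
  refine Summable.of_nat_of_neg (by simpa using key) ?_
  refine key.congr fun m => ?_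
  rw [mordellShift_neg]
  push_cast
  rw [neg_sq]

/-- This is Poisson summation, in the form of the Jacobi theta functional equation at the modulus
i/s. It removes the Gaussian from the integrand of Watson's identity. -/
theorem theta_axis {s : ℝ} (hs : 0 < s) (y : ℝ) :
    ∑' m : ℤ, cexp (-π * m ^ 2 / s + 2 * π * m * y) =
      √s * cexp (π * s * y ^ 2) * ∑' n : ℤ, cexp (-π * n ^ 2 * s) * cexp (2 * π * I * (-(s * n) : ℝ) * y) := by
  have h := jacobiTheta₂_functional_equation (-I * y) (I / s)
  have hs' : (s : ℂ) ≠ 0 := by exact_mod_cast hs.ne'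
  have e1 : (1 : ℂ) / (-I * (I / s)) ^ (1 / 2 : ℂ) = √s := by
    rw [show -I * (I / s) = ((s⁻¹ : ℝ) : ℂ) by
      push_cast; field_simp; simp, show (1 / 2 : ℂ) = ((1 / 2 : ℝ) : ℂ) by push_cast; rfl,
      ← ofReal_cpow (by positivity), ← Real.sqrt_eq_rpow, Real.sqrt_inv]
    push_cast
    rw [one_div, inv_inv]
  have e2 : -π * I * (-I * y) ^ 2 / (I / s) = π * s * y ^ 2 := by
    field_simp
    rw [I_sq]; ring
  have e3 : -I * y / (I / s) = -(s * y) := by field_simp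
  have e4 : -1 / (I / s) = I * s := by
    field_simp; rw [I_sq]
  rw [e1, e2, e3, e4] at h
  refine Eq.trans ?_ (h.trans ?_)
  · refine tsum_congr fun m => ?_
    rw [jacobiTheta₂_term]
    congr 1
    field_simp
    ring_nf
    rw [I_sq]
    ring
  · congr 1
    refine tsum_congr fun m => ?_
    rw [jacobiTheta₂_term, ← Complex.exp_add]
    congr 1
    push_cast
    linear_combination (π * m ^ 2 * s) * I_sq

/-- Of the two evaluations of the same integral, this one integrates the theta series term by term
as it stands. The next one does so after Poisson summation, where the self-dual transform of 1/cosh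
produces `appellTwo`. -/
theorem hasSum_mordellShift_left {s : ℝ} (hs : 0 < s) :
    HasSum (fun m : ℤ => ((Real.exp (-π * m ^ 2 / s) * mordellShift s m : ℝ) : ℂ))
      (∫ y : ℝ, cexp (-π * s * y ^ 2) * (∑' m : ℤ, cexp (-π * m ^ 2 / s + 2 * π * m * y)) *
        ((Real.cosh (π * y))⁻¹ : ℝ)) := by
  set F : ℤ → ℝ → ℂ := fun m y => ((Real.exp (-π * m ^ 2 / s) *
    (Real.exp (-π * s * y ^ 2 + 2 * π * m * y) * (Real.cosh (π * y))⁻¹) : ℝ) : ℂ) with hF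
  have hI : ∀ m, Integrable (F m) := fun m =>
    ((integrable_mordellShift hs m).const_mul _).ofReal
  have hn : ∀ m, ∫ y, ‖F m y‖ = Real.exp (-π * m ^ 2 / s) * mordellShift s m := fun m => by
    rw [mordellShift, ← integral_const_mul]
    congr 1
    funext y
    rw [hF, norm_real, Real.norm_of_nonneg]
    have := Real.cosh_pos (π * y)
    positivity
  have h := hasSum_integral_of_summable_integral_norm hI
    ((summable_mordellShift hs).congr fun m => (hn m).symm)
  convert! h using 1
  · funext m
    rw [hF, integral_complex_ofReal, mordellShift, integral_const_mul]
  · congr 1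
    funext y
    rw [← tsum_mul_left, ← tsum_mul_right]
    refine tsum_congr fun m => ?_
    rw [hF, ← Complex.exp_add]
    push_cast
    rw [← mul_assoc, ← Complex.exp_add]
    ring_nf

theorem hasSum_mordellShift_right {s : ℝ} (hs : 0 < s) :
    HasSum (fun n : ℤ => √s * (cexp (-π * n ^ 2 * s) / Real.cosh (π * (s * n))))
      (∫ y : ℝ, cexp (-π * s * y ^ 2) * (∑' m : ℤ, cexp (-π * m ^ 2 / s + 2 * π * m * y)) *
        ((Real.cosh (π * y))⁻¹ : ℝ)) := by
  set F : ℤ → ℝ → ℂ := fun n y => √s * cexp (-π * n ^ 2 * s) *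
    (cexp (2 * π * I * (-(s * n) : ℝ) * y) / (Real.cosh (π * y) : ℂ)) with hF
  have hx : ∀ x y : ℝ, ‖cexp (2 * π * I * x * y) / (Real.cosh (π * y) : ℂ)‖ =
      (Real.cosh (π * y))⁻¹ := fun x y => by
    rw [norm_div, show (2 : ℂ) * π * I * x * y = (2 * π * x * y : ℝ) * I by push_cast; ring,
      norm_exp_ofReal_mul_I, norm_real, Real.norm_of_nonneg (Real.cosh_pos _).le, one_div]
  have hx1 : ∀ x : ℝ, Integrable fun y : ℝ => cexp (2 * π * I * x * y) / (Real.cosh (π * y) : ℂ) :=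
    fun x => by
    refine integrable_inv_cosh.mono' ?_ (.of_forall fun y => (hx x y).le)
    refine Continuous.aestronglyMeasurable ?_
    refine Continuous.div (by fun_prop) (by fun_prop) fun y => ?_
    exact_mod_cast (Real.cosh_pos _).ne'
  have hI : ∀ m, Integrable (F m) := fun m => (hx1 _).const_mul _
  have hn : ∀ n, ∫ y, ‖F n y‖ = √s * Real.exp (-(π * s) * n ^ 2 + 0 * n) *
      ∫ y, (Real.cosh (π * y))⁻¹ := fun n => by
    rw [← integral_const_mul]
    congr 1
    funext y
    rw [hF, norm_mul, hx, norm_mul, norm_real, Real.norm_of_nonneg (Real.sqrt_nonneg _),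
      show (-π * n ^ 2 * s : ℂ) = (-(π * s) * n ^ 2 + 0 * n : ℝ) by push_cast; ring,
      ← ofReal_exp, norm_real, Real.norm_of_nonneg (Real.exp_pos _).le]
  have h := hasSum_integral_of_summable_integral_norm hI
    ((((summable_exp_neg_quadratic (mul_pos Real.pi_pos hs) 0).mul_left (√s)).mul_right _).congr
      fun m => (hn m).symm)
  convert! h using 1
  · funext n
    rw [hF, integral_const_mul, integral_cexp_div_cosh, mul_neg, Real.cosh_neg]
    ring
  · congr 1
    funext y
    rw [theta_axis hs, ← mul_assoc, mul_left_comm, ← Complex.exp_add,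
      show -π * s * (y : ℂ) ^ 2 + π * s * y ^ 2 = 0 by ring, Complex.exp_zero, mul_one,
      ← tsum_mul_left, ← tsum_mul_right]
    refine tsum_congr fun n => ?_
    rw [hF]
    push_cast
    ring

theorem axis_mul_I_im {s : ℝ} (hs : 0 < s) : 0 < ((s : ℂ) * I).im := by simpa using hs

theorem appellTwo_axis {s : ℝ} (hs : 0 < s) :
    ∑' n : ℤ, (√s : ℂ) * (cexp (-π * n ^ 2 * s) / Real.cosh (π * (s * n))) =
      2 * √s * appellTwo (s * I) := by
  rw [appellTwo, ← tsum_mul_left]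
  refine tsum_congr fun n => ?_
  rw [show π * I * n ^ 2 * (s * I) = -π * n ^ 2 * (s : ℂ) by linear_combination (π * n ^ 2 * s) * I_sq,
    show π * I * n * (s * I) = -(π * (s * n) : ℂ) by linear_combination (π * n * s) * I_sq, neg_neg]
  push_cast
  rw [Complex.cosh]
  have : cexp (-(π * (s * n))) + cexp (π * (s * n)) ≠ 0 := by
    have := appellTwo_denom_ne_zero (axis_mul_I_im hs) n
    rwa [show π * I * n * (s * I) = -(π * (s * n) : ℂ) by linear_combination (π * n * s) * I_sq,
      neg_neg] at this
  have h2 : cexp (π * (s * n)) + cexp (-(π * (s * n))) ≠ 0 := by rwa [add_comm]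
  field_simp
  ring

theorem hasSum_antidiagonal {f : ℕ × ℕ → ℂ} {a : ℂ} (h : HasSum f a) :
    HasSum (fun n : ℕ => ∑ p ∈ Finset.HasAntidiagonal.antidiagonal n, f p) a := by
  have h1 := (Finset.HasAntidiagonal.sigmaAntidiagonalEquivProd (A := ℕ)).hasSum_iff.mpr h
  refine h1.sigma fun n => ?_
  rw [← Finset.sum_coe_sort]
  exact hasSum_fintype _

/-- Watson's identity. -/
theorem watson_axis {s : ℝ} (hs : 0 < s) :
    2 * √s * appellTwo (s * I) =
      mordell s * th4 ((s⁻¹ : ℝ) * I) - 2 * (√s)⁻¹ * appellFour ((s⁻¹ : ℝ) * I) := by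
  have hs1 := inv_pos.mpr hs
  have hs' : (s : ℂ) ≠ 0 := by exact_mod_cast hs.ne'
  rw [← appellTwo_axis hs, (hasSum_mordellShift_right hs).tsum_eq]
  have hθ : HasSum (fun m : ℤ => (((-1) ^ m * Real.exp (-π * m ^ 2 / s) : ℝ) : ℂ))
      (th4 ((s⁻¹ : ℝ) * I)) := by
    refine (hasSum_jacobiTheta₂_term (1 / 2) (axis_mul_I_im hs1)).congr_fun fun m => ?_
    rw [jacobiTheta₂_term, Complex.exp_add]
    push_cast
    rw [show 2 * π * I * m * (1 / 2) = π * I * (m : ℂ) by ring, cexp_int_mul_pi_I]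
    congr 2
    field_simp
    rw [I_sq]
    ring
  have h1 := hasSum_antidiagonal (hasSum_indefinite (axis_mul_I_im hs1))
  -- Removing the mordell(s)·θ₄ part from each term leaves an even function of m that is zero at m =
  -- 0. Its positive half consists of the finite Gaussian sums from `mordellShift_nat`.
  set g : ℤ → ℂ := fun m => ((Real.exp (-π * m ^ 2 / s) * mordellShift s m : ℝ) : ℂ) -
    mordell s * (((-1) ^ m * Real.exp (-π * m ^ 2 / s) : ℝ) : ℂ) with hg
  have hpos : HasSum (fun n : ℕ => g (n + 1)) (-(2 * (√s)⁻¹) * (appellFour ((s⁻¹ : ℝ) * I) / 2)) := by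
    refine (h1.mul_left _).congr_fun fun n => ?_
    have e := mordellShift_nat hs (n + 1)
    -- On the antidiagonal p.1 + p.2 = n the first square is (n + 1)², so the finite Gaussian sums
    -- are the antidiagonal sums of the indefinite theta series.
    have hterm : ∀ k ∈ Finset.range (n + 1), (-1 : ℂ) ^ ((n - k) + 1) *
        cexp (π * I * ((k + 1 + ((n - k : ℕ) : ℂ)) ^ 2 - (k + 1 / 2) ^ 2) * ((s⁻¹ : ℝ) * I)) =
        (((-1) ^ (n + 1) * Real.exp (-π * (n + 1) ^ 2 / s) *
          ((-1) ^ k * Real.exp (π * (k + 1 / 2) ^ 2 / s)) : ℝ) : ℂ) := fun k hk => by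
      have hk' : k ≤ n := Nat.lt_succ_iff.mp (Finset.mem_range.mp hk)
      have e1 : (-1 : ℂ) ^ ((n - k) + 1) = (-1) ^ (n + 1) * (-1) ^ k := by
        obtain ⟨d, rfl⟩ := Nat.exists_eq_add_of_le hk'
        have : (-1 : ℂ) ^ k * (-1) ^ k = 1 := by rw [← mul_pow]; norm_num
        rw [Nat.add_sub_cancel_left, add_assoc, pow_add (-1 : ℂ) k]
        linear_combination (-(-1 : ℂ) ^ (d + 1)) * this
      rw [e1]
      push_cast [Nat.cast_sub hk']
      rw [mul_mul_mul_comm ((-1 : ℂ) ^ (n + 1)) (cexp _), ← Complex.exp_add]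
      congr 2
      field_simp
      ring_nf
      rw [I_sq]
      ring
    rw [Finset.Nat.sum_antidiagonal_eq_sum_range_succ_mk, Finset.sum_congr rfl hterm,
      ← ofReal_sum, ← Finset.mul_sum]
    simp only [hg]
    push_cast at e
    rw [e]
    push_cast
    rw [zpow_add_one₀ (by norm_num), zpow_natCast, pow_succ]
    ring
  have hneg : ∀ m : ℤ, g (-m) = g m := fun m => by
    simp only [hg]
    rw [mordellShift_neg, show (-1 : ℝ) ^ (-m) = (-1) ^ m by rw [zpow_neg, ← inv_zpow]; norm_num]
    push_cast
    rw [neg_sq]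
  have hg1 := hpos.of_add_one_of_neg_add_one (hpos.congr_fun fun n => hneg _)
  have hg0 : g 0 = 0 := by simp [hg, mordellShift_zero]
  have h2 := ((hasSum_mordellShift_left hs).sub (hθ.mul_left (mordell s : ℂ))).unique hg1
  rw [hg0] at h2
  linear_combination h2

/-! ### Period integrals -/

/-- Holomorphic functions on the upper half-plane decaying exponentially towards `i∞`. -/
structure IsRapid (g : ℂ → ℂ) : Prop where
  differentiableAt : ∀ z : ℂ, 0 < z.im → DifferentiableAt ℂ g z
  decay : ∀ T : ℝ, 0 < T → ∃ C c : ℝ, 0 < c ∧ ∀ z : ℂ, T ≤ z.im → ‖g z‖ ≤ C * Real.exp (-c * z.im)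

/-- The point `-τ̄ + it`. -/
noncomputable def ray (τ : ℂ) (t : ℝ) : ℂ := -(starRingEnd ℂ) τ + I * t

theorem ray_im (τ : ℂ) (t : ℝ) : (ray τ t).im = τ.im + t := by simp [ray]

/-- The integral `∫ g(-τ̄ + it) (2v + t)^{-s} dt` over `t > 0`. -/
noncomputable def period (s : ℝ) (g : ℂ → ℂ) (τ : ℂ) : ℂ :=
  ∫ t in Ioi (0 : ℝ), g (ray τ t) * (((2 * τ.im + t) ^ (-s) : ℝ) : ℂ)

theorem periodIntegral_eq (g : ℂ → ℂ) (τ : ℍ) :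
    periodIntegral g τ = I * period (1 / 2) g τ := by
  rw [periodIntegral, period, ← integral_const_mul]
  refine setIntegral_congr_fun measurableSet_Ioi fun t ht => ?_
  have ht' : (0 : ℝ) < t := ht
  have hpos : 0 < 2 * (τ : ℂ).im + t := by have := τ.im_pos; rw [UpperHalfPlane.coe_im]; positivity
  have e : -I * ((τ : ℂ) + (-(starRingEnd ℂ) (τ : ℂ) + I * t)) = ((2 * (τ : ℂ).im + t : ℝ) : ℂ) := by
    apply Complex.ext <;> simp; ring
  simp only [e]
  rw [show (1 / 2 : ℂ) = ((1 / 2 : ℝ) : ℂ) by push_cast; rfl, ← ofReal_cpow hpos.le,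
    Real.rpow_neg hpos.le, ray]
  push_cast
  rw [div_eq_mul_inv]
  ring

namespace IsRapid

variable {g : ℂ → ℂ}

/-- Cauchy's estimate on discs of radius T/2 transfers the exponential decay of g to its derivative.
-/
theorem deriv_decay (hg : IsRapid g) {T : ℝ} (hT : 0 < T) :
    ∃ C c : ℝ, 0 < c ∧ ∀ z : ℂ, T ≤ z.im → ‖deriv g z‖ ≤ C * Real.exp (-c * z.im) := by
  obtain ⟨C, c, hc, h⟩ := hg.decay (T / 2) (by positivity)
  have hC : 0 ≤ C := by
    have h1 := (norm_nonneg _).trans (h (T * I) (by simpa using by linarith))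
    exact nonneg_of_mul_nonneg_left h1 (Real.exp_pos _)
  refine ⟨C * Real.exp (c * (T / 2)) / (T / 2), c, hc, fun z hz => ?_⟩
  have him : ∀ w ∈ Metric.closedBall z (T / 2), z.im - T / 2 ≤ w.im := fun w hw => by
    have h1 : |(w - z).im| ≤ T / 2 := (abs_im_le_norm _).trans (by simpa [dist_eq_norm] using hw)
    rw [sub_im] at h1
    linarith [(abs_le.mp h1).1]
  have := norm_deriv_le_of_forall_mem_sphere_norm_le (f := g) (c := z) (R := T / 2)
    (C := C * Real.exp (-c * (z.im - T / 2))) (by positivity) ?_ ?_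
  · refine this.trans (le_of_eq ?_)
    rw [show -c * (z.im - T / 2) = c * (T / 2) + -c * z.im by ring, Real.exp_add]
    ring
  · refine DifferentiableOn.diffContOnCl fun w hw => ?_
    rw [closure_ball _ (by positivity)] at hw
    exact (hg.differentiableAt w (by linarith [him w hw])).differentiableWithinAt
  · intro w hw
    have h1 := him w (Metric.sphere_subset_closedBall hw)
    refine (h w (by linarith)).trans (mul_le_mul_of_nonneg_left (Real.exp_le_exp.mpr ?_) hC)
    nlinarith

theorem continuousOn_deriv (hg : IsRapid g) : ContinuousOn (deriv g) ℍₒ := by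
  have h1 : DifferentiableOn ℂ g ℍₒ := fun z hz => (hg.differentiableAt z hz).differentiableWithinAt
  exact (h1.deriv UpperHalfPlane.isOpen_upperHalfPlaneSet).continuousOn

theorem continuousOn (hg : IsRapid g) : ContinuousOn g ℍₒ :=
  fun z hz => (hg.differentiableAt z hz).continuousAt.continuousWithinAt

end IsRapid

theorem rpow_neg_le {v T s t : ℝ} (hT : 0 < T) (h : T ≤ v) (ht : 0 ≤ t) (hs : 0 ≤ s) :
    (2 * v + t) ^ (-s) ≤ (2 * T) ^ (-s) :=
  Real.rpow_le_rpow_of_nonpos (by positivity) (by linarith) (by linarith)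

/-- Continuity and domination of the integrands of period integrals. -/
theorem continuousOn_ray_mul {φ : ℂ → ℂ} (hφ : ContinuousOn φ ℍₒ) {τ : ℂ} (hτ : 0 < τ.im) (s : ℝ) :
    ContinuousOn (fun t : ℝ => φ (ray τ t) * (((2 * τ.im + t) ^ (-s) : ℝ) : ℂ)) (Ici 0) := by
  refine ContinuousOn.mul (hφ.comp (by unfold ray; fun_prop) fun t ht => ?_) ?_
  · change 0 < (ray τ t).im
    rw [ray_im]
    have : (0 : ℝ) ≤ t := ht
    positivity
  · refine continuous_ofReal.comp_continuousOn (ContinuousOn.rpow_const (by fun_prop) fun t ht => ?_)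
    have : (0 : ℝ) ≤ t := ht
    left; positivity

theorem norm_ray_mul_le {φ : ℂ → ℂ} {T C c s : ℝ} (hT : 0 < T) (hs : 0 ≤ s) (hc : 0 < c)
    (h : ∀ z : ℂ, T ≤ z.im → ‖φ z‖ ≤ C * Real.exp (-c * z.im)) {τ : ℂ} (hτ : T ≤ τ.im) {t : ℝ}
    (ht : 0 ≤ t) : ‖φ (ray τ t) * (((2 * τ.im + t) ^ (-s) : ℝ) : ℂ)‖ ≤
      C * (2 * T) ^ (-s) * Real.exp (-c * t) := by
  have hC : 0 ≤ C := by
    have h1 := (norm_nonneg _).trans (h (T * I) (by simp))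
    exact nonneg_of_mul_nonneg_left h1 (Real.exp_pos _)
  have h2 : 0 ≤ 2 * τ.im + t := by linarith
  rw [norm_mul, norm_real, Real.norm_of_nonneg (by positivity), mul_right_comm]
  refine mul_le_mul ((h _ (by rw [ray_im]; linarith)).trans ?_) (rpow_neg_le hT hτ ht hs)
    (by positivity) (by positivity)
  refine mul_le_mul_of_nonneg_left (Real.exp_le_exp.mpr ?_) hC
  rw [ray_im]
  nlinarith

theorem integrableOn_ray_mul {φ : ℂ → ℂ} (hφ : ContinuousOn φ ℍₒ)
    (h : ∀ T : ℝ, 0 < T → ∃ C c : ℝ, 0 < c ∧ ∀ z : ℂ, T ≤ z.im → ‖φ z‖ ≤ C * Real.exp (-c * z.im))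
    {τ : ℂ} (hτ : 0 < τ.im) {s : ℝ} (hs : 0 ≤ s) :
    IntegrableOn (fun t : ℝ => φ (ray τ t) * (((2 * τ.im + t) ^ (-s) : ℝ) : ℂ)) (Ioi 0) := by
  obtain ⟨C, c, hc, h⟩ := h τ.im hτ
  refine Integrable.mono' ((exp_neg_integrableOn_Ioi 0 hc).const_mul (C * (2 * τ.im) ^ (-s)))
    (((continuousOn_ray_mul hφ hτ s).mono Ioi_subset_Ici_self).aestronglyMeasurable
      measurableSet_Ioi) ?_
  filter_upwards [ae_restrict_mem measurableSet_Ioi] with t ht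
  exact norm_ray_mul_le hτ hs hc h le_rfl (le_of_lt ht)

variable {g : ℂ → ℂ}

/-- The real-linear map `δ ↦ -a·conj δ + b·Im δ`. -/
noncomputable def conjIm (a b : ℂ) : ℂ →L[ℝ] ℂ :=
  a • (-(conjCLE : ℂ →L[ℝ] ℂ)) + b • (ofRealCLM.comp imCLM)

theorem conjIm_apply (a b δ : ℂ) : conjIm a b δ = -a * (starRingEnd ℂ) δ + b * δ.im := by
  simp [conjIm]

theorem norm_conjIm_le (a b : ℂ) : ‖conjIm a b‖ ≤ ‖a‖ + ‖b‖ := by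
  refine ContinuousLinearMap.opNorm_le_bound _ (by positivity) fun δ => ?_
  rw [conjIm_apply, add_mul]
  refine (norm_add_le _ _).trans (add_le_add ?_ ?_)
  · rw [norm_mul, norm_neg, norm_conj]
  · rw [norm_mul, norm_real]
    exact mul_le_mul_of_nonneg_left (abs_im_le_norm δ) (norm_nonneg b)

theorem hasFDerivAt_ray_mul (hg : IsRapid g) (s : ℝ) {τ : ℂ} (hτ : 0 < τ.im) {t : ℝ} (ht : 0 ≤ t) :
    HasFDerivAt (𝕜 := ℝ) (fun τ : ℂ => g (ray τ t) * (((2 * τ.im + t) ^ (-s) : ℝ) : ℂ))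
      (conjIm (deriv g (ray τ t) * (((2 * τ.im + t) ^ (-s) : ℝ) : ℂ))
        (-2 * s * (g (ray τ t) * (((2 * τ.im + t) ^ (-(s + 1)) : ℝ) : ℂ)))) τ := by
  have h1 : HasFDerivAt (𝕜 := ℝ) (fun τ : ℂ => ray τ t) (-(conjCLE : ℂ →L[ℝ] ℂ)) τ :=
    ((conjCLE : ℂ →L[ℝ] ℂ).hasFDerivAt.neg).add_const _
  have hz : 0 < (ray τ t).im := by rw [ray_im]; positivity
  have h2 : HasFDerivAt (𝕜 := ℝ) g _ (ray τ t) :=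
    ((hg.differentiableAt _ hz).hasDerivAt.hasFDerivAt).restrictScalars ℝ
  have h3 := h2.comp τ h1
  have hne : 2 * τ.im + t ≠ 0 := by positivity
  have h4 : HasFDerivAt (𝕜 := ℝ) (fun τ : ℂ => 2 * τ.im + t) ((2 : ℝ) • imCLM) τ :=
    (imCLM.hasFDerivAt.const_mul (2 : ℝ)).add_const t
  have h5 := (Real.hasDerivAt_rpow_const (p := -s) (Or.inl hne)).comp_hasFDerivAt τ h4
  have h6 := ofRealCLM.hasFDerivAt.comp τ h5
  refine (h3.mul h6).congr_fderiv ?_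
  ext δ
  rw [conjIm_apply]
  simp [ray, show -s - 1 = -(s + 1) by ring]
  ring

/-- This is integration by parts along the ray, on which d/dt g = i·g′. It trades g′ for a boundary
value and a period integral with exponent raised by one. -/
theorem integral_deriv_ray_mul (hg : IsRapid g) {s : ℝ} (hs : 0 ≤ s) {τ : ℂ} (hτ : 0 < τ.im) :
    ∫ t in Ioi (0 : ℝ), deriv g (ray τ t) * (((2 * τ.im + t) ^ (-s) : ℝ) : ℂ) =
      I * (g (-(starRingEnd ℂ) τ) * (((2 * τ.im) ^ (-s) : ℝ) : ℂ)) - I * s * period (s + 1) g τ := by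
  have i1 := integrableOn_ray_mul hg.continuousOn_deriv (fun T hT => hg.deriv_decay hT) hτ hs
  have i2 := integrableOn_ray_mul (s := s + 1) hg.continuousOn hg.decay hτ (by linarith)
  have key := integral_Ioi_of_hasDerivAt_of_tendsto' (a := 0) (m := 0)
    (f := fun t : ℝ => g (ray τ t) * (((2 * τ.im + t) ^ (-s) : ℝ) : ℂ))
    (f' := fun t : ℝ => I * (deriv g (ray τ t) * (((2 * τ.im + t) ^ (-s) : ℝ) : ℂ)) +
      (-s) * (g (ray τ t) * (((2 * τ.im + t) ^ (-(s + 1)) : ℝ) : ℂ))) (fun t ht => ?_)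
    ((i1.const_mul _).add (i2.const_mul _)) ?_
  · rw [integral_add (i1.const_mul _) (i2.const_mul _), integral_const_mul, integral_const_mul] at key
    have e : ray τ 0 = -(starRingEnd ℂ) τ := by simp [ray]
    rw [e, add_zero, zero_sub] at key
    change _ + _ * period (s + 1) g τ = _ at key
    linear_combination (-I) * key +
      (∫ t in Ioi (0 : ℝ), deriv g (ray τ t) * (((2 * τ.im + t) ^ (-s) : ℝ) : ℂ)) * I_sq
  · have ht' : (0 : ℝ) ≤ t := ht
    have hz : 0 < (ray τ t).im := by rw [ray_im]; positivity
    have h1 : HasDerivAt (fun t : ℝ => ray τ t) I t := by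
      simpa [ray] using ((hasDerivAt_id t).ofReal_comp.const_mul I).const_add (-(starRingEnd ℂ) τ)
    have h2 := (hg.differentiableAt _ hz).hasDerivAt.comp_of_eq t h1 rfl
    have hne : 2 * τ.im + t ≠ 0 := by positivity
    have h3 := ((Real.hasDerivAt_rpow_const (p := -s) (Or.inl hne)).comp t
      ((hasDerivAt_id t).const_add (2 * τ.im))).ofReal_comp
    refine (h2.mul h3).congr_deriv ?_
    simp [show -s - 1 = -(s + 1) by ring]
    ring
  · obtain ⟨C, c, hc, h⟩ := hg.decay τ.im hτ
    have hlim : Tendsto (fun t : ℝ => C * (2 * τ.im) ^ (-s) * Real.exp (-c * t)) atTop (𝓝 0) := by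
      have : Tendsto (fun t : ℝ => -c * t) atTop atBot := tendsto_id.const_mul_atTop_of_neg (by linarith)
      simpa using (Real.tendsto_exp_atBot.comp this).const_mul (C * (2 * τ.im) ^ (-s))
    refine squeeze_zero_norm' ?_ hlim
    filter_upwards [eventually_ge_atTop 0] with t ht
    exact norm_ray_mul_le hτ hs hc h le_rfl ht

/-- Differentiation under the integral sign produces an integral of g′, which integration by parts
removes. The derivative involves only boundary values and `period (s + 1)`, and this closed form
drives the regularity and Laplacian computations. -/
theorem hasFDerivAt_period (hg : IsRapid g) {s : ℝ} (hs : 0 ≤ s) {τ : ℂ} (hτ : 0 < τ.im) :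
    HasFDerivAt (𝕜 := ℝ) (period s g)
      (conjIm (I * (g (-(starRingEnd ℂ) τ) * (((2 * τ.im) ^ (-s) : ℝ) : ℂ)) -
        I * s * period (s + 1) g τ) (-2 * s * period (s + 1) g τ)) τ := by
  set T := τ.im / 2 with hTdef
  have hT : 0 < T := by positivity
  obtain ⟨C, c, hc, h⟩ := hg.decay T hT
  obtain ⟨C', c', hc', h'⟩ := hg.deriv_decay hT
  have hmem : {z : ℂ | T < z.im} ∈ 𝓝 τ :=
    (continuous_im.isOpen_preimage _ isOpen_Ioi).mem_nhds (by change T < τ.im; linarith)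
  have i1 := integrableOn_ray_mul hg.continuousOn_deriv (fun T hT => hg.deriv_decay hT) hτ hs
  have i2 := integrableOn_ray_mul (s := s + 1) hg.continuousOn hg.decay hτ (by linarith)
  have e : ∫ t in Ioi (0 : ℝ), conjIm (deriv g (ray τ t) * (((2 * τ.im + t) ^ (-s) : ℝ) : ℂ))
        (-2 * s * (g (ray τ t) * (((2 * τ.im + t) ^ (-(s + 1)) : ℝ) : ℂ))) =
      conjIm (I * (g (-(starRingEnd ℂ) τ) * (((2 * τ.im) ^ (-s) : ℝ) : ℂ)) -
        I * s * period (s + 1) g τ) (-2 * s * period (s + 1) g τ) := by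
    rw [← integral_deriv_ray_mul hg hs hτ]
    simp only [conjIm]
    rw [integral_add (i1.smul_const _) ((i2.const_mul _).smul_const _), integral_smul_const,
      integral_smul_const, integral_const_mul]
    rfl
  rw [← e]
  refine hasFDerivAt_integral_of_dominated_of_fderiv_le (μ := volume.restrict (Ioi 0))
    (F := fun τ t => g (ray τ t) * (((2 * τ.im + t) ^ (-s) : ℝ) : ℂ)) (F' := fun τ t =>
      conjIm (deriv g (ray τ t) * (((2 * τ.im + t) ^ (-s) : ℝ) : ℂ))
        (-2 * s * (g (ray τ t) * (((2 * τ.im + t) ^ (-(s + 1)) : ℝ) : ℂ))))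
    (s := {z : ℂ | T < z.im}) (bound := fun t =>
    C' * (2 * T) ^ (-s) * Real.exp (-c' * t) +
      2 * s * (C * (2 * T) ^ (-(s + 1)) * Real.exp (-c * t))) hmem ?_
    (integrableOn_ray_mul hg.continuousOn hg.decay hτ hs) ?_ ?_ ?_ ?_
  · filter_upwards [hmem] with z hz
    exact ((continuousOn_ray_mul hg.continuousOn (hT.trans hz) s).mono
      Ioi_subset_Ici_self).aestronglyMeasurable measurableSet_Ioi
  · simp only [conjIm]
    exact AEStronglyMeasurable.add (i1.smul_const _).aestronglyMeasurable
      ((i2.const_mul _).smul_const _).aestronglyMeasurable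
  · filter_upwards [ae_restrict_mem measurableSet_Ioi] with t ht z hz
    have hz' : T ≤ z.im := le_of_lt hz
    refine (norm_conjIm_le _ _).trans (add_le_add (norm_ray_mul_le hT hs hc' h' hz' (le_of_lt ht)) ?_)
    rw [norm_mul]
    refine mul_le_mul (le_of_eq ?_)
      (norm_ray_mul_le hT (by linarith : 0 ≤ s + 1) hc h hz' (le_of_lt ht))
      (norm_nonneg _) (by positivity)
    rw [norm_mul, norm_real, Real.norm_of_nonneg hs]; simp
  · exact ((exp_neg_integrableOn_Ioi 0 hc').const_mul _).add
      (((exp_neg_integrableOn_Ioi 0 hc).const_mul _).const_mul _)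
  · filter_upwards [ae_restrict_mem measurableSet_Ioi] with t ht z hz
    exact hasFDerivAt_ray_mul hg s (hT.trans hz) (le_of_lt ht)

theorem contDiffOn_comp_neg_conj (hg : IsRapid g) {n : WithTop ℕ∞} :
    ContDiffOn ℝ n (fun τ => g (-(starRingEnd ℂ) τ)) ℍₒ := by
  have h1 : DifferentiableOn ℂ g ℍₒ := fun z hz => (hg.differentiableAt z hz).differentiableWithinAt
  have h2 : ContDiffOn ℝ n g ℍₒ :=
    (h1.contDiffOn UpperHalfPlane.isOpen_upperHalfPlaneSet).restrict_scalars ℝ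
  refine h2.comp (conjCLE.contDiff.neg).contDiffOn fun z hz => ?_
  change 0 < (-(starRingEnd ℂ) z).im
  simpa using hz

theorem contDiffOn_im_rpow (s : ℝ) {n : WithTop ℕ∞} :
    ContDiffOn ℝ n (fun τ : ℂ => (((2 * τ.im) ^ (-s) : ℝ) : ℂ)) ℍₒ := by
  refine ofRealCLM.contDiff.comp_contDiffOn ?_
  refine ContDiffOn.rpow_const_of_ne (contDiff_const.mul imCLM.contDiff).contDiffOn fun z hz => ?_
  have : 0 < z.im := hz
  positivity

theorem contDiffOn_period (hg : IsRapid g) (n : ℕ) :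
    ∀ {s : ℝ}, 0 ≤ s → ContDiffOn ℝ n (period s g) ℍₒ := by
  have hd : ∀ {s : ℝ}, 0 ≤ s → DifferentiableOn ℝ (period s g) ℍₒ := fun hs z hz =>
    (hasFDerivAt_period hg hs hz).differentiableAt.differentiableWithinAt
  -- The exponent s stays general, since the derivative at exponent s involves the period at
  -- exponent s + 1.
  induction n with
  | zero => intro s hs; exact contDiffOn_zero.mpr (hd hs).continuousOn
  | succ n ih =>
    intro s hs
    push_cast
    rw [contDiffOn_succ_iff_fderiv_of_isOpen UpperHalfPlane.isOpen_upperHalfPlaneSet]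
    refine ⟨hd hs, by simp, ?_⟩
    have h1 := ih (s := s + 1) (by linarith)
    refine ContDiffOn.congr ?_ fun z hz => (hasFDerivAt_period hg hs hz).fderiv
    have h2 := (contDiffOn_comp_neg_conj (n := n) hg).mul (contDiffOn_im_rpow s)
    unfold conjIm
    exact (((contDiffOn_const.mul h2).sub (contDiffOn_const.mul h1)).smul contDiffOn_const).add
      ((contDiffOn_const.mul h1).smul contDiffOn_const)

/-! ### The period integral of `η³` on the imaginary axis -/

/-- The antiderivative of the Gaussian. -/
noncomputable def gaussPrim (x : ℝ) : ℝ := ∫ t in (0 : ℝ)..x, Real.exp (-π * t ^ 2)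

theorem hasDerivAt_gaussPrim (x : ℝ) : HasDerivAt gaussPrim (Real.exp (-π * x ^ 2)) x :=
  (Continuous.integral_hasStrictDerivAt (f := fun t : ℝ => Real.exp (-π * t ^ 2))
    (by fun_prop) 0 x).hasDerivAt

theorem tendsto_gaussPrim_atTop : Tendsto gaussPrim atTop (𝓝 (1 / 2)) := by
  have h := intervalIntegral_tendsto_integral_Ioi (f := fun t : ℝ => Real.exp (-π * t ^ 2)) 0
    (integrable_exp_neg_mul_sq Real.pi_pos).integrableOn tendsto_id
  rwa [integral_gaussian_Ioi, div_self Real.pi_ne_zero, Real.sqrt_one] at h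

theorem gaussPrim_neg (x : ℝ) : gaussPrim (-x) = -gaussPrim x := by
  have h := intervalIntegral.integral_comp_neg (a := 0) (b := x)
    (fun t : ℝ => Real.exp (-π * t ^ 2))
  simp only [neg_sq, neg_zero] at h
  rw [gaussPrim, intervalIntegral.integral_symm, ← h, gaussPrim]

theorem tendsto_gaussPrim_atBot : Tendsto gaussPrim atBot (𝓝 (-(1 / 2))) := by
  refine ((tendsto_gaussPrim_atTop.comp tendsto_neg_atBot_atTop).neg).congr fun x => ?_
  rw [Function.comp, gaussPrim_neg, neg_neg]

theorem tendsto_sqrt_nhdsGT_zero : Tendsto (fun u : ℝ => √u) (𝓝[>] 0) (𝓝[>] 0) := by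
  refine tendsto_nhdsWithin_iff.mpr ⟨?_, ?_⟩
  · have := Real.continuous_sqrt.tendsto 0
    rw [Real.sqrt_zero] at this
    exact this.mono_left nhdsWithin_le_nhds
  · filter_upwards [self_mem_nhdsWithin] with u hu
    exact Real.sqrt_pos.mpr hu

theorem hasDerivAt_gaussPrim_comp (a b : ℝ) {u : ℝ} (hu : 0 < u) :
    HasDerivAt (fun u : ℝ => gaussPrim (b * √u + a * (√u)⁻¹))
      (Real.exp (-π * (a ^ 2 / u) - π * b ^ 2 * u - 2 * π * a * b) *
        ((b * (√u)⁻¹ - a * (√u)⁻¹ ^ 3) / 2)) u := by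
  have hs := Real.sqrt_pos.mpr hu
  have hsq : √u ^ 2 = u := Real.sq_sqrt hu.le
  have h1 : HasDerivAt (fun u : ℝ => √u) (1 / (2 * √u)) u := Real.hasDerivAt_sqrt hu.ne'
  have h2 := (h1.const_mul b).add ((h1.inv hs.ne').const_mul a)
  refine ((hasDerivAt_gaussPrim _).comp u h2).congr_deriv ?_
  have e : (b * √u + a * (√u)⁻¹) ^ 2 = a ^ 2 / u + b ^ 2 * u + 2 * a * b := by
    have h : ∀ r : ℝ, 0 < r → (b * r + a * r⁻¹) ^ 2 = a ^ 2 / r ^ 2 + b ^ 2 * r ^ 2 + 2 * a * b :=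
      fun r hr => by field_simp; ring
    rw [h _ hs, hsq]
  congr 1
  · simp only [Pi.add_apply, Pi.inv_apply]
    rw [e]
    congr 1
    ring
  · field_simp
    ring

/-- The squares of b√u ± a/√u differ from a²/u + b²u by ±2ab, which the factors e^{±2πab} absorb.
The b-parts of the two derivatives then cancel and the a-parts add. -/
theorem hasDerivAt_inverse_gaussian (a b : ℝ) {u : ℝ} (hu : 0 < u) :
    HasDerivAt (fun u : ℝ => Real.exp (-2 * π * a * b) * gaussPrim (b * √u + -a * (√u)⁻¹) -
        Real.exp (2 * π * a * b) * gaussPrim (b * √u + a * (√u)⁻¹))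
      (a * (√u)⁻¹ ^ 3 * Real.exp (-π * (a ^ 2 / u) - π * b ^ 2 * u)) u := by
  refine (((hasDerivAt_gaussPrim_comp (-a) b hu).const_mul _).sub
    ((hasDerivAt_gaussPrim_comp a b hu).const_mul _)).congr_deriv ?_
  rw [← mul_assoc, ← mul_assoc, ← Real.exp_add, ← Real.exp_add, neg_sq,
    show -2 * π * a * b + (-π * (a ^ 2 / u) - π * b ^ 2 * u - 2 * π * -a * b) =
      -π * (a ^ 2 / u) - π * b ^ 2 * u by ring,
    show 2 * π * a * b + (-π * (a ^ 2 / u) - π * b ^ 2 * u - 2 * π * a * b) =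
      -π * (a ^ 2 / u) - π * b ^ 2 * u by ring]
  ring

/-- The inverse Gaussian integral. -/
theorem inverse_gaussian {a b : ℝ} (ha : 0 < a) (hb : 0 < b) :
    IntegrableOn (fun u : ℝ => a * (√u)⁻¹ ^ 3 * Real.exp (-π * (a ^ 2 / u) - π * b ^ 2 * u))
      (Ioi 0) ∧
    ∫ u in Ioi (0 : ℝ), a * (√u)⁻¹ ^ 3 * Real.exp (-π * (a ^ 2 / u) - π * b ^ 2 * u) =
      Real.exp (-2 * π * a * b) := by
  set F : ℝ → ℝ := fun u : ℝ => Real.exp (-2 * π * a * b) * gaussPrim (b * √u + -a * (√u)⁻¹) -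
        Real.exp (2 * π * a * b) * gaussPrim (b * √u + a * (√u)⁻¹) with hF
  set l : ℝ := Real.exp (-2 * π * a * b) * (-(1 / 2)) - Real.exp (2 * π * a * b) * (1 / 2) with hl
  have hinv : Tendsto (fun u : ℝ => (√u)⁻¹) (𝓝[>] 0) atTop :=
    tendsto_inv_nhdsGT_zero.comp tendsto_sqrt_nhdsGT_zero
  have hsq0 : Tendsto (fun u : ℝ => b * √u) (𝓝[>] 0) (𝓝 0) := by
    simpa using (tendsto_sqrt_nhdsGT_zero.mono_right nhdsWithin_le_nhds).const_mul b
  have hsqT : Tendsto (fun u : ℝ => b * √u) atTop atTop := Real.tendsto_sqrt_atTop.const_mul_atTop hb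
  have hinvT : ∀ c : ℝ, Tendsto (fun u : ℝ => c * (√u)⁻¹) atTop (𝓝 0) := fun c => by
    simpa using (tendsto_inv_atTop_zero.comp Real.tendsto_sqrt_atTop).const_mul c
  have h0 : Tendsto F (𝓝[>] 0) (𝓝 l) :=
    ((tendsto_gaussPrim_atBot.comp (hsq0.add_atBot
      (hinv.const_mul_atTop_of_neg (by linarith : -a < 0)))).const_mul _).sub
      ((tendsto_gaussPrim_atTop.comp (hsq0.add_atTop (hinv.const_mul_atTop ha))).const_mul _)
  have hT : Tendsto F atTop (𝓝 (Real.exp (-2 * π * a * b) * (1 / 2) -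
      Real.exp (2 * π * a * b) * (1 / 2))) :=
    ((tendsto_gaussPrim_atTop.comp (hsqT.atTop_add (hinvT _))).const_mul _).sub
      ((tendsto_gaussPrim_atTop.comp (hsqT.atTop_add (hinvT _))).const_mul _)
  -- The primitive is undefined in meaning at u = 0 and is replaced there by its right limit. With a
  -- nonnegative integrand, the fundamental theorem yields integrability and the value together.
  set G := Function.update F 0 l with hG
  have hGF : ∀ u : ℝ, 0 < u → G =ᶠ[𝓝 u] F := fun u hu => by
    filter_upwards [lt_mem_nhds hu] with w hw
    exact Function.update_of_ne hw.ne' _ _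
  have hcont : ContinuousWithinAt G (Ici 0) 0 := by
    rw [← continuousWithinAt_Ioi_iff_Ici, ContinuousWithinAt, hG, Function.update_self]
    refine h0.congr' ?_
    filter_upwards [self_mem_nhdsWithin] with w hw
    exact (Function.update_of_ne (ne_of_gt hw) _ _).symm
  have hd : ∀ u ∈ Ioi (0 : ℝ), HasDerivAt G
      (a * (√u)⁻¹ ^ 3 * Real.exp (-π * (a ^ 2 / u) - π * b ^ 2 * u)) u := fun u hu =>
    (hasDerivAt_inverse_gaussian a b hu).congr_of_eventuallyEq (hGF u hu)
  have hpos : ∀ u ∈ Ioi (0 : ℝ),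
      0 ≤ a * (√u)⁻¹ ^ 3 * Real.exp (-π * (a ^ 2 / u) - π * b ^ 2 * u) := fun u _ => by positivity
  have hT' : Tendsto G atTop (𝓝 (Real.exp (-2 * π * a * b) * (1 / 2) -
      Real.exp (2 * π * a * b) * (1 / 2))) := by
    refine hT.congr' ?_
    filter_upwards [eventually_gt_atTop 0] with w hw
    exact (Function.update_of_ne hw.ne' _ _).symm
  refine ⟨integrableOn_Ioi_deriv_of_nonneg hcont hd hpos hT', ?_⟩
  rw [integral_Ioi_of_hasDerivAt_of_nonneg hcont hd hpos hT', hG, Function.update_self, hl]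
  ring

theorem isRapid_eta_pow_three : IsRapid fun z => η z ^ 3 := by
  refine ⟨fun z hz => (differentiableAt_eta hz).pow 3, fun T hT => ?_⟩
  have hs := (hasSum_thEta (τ := T * I) (by simpa using hT)).summable.norm
  refine ⟨Real.exp (π / 4 * T) * ∑' n : ℤ, ‖(-1 : ℂ) ^ n * (n + 1 / 2) *
    cexp (π * I * (n + 1 / 2) ^ 2 * (T * I))‖, π / 4, by positivity, fun z hz => ?_⟩
  have hz' := hT.trans_le hz
  rw [eta_pow_three_eq hz', mul_right_comm, ← Real.exp_add, ← tsum_mul_left,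
    ← (hasSum_thEta hz').tsum_eq]
  refine tsum_of_norm_bounded (hs.mul_left _).hasSum fun n => ?_
  have e : ∀ τ : ℂ, cexp (π * I * (n + 1 / 2) ^ 2 * τ) =
      cexp ((π * (n + 1 / 2) ^ 2 : ℝ) * I * τ) := fun τ => by push_cast; ring_nf
  rw [norm_mul, norm_mul _ (cexp _), e, e, norm_cexp_mul_I, norm_cexp_mul_I, mul_left_comm,
    ← Real.exp_add]
  refine mul_le_mul_of_nonneg_left (Real.exp_le_exp.mpr ?_) (norm_nonneg _)
  have h1 : 0 ≤ π * ((n : ℝ) * (n + 1)) := by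
    refine mul_nonneg Real.pi_pos.le ?_
    have : 0 ≤ n * (n + 1) := by
      rcases le_or_gt 0 n with h | h
      · positivity
      · exact mul_nonneg_of_nonpos_of_nonpos h.le (by omega)
    exact_mod_cast this
  simp only [mul_im, ofReal_re, I_im, mul_one, ofReal_im, I_re, mul_zero, add_zero]
  nlinarith

theorem IsRapid.comp_mul {g : ℂ → ℂ} (hg : IsRapid g) {a : ℝ} (ha : 0 < a) :
    IsRapid fun z => g (a * z) := by
  refine ⟨fun z hz => ?_, fun T hT => ?_⟩
  · refine (hg.differentiableAt (a * z) ?_).comp (f := fun z => (a : ℂ) * z) z (by fun_prop)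
    simpa using mul_pos ha hz
  · obtain ⟨C, c, hc, h⟩ := hg.decay (a * T) (by positivity)
    refine ⟨C, c * a, by positivity, fun z hz => (h _ ?_).trans (le_of_eq ?_)⟩
    · simpa using mul_le_mul_of_nonneg_left hz ha.le
    · simp; left; ring

/-- `η³` on the imaginary axis. -/
theorem hasSum_eta_axis {w : ℝ} (hw : 0 < w) :
    HasSum (fun n : ℕ => (((-1) ^ n * (2 * ((n + 1 / 2) * Real.exp (-π * (n + 1 / 2) ^ 2 * w)))
      : ℝ) : ℂ)) (η (w * I) ^ 3) := by
  rw [eta_pow_three_eq (axis_mul_I_im hw)]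
  refine ((hasSum_thEta (axis_mul_I_im hw)).nat_add_neg_add_one).congr_fun fun n => ?_
  have e : (-1 : ℂ) ^ (-((n : ℤ) + 1)) = -(-1) ^ n := by
    rw [zpow_neg, ← inv_zpow, zpow_add_one₀ (by norm_num)]; norm_num
  rw [e]
  push_cast
  rw [zpow_natCast, show (-((n : ℂ) + 1) + 1 / 2) = -(n + 1 / 2) by ring, neg_sq,
    show π * I * ((n : ℂ) + 1 / 2) ^ 2 * (w * I) = -π * (n + 1 / 2) ^ 2 * w by
      linear_combination (π * ((n : ℂ) + 1 / 2) ^ 2 * w) * I_sq]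
  ring

theorem rootS_axis {w : ℝ} (hw : 0 < w) : rootS (w * I) = √w := by
  rw [rootS, show -I * (w * I) = (w : ℂ) by linear_combination (-(w : ℂ)) * I_sq,
    show (1 / 2 : ℂ) = ((1 / 2 : ℝ) : ℂ) by push_cast; rfl, ← ofReal_cpow hw.le,
    ← Real.sqrt_eq_rpow]

theorem eta_axis_inv {w : ℝ} (hw : 0 < w) :
    η ((w⁻¹ : ℝ) * I) ^ 3 = (√w : ℂ) ^ 3 * η (w * I) ^ 3 := by
  have h := eta_pow_three_S (axis_mul_I_im hw)
  rw [rootS_axis hw] at h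
  rw [← h]
  congr 2
  have : (w : ℂ) ≠ 0 := by exact_mod_cast hw.ne'
  push_cast
  field_simp
  rw [I_sq]

/-- The Laplace transform of `η³` on the imaginary axis. -/
theorem integral_eta_axis {y : ℝ} (hy : y ≠ 0) :
    ∫ u in Ioi (0 : ℝ), η (u * I) ^ 3 * (Real.exp (-π * u * y ^ 2) : ℂ) =
      ((Real.cosh (π * y))⁻¹ : ℝ) := by
  set b := |y|
  have hb : 0 < b := abs_pos.mpr hy
  have hr : Real.exp (-2 * π * b) < 1 := by
    rw [Real.exp_lt_one_iff]; nlinarith [mul_pos Real.pi_pos hb]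
  -- Inversion gives η(iu)³ = u^{−3/2}η(i/u)³. Each term of the expansion at i/u is an inverse
  -- Gaussian with a = n + 1/2, and its integrals form a geometric series with sum 1/cosh(πb). The
  -- ratio has modulus below 1 because y ≠ 0.
  set F : ℕ → ℝ → ℂ := fun n u => (((-1) ^ n * (2 * ((n + 1 / 2) * (√u)⁻¹ ^ 3 *
    Real.exp (-π * ((n + 1 / 2) ^ 2 / u) - π * b ^ 2 * u))) : ℝ) : ℂ) with hF
  have hn : ∀ n : ℕ, (0 : ℝ) < n + 1 / 2 := fun n => by positivity
  have hI : ∀ n, Integrable (F n) (volume.restrict (Ioi 0)) := fun n =>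
    (((inverse_gaussian (hn n) hb).1.const_mul 2).const_mul _).ofReal
  have hexp : ∀ n : ℕ, Real.exp (-2 * π * (n + 1 / 2) * b) =
      Real.exp (-(π * b)) * Real.exp (-2 * π * b) ^ n := fun n => by
    rw [← Real.exp_nat_mul, ← Real.exp_add]; ring_nf
  have hnorm : ∀ n, ∫ u in Ioi (0 : ℝ), ‖F n u‖ =
      2 * Real.exp (-(π * b)) * Real.exp (-2 * π * b) ^ n := fun n => by
    rw [mul_assoc, ← hexp, ← (inverse_gaussian (hn n) hb).2, ← integral_const_mul]
    congr 1
    funext u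
    rw [hF, norm_real, norm_mul, norm_pow, norm_neg, norm_one, one_pow, one_mul,
      Real.norm_of_nonneg (by have := hn n; positivity)]
  have hg := summable_geometric_of_lt_one (Real.exp_pos _).le hr
  have h := hasSum_integral_of_summable_integral_norm hI
    ((hg.mul_left _).congr fun n => (hnorm n).symm)
  have e1 : ∫ u in Ioi (0 : ℝ), η (u * I) ^ 3 * (Real.exp (-π * u * y ^ 2) : ℂ) =
      ∫ u in Ioi (0 : ℝ), ∑' n, F n u := by
    refine setIntegral_congr_fun measurableSet_Ioi fun u hu => ?_
    have hu' : (0 : ℝ) < u := hu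
    have h1 := eta_axis_inv (inv_pos.mpr hu')
    rw [inv_inv] at h1
    rw [h1, ← (hasSum_eta_axis (inv_pos.mpr hu')).tsum_eq, ← tsum_mul_left, ← tsum_mul_right]
    refine tsum_congr fun n => ?_
    have key : (√u)⁻¹ ^ 3 * ((-1) ^ n * (2 * ((n + 1 / 2) *
        Real.exp (-π * (n + 1 / 2) ^ 2 * u⁻¹)))) * Real.exp (-π * u * y ^ 2) =
        (-1) ^ n * (2 * ((n + 1 / 2) * (√u)⁻¹ ^ 3 *
          Real.exp (-π * ((n + 1 / 2) ^ 2 / u) - π * b ^ 2 * u))) := by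
      rw [sub_eq_add_neg, Real.exp_add, show -(π * b ^ 2 * u) = -π * u * y ^ 2 by
        rw [sq_abs]; ring, show -π * (n + 1 / 2 : ℝ) ^ 2 * u⁻¹ = -π * ((n + 1 / 2) ^ 2 / u) by ring]
      ring
    rw [hF]
    simp only
    rw [← key, Real.sqrt_inv]
    simp only [ofReal_mul, ofReal_pow]
  have hval : ∀ n, ∫ u in Ioi (0 : ℝ), F n u =
      (((2 * Real.exp (-(π * b))) * (-Real.exp (-2 * π * b)) ^ n : ℝ) : ℂ) := fun n => by
    rw [hF, integral_complex_ofReal, integral_const_mul, integral_const_mul,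
      (inverse_gaussian (hn n) hb).2, hexp, neg_pow (Real.exp _), ofReal_inj]
    ring
  have h := h.congr_fun fun n => (hval n).symm
  have h2 : HasSum (fun n : ℕ => (2 * Real.exp (-(π * b))) * (-Real.exp (-2 * π * b)) ^ n)
      ((2 * Real.exp (-(π * b))) * (1 - -Real.exp (-2 * π * b))⁻¹) := by
    have hr' : ‖-Real.exp (-2 * π * b)‖ < 1 := by
      rwa [norm_neg, Real.norm_of_nonneg (Real.exp_pos _).le]
    exact (hasSum_geometric_of_norm_lt_one hr').mul_left _
  rw [e1, h.unique (hasSum_ofReal.mpr h2), ofReal_inj, ← Real.cosh_abs, abs_mul,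
    abs_of_pos Real.pi_pos, Real.cosh_eq, show (-2 * π * b) = -(π * b) + -(π * b) by ring,
    Real.exp_add, Real.exp_neg]
  have := Real.exp_pos (π * b)
  simp only [b] at this ⊢
  field_simp
  rw [sub_neg_eq_add, div_self (by positivity)]

/-- The integrand of the period integral of `η³` along the imaginary axis. -/
noncomputable def axisIntegrand (s u : ℝ) : ℂ := η (u * I) ^ 3 * ((√(s + u))⁻¹ : ℝ)

theorem ray_axis (s t : ℝ) : ray (s * I) t = ((s + t : ℝ) : ℂ) * I := by
  simp [ray]; ring

theorem period_axis_integrand {s t : ℝ} (h : 0 ≤ 2 * s + t) :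
    η (ray (s * I) t) ^ 3 * (((2 * ((s : ℂ) * I).im + t) ^ (-(1 / 2 : ℝ)) : ℝ) : ℂ) =
      axisIntegrand s (s + t) := by
  have : ((s : ℂ) * I).im = s := by simp
  rw [ray_axis, axisIntegrand, this, Real.rpow_neg h, ← Real.sqrt_eq_rpow]
  ring_nf

theorem period_axis_eq {s : ℝ} (hs : 0 < s) :
    IntegrableOn (axisIntegrand s) (Ioi s) ∧
      period (1 / 2) (fun z => η z ^ 3) (s * I) = ∫ u in Ioi s, axisIntegrand s u := by
  have hm := measurePreserving_add_left volume s
  have he := measurableEmbedding_addLeft s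
  have hpre : (fun t => s + t) ⁻¹' Ioi s = Ioi 0 := by simp
  have hcongr : EqOn (fun t : ℝ => η (ray (s * I) t) ^ 3 *
      (((2 * ((s : ℂ) * I).im + t) ^ (-(1 / 2 : ℝ)) : ℝ) : ℂ))
      (fun t => axisIntegrand s (s + t)) (Ioi 0) := fun t ht => by
    have : (0 : ℝ) < t := ht
    exact period_axis_integrand (by positivity)
  constructor
  · rw [← hm.integrableOn_comp_preimage he, hpre]
    refine (integrableOn_congr_fun hcongr measurableSet_Ioi).mp ?_
    exact integrableOn_ray_mul isRapid_eta_pow_three.continuousOn isRapid_eta_pow_three.decay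
      (axis_mul_I_im hs) (by norm_num)
  · rw [← hm.setIntegral_preimage_emb he, hpre, period]
    exact setIntegral_congr_fun measurableSet_Ioi hcongr

/-- The substitution u ↦ 1/u combines the Jacobian u^{−2}, the factor u^{3/2} from η³, and √(1/s +
1/u) = √(s + u)/(√s√u). -/
theorem axisIntegrand_inv {s u : ℝ} (hs : 0 < s) (hu : 0 < u) :
    |-(u ^ 2)⁻¹| • axisIntegrand s⁻¹ u⁻¹ = √s * axisIntegrand s u := by
  rw [axisIntegrand, axisIntegrand, eta_axis_inv hu, real_smul, abs_neg, abs_of_pos (by positivity)]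
  have e : √(s⁻¹ + u⁻¹) = √(s + u) / (√s * √u) := by
    rw [← Real.sqrt_mul hs.le, ← Real.sqrt_div (by positivity)]
    congr 1
    field_simp
    ring
  have hu2 : (√u) ^ 2 = u := Real.sq_sqrt hu.le
  have h1 := Real.sqrt_pos.mpr hu
  have h2 := Real.sqrt_pos.mpr hs
  have h3 := Real.sqrt_pos.mpr (add_pos hs hu)
  have key : (u ^ 2)⁻¹ * √u ^ 3 * (√(s⁻¹ + u⁻¹))⁻¹ = √s * (√(s + u))⁻¹ := by
    rw [e]
    nth_rw 1 [← hu2]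
    field_simp
  have key' := congrArg (fun x : ℝ => (x : ℂ)) key
  simp only [ofReal_mul, ofReal_pow] at key'
  linear_combination (η (u * I) ^ 3) * key'

theorem period_axis_inv_eq {s : ℝ} (hs : 0 < s) :
    IntegrableOn (axisIntegrand s) (Ioo 0 s) ∧
      period (1 / 2) (fun z => η z ^ 3) ((s⁻¹ : ℝ) * I) =
        √s * ∫ u in Ioo 0 s, axisIntegrand s u := by
  obtain ⟨h1, h2⟩ := period_axis_eq (inv_pos.mpr hs)
  have hd : ∀ u ∈ Ioo 0 s, HasDerivWithinAt (fun u : ℝ => u⁻¹) (-(u ^ 2)⁻¹) (Ioo 0 s) u :=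
    fun u hu => (hasDerivAt_inv hu.1.ne').hasDerivWithinAt
  have himg : (fun u : ℝ => u⁻¹) '' Ioo 0 s = Ioi s⁻¹ := by
    rw [image_inv_eq_inv, inv_Ioo_0_left hs]
  have hcongr : EqOn (fun u : ℝ => |-(u ^ 2)⁻¹| • axisIntegrand s⁻¹ u⁻¹)
      (fun u => √s * axisIntegrand s u) (Ioo 0 s) := fun u hu => axisIntegrand_inv hs hu.1
  have hinj : InjOn (fun u : ℝ => u⁻¹) (Ioo 0 s) := inv_injective.injOn
  have hs0 : (√s : ℂ) ≠ 0 := by exact_mod_cast (Real.sqrt_pos.mpr hs).ne'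
  constructor
  · rw [← himg, integrableOn_image_iff_integrableOn_abs_deriv_smul measurableSet_Ioo hd hinj,
      integrableOn_congr_fun hcongr measurableSet_Ioo] at h1
    have := h1.const_mul (√s : ℂ)⁻¹
    refine this.congr (.of_forall fun u => ?_)
    simp only
    rw [inv_mul_cancel_left₀ hs0]
  · rw [h2, ← himg, integral_image_eq_integral_abs_deriv_smul measurableSet_Ioo hd hinj,
      setIntegral_congr_fun measurableSet_Ioo hcongr, integral_const_mul]

theorem integrableOn_axisIntegrand {s : ℝ} (hs : 0 < s) :
    IntegrableOn (axisIntegrand s) (Ioi 0) := by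
  rw [← Ioc_union_Ioi_eq_Ioi hs.le]
  exact IntegrableOn.union ((period_axis_inv_eq hs).1.congr_set_ae Ioo_ae_eq_Ioc.symm)
    (period_axis_eq hs).1

theorem integral_gauss_sqrt {c : ℝ} : ∫ y : ℝ, Real.exp (-π * c * y ^ 2) = (√c)⁻¹ := by
  have := integral_gaussian (π * c)
  rw [← neg_mul, ← div_div, div_self Real.pi_ne_zero, one_div, Real.sqrt_inv] at this
  exact this

/-- Writing (s + u)^{−1/2} as the integral of e^{−π(s+u)y²} over y and applying Fubini leaves the
Laplace transform of η³ inside, which is 1/cosh(πy). -/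
theorem integral_axisIntegrand {s : ℝ} (hs : 0 < s) :
    ∫ u in Ioi (0 : ℝ), axisIntegrand s u = mordell s := by
  set f : ℝ → ℝ → ℂ := fun u y => η (u * I) ^ 3 * (Real.exp (-π * (s + u) * y ^ 2) : ℂ) with hf
  have e1 : ∀ u : ℝ, axisIntegrand s u = ∫ y : ℝ, f u y := fun u => by
    rw [hf, integral_const_mul, integral_complex_ofReal, integral_gauss_sqrt, axisIntegrand]
  have hcont : ContinuousOn (fun u : ℝ => η (u * I) ^ 3) (Ioi 0) :=
    isRapid_eta_pow_three.continuousOn.comp (f := fun u : ℝ => (u : ℂ) * I) (by fun_prop)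
      fun u hu => axis_mul_I_im hu
  have hmeas : AEStronglyMeasurable (Function.uncurry f)
      ((volume.restrict (Ioi 0)).prod volume) := by
    refine AEStronglyMeasurable.mul
      (hcont.aestronglyMeasurable measurableSet_Ioi).comp_fst ?_
    exact (by fun_prop : Continuous fun p : ℝ × ℝ =>
      ((Real.exp (-π * (s + p.1) * p.2 ^ 2) : ℝ) : ℂ)).aestronglyMeasurable
  have hint : Integrable (Function.uncurry f) ((volume.restrict (Ioi 0)).prod volume) := by
    rw [integrable_prod_iff hmeas]
    constructor
    · filter_upwards [ae_restrict_mem measurableSet_Ioi] with u hu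
      have hu' : (0 : ℝ) < u := hu
      have := integrable_exp_neg_mul_sq (b := π * (s + u)) (by have := Real.pi_pos; positivity)
      rw [← neg_mul] at this
      exact (this.ofReal (𝕜 := ℂ)).const_mul (η (u * I) ^ 3)
    · refine (integrableOn_axisIntegrand hs).norm.congr (.of_forall fun u => ?_)
      simp only [Function.uncurry, hf]
      simp only [norm_mul, norm_real, Real.norm_of_nonneg (Real.exp_pos _).le]
      rw [integral_const_mul, integral_gauss_sqrt, axisIntegrand, norm_mul, norm_real,
        Real.norm_of_nonneg (by positivity)]
  simp only [e1]
  rw [integral_integral_swap hint, mordell, ← integral_complex_ofReal]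
  refine integral_congr_ae ?_
  -- The Laplace transform was evaluated only for y ≠ 0; the excluded point is null.
  have h0 : ∀ᵐ y : ℝ, y ≠ 0 := by simp [ae_iff, measure_singleton]
  filter_upwards [h0] with y hy
  have e2 : ∀ u : ℝ, f u y = (Real.exp (-π * s * y ^ 2) : ℂ) *
      (η (u * I) ^ 3 * (Real.exp (-π * u * y ^ 2) : ℂ)) := fun u => by
    have : Real.exp (-π * (s + u) * y ^ 2) =
        Real.exp (-π * s * y ^ 2) * Real.exp (-π * u * y ^ 2) := by
      rw [← Real.exp_add]; ring_nf
    simp only [hf]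
    rw [this, ofReal_mul]
    ring
  simp only [e2]
  rw [integral_const_mul, integral_eta_axis hy, ofReal_mul]

/-- The Mordell integral as a sum of two period integrals. -/
theorem period_axis {s : ℝ} (hs : 0 < s) :
    period (1 / 2) (fun z => η z ^ 3) (s * I) +
      (√s : ℂ)⁻¹ * period (1 / 2) (fun z => η z ^ 3) ((s⁻¹ : ℝ) * I) = mordell s := by
  have hs0 : (√s : ℂ) ≠ 0 := by exact_mod_cast (Real.sqrt_pos.mpr hs).ne'
  rw [(period_axis_eq hs).2, (period_axis_inv_eq hs).2, inv_mul_cancel_left₀ hs0,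
    ← integral_axisIntegrand hs, ← Ioc_union_Ioi_eq_Ioi hs.le,
    setIntegral_union (Ioc_disjoint_Ioi le_rfl) measurableSet_Ioi
      ((period_axis_inv_eq hs).1.congr_set_ae Ioo_ae_eq_Ioc.symm) (period_axis_eq hs).1,
    integral_Ioc_eq_integral_Ioo, add_comm]

/-! ### Completed Appell sums -/

/-- The period integral of `η³`. -/
noncomputable def etaPeriod (τ : ℂ) : ℂ := period (1 / 2) (fun z => η z ^ 3) τ

/-- The difference L(iw) − iL(w) measures the failure of complex linearity, that is, the
antiholomorphic derivative. -/
theorem conjIm_mul_I_sub (a b w : ℂ) :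
    conjIm a b (I * w) - I * conjIm a b w = (2 * I * a + b) * (starRingEnd ℂ) w := by
  rw [conjIm_apply, conjIm_apply]
  have h1 : ((I * w).im : ℂ) = w.re := by simp
  have h2 : (starRingEnd ℂ) w = w.re - w.im * I := by
    apply Complex.ext <;> simp
  rw [h1, map_mul, conj_I, h2]
  ring

theorem rootS_neg_conj {τ : ℂ} (hτ : 0 < τ.im) :
    rootS (-(starRingEnd ℂ) τ) = (starRingEnd ℂ) (rootS τ) := by
  have harg : (-I * τ).arg ≠ π := by
    have : -I * τ ∈ slitPlane := Or.inl (neg_I_mul_re_pos hτ)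
    exact (mem_slitPlane_iff_arg.mp this).1
  have h := conj_cpow (-I * τ) (1 / 2) harg
  rw [rootS, rootS]
  have e : -I * -(starRingEnd ℂ) τ = (starRingEnd ℂ) (-I * τ) := by simp
  have h2 : (starRingEnd ℂ) (1 / 2 : ℂ) = 1 / 2 := by
    rw [show (1 / 2 : ℂ) = ((1 / 2 : ℝ) : ℂ) by push_cast; rfl, conj_ofReal]
  rw [e, h, h2]

theorem rootS_mul_conj (τ : ℂ) : rootS τ * (starRingEnd ℂ) (rootS τ) = ‖τ‖ := by
  rw [mul_conj, normSq_eq_norm_sq, ← norm_pow, rootS_sq]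
  simp

theorem neg_conj_im {τ : ℂ} : (-(starRingEnd ℂ) τ).im = τ.im := by simp

/-- The antiholomorphic derivatives of the two period integrals cancel. -/
theorem period_antiholomorphic_cancel {τ : ℂ} (hτ : 0 < τ.im) :
    η (-(starRingEnd ℂ) τ) ^ 3 * (((2 * τ.im) ^ (-(1 / 2 : ℝ)) : ℝ) : ℂ) +
      (rootS τ)⁻¹ * (η (-(starRingEnd ℂ) (-1 / τ)) ^ 3 *
        (((2 * (-1 / τ).im) ^ (-(1 / 2 : ℝ)) : ℝ) : ℂ)) * (starRingEnd ℂ) (1 / τ ^ 2) = 0 := by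
  have h0 := ne_zero_of_im_pos hτ
  have hz : 0 < (-(starRingEnd ℂ) τ).im := by rwa [neg_conj_im]
  have hc : (starRingEnd ℂ) τ ≠ 0 := by simpa using h0
  have e1 : -(starRingEnd ℂ) (-1 / τ) = -1 / (-(starRingEnd ℂ) τ) := by
    rw [map_div₀, map_neg, map_one]; field_simp
  have him : (-1 / τ).im = τ.im / ‖τ‖ ^ 2 := by
    rw [neg_div, neg_im, one_div, inv_im, normSq_eq_norm_sq]; ring
  have hn : 0 < ‖τ‖ := norm_pos_iff.mpr h0
  have e2 : (2 * (-1 / τ).im) ^ (-(1 / 2 : ℝ)) = ‖τ‖ * (2 * τ.im) ^ (-(1 / 2 : ℝ)) := by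
    rw [him, ← mul_div_assoc, Real.div_rpow (by positivity) (by positivity),
      Real.rpow_neg (by positivity : 0 ≤ ‖τ‖ ^ 2), ← Real.sqrt_eq_rpow, Real.sqrt_sq hn.le]
    field_simp
  have hr := rootS_ne_zero hτ
  have h4 : (starRingEnd ℂ) (rootS τ) ^ 4 = -(starRingEnd ℂ) τ ^ 2 := by
    rw [← map_pow, rootS_pow_four, map_neg, map_pow]
  rw [e1, eta_pow_three_S hz, e2, rootS_neg_conj hτ, ofReal_mul, ← rootS_mul_conj, map_div₀,
    map_one, map_pow]
  field_simp
  linear_combination (η (-(starRingEnd ℂ) τ) ^ 3 * (((2 * τ.im) ^ (-(1 / 2 : ℝ)) : ℝ) : ℂ)) * h4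

/-- The sum is real differentiable, and the Cauchy–Riemann defect of one period is cancelled by that
of its S-transform because η³ has weight 3/2. -/
theorem differentiableAt_period_add {τ : ℂ} (hτ : 0 < τ.im) :
    DifferentiableAt ℂ (fun τ => etaPeriod τ + (rootS τ)⁻¹ * etaPeriod (-1 / τ)) τ := by
  have h0 := ne_zero_of_im_pos hτ
  have h1 := hasFDerivAt_period isRapid_eta_pow_three (s := 1 / 2) (by norm_num) hτ
  have h2 := hasFDerivAt_period isRapid_eta_pow_three (s := 1 / 2) (by norm_num)
    (im_neg_one_div_pos hτ)
  have h3 : HasFDerivAt (𝕜 := ℝ) (fun τ : ℂ => -1 / τ) _ τ :=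
    (HasDerivAt.hasFDerivAt (f' := 1 / τ ^ 2) (f := fun τ : ℂ => -1 / τ) (by
      have := ((hasDerivAt_inv h0).const_mul (-1))
      refine (this.congr_deriv (by ring)).congr_of_eventuallyEq (.of_forall fun z => ?_)
      simp only
      rw [div_eq_mul_inv])).restrictScalars ℝ
  have h4 : HasFDerivAt (𝕜 := ℝ) (fun τ : ℂ => (rootS τ)⁻¹) _ τ :=
    ((differentiableAt_rootS hτ).inv (rootS_ne_zero hτ)).hasFDerivAt.restrictScalars ℝ
  have h5 := h1.add (h4.mul (h2.comp τ h3))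
  rw [differentiableAt_complex_iff_differentiableAt_real]
  have hd : fderiv ℝ (fun τ => etaPeriod τ + (rootS τ)⁻¹ * etaPeriod (-1 / τ)) τ = _ := h5.fderiv
  refine ⟨h5.differentiableAt, ?_⟩
  rw [hd]
  have k1 := conjIm_mul_I_sub (I * (η (-(starRingEnd ℂ) τ) ^ 3 *
      (((2 * τ.im) ^ (-(1 / 2 : ℝ)) : ℝ) : ℂ)) - I * ((1 / 2 : ℝ) : ℂ) *
        period (1 / 2 + 1) (fun z => η z ^ 3) τ)
      (-2 * ((1 / 2 : ℝ) : ℂ) * period (1 / 2 + 1) (fun z => η z ^ 3) τ) 1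
  have k2 := conjIm_mul_I_sub (I * (η (-(starRingEnd ℂ) (-1 / τ)) ^ 3 *
      (((2 * (-1 / τ).im) ^ (-(1 / 2 : ℝ)) : ℝ) : ℂ)) - I * ((1 / 2 : ℝ) : ℂ) *
        period (1 / 2 + 1) (fun z => η z ^ 3) (-1 / τ))
      (-2 * ((1 / 2 : ℝ) : ℂ) * period (1 / 2 + 1) (fun z => η z ^ 3) (-1 / τ)) (1 / τ ^ 2)
  have k3 := period_antiholomorphic_cancel hτ
  simp only [add_apply, smul_apply, smul_eq_mul,
    ContinuousLinearMap.comp_apply, ContinuousLinearMap.coe_restrictScalars',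
    ContinuousLinearMap.toSpanSingleton_apply, Function.comp, one_mul]
  have k4 : (fderiv ℂ rootS⁻¹ τ) I = I * (fderiv ℂ rootS⁻¹ τ) 1 := by
    have := (fderiv ℂ rootS⁻¹ τ).map_smul I 1
    simpa only [smul_eq_mul, mul_one] using this
  rw [mul_one, map_one (starRingEnd ℂ), mul_one] at k1
  rw [k4]
  push_cast at k1 k2 ⊢
  linear_combination k1 + (rootS τ)⁻¹ * k2 - 2 * k3 +
    (2 * (η (-(starRingEnd ℂ) τ) ^ 3 * (((2 * τ.im) ^ (-(1 / 2 : ℝ)) : ℝ) : ℂ)) -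
      period (1 / 2 + 1) (fun z => η z ^ 3) τ) * I_sq +
    (rootS τ)⁻¹ * (starRingEnd ℂ) (1 / τ ^ 2) * (2 * (η (-(starRingEnd ℂ) (-1 / τ)) ^ 3 *
      (((2 * (-1 / τ).im) ^ (-(1 / 2 : ℝ)) : ℝ) : ℂ)) -
      period (1 / 2 + 1) (fun z => η z ^ 3) (-1 / τ)) * I_sq

/-- The Mordell integral in Watson's identity is replaced by the two period integrals, and θ₄(i/s) =
√s·θ₂(is) normalises the quotients. -/
theorem ratio_axis {s : ℝ} (hs : 0 < s) :
    appellTwo (s * I) / th2 (s * I) - etaPeriod (s * I) / 2 +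
      (rootS (s * I))⁻¹ * (appellFour (-1 / (s * I)) / th4 (-1 / (s * I)) -
        etaPeriod (-1 / (s * I)) / 2) = 0 := by
  have hs0 : (s : ℂ) ≠ 0 := by exact_mod_cast hs.ne'
  have hr : (√s : ℂ) ≠ 0 := by exact_mod_cast (Real.sqrt_pos.mpr hs).ne'
  have e : -1 / ((s : ℂ) * I) = ((s⁻¹ : ℝ) : ℂ) * I := by
    push_cast
    field_simp
    rw [I_sq]
  have hi := axis_mul_I_im hs
  have h1 := watson_axis hs
  have h2 := period_axis hs
  have h3 := th4_S hi
  have n2 := th2_ne_zero hi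
  rw [e, rootS_axis hs] at h3
  rw [e, rootS_axis hs, etaPeriod, etaPeriod, h3]
  rw [h3, ← h2] at h1
  push_cast at h1 ⊢
  field_simp at h1 ⊢
  linear_combination h1

/-- The axis accumulates at the interior point i, so the identity theorem applies. -/
theorem eq_zero_of_axis {X : ℂ → ℂ} (hX : DifferentiableOn ℂ X ℍₒ)
    (h : ∀ s : ℝ, 0 < s → X (s * I) = 0) {τ : ℂ} (hτ : 0 < τ.im) : X τ = 0 := by
  have o : IsOpen ℍₒ := UpperHalfPlane.isOpen_upperHalfPlaneSet
  have c : IsPreconnected ℍₒ := Convex.isPreconnected (convex_halfSpace_im_gt 0)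
  have hI : (I : ℂ) ∈ ℍₒ := by change 0 < I.im; simp
  refine (hX.analyticOnNhd o).eqOn_zero_of_preconnected_of_frequently_eq_zero c hI ?_ hτ
  have ht : Tendsto (fun s : ℝ => (s : ℂ) * I) (𝓝[>] 1) (𝓝[≠] I) := by
    refine tendsto_nhdsWithin_iff.mpr ⟨?_, ?_⟩
    · have : Continuous fun s : ℝ => (s : ℂ) * I := by fun_prop
      have := this.tendsto 1
      rw [ofReal_one, one_mul] at this
      exact this.mono_left nhdsWithin_le_nhds
    · filter_upwards [self_mem_nhdsWithin] with s hs h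
      have h2 : (s : ℂ) * I = 1 * I := by rw [one_mul]; exact h
      have := mul_right_cancel₀ I_ne_zero h2
      exact (ne_of_gt (show (1 : ℝ) < s from hs)) (by exact_mod_cast this)
  refine ht.frequently (Eventually.frequently ?_)
  filter_upwards [self_mem_nhdsWithin] with s hs
  exact h s (one_pos.trans hs)

theorem differentiableAt_comp_S {F : ℂ → ℂ} (hF : ∀ τ : ℂ, 0 < τ.im → DifferentiableAt ℂ F τ)
    {τ : ℂ} (hτ : 0 < τ.im) : DifferentiableAt ℂ (fun τ => F (-1 / τ)) τ :=
  (hF _ (im_neg_one_div_pos hτ)).comp (f := fun τ : ℂ => -1 / τ) τ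
    ((differentiableAt_const _).div differentiableAt_id (ne_zero_of_im_pos hτ))

/-- Although `etaPeriod` is not holomorphic, the combination of its two values occurring here is.
The relation therefore spreads from the imaginary axis to the whole half-plane. -/
theorem ratio_S {τ : ℂ} (hτ : 0 < τ.im) :
    appellTwo τ / th2 τ - etaPeriod τ / 2 +
      (rootS τ)⁻¹ * (appellFour (-1 / τ) / th4 (-1 / τ) - etaPeriod (-1 / τ) / 2) = 0 := by
  refine eq_zero_of_axis (X := fun τ => appellTwo τ / th2 τ - etaPeriod τ / 2 +
      (rootS τ)⁻¹ * (appellFour (-1 / τ) / th4 (-1 / τ) - etaPeriod (-1 / τ) / 2))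
    (differentiableOn_of_differentiableAt fun τ hτ => ?_) (fun s hs => ratio_axis hs) hτ
  have h1 := (differentiableAt_appellTwo hτ).div (differentiableAt_th2 hτ) (th2_ne_zero hτ)
  have h2 := differentiableAt_comp_S (F := fun τ => appellFour τ / th4 τ) (fun τ hτ =>
    (differentiableAt_appellFour hτ).div (differentiableAt_th4 hτ) (th4_ne_zero hτ)) hτ
  have h3 := (differentiableAt_rootS hτ).inv (rootS_ne_zero hτ)
  have h4 := (differentiableAt_period_add hτ).div_const 2
  refine ((h1.add (h3.mul h2)).sub h4).congr_of_eventuallyEq (.of_forall fun z => ?_)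
  simp only [Pi.add_apply, Pi.sub_apply, Pi.mul_apply, Pi.inv_apply, Pi.div_apply]
  ring

/-- The completion `M̂₂`. -/
noncomputable def compTwo (τ : ℂ) : ℂ := th3 τ * th4 τ * appellTwo τ / 2 - η τ ^ 3 * etaPeriod τ / 2

/-- The completion `M̂₄`. -/
noncomputable def compFour (τ : ℂ) : ℂ := th2 τ * th3 τ * appellFour τ / 2 - η τ ^ 3 * etaPeriod τ / 2

theorem compTwo_eq {τ : ℂ} (hτ : 0 < τ.im) :
    compTwo τ = η τ ^ 3 * (appellTwo τ / th2 τ - etaPeriod τ / 2) := by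
  have h := two_mul_eta_pow_three hτ
  have n := th2_ne_zero hτ
  rw [compTwo, show η τ ^ 3 = th2 τ * th3 τ * th4 τ / 2 by rw [← h]; ring]
  field_simp

theorem compFour_eq {τ : ℂ} (hτ : 0 < τ.im) :
    compFour τ = η τ ^ 3 * (appellFour τ / th4 τ - etaPeriod τ / 2) := by
  have h := two_mul_eta_pow_three hτ
  have n := th4_ne_zero hτ
  rw [compFour, show η τ ^ 3 = th2 τ * th3 τ * th4 τ / 2 by rw [← h]; ring]
  field_simp

/-- The factor η³ contributes `rootS` to the third power and the ratio law contributes minus one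
more; −`rootS`⁴ = τ² gives weight two without a multiplier. -/
theorem compFour_S (τ : ℂ) (hτ : 0 < τ.im) : compFour (-1 / τ) = τ ^ (2 : ℤ) * compTwo τ := by
  have h := ratio_S hτ
  have hr := rootS_ne_zero hτ
  rw [compFour_eq (im_neg_one_div_pos hτ), compTwo_eq hτ, eta_pow_three_S hτ]
  have h4 := rootS_pow_four τ
  have : appellFour (-1 / τ) / th4 (-1 / τ) - etaPeriod (-1 / τ) / 2 =
      -rootS τ * (appellTwo τ / th2 τ - etaPeriod τ / 2) := by
    generalize appellFour (-1 / τ) / th4 (-1 / τ) - etaPeriod (-1 / τ) / 2 = x at h ⊢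
    linear_combination rootS τ * h - x * mul_inv_cancel₀ hr
  rw [this, show τ ^ (2 : ℤ) = τ ^ 2 by norm_cast]
  linear_combination (-(η τ ^ 3) * (appellTwo τ / th2 τ - etaPeriod τ / 2)) * h4

theorem compTwo_S (τ : ℂ) (hτ : 0 < τ.im) : compTwo (-1 / τ) = τ ^ (2 : ℤ) * compFour τ :=
  pair_comp_S (by norm_num) compFour_S τ hτ

/-- Replacing τ by τ + 1 moves the ray by −1, so the period acquires the inverse of the root of
unity acquired by η³. -/
theorem eta_mul_period_add_one (τ : ℂ) :
    η (τ + 1) ^ 3 * etaPeriod (τ + 1) = η τ ^ 3 * etaPeriod τ := by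
  have hc : cexp (π / 12 * I) ≠ 0 := Complex.exp_ne_zero _
  have h1 : etaPeriod (τ + 1) = (cexp (π / 12 * I) ^ 3)⁻¹ * etaPeriod τ := by
    rw [etaPeriod, etaPeriod, period, period, ← integral_const_mul]
    refine setIntegral_congr_fun measurableSet_Ioi fun t ht => ?_
    have h2 := eta_add_one (ray (τ + 1) t)
    have h3 : ray (τ + 1) t + 1 = ray τ t := by simp [ray]; ring
    have h4 : (τ + 1).im = τ.im := by simp
    rw [h3] at h2
    simp only [h4]
    rw [h2, mul_pow]
    field_simp
  rw [h1, eta_add_one, mul_pow]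
  field_simp

theorem compTwo_add_one (τ : ℂ) (_ : 0 < τ.im) : compTwo (τ + 1) = compTwo τ := by
  rw [compTwo, compTwo, eta_mul_period_add_one τ, th3_add_one, th4_add_one, appellTwo_add_one]
  ring

theorem compFour_add_two (τ : ℂ) (_ : 0 < τ.im) : compFour (τ + 2) = compFour τ := by
  have e : cexp (π * I / 4) * cexp (π * I / 4) = I := by
    rw [← Complex.exp_add, show π * I / 4 + π * I / 4 = π / 2 * I by ring,
      Complex.exp_pi_div_two_mul_I]
  have h1 := eta_mul_period_add_one (τ + 1)
  rw [show τ + 1 + 1 = τ + 2 by ring] at h1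
  rw [compFour, compFour, appellFour_add_two, h1, eta_mul_period_add_one τ,
    show τ + 2 = τ + 1 + 1 by ring, th3_add_one, th4_add_one, th2_add_one, th2_add_one]
  linear_combination (-(th2 τ * th3 τ * appellFour τ * I) / 2) * e -
    (th2 τ * th3 τ * appellFour τ) / 2 * I_sq

/-- The sum of the three completions, a form of weight two for the full modular group. -/
noncomputable def compSum (τ : ℂ) : ℂ := compTwo τ + compFour τ + compFour (τ + 1)

theorem compSum_S (τ : ℂ) (hτ : 0 < τ.im) : compSum (-1 / τ) = τ ^ (2 : ℤ) * compSum τ := by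
  rw [compSum, compSum, compTwo_S τ hτ, compFour_S τ hτ,
    pair_shift_comp_S compTwo_S compTwo_add_one compFour_add_two τ hτ]
  ring

theorem compSum_add_one (τ : ℂ) (hτ : 0 < τ.im) : compSum (τ + 1) = compSum τ := by
  rw [compSum, compSum, compTwo_add_one τ hτ, show τ + 1 + 1 = τ + 2 by ring,
    compFour_add_two τ hτ]
  ring

/-- The holomorphic parts of the completions. -/
noncomputable def holTwo (τ : ℂ) : ℂ := th3 τ * th4 τ * appellTwo τ / 2

/-- The holomorphic part of `M̂₄`. -/
noncomputable def holFour (τ : ℂ) : ℂ := th2 τ * th3 τ * appellFour τ / 2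

theorem differentiableAt_holTwo {τ : ℂ} (hτ : 0 < τ.im) : DifferentiableAt ℂ holTwo τ :=
  (((differentiableAt_th3 hτ).mul (differentiableAt_th4 hτ)).mul
    (differentiableAt_appellTwo hτ)).div_const 2

theorem differentiableAt_holFour {τ : ℂ} (hτ : 0 < τ.im) : DifferentiableAt ℂ holFour τ :=
  (((differentiableAt_th2 hτ).mul (differentiableAt_th3 hτ)).mul
    (differentiableAt_appellFour hτ)).div_const 2

theorem tendsto_holTwo : Tendsto (fun τ : ℍ => holTwo τ) atImInfty (𝓝 (1 / 4)) := by
  have := ((tendsto_th3_atImInfty.mul tendsto_th4_atImInfty).mul tendsto_appellTwo).div_const 2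
  convert! this using 2
  norm_num

theorem tendsto_holFour : Tendsto (fun τ : ℍ => holFour τ) atImInfty (𝓝 0) := by
  have := ((tendsto_th2_atImInfty.mul tendsto_th3_atImInfty).mul tendsto_appellFour).div_const 2
  convert! this using 2
  norm_num

/-- All three completions contain the same −η³·`etaPeriod`/2, since that product is invariant under
T. Subtracting a third of the sum leaves holomorphic forms exchanged by S. They are compared with
the theta quartics by `eq_zero_of_pair`; limits at i∞ such as 1/4 − 1/12 = 1/6 match. -/
theorem comp_pair {τ : ℂ} (hτ : 0 < τ.im) :
    compTwo τ - compSum τ / 3 = (th3 τ ^ 4 + th4 τ ^ 4) / 12 ∧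
      compFour τ - compSum τ / 3 = -(2 * th3 τ ^ 4 - th4 τ ^ 4) / 12 := by
  have hF : ∀ τ : ℂ, 0 < τ.im → compTwo τ - compSum τ / 3 =
      holTwo τ - (holTwo τ + holFour τ + holFour (τ + 1)) / 3 := fun τ hτ => by
    have := eta_mul_period_add_one τ
    rw [compSum, compTwo, compFour, compFour, holTwo, holFour, holFour, this]
    ring
  have hG : ∀ τ : ℂ, 0 < τ.im → compFour τ - compSum τ / 3 =
      holFour τ - (holTwo τ + holFour τ + holFour (τ + 1)) / 3 := fun τ hτ => by
    have := eta_mul_period_add_one τ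
    rw [compSum, compTwo, compFour, compFour, holTwo, holFour, holFour, this]
    ring
  have hd : ∀ τ : ℂ, 0 < τ.im → DifferentiableAt ℂ (fun τ => holFour (τ + 1)) τ := fun τ hτ =>
    (differentiableAt_holFour (τ := τ + 1) (by simpa using hτ)).comp (f := fun τ => τ + 1) τ
      (by fun_prop)
  have hl3 := tendsto_add_one_atImInfty tendsto_holFour
  have key := eq_zero_of_pair (k := 2) (by norm_num) (by norm_num)
    (F := fun τ => compTwo τ - compSum τ / 3 - (th3 τ ^ 4 + th4 τ ^ 4) / 12)
    (G := fun τ => compFour τ - compSum τ / 3 + (2 * th3 τ ^ 4 - th4 τ ^ 4) / 12)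
    ?_ ?_ (fun τ hτ => ?_) (fun τ hτ => ?_) (fun τ hτ => ?_) ?_ ?_ τ hτ
  · exact ⟨by linear_combination key.1, by linear_combination key.2⟩
  · refine DifferentiableOn.congr (f := fun τ => holTwo τ -
      (holTwo τ + holFour τ + holFour (τ + 1)) / 3 - (th3 τ ^ 4 + th4 τ ^ 4) / 12) ?_
      (fun τ hτ => by simp only [hF τ hτ])
    refine differentiableOn_of_differentiableAt fun τ hτ => ?_
    exact ((differentiableAt_holTwo hτ).sub ((((differentiableAt_holTwo hτ).add
      (differentiableAt_holFour hτ)).add (hd τ hτ)).div_const 3)).sub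
      ((((differentiableAt_th3 hτ).pow 4).add ((differentiableAt_th4 hτ).pow 4)).div_const 12)
  · refine DifferentiableOn.congr (f := fun τ => holFour τ -
      (holTwo τ + holFour τ + holFour (τ + 1)) / 3 + (2 * th3 τ ^ 4 - th4 τ ^ 4) / 12) ?_
      (fun τ hτ => by simp only [hG τ hτ])
    refine differentiableOn_of_differentiableAt fun τ hτ => ?_
    exact ((differentiableAt_holFour hτ).sub ((((differentiableAt_holTwo hτ).add
      (differentiableAt_holFour hτ)).add (hd τ hτ)).div_const 3)).add
      (((((differentiableAt_th3 hτ).pow 4).const_mul 2).sub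
        ((differentiableAt_th4 hτ).pow 4)).div_const 12)
  · have h4 := rootS_pow_four τ
    have hj := th3_pow_four hτ
    rw [compTwo_S τ hτ, compSum_S τ hτ, th3_S hτ, th4_S hτ, show τ ^ (2 : ℤ) = τ ^ 2 by norm_cast,
      mul_pow, mul_pow, h4]
    linear_combination (-(τ ^ 2) / 12) * hj
  · rw [compTwo_add_one τ hτ, compSum_add_one τ hτ, th3_add_one, th4_add_one]
    ring
  · have h1 := compSum_add_one (τ + 1) (by simpa using hτ)
    rw [show τ + 1 + 1 = τ + 2 by ring] at h1
    rw [compFour_add_two τ hτ, h1, compSum_add_one τ hτ, show τ + 2 = τ + 1 + 1 by ring,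
      th3_add_one, th4_add_one, th4_add_one, th3_add_one]
  · have := (tendsto_holTwo.sub (((tendsto_holTwo.add tendsto_holFour).add hl3).div_const 3)).sub
      (((tendsto_th3_atImInfty.pow 4).add (tendsto_th4_atImInfty.pow 4)).div_const 12)
    rw [show (1 / 4 : ℂ) - (1 / 4 + 0 + 0) / 3 - (1 ^ 4 + 1 ^ 4) / 12 = 0 by norm_num] at this
    exact this.congr fun τ => by rw [hF τ τ.im_pos]
  · have := (tendsto_holFour.sub (((tendsto_holTwo.add tendsto_holFour).add hl3).div_const 3)).add
      ((((tendsto_th3_atImInfty.pow 4).const_mul 2).sub (tendsto_th4_atImInfty.pow 4)).div_const 12)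
    rw [show (0 : ℂ) - (1 / 4 + 0 + 0) / 3 + (2 * 1 ^ 4 - 1 ^ 4) / 12 = 0 by norm_num] at this
    exact this.congr fun τ => by rw [hG τ τ.im_pos]

/-- The non-holomorphic terms and the average both cancel in the difference. This is the bridge
between 𝒬, built on `appellFour`, and M, built on `appellTwo`. -/
theorem holFour_sub_holTwo {τ : ℂ} (hτ : 0 < τ.im) :
    holFour τ - holTwo τ = -(th3 τ ^ 4) / 4 := by
  obtain ⟨h1, h2⟩ := comp_pair hτ
  rw [compTwo] at h1
  rw [compFour] at h2
  rw [holFour, holTwo]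
  linear_combination h2 - h1

/-! ### Differential operators -/

theorem dU_congr {F G : ℂ → ℂ} (h : EqOn F G ℍₒ) {z : ℂ} (hz : 0 < z.im) : dU F z = dU G z := by
  refine Filter.EventuallyEq.deriv_eq (.of_forall fun t => h ?_)
  change 0 < (z + t).im
  simpa using hz

theorem dV_congr {F G : ℂ → ℂ} (h : EqOn F G ℍₒ) {z : ℂ} (hz : 0 < z.im) : dV F z = dV G z := by
  refine Filter.EventuallyEq.deriv_eq ?_
  filter_upwards [lt_mem_nhds (neg_lt_zero.mpr hz)] with t ht
  refine h ?_
  change 0 < (z + t * I).im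
  simp
  linarith

theorem dU_eq {F : ℂ → ℂ} {L : ℂ →L[ℝ] ℂ} {z : ℂ} (h : HasFDerivAt F L z) : dU F z = L 1 := by
  have h1 : HasDerivAt (fun t : ℝ => z + (t : ℂ)) 1 0 := by
    simpa using (hasDerivAt_id (0 : ℝ)).ofReal_comp.const_add z
  have h2 : HasFDerivAt F L (z + ((0 : ℝ) : ℂ)) := by simpa using h
  exact (h2.comp_hasDerivAt 0 h1).deriv

theorem dV_eq {F : ℂ → ℂ} {L : ℂ →L[ℝ] ℂ} {z : ℂ} (h : HasFDerivAt F L z) : dV F z = L I := by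
  have h1 : HasDerivAt (fun t : ℝ => z + (t : ℂ) * I) I 0 := by
    simpa using ((hasDerivAt_id (0 : ℝ)).ofReal_comp.mul_const I).const_add z
  have h2 : HasFDerivAt F L (z + ((0 : ℝ) : ℂ) * I) := by simpa using h
  exact (h2.comp_hasDerivAt 0 h1).deriv

theorem conjIm_one (a b : ℂ) : conjIm a b 1 = -a := by simp [conjIm_apply]

theorem conjIm_I (a b : ℂ) : conjIm a b I = I * a + b := by
  simp [conjIm_apply]; ring

theorem eqOn_comp_ofComplex {f : ℍ → ℂ} {F : ℂ → ℂ} (h : ∀ τ : ℍ, f τ = F τ) :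
    EqOn (f ∘ UpperHalfPlane.ofComplex) F ℍₒ := fun z hz => by
  rw [Function.comp, h, UpperHalfPlane.ofComplex_apply_of_im_pos hz]

section

variable {g H : ℂ → ℂ} {c : ℂ} {z : ℂ}

/-- The boundary term `g(-τ̄)(2v)^{-s}`. -/
noncomputable def bdry (s : ℝ) (g : ℂ → ℂ) (τ : ℂ) : ℂ :=
  g (-(starRingEnd ℂ) τ) * (((2 * τ.im) ^ (-s) : ℝ) : ℂ)

theorem hasFDerivAt_bdry (hg : IsRapid g) (s : ℝ) (hz : 0 < z.im) :
    HasFDerivAt (𝕜 := ℝ) (bdry s g)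
      (conjIm (bdry s (deriv g) z) (-2 * s * bdry (s + 1) g z)) z := by
  have h := hasFDerivAt_ray_mul hg s hz (le_refl 0)
  have e : ∀ τ : ℂ, ray τ 0 = -(starRingEnd ℂ) τ := fun τ => by simp [ray]
  simp only [e, add_zero] at h
  exact h

theorem hasFDerivAt_holomorphic (hH : DifferentiableOn ℂ H ℍₒ) (hz : 0 < z.im) :
    HasFDerivAt (𝕜 := ℝ) H
      ((ContinuousLinearMap.toSpanSingleton ℂ (deriv H z)).restrictScalars ℝ) z :=
  ((hH.differentiableAt (UpperHalfPlane.isOpen_upperHalfPlaneSet.mem_nhds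
    hz)).hasDerivAt.hasFDerivAt).restrictScalars ℝ

theorem dU_add_period (hH : DifferentiableOn ℂ H ℍₒ) (hg : IsRapid g) {s : ℝ} (hs : 0 ≤ s)
    (hz : 0 < z.im) : dU (fun τ => H τ + c * period s g τ) z =
      deriv H z + c * (-I * bdry s g z + I * s * period (s + 1) g z) := by
  have h := (hasFDerivAt_holomorphic hH hz).add ((hasFDerivAt_period hg hs hz).const_mul c)
  refine (dU_eq h).trans ?_
  simp only [add_apply, smul_apply, smul_eq_mul, conjIm_one,
    ContinuousLinearMap.coe_restrictScalars', ContinuousLinearMap.toSpanSingleton_apply, bdry]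
  ring

theorem dV_add_period (hH : DifferentiableOn ℂ H ℍₒ) (hg : IsRapid g) {s : ℝ} (hs : 0 ≤ s)
    (hz : 0 < z.im) : dV (fun τ => H τ + c * period s g τ) z =
      I * deriv H z + c * (-bdry s g z - s * period (s + 1) g z) := by
  have h := (hasFDerivAt_holomorphic hH hz).add ((hasFDerivAt_period hg hs hz).const_mul c)
  refine (dV_eq h).trans ?_
  simp only [add_apply, smul_apply, smul_eq_mul, conjIm_I,
    ContinuousLinearMap.coe_restrictScalars', ContinuousLinearMap.toSpanSingleton_apply, bdry]
  linear_combination (c * (g (-(starRingEnd ℂ) z) * (((2 * z.im) ^ (-s) : ℝ) : ℂ)) -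
    c * s * period (s + 1) g z) * I_sq

/-- The holomorphic part is harmonic and the second-order period terms cancel, so only a boundary
term survives. -/
theorem laplace_add_period (hH : DifferentiableOn ℂ H ℍₒ) (hg : IsRapid g) {s : ℝ} (hs : 0 ≤ s)
    (hz : 0 < z.im) :
    dU (dU (fun τ => H τ + c * period s g τ)) z + dV (dV (fun τ => H τ + c * period s g τ)) z =
      c * (4 * s * bdry (s + 1) g z) := by
  have hH' := hH.deriv UpperHalfPlane.isOpen_upperHalfPlaneSet
  rw [dU_congr (fun w hw => dU_add_period (c := c) hH hg hs hw) hz,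
    dV_congr (fun w hw => dV_add_period (c := c) hH hg hs hw) hz]
  have h1 := (hasFDerivAt_holomorphic hH' hz)
  have h2 := hasFDerivAt_bdry hg s hz
  have h3 := hasFDerivAt_period hg (by linarith : 0 ≤ s + 1) hz
  have hU := h1.add (((h2.const_mul (-I)).add (h3.const_mul (I * s))).const_mul c)
  have hV := (h1.const_mul I).add ((h2.neg.sub (h3.const_mul (s : ℂ))).const_mul c)
  rw [show dU (fun w => deriv H w + c * (-I * bdry s g w + I * s * period (s + 1) g w)) z = _ from
    dU_eq hU, show dV (fun w => I * deriv H w + c * (-bdry s g w - s * period (s + 1) g w)) z = _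
      from dV_eq hV]
  simp only [add_apply, smul_apply, smul_eq_mul, conjIm_I, conjIm_one, neg_apply, sub_apply,
    ContinuousLinearMap.coe_restrictScalars', ContinuousLinearMap.toSpanSingleton_apply]
  simp only [bdry]
  push_cast
  ring_nf
  simp only [I_sq]
  ring

theorem rpow_two_mul {v : ℝ} (hv : 0 < v) :
    v * (2 * v) ^ (-(1 / 2 + 1) : ℝ) = (2 * v) ^ (-(1 / 2) : ℝ) / 2 := by
  have h2 : 0 < 2 * v := by positivity
  rw [show (-(1 / 2 + 1) : ℝ) = -(1 / 2) - 1 by ring, Real.rpow_sub_one h2.ne']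
  field_simp

/-- The surviving second-order term is −2v²c·bdry(3/2) and the first-order term is vc·bdry(1/2).
They cancel because v(2v)^{−3/2} = (2v)^{−1/2}/2. -/
theorem hypLaplacian_eq_zero {f : ℍ → ℂ} (hH : DifferentiableOn ℂ H ℍₒ) (hg : IsRapid g)
    (hf : ∀ τ : ℍ, f τ = H τ + c * period (1 / 2) g τ) (τ : ℍ) :
    hypLaplacian (1 / 2) f τ = 0 := by
  have hE := eqOn_comp_ofComplex (F := fun z => H z + c * period (1 / 2) g z) hf
  have hz : 0 < (τ : ℂ).im := τ.im_pos
  have hs : (0 : ℝ) ≤ 1 / 2 := by norm_num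
  have e1 : dU (dU (f ∘ UpperHalfPlane.ofComplex)) τ =
      dU (dU (fun z => H z + c * period (1 / 2) g z)) τ :=
    dU_congr (fun w hw => dU_congr hE hw) hz
  have e2 : dV (dV (f ∘ UpperHalfPlane.ofComplex)) τ =
      dV (dV (fun z => H z + c * period (1 / 2) g z)) τ :=
    dV_congr (fun w hw => dV_congr hE hw) hz
  have hb : (τ.im : ℂ) * bdry (1 / 2 + 1) g τ = bdry (1 / 2) g τ / 2 := by
    have := congrArg (fun x : ℝ => (x : ℂ)) (rpow_two_mul hz)
    simp only [ofReal_mul, ofReal_div, ofReal_ofNat] at this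
    rw [bdry, bdry]
    rw [UpperHalfPlane.coe_im] at this ⊢
    linear_combination g (-(starRingEnd ℂ) (τ : ℂ)) * this
  simp only [hypLaplacian]
  rw [e1, e2, laplace_add_period hH hg hs hz, dU_congr hE hz, dV_congr hE hz,
    dU_add_period hH hg hs hz, dV_add_period hH hg hs hz]
  push_cast
  linear_combination (-2 * τ.im * c) * hb + (1 / 2 * τ.im * (deriv H τ) * I -
    τ.im * c * bdry (1 / 2) g τ / 2 * 2) * I_sq * 1

/-- Only the endpoint −τ̄ of the ray contributes to the antiholomorphic derivative. The powers of v
cancel, since 2v^{1/2}(2v)^{−1/2} = √2. -/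
theorem xiOp_eq {f : ℍ → ℂ} (hH : DifferentiableOn ℂ H ℍₒ) (hg : IsRapid g)
    (hf : ∀ τ : ℍ, f τ = H τ + c * period (1 / 2) g τ) (τ : ℍ) :
    xiOp (1 / 2) f τ = -(√2 : ℂ) * (starRingEnd ℂ) (c * g (-(starRingEnd ℂ) (τ : ℂ))) := by
  have hE := eqOn_comp_ofComplex (F := fun z => H z + c * period (1 / 2) g z) hf
  have hz : 0 < (τ : ℂ).im := τ.im_pos
  have hs : (0 : ℝ) ≤ 1 / 2 := by norm_num
  have hv : ((τ.im ^ (1 / 2 : ℝ) : ℝ) : ℂ) * (((2 * τ.im) ^ (-(1 / 2 : ℝ)) : ℝ) : ℂ) * 2 = √2 := by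
    have h2 : 0 < √2 := by positivity
    have h3 : 0 < √τ.im := Real.sqrt_pos.mpr τ.im_pos
    have : τ.im ^ (1 / 2 : ℝ) * (2 * τ.im) ^ (-(1 / 2 : ℝ)) * 2 = √2 := by
      rw [Real.rpow_neg (by have := τ.im_pos; positivity), ← Real.sqrt_eq_rpow, ← Real.sqrt_eq_rpow,
        Real.sqrt_mul (by norm_num)]
      field_simp
      rw [Real.sq_sqrt (by norm_num)]
    exact_mod_cast this
  simp only [xiOp]
  rw [dU_congr hE hz, dV_congr hE hz, dU_add_period hH hg hs hz, dV_add_period hH hg hs hz]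
  have e : (deriv H τ + c * (-I * bdry (1 / 2) g τ + I * ((1 / 2 : ℝ) : ℂ) * period (1 / 2 + 1) g τ) +
      I * (I * deriv H τ + c * (-bdry (1 / 2) g τ - ((1 / 2 : ℝ) : ℂ) * period (1 / 2 + 1) g τ))) / 2 =
      -I * ((c * g (-(starRingEnd ℂ) (τ : ℂ))) * (((2 * τ.im) ^ (-(1 / 2 : ℝ)) : ℝ) : ℂ)) := by
    rw [bdry, UpperHalfPlane.coe_im]
    linear_combination (deriv H τ / 2) * I_sq
  rw [e, map_mul, map_mul, conj_ofReal, map_neg, conj_I]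
  linear_combination (-(starRingEnd ℂ) (c * g (-(starRingEnd ℂ) (τ : ℂ)))) * hv +
    2 * ((τ.im ^ (1 / 2 : ℝ) : ℝ) : ℂ) * (starRingEnd ℂ) (c * g (-(starRingEnd ℂ) (τ : ℂ))) *
      (((2 * τ.im) ^ (-(1 / 2 : ℝ)) : ℝ) : ℂ) * I_sq

theorem contDiffOn_add_period {f : ℍ → ℂ} (hH : DifferentiableOn ℂ H ℍₒ) (hg : IsRapid g)
    (hf : ∀ τ : ℍ, f τ = H τ + c * period (1 / 2) g τ) :
    ContDiffOn ℝ (⊤ : ℕ∞) (f ∘ UpperHalfPlane.ofComplex) {z : ℂ | 0 < z.im} := by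
  refine ContDiffOn.congr ?_ (eqOn_comp_ofComplex (F := fun z => H z + c * period (1 / 2) g z) hf)
  refine contDiffOn_infty.mpr fun n => ?_
  exact ((hH.contDiffOn UpperHalfPlane.isOpen_upperHalfPlaneSet).restrict_scalars ℝ).add
    (contDiffOn_const.mul (contDiffOn_period hg n (by norm_num)))

end

/-! ### The non-holomorphic part -/

theorem hasSum_eta_pow_three {τ : ℂ} (hτ : 0 < τ.im) :
    HasSum (fun n : ℕ => (-1 : ℂ) ^ n * (2 * n + 1) * cexp (π * I * (n + 1 / 2) ^ 2 * τ))
      (η τ ^ 3) := by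
  rw [eta_pow_three_eq hτ]
  refine ((hasSum_thEta hτ).nat_add_neg_add_one).congr_fun fun n => ?_
  have e : (-1 : ℂ) ^ (-((n : ℤ) + 1)) = -(-1) ^ n := by
    rw [zpow_neg, ← inv_zpow, zpow_add_one₀ (by norm_num)]; norm_num
  rw [e]
  push_cast
  rw [zpow_natCast, show (-((n : ℂ) + 1) + 1 / 2) = -(n + 1 / 2) by ring, neg_sq]
  ring

theorem hasSum_eta_eight {τ : ℂ} (hτ : 0 < τ.im) :
    HasSum (fun n : ℕ => (-1 : ℂ) ^ n * (2 * n + 1) * qpow τ ((2 * n + 1) ^ 2))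
      (η (8 * τ) ^ 3) := by
  refine (hasSum_eta_pow_three (τ := 8 * τ) (by simpa using hτ)).congr_fun fun n => ?_
  rw [qpow]
  congr 2
  push_cast
  ring

/-- The q-expansion of η(8τ)³ has real coefficients, and τ ↦ −τ̄ conjugates q. -/
theorem eta_eight_neg_conj {τ : ℂ} (hτ : 0 < τ.im) :
    (starRingEnd ℂ) (η (8 * -(starRingEnd ℂ) τ) ^ 3) = η (8 * τ) ^ 3 := by
  have h := (hasSum_eta_eight (τ := -(starRingEnd ℂ) τ) (by simpa using hτ)).map (starRingEnd ℂ)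
    continuous_conj
  refine h.unique ((hasSum_eta_eight hτ).congr_fun fun n => ?_)
  simp only [Function.comp, qpow, map_mul, ← Complex.exp_conj, map_pow, map_neg, map_one, map_add,
    map_ofNat, conj_conj, conj_I, conj_ofReal, conj_natCast, map_intCast]
  congr 2
  ring

theorem integral_Ioi_shift (f : ℝ → ℝ) (a : ℝ) :
    ∫ t in Ioi (0 : ℝ), f (a + t) = ∫ u in Ioi a, f u := by
  have hm := measurePreserving_add_left volume a
  have he := measurableEmbedding_addLeft a
  have hpre : (fun t => a + t) ⁻¹' Ioi a = Ioi 0 := by simp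
  rw [← hpre]
  exact hm.setIntegral_preimage_emb he f (Ioi a)

theorem integral_exp_mul_rpow {b v : ℝ} (hb : 0 < b) (hv : 0 < v) :
    ∫ t in Ioi (0 : ℝ), Real.exp (-b * (2 * v + t)) * (2 * v + t) ^ (-(1 / 2) : ℝ) =
      (√b)⁻¹ * incGamma (1 / 2) (b * (2 * v)) := by
  rw [integral_Ioi_shift (fun u => Real.exp (-b * u) * u ^ (-(1 / 2) : ℝ)), incGamma]
  have h := integral_comp_mul_left_Ioi (fun t => Real.exp (-t) * t ^ ((1 / 2 : ℝ) - 1)) (2 * v) hb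
  have h1 : ∫ x in Ioi (2 * v), Real.exp (-(b * x)) * (b * x) ^ ((1 / 2 : ℝ) - 1) =
      ∫ x in Ioi (2 * v), (√b)⁻¹ * (Real.exp (-b * x) * x ^ (-(1 / 2) : ℝ)) := by
    refine setIntegral_congr_fun measurableSet_Ioi fun u hu => ?_
    have hu' : 0 < u := lt_trans (by positivity) hu
    rw [Real.mul_rpow hb.le hu'.le, show (1 / 2 : ℝ) - 1 = -(1 / 2) by norm_num,
      Real.rpow_neg hb.le, ← Real.sqrt_eq_rpow]
    ring_nf
  rw [h1, integral_const_mul, smul_eq_mul] at h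
  have hs := Real.sqrt_pos.mpr hb
  have hsq : √b * √b = b := Real.mul_self_sqrt hb.le
  have hI : incGamma (1 / 2) (b * (2 * v)) = b * ((√b)⁻¹ *
      ∫ u in Ioi (2 * v), Real.exp (-b * u) * u ^ (-(1 / 2) : ℝ)) := by
    rw [h, incGamma, mul_inv_cancel_left₀ hb.ne']
  rw [incGamma] at hI
  rw [hI]
  have e : (√b)⁻¹ * (b * (√b)⁻¹) = 1 := by
    nth_rw 2 [← hsq]
    field_simp
  linear_combination (-(∫ u in Ioi (2 * v), Real.exp (-b * u) * u ^ (-(1 / 2) : ℝ))) * e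

theorem eta_eight_ray_term {τ : ℂ} (n : ℕ) (t : ℝ) :
    qpow (ray τ t) ((2 * n + 1) ^ 2) =
      qpow τ (-(2 * n + 1) ^ 2) * (Real.exp (-(2 * π * (2 * n + 1) ^ 2) * (2 * τ.im + t)) : ℂ) := by
  rw [qpow, qpow, ofReal_exp, ← Complex.exp_add, ray]
  congr 1
  have : (starRingEnd ℂ) τ = τ - 2 * τ.im * I := by
    apply Complex.ext <;> simp; ring
  rw [this]
  push_cast
  linear_combination (2 * π * (2 * n + 1) ^ 2 * (2 * τ.im + t)) * I_sq

/-- On the ray, q^{m²} becomes q^{−m²}(τ)·e^{−2πm²(2v+t)}, so each term integrates to an incomplete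
Gamma value at 4πm²v. The coefficient m = 2n + 1 cancels against the root of m² from the
substitution. -/
theorem hasSum_period_eta_eight {τ : ℂ} (hτ : 0 < τ.im) :
    HasSum (fun n : ℕ => ((-1) ^ n * (√(2 * π) : ℂ)⁻¹) *
      ((incGamma (1 / 2) (4 * π * |(((-(2 * n + 1) ^ 2 : ℤ)) : ℝ)| * τ.im) : ℂ) *
        qpow τ (-(2 * n + 1) ^ 2))) (period (1 / 2) (fun z => η (8 * z) ^ 3) τ) := by
  set F : ℕ → ℝ → ℂ := fun n t => (-1 : ℂ) ^ n * (2 * n + 1) * qpow (ray τ t) ((2 * n + 1) ^ 2) *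
    (((2 * τ.im + t) ^ (-(1 / 2 : ℝ)) : ℝ) : ℂ) with hF
  have hF' : ∀ n t, F n t = (-1 : ℂ) ^ n * (2 * n + 1) * qpow τ (-(2 * n + 1) ^ 2) *
      ((Real.exp (-(2 * π * (2 * n + 1) ^ 2) * (2 * τ.im + t)) *
        (2 * τ.im + t) ^ (-(1 / 2) : ℝ) : ℝ) : ℂ) := fun n t => by
    rw [hF]
    simp only
    rw [eta_eight_ray_term]
    push_cast
    ring
  set K : ℕ → ℝ := fun n => ‖(-1 : ℂ) ^ n * (2 * n + 1) * qpow (-(starRingEnd ℂ) τ) ((2 * n + 1) ^ 2)‖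
  have hK : Summable K := (hasSum_eta_eight (τ := -(starRingEnd ℂ) τ) (by simpa using hτ)).summable.norm
  have hb : ∀ (n : ℕ) (t : ℝ), 0 < t →
      ‖F n t‖ ≤ K n * ((2 * τ.im) ^ (-(1 / 2 : ℝ)) * Real.exp (-2 * π * t)) := fun n t ht => by
    have e : qpow (ray τ t) ((2 * n + 1) ^ 2) = qpow (-(starRingEnd ℂ) τ) ((2 * n + 1) ^ 2) *
        (Real.exp (-(2 * π * (2 * n + 1) ^ 2) * t) : ℂ) := by
      rw [qpow, qpow, ofReal_exp, ← Complex.exp_add, ray]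
      congr 1
      push_cast
      linear_combination (2 * π * (2 * n + 1) ^ 2 * t) * I_sq
    have h0 : 0 < 2 * τ.im + t := by positivity
    rw [hF]
    simp only
    rw [e, ← mul_assoc, norm_mul, norm_mul, norm_real, norm_real,
      Real.norm_of_nonneg (Real.exp_pos _).le, Real.norm_of_nonneg (Real.rpow_nonneg h0.le _),
      mul_assoc, mul_comm (Real.exp _)]
    refine mul_le_mul_of_nonneg_left (mul_le_mul (rpow_neg_le hτ le_rfl ht.le (by norm_num))
      (Real.exp_le_exp.mpr ?_) (Real.exp_pos _).le (by positivity)) (norm_nonneg _)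
    have : (1 : ℝ) ≤ (2 * n + 1) ^ 2 := one_le_pow₀ (by linarith [Nat.cast_nonneg (α := ℝ) n])
    nlinarith [mul_pos Real.pi_pos ht]
  have h := hasSum_integral_of_dominated_convergence (μ := volume.restrict (Ioi (0 : ℝ))) (F := F)
    (f := fun t => η (8 * ray τ t) ^ 3 * (((2 * τ.im + t) ^ (-(1 / 2 : ℝ)) : ℝ) : ℂ))
    (fun n t => K n * ((2 * τ.im) ^ (-(1 / 2 : ℝ)) * Real.exp (-2 * π * t))) (fun n => ?_)
    (fun n => (ae_restrict_iff' measurableSet_Ioi).mpr (ae_of_all _ fun t ht => hb n t ht))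
    (ae_of_all _ fun t => hK.mul_right _) ?_
    ((ae_restrict_iff' measurableSet_Ioi).mpr (ae_of_all _ fun t ht => ?_))
  · refine h.congr_fun fun n => ?_
    have hpos : (0 : ℝ) < 2 * π * (2 * n + 1) ^ 2 := by positivity
    simp only [hF']
    rw [integral_const_mul, integral_complex_ofReal, integral_exp_mul_rpow hpos hτ,
      Real.sqrt_mul (by positivity : 0 ≤ 2 * π), Real.sqrt_sq (by positivity)]
    have e : 4 * π * |((-(2 * n + 1) ^ 2 : ℤ) : ℝ)| * τ.im = 2 * π * (2 * n + 1) ^ 2 * (2 * τ.im) := by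
      push_cast
      rw [abs_neg, abs_of_nonneg (by positivity)]
      ring
    have hn : (2 * n + 1 : ℂ) ≠ 0 := by exact_mod_cast (by omega : 2 * n + 1 ≠ 0)
    rw [e]
    push_cast
    field_simp
  · refine ContinuousOn.aestronglyMeasurable ?_ measurableSet_Ioi
    rw [show F n = _ from funext (hF' n)]
    refine continuousOn_const.mul (continuous_ofReal.comp_continuousOn ?_)
    refine ContinuousOn.mul (by fun_prop) (ContinuousOn.rpow_const (by fun_prop) fun t ht => ?_)
    have : (0 : ℝ) < t := ht
    left; positivity
  · simp only [tsum_mul_right, neg_mul]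
    have := exp_neg_integrableOn_Ioi 0 (by positivity : (0 : ℝ) < 2 * π)
    simp only [neg_mul] at this
    exact (this.const_mul _).const_mul _
  · have ht' : (0 : ℝ) < t := ht
    exact (hasSum_eta_eight (by rw [ray_im]; positivity)).mul_right _

theorem hasSum_int_of_nat {e : ℕ → ℤ} (he : Function.Injective e) (a : ℕ → ℂ) {F : ℤ → ℂ} {s : ℂ}
    (h : HasSum (fun n => a n * F (e n)) s) :
    HasSum (fun m => Function.extend e a 0 m * F m) s := by
  refine (he.hasSum_iff fun m hm => ?_).mp (h.congr_fun fun n => ?_)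
  · rw [Function.extend_apply' _ _ _ (by simpa using hm)]; simp
  · simp [he.extend_apply]

theorem neg_odd_sq_injective : Function.Injective fun n : ℕ => -(2 * (n : ℤ) + 1) ^ 2 := by
  intro m n h
  have h1 : (2 * (m : ℤ) + 1) ^ 2 = (2 * (n : ℤ) + 1) ^ 2 := by simpa using h
  have h2 := (sq_eq_sq₀ (by positivity) (by positivity)).mp h1
  omega

/-- The substitution t = 8x gives 8·8^{−1/2} = 2√2. -/
theorem etaPeriod_eight {τ : ℂ} (hτ : 0 < τ.im) :
    etaPeriod (8 * τ) = 2 * √2 * period (1 / 2) (fun z => η (8 * z) ^ 3) τ := by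
  have h := integral_comp_mul_left_Ioi (fun t : ℝ => η (ray (8 * τ) t) ^ 3 *
    (((2 * (8 * τ).im + t) ^ (-(1 / 2 : ℝ)) : ℝ) : ℂ)) 0 (by norm_num : (0 : ℝ) < 8)
  rw [mul_zero] at h
  have h8 : (8 : ℝ) ^ (-(1 / 2 : ℝ)) = (2 * √2)⁻¹ := by
    rw [Real.rpow_neg (by norm_num), ← Real.sqrt_eq_rpow, show (8 : ℝ) = 2 ^ 2 * 2 by norm_num,
      Real.sqrt_mul (by norm_num), Real.sqrt_sq (by norm_num)]
  have e : ∫ x in Ioi (0 : ℝ), η (ray (8 * τ) (8 * x)) ^ 3 *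
      (((2 * (8 * τ).im + 8 * x) ^ (-(1 / 2 : ℝ)) : ℝ) : ℂ) =
      ∫ x in Ioi (0 : ℝ), ((2 * √2)⁻¹ : ℝ) * (η (8 * ray τ x) ^ 3 *
        (((2 * τ.im + x) ^ (-(1 / 2 : ℝ)) : ℝ) : ℂ)) := by
    refine setIntegral_congr_fun measurableSet_Ioi fun x hx => ?_
    have hx' : (0 : ℝ) < x := hx
    have e0 : 0 < 2 * τ.im + x := by positivity
    have e1 : ray (8 * τ) (8 * x) = 8 * ray τ x := by
      simp only [ray, map_mul, map_ofNat]; push_cast; ring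
    have e2 : (8 * τ).im = 8 * τ.im := by simp
    rw [e1, e2, show 2 * (8 * τ.im) + 8 * x = 8 * (2 * τ.im + x) by ring,
      Real.mul_rpow (by norm_num) (by positivity), h8, ofReal_mul]
    ring
  rw [e, integral_const_mul] at h
  have h2 : (√2 : ℂ) * √2 = 2 := by
    exact_mod_cast Real.mul_self_sqrt (by norm_num : (0 : ℝ) ≤ 2)
  have hs : (√2 : ℂ) ≠ 0 := fun h0 => by simp [h0] at h2
  rw [real_smul] at h
  rw [etaPeriod, period, period]
  push_cast at h
  field_simp at h
  linear_combination (-(√2 : ℂ) / 4) * h -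
    (∫ (t : ℝ) in Ioi 0, η (ray (8 * τ) t) ^ 3 * ↑((2 * (8 * τ).im + t) ^ (-(1 / 2 : ℝ)))) / 2 * h2

/-! ### The theta multiplier -/

open scoped NumberTheorySymbols in
theorem jacobiSym_four_mul (c : ℤ) {b : ℕ} (hb : Odd b) : J(4 * c | b) = J(c | b) := by
  have h : Int.gcd 2 b = 1 := by
    have : Nat.Coprime 2 b := (Nat.coprime_two_left).mpr hb
    exact this
  rw [jacobiSym.mul_left, show (4 : ℤ) = 2 ^ 2 by norm_num, jacobiSym.sq_one' h, one_mul]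

open scoped NumberTheorySymbols in
-- The symbol J(c | ·) is periodic modulo 4|c| on odd arguments.
theorem jacobiSym_congr {c : ℤ} {b b' : ℕ} (hb : Odd b) (hb' : Odd b')
    (h : (4 * c) ∣ (b : ℤ) - b') : J(c | b) = J(c | b') := by
  rw [jacobiSym.mod_right c hb, jacobiSym.mod_right c hb']
  congr 1
  have : (b' : ℤ) ≡ b [ZMOD (4 * c.natAbs : ℕ)] := by
    refine (Int.modEq_iff_dvd).mpr ?_
    push_cast
    rw [Int.dvd_def] at h ⊢
    obtain ⟨k, hk⟩ := h
    rcases abs_choice c with h | h <;> rw [h]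
    · exact ⟨k, hk⟩
    · exact ⟨-k, by rw [hk]; ring⟩
  exact ((Int.natCast_modEq_iff).mp this).symm

open scoped NumberTheorySymbols in
-- Modulo 4|c| − 1 the number 4c is congruent to the sign of c, and the modulus is 3 mod 4, so −1
-- has symbol −1.
theorem jacobiSym_natAbs_sub_one {c : ℤ} (hc : c ≠ 0) :
    J(c | 4 * c.natAbs - 1) = if c < 0 then -1 else 1 := by
  have hn : 0 < c.natAbs := Int.natAbs_pos.mpr hc
  have hodd : Odd (4 * c.natAbs - 1) := ⟨2 * c.natAbs - 1, by omega⟩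
  rw [← jacobiSym_four_mul c hodd]
  split_ifs with h
  · have : J(4 * c | 4 * c.natAbs - 1) = J(-1 | 4 * c.natAbs - 1) := by
      refine jacobiSym.mod_left' ?_
      refine (Int.modEq_iff_dvd).mpr ⟨1, ?_⟩
      omega
    rw [this, jacobiSym.at_neg_one hodd, ZMod.χ₄_nat_three_mod_four (by omega)]
  · have : J(4 * c | 4 * c.natAbs - 1) = J(1 | 4 * c.natAbs - 1) := by
      refine jacobiSym.mod_left' ?_
      refine (Int.modEq_iff_dvd).mpr ⟨-1, ?_⟩
      omega
    rw [this, jacobiSym.one_left]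

open scoped NumberTheorySymbols in
-- Since b′ ≡ −b, one has bb′ ≡ (4|c| − 1)b² modulo 4c, so the product of the two symbols is the
-- symbol at 4|c| − 1.
theorem jacobiSym_reflect {c : ℤ} (hc : c ≠ 0) {b b' : ℕ} (hb : Odd b) (hb' : Odd b')
    (hg : c.gcd b = 1) (h : (4 * c) ∣ (b : ℤ) + b') :
    J(c | b') = (if c < 0 then -1 else 1) * J(c | b) := by
  have hn : 0 < c.natAbs := Int.natAbs_pos.mpr hc
  have hodd : Odd (4 * c.natAbs - 1) := ⟨2 * c.natAbs - 1, by omega⟩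
  have h1 : J(c | b * b') = J(c | (4 * c.natAbs - 1) * (b * b)) := by
    refine jacobiSym_congr (hb.mul hb') (hodd.mul (hb.mul hb)) ?_
    have e : ((b * b' : ℕ) : ℤ) - ((4 * c.natAbs - 1) * (b * b) : ℕ) =
        b * (b + b') - 4 * |c| * (b * b) := by
      rw [Nat.cast_mul, Nat.cast_mul, Nat.cast_sub (by omega)]
      push_cast
      ring
    rw [e]
    refine dvd_sub (h.mul_left _) (Dvd.dvd.mul_right ?_ _)
    exact mul_dvd_mul_left 4 (self_dvd_abs c)
  have hb0 : b ≠ 0 := by rintro rfl; simp at hb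
  have hb0' : b' ≠ 0 := by rintro rfl; simp at hb'
  rw [jacobiSym.mul_right' c hb0 hb0', jacobiSym.mul_right' c (by omega) (mul_ne_zero hb0 hb0),
    jacobiSym.mul_right' c hb0 hb0, jacobiSym_natAbs_sub_one hc] at h1
  have h2 := jacobiSym.sq_one hg
  linear_combination J(c | b) * h1 + ((if c < 0 then -1 else 1) * J(c | b) - J(c | b')) * h2

theorem extLegendre_four_mul (c : ℤ) {d : ℤ} (hd : Odd d) :
    extLegendre (4 * c) d = extLegendre c d := by
  have e : 4 * c < 0 ↔ c < 0 := by omega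
  rw [extLegendre, extLegendre, jacobiSym_four_mul c (Int.natAbs_odd.mpr hd)]
  simp only [e]

/-- The sign built into the extended symbol is exactly the reflection sign of the Jacobi symbol, so
periodicity in d survives a change of sign of d. -/
theorem extLegendre_add_mul {c d : ℤ} (hc : c ≠ 0) (hg : IsCoprime (4 * c) d) (n : ℤ) :
    extLegendre (4 * c) (d + n * (4 * c)) = extLegendre (4 * c) d := by
  -- This leaves only one mixed-sign case, d > 0 > d′.
  wlog h0 : d + n * (4 * c) ≤ d generalizing d n
  · have := this (d := d + n * (4 * c)) (n := -n) (by simpa using hg) (by linarith)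
    rw [← this]; ring_nf
  set d' := d + n * (4 * c) with hd'
  have hodd : Odd d := by
    rcases Int.even_or_odd d with h | h
    · obtain ⟨k, rfl⟩ := h
      obtain ⟨u, v, huv⟩ := hg
      exfalso
      have : (2 : ℤ) ∣ 1 := ⟨2 * u * c + v * k, by linarith⟩
      omega
    · exact h
  have hodd' : Odd d' := hodd.add_even ⟨n * (2 * c), by ring⟩
  rw [extLegendre_four_mul c hodd, extLegendre_four_mul c hodd', extLegendre, extLegendre]
  have hb := Int.natAbs_odd.mpr hodd
  have hb' := Int.natAbs_odd.mpr hodd'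
  have hg1 : c.gcd d.natAbs = 1 := by
    have h2 : IsCoprime c d := (IsCoprime.mul_left_iff.mp hg).2
    have := Int.isCoprime_iff_gcd_eq_one.mp h2
    simpa only [Int.gcd, Int.natAbs_natCast] using this
  have hd0 : d ≠ 0 := by rintro rfl; simp at hodd
  have hd0' : d' ≠ 0 := by intro h; rw [h] at hodd'; simp at hodd'
  rcases lt_or_gt_of_ne hd0 with h | h <;> rcases lt_or_gt_of_ne hd0' with h' | h'
  · have e : (d'.natAbs : ℤ) - d.natAbs = 4 * c * -n := by
      rw [Int.natCast_natAbs, Int.natCast_natAbs, abs_of_neg h, abs_of_neg h', hd']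
      ring
    rw [jacobiSym_congr hb' hb ⟨_, e⟩]
    simp only [h, h']
  · omega
  · have e : (d.natAbs : ℤ) + d'.natAbs = 4 * c * -n := by
      rw [Int.natCast_natAbs, Int.natCast_natAbs, abs_of_pos h, abs_of_neg h', hd']
      ring
    rw [jacobiSym_reflect hc hb hb' hg1 ⟨_, e⟩]
    simp only [h', not_lt.mpr h.le, and_true, and_false, if_false]
    split_ifs <;> ring
  · have e : (d'.natAbs : ℤ) - d.natAbs = 4 * c * n := by
      rw [Int.natCast_natAbs, Int.natCast_natAbs, abs_of_pos h, abs_of_pos h', hd']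
      ring
    rw [jacobiSym_congr hb' hb ⟨_, e⟩]
    simp only [not_lt.mpr h.le, not_lt.mpr h'.le]

theorem eq_cpow_half_of_sq {z w : ℂ} (h : z ^ 2 = w) (hz : 0 < z.re) : z = w ^ (1 / 2 : ℂ) := by
  have := abs_lt.mp (abs_arg_lt_pi_div_two_iff.mpr (Or.inl hz))
  rw [← h, one_div]
  exact_mod_cast (pow_cpow_nat_inv (n := 2) two_ne_zero (by push_cast; linarith [this.1])
    (by push_cast; linarith [this.2])).symm

theorem cpow_half_sq (w : ℂ) : (w ^ (1 / 2 : ℂ)) ^ 2 = w := by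
  rw [one_div]; exact_mod_cast cpow_nat_inv_pow w two_ne_zero

theorem cpow_half_re_pos {w : ℂ} (hw : w ∈ slitPlane) : 0 < (w ^ (1 / 2 : ℂ)).re := by
  have h0 := slitPlane_ne_zero hw
  rw [cpow_def_of_ne_zero h0, Complex.exp_re]
  refine mul_pos (Real.exp_pos _) (Real.cos_pos_of_mem_Ioo ?_)
  have e : (Complex.log w * (1 / 2)).im = w.arg / 2 := by
    rw [show Complex.log w * (1 / 2) = ((1 / 2 : ℝ) : ℂ) * Complex.log w by push_cast; ring,
      im_ofReal_mul, log_im]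
    ring
  rw [e]
  have h1 := (mem_slitPlane_iff_arg.mp hw).1
  have h2 := neg_pi_lt_arg w
  have h3 := lt_of_le_of_ne (arg_le_pi w) h1
  constructor <;> linarith

theorem cpow_half_neg_of_im_pos {w : ℂ} (hw : 0 < w.im) :
    w ^ (1 / 2 : ℂ) = I * (-w) ^ (1 / 2 : ℂ) := by
  have h0 : w ≠ 0 := fun h => by simp [h] at hw
  rw [cpow_def_of_ne_zero h0, cpow_def_of_ne_zero (neg_ne_zero.mpr h0), Complex.log, Complex.log,
    norm_neg, arg_neg_eq_arg_sub_pi_of_im_pos hw]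
  nth_rw 2 [← Complex.exp_pi_div_two_mul_I]
  rw [← Complex.exp_add]
  congr 1
  push_cast
  ring

theorem cpow_half_neg_of_im_neg {w : ℂ} (hw : w.im < 0) :
    w ^ (1 / 2 : ℂ) = -I * (-w) ^ (1 / 2 : ℂ) := by
  have h0 : w ≠ 0 := fun h => by simp [h] at hw
  have h := cpow_half_neg_of_im_pos (w := -w) (by simpa using hw)
  rw [neg_neg] at h
  rw [h]
  linear_combination (w ^ (1 / 2 : ℂ)) * I_sq

/-- The theta function `∑ q^{n²}`. -/
noncomputable def thetaQ (τ : ℂ) : ℂ := th3 (2 * τ)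

theorem thetaQ_add_int (τ : ℂ) (n : ℤ) : thetaQ (τ + n) = thetaQ τ := by
  have h : Function.Periodic thetaQ 1 := fun τ => by
    rw [thetaQ, thetaQ, show 2 * (τ + 1) = 2 * τ + 1 + 1 by ring, th3_add_one, th4_add_one]
  simpa using h.int_mul n τ

theorem cpow_half_mul {z w : ℂ} (hz : 0 < z.re) (hw : 0 < w.re) :
    z ^ (1 / 2 : ℂ) * w ^ (1 / 2 : ℂ) = (z * w) ^ (1 / 2 : ℂ) := by
  have h1 := cpow_half_re_pos (w := z) (Or.inl hz)
  have h2 := cpow_half_re_pos (w := w) (Or.inl hw)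
  have e1 := congrArg re (cpow_half_sq z)
  have e2 := congrArg re (cpow_half_sq w)
  refine eq_cpow_half_of_sq (by rw [mul_pow, cpow_half_sq, cpow_half_sq]) ?_
  set a := z ^ (1 / 2 : ℂ)
  set b := w ^ (1 / 2 : ℂ)
  rw [sq, mul_re] at e1 e2
  have h3 : |a.im| < a.re := abs_lt_of_sq_lt_sq (by nlinarith) h1.le
  have h4 : |b.im| < b.re := abs_lt_of_sq_lt_sq (by nlinarith) h2.le
  rw [mul_re]
  have h5 : a.im * b.im ≤ |a.im| * |b.im| := by rw [← abs_mul]; exact le_abs_self _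
  have h6 := mul_lt_mul'' h3 h4 (abs_nonneg _) (abs_nonneg _)
  linarith

theorem thetaQ_fricke {τ : ℂ} (hτ : 0 < τ.im) :
    thetaQ (-1 / (4 * τ)) = rootS (2 * τ) * thetaQ τ := by
  have h := th3_S (τ := 2 * τ) (by simpa using hτ)
  have h0 := ne_zero_of_im_pos hτ
  rw [thetaQ, thetaQ, ← h]
  congr 1
  field_simp
  norm_num

theorem moebius_lower_im {τ : ℂ} (hτ : 0 < τ.im) (m : ℤ) : 0 < (τ / (4 * m * τ + 1)).im := by
  have h0 := ne_zero_of_im_pos hτ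
  have hw : 0 < (-1 / (4 * τ) - m).im := by
    have := im_neg_one_div_pos (τ := 4 * τ) (by simpa using hτ)
    simpa using this
  have h1 : (4 * m * τ + 1 : ℂ) ≠ 0 := fun h => by
    have : (-1 / (4 * τ) - m) = 0 := by field_simp; linear_combination -h
    rw [this] at hw; simp at hw
  have h2 := im_neg_one_div_pos (τ := 4 * (-1 / (4 * τ) - m)) (by
    simpa only [mul_im, re_ofNat, im_ofNat, zero_mul, add_zero] using by positivity)
  have h3 : (-1 - 4 * τ * m : ℂ) ≠ 0 := fun h => h1 (by linear_combination -h)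
  convert! h2 using 2
  have h4 : 4 * (-1 / (4 * τ) - m) = -(4 * m * τ + 1) / τ := by field_simp; ring
  rw [h4]
  field_simp

theorem thetaQ_lower {τ : ℂ} (hτ : 0 < τ.im) (m : ℤ) :
    thetaQ (τ / (4 * m * τ + 1)) = (4 * m * τ + 1) ^ (1 / 2 : ℂ) * thetaQ τ := by
  have h0 := ne_zero_of_im_pos hτ
  set w := -1 / (4 * τ) - m with hw
  have hwim : 0 < w.im := by
    have := im_neg_one_div_pos (τ := 4 * τ) (by simpa using hτ)
    simpa [w] using this
  have hw0 := ne_zero_of_im_pos hwim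
  have e : τ / (4 * m * τ + 1) = -1 / (4 * w) := by
    have h1 : (4 * m * τ + 1 : ℂ) = -4 * τ * w := by rw [hw]; field_simp; ring
    rw [h1]
    field_simp
  have e2 : thetaQ w = thetaQ (-1 / (4 * τ)) := by
    rw [hw, sub_eq_add_neg, ← Int.cast_neg, thetaQ_add_int]
  rw [e, thetaQ_fricke hwim, e2, thetaQ_fricke hτ, ← mul_assoc, rootS, rootS,
    cpow_half_mul (neg_I_mul_re_pos (by simpa using hwim)) (neg_I_mul_re_pos (by simpa using hτ))]
  congr 2
  rw [hw]
  field_simp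
  linear_combination (-4 * (1 + 4 * τ * m)) * I_sq

theorem linear_mem_slitPlane (e : ℤ) {f : ℤ} (hf : 0 < f) {τ : ℂ} (hτ : 0 < τ.im) :
    (e * τ + f : ℂ) ∈ slitPlane := by
  rcases eq_or_ne e 0 with rfl | he
  · left; simpa using hf
  · right
    simpa using ⟨he, hτ.ne'⟩

theorem moebius_lower_ne_zero {τ : ℂ} (hτ : 0 < τ.im) (m : ℤ) : (4 * m * τ + 1 : ℂ) ≠ 0 := by
  have := slitPlane_ne_zero (linear_mem_slitPlane (4 * m) one_pos hτ)
  exact_mod_cast this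

/-- Both sides have equal squares, so their ratio is a constant sign on the half-plane. The ratio
extends continuously to τ = 0, where f > 0 keeps every base in the slit plane, and equals 1 there.
-/
theorem cpow_half_cocycle {e f : ℤ} (hf : 0 < f) (m : ℤ) {τ : ℂ} (hτ : 0 < τ.im) :
    (e * (τ / (4 * m * τ + 1)) + f : ℂ) ^ (1 / 2 : ℂ) * (4 * m * τ + 1 : ℂ) ^ (1 / 2 : ℂ) =
      (((e + 4 * m * f : ℤ) : ℂ) * τ + f) ^ (1 / 2 : ℂ) := by
  set r : ℂ → ℂ := fun τ => (e * (τ / (4 * m * τ + 1)) + f : ℂ) ^ (1 / 2 : ℂ) *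
    (4 * m * τ + 1 : ℂ) ^ (1 / 2 : ℂ) / (((e + 4 * m * f : ℤ) : ℂ) * τ + f) ^ (1 / 2 : ℂ) with hr
  have hcont : ∀ τ : ℂ, (4 * m * τ + 1 : ℂ) ∈ slitPlane →
      (e * (τ / (4 * m * τ + 1)) + f : ℂ) ∈ slitPlane →
      (((e + 4 * m * f : ℤ) : ℂ) * τ + f) ∈ slitPlane → ContinuousAt r τ := fun τ h1 h2 h3 => by
    have h1' := slitPlane_ne_zero h1
    have c1 : ContinuousAt (fun τ : ℂ => (e * (τ / (4 * m * τ + 1)) + f : ℂ)) τ := by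
      fun_prop (disch := assumption)
    have c2 : ContinuousAt (fun τ : ℂ => (e * (τ / (4 * m * τ + 1)) + f : ℂ) ^ (1 / 2 : ℂ)) τ :=
      c1.cpow continuousAt_const h2
    have c3 : ContinuousAt (fun τ : ℂ => (4 * m * τ + 1 : ℂ) ^ (1 / 2 : ℂ)) τ :=
      ContinuousAt.cpow (by fun_prop) continuousAt_const h1
    have c4 : ContinuousAt (fun τ : ℂ => (((e + 4 * m * f : ℤ) : ℂ) * τ + f) ^ (1 / 2 : ℂ)) τ :=
      ContinuousAt.cpow (by fun_prop) continuousAt_const h3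
    refine (c2.mul c3).div c4 ?_
    exact fun h => slitPlane_ne_zero h3 (by
      have := cpow_half_sq (((e + 4 * m * f : ℤ) : ℂ) * τ + f)
      rw [← this, h]; ring)
  have h1 : ∀ τ : ℂ, 0 < τ.im → (4 * m * τ + 1 : ℂ) ∈ slitPlane := fun τ hτ => by
    exact_mod_cast linear_mem_slitPlane (4 * m) one_pos hτ
  have hC : ContinuousOn r ℍₒ := fun τ hτ => (hcont τ (h1 τ hτ)
    (linear_mem_slitPlane e hf (moebius_lower_im hτ m))
    (linear_mem_slitPlane _ hf hτ)).continuousWithinAt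
  have hpow : ∀ τ : ℂ, 0 < τ.im → r τ ^ 2 = 1 := fun τ hτ => by
    have h3 := slitPlane_ne_zero (linear_mem_slitPlane (e + 4 * m * f) hf hτ)
    rw [hr]
    simp only
    rw [div_pow, mul_pow, cpow_half_sq, cpow_half_sq, cpow_half_sq, div_eq_one_iff_eq h3]
    rw [add_mul, mul_assoc, div_mul_cancel₀ _ (moebius_lower_ne_zero hτ m)]
    push_cast
    ring
  have hfs : (f : ℂ) ∈ slitPlane := Or.inl (by simpa using hf)
  have h0 : ContinuousAt r 0 := hcont 0 (by simp) (by simpa using hfs) (by simpa using hfs)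
  have hr0 : r 0 = 1 := by
    have : (f : ℂ) ^ (1 / 2 : ℂ) ≠ 0 := fun h => slitPlane_ne_zero hfs (by
      rw [← cpow_half_sq (f : ℂ), h]; ring)
    simp only [hr, zero_div, mul_zero, zero_add, one_cpow, mul_one]
    exact div_self this
  have ht : Tendsto (fun s : ℝ => r (s * I)) (𝓝[>] 0) (𝓝 1) := by
    have c : ContinuousAt (fun s : ℝ => r (s * I)) 0 := by
      refine ContinuousAt.comp (f := fun s : ℝ => (s : ℂ) * I) (g := r) ?_ (by fun_prop)
      simpa using h0
    have := c.tendsto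
    simp only [ofReal_zero, zero_mul, hr0] at this
    exact this.mono_left nhdsWithin_le_nhds
  have hconst : r τ = 1 := by
    refine tendsto_nhds_unique (tendsto_const_nhds.congr' ?_) ht
    filter_upwards [self_mem_nhdsWithin] with s hs
    exact eq_of_pow_eq_const hC two_ne_zero hpow hτ (axis_mul_I_im hs)
  have h3 := linear_mem_slitPlane (e + 4 * m * f) hf hτ
  refine (div_eq_one_iff_eq fun h => slitPlane_ne_zero h3 ?_).mp hconst
  rw [← cpow_half_sq (((e + 4 * m * f : ℤ) : ℂ) * τ + f), h]; ring

/-- The theta multiplier `(c/d) (cτ + d)^{1/2}`. -/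
noncomputable def thetaFactor (c d : ℤ) (τ : ℂ) : ℂ :=
  (extLegendre c d : ℂ) * ((c : ℂ) * τ + d) ^ (1 / 2 : ℂ)

theorem thetaFactor_of_pos (c : ℤ) {d : ℤ} (hd : 0 < d) (τ : ℂ) :
    thetaFactor c d τ = (jacobiSym c d.natAbs : ℂ) * ((c : ℂ) * τ + d) ^ (1 / 2 : ℂ) := by
  simp [thetaFactor, extLegendre, not_lt.mpr hd.le]

/-- Negating both entries multiplies the principal root by i or −i according to the sign of c. The
sign in the extended symbol compensates, so the factor is always i. -/
theorem thetaFactor_of_neg {c d : ℤ} (hd : d < 0) (hc : c ≠ 0) {τ : ℂ} (hτ : 0 < τ.im) :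
    thetaFactor c d τ = I * ((jacobiSym c d.natAbs : ℂ) *
      (((-c : ℤ) : ℂ) * τ + ((-d : ℤ) : ℂ)) ^ (1 / 2 : ℂ)) := by
  have e : (((-c : ℤ) : ℂ) * τ + ((-d : ℤ) : ℂ)) = -((c : ℂ) * τ + d) := by push_cast; ring
  have him : ((c : ℂ) * τ + d).im = c * τ.im := by simp
  rw [e, thetaFactor, extLegendre]
  rcases lt_or_gt_of_ne hc with h | h
  · rw [if_pos ⟨h, hd⟩, cpow_half_neg_of_im_neg]
    · push_cast; ring
    · rw [him]; exact mul_neg_of_neg_of_pos (by exact_mod_cast h) hτ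
  · rw [if_neg (by omega), cpow_half_neg_of_im_pos]
    · push_cast; ring
    · rw [him]; exact mul_pos (by exact_mod_cast h) hτ

/-- This is the cocycle rule under right multiplication by a lower unipotent matrix: the Jacobi
symbol depends on c only modulo d, and the roots obey `cpow_half_cocycle`. -/
theorem thetaFactor_lower {c d : ℤ} (m : ℤ) (hd : d ≠ 0) (h1 : d < 0 → c ≠ 0)
    (h2 : d < 0 → c + 4 * m * d ≠ 0) {τ : ℂ} (hτ : 0 < τ.im) :
    thetaFactor (c + 4 * m * d) d τ =
      thetaFactor c d (τ / (4 * m * τ + 1)) * (4 * m * τ + 1) ^ (1 / 2 : ℂ) := by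
  have hJ : jacobiSym (c + 4 * m * d) d.natAbs = jacobiSym c d.natAbs := by
    refine jacobiSym.mod_left' ?_
    refine Int.modEq_iff_dvd.mpr ?_
    rw [Int.natCast_natAbs, abs_dvd]
    exact ⟨-(4 * m), by ring⟩
  rcases lt_or_gt_of_ne hd with h | h
  · rw [thetaFactor_of_neg h (h1 h) (moebius_lower_im hτ m), thetaFactor_of_neg h (h2 h) hτ, hJ]
    have key := cpow_half_cocycle (e := -c) (f := -d) (by omega) m hτ
    rw [show -c + 4 * m * -d = -(c + 4 * m * d) by ring] at key
    linear_combination (-I * (jacobiSym c d.natAbs : ℂ)) * key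
  · rw [thetaFactor_of_pos _ h, thetaFactor_of_pos _ h, hJ]
    linear_combination (-(jacobiSym c d.natAbs : ℂ)) * cpow_half_cocycle (e := c) h m hτ

theorem exists_abs_add_mul_le {c : ℤ} (hc : c ≠ 0) (d : ℤ) : ∃ n : ℤ, 2 * |d + n * c| ≤ |c| := by
  have h1 := Int.emod_nonneg d hc
  have h2 := Int.emod_lt_abs d hc
  have h3 := Int.emod_add_mul_ediv d c
  rcases le_or_gt (2 * (d % c)) |c| with h | h
  · refine ⟨-(d / c), ?_⟩
    rw [show d + -(d / c) * c = d % c by linarith, abs_of_nonneg h1]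
    exact h
  · refine ⟨-(d / c) - c.sign, ?_⟩
    rw [show d + (-(d / c) - c.sign) * c = d % c - c.sign * c by linarith, Int.sign_mul_self_eq_abs,
      abs_of_nonpos (by linarith)]
    linarith

/-- A Euclidean descent on |c|: translations reduce d modulo c, lower unipotent matrices reduce c
modulo 4d, and the factor is compatible with both moves. The bound k makes the descent an induction.
-/
theorem thetaQ_moebius (k : ℕ) : ∀ {a b c d : ℤ}, c.natAbs < k → a * d - b * c = 1 → 4 ∣ c →
    d % 4 = 1 → ∀ {τ : ℂ}, 0 < τ.im →
    thetaQ ((a * τ + b) / (c * τ + d)) = thetaFactor c d τ * thetaQ τ := by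
  induction k with
  | zero => intro a b c d h; omega
  | succ k ih =>
    intro a b c d hk hdet h4 hd τ hτ
    rcases eq_or_ne c 0 with rfl | hc
    · have hd1 : d = 1 := by
        have : d ∣ 1 := ⟨a, by linarith⟩
        rcases Int.isUnit_iff.mp (isUnit_of_dvd_one this) with h | h <;> omega
      subst hd1
      have ha : a = 1 := by linarith
      subst ha
      simp [thetaFactor, extLegendre, thetaQ_add_int]
    obtain ⟨n, hn⟩ := exists_abs_add_mul_le hc d
    obtain ⟨c', rfl⟩ := h4
    set d' := d + n * (4 * c') with hd'
    have hd4 : d' % 4 = 1 := by rw [hd', show n * (4 * c') = 4 * (n * c') by ring]; omega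
    have hd0 : d' ≠ 0 := by intro h; rw [h] at hd4; simp at hd4
    obtain ⟨m, hm⟩ := exists_abs_add_mul_le (c := 4 * d') (by omega) (4 * c')
    -- Equality would force |d′| = 2|c′|, although d′ is odd. Strictness is what makes |c| decrease.
    have hlt : |d'| * 2 < |4 * c'| := by
      refine lt_of_le_of_ne (by linarith) fun h => ?_
      have h1 : 2 * |c'| = |d'| := by rw [abs_mul] at h; norm_num at h; linarith
      rcases abs_choice d' with h2 | h2 <;> rw [h2] at h1 <;> omega
    have h4d : |4 * d'| = 4 * |d'| := by rw [abs_mul]; rfl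
    set c₂ := 4 * c' + 4 * m * d' with hc2
    have hc2' : |c₂| < |4 * c'| := by
      have : 4 * c' + m * (4 * d') = c₂ := by rw [hc2]; ring
      rw [this] at hm
      linarith
    have hc2'' : c₂.natAbs < (4 * c').natAbs := by zify; exact hc2'
    have hdet' : (a + 4 * m * (b + n * a)) * d' - (b + n * a) * c₂ = 1 := by
      rw [hc2, hd']; linear_combination hdet
    have key := fun {τ : ℂ} (hτ : 0 < τ.im) => ih (a := a + 4 * m * (b + n * a)) (b := b + n * a) (c := c₂) (d := d') (by omega)
      hdet' ⟨c' + m * d', by rw [hc2]; ring⟩ hd4 hτ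
    have hnz : d' < 0 → c₂ ≠ 0 := fun h h0 => by
      rw [h0, mul_zero, sub_zero] at hdet'
      have : d' ∣ 1 := ⟨_, by rw [mul_comm]; exact hdet'.symm⟩
      rcases Int.isUnit_iff.mp (isUnit_of_dvd_one this) with h | h <;> omega
    have step : ∀ {τ : ℂ}, 0 < τ.im → thetaQ ((a * τ + (b + n * a)) / ((4 * c' : ℤ) * τ + d')) =
        thetaFactor (4 * c') d' τ * thetaQ τ := by
      intro τ hτ
      have hτ' := moebius_lower_im hτ (-m)
      have hne := moebius_lower_ne_zero hτ (-m)
      set τ' := τ / (4 * ((-m : ℤ) : ℂ) * τ + 1) with hτ'def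
      have hne' := moebius_lower_ne_zero hτ' m
      have hback : τ' / (4 * m * τ' + 1) = τ := by
        have : 4 * (m : ℂ) * τ' + 1 = 1 / (4 * ((-m : ℤ) : ℂ) * τ + 1) := by
          rw [hτ'def, eq_div_iff hne, add_mul, mul_assoc, div_mul_cancel₀ _ hne]
          push_cast
          ring
        rw [this, hτ'def, div_div_div_cancel_right₀ hne, div_one]
      have h1 := key hτ'
      rw [hc2, thetaFactor_lower m hd0 (fun _ => hc) hnz hτ', mul_assoc (thetaFactor _ _ _), ← thetaQ_lower hτ' m,
        hback] at h1
      rw [← h1]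
      congr 1
      rw [← hback]
      push_cast
      have e1 : ∀ x y : ℂ, x * (τ' / (4 * m * τ' + 1)) + y =
          (x * τ' + y * (4 * m * τ' + 1)) / (4 * m * τ' + 1) := fun x y => by
        rw [eq_div_iff hne', add_mul, mul_assoc, div_mul_cancel₀ _ hne']
      rw [e1, e1, div_div_div_cancel_right₀ hne']
      congr 1 <;> ring
    -- This undoes the reduction of d; theta has period 1 and the extended symbol has period 4c′ in
    -- d.
    have h2 := step (τ := τ - n) (by simpa using hτ)
    have e3 : thetaQ (τ - n) = thetaQ τ := by
      rw [sub_eq_add_neg, ← Int.cast_neg, thetaQ_add_int]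
    have hcop : IsCoprime (4 * c') d := ⟨-b, a, by linarith⟩
    rw [e3, thetaFactor, hd', extLegendre_add_mul (by omega) hcop n] at h2
    rw [thetaFactor]
    convert! h2 using 3
    · ring
    · push_cast; ring
    · congr 1; push_cast; ring

/-! ### Duplication of theta functions and the level structure -/

theorem hasSum_int_even_add_odd {f : ℤ → ℂ} {a b : ℂ} (he : HasSum (fun k : ℤ => f (2 * k)) a)
    (ho : HasSum (fun k : ℤ => f (2 * k + 1)) b) : HasSum f (a + b) := by
  have h2 := mul_right_injective₀ (two_ne_zero' ℤ)
  replace ho := ((add_left_injective 1).comp h2).hasSum_range_iff.2 ho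
  refine (h2.hasSum_range_iff.2 he).add_isCompl ?_ ho
  convert! Int.isCompl_even_odd using 1
  · ext n
    exact ⟨fun ⟨k, hk⟩ => ⟨k, by linarith⟩, fun ⟨k, hk⟩ => ⟨k, by linarith⟩⟩
  · ext n
    exact ⟨fun ⟨k, hk⟩ => ⟨k, hk.symm⟩, fun ⟨k, hk⟩ => ⟨k, hk.symm⟩⟩

theorem hasSum_th3 {τ : ℂ} (hτ : 0 < τ.im) :
    HasSum (fun n : ℤ => cexp (π * I * n ^ 2 * τ)) (th3 τ) := by
  refine (hasSum_jacobiTheta₂_term 0 hτ).congr_fun fun n => ?_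
  rw [jacobiTheta₂_term]
  ring_nf

theorem hasSum_th2 {τ : ℂ} (hτ : 0 < τ.im) :
    HasSum (fun n : ℤ => cexp (π * I * (n + 1 / 2) ^ 2 * τ)) (th2 τ) := by
  refine ((hasSum_jacobiTheta₂_term (τ / 2) hτ).mul_left (cexp (π * I * τ / 4))).congr_fun
    fun n => ?_
  rw [jacobiTheta₂_term, ← Complex.exp_add]
  ring_nf

/-- Even and odd n in ∑ e^{πin²τ} give θ₃(4τ) and θ₂(4τ). -/
theorem th3_eq_add {τ : ℂ} (hτ : 0 < τ.im) : th3 τ = th3 (4 * τ) + th2 (4 * τ) := by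
  have h4 : 0 < (4 * τ).im := by simpa using hτ
  refine (hasSum_th3 hτ).unique (hasSum_int_even_add_odd ((hasSum_th3 h4).congr_fun fun n => ?_)
    ((hasSum_th2 h4).congr_fun fun n => ?_))
  · push_cast; ring_nf
  · push_cast; ring_nf

theorem th4_eq_sub {τ : ℂ} (hτ : 0 < τ.im) : th4 τ = th3 (4 * τ) - th2 (4 * τ) := by
  have h := th3_eq_add (τ := τ + 1) (by simpa using hτ)
  have e : 4 * (τ + 1) = 4 * τ + 1 + 1 + 1 + 1 := by ring
  rw [th3_add_one, e, th3_add_one, th4_add_one, th3_add_one, th4_add_one, th2_add_one, th2_add_one,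
    th2_add_one, th2_add_one] at h
  rw [h]
  linear_combination th2 (4 * τ) * cexp_pi_I_div_four_pow_four

theorem th3_eight (τ : ℂ) : th3 (8 * τ) = thetaQ (4 * τ) := by rw [thetaQ]; ring_nf

theorem th2_eight {τ : ℂ} (hτ : 0 < τ.im) : th2 (8 * τ) = thetaQ τ - thetaQ (4 * τ) := by
  rw [thetaQ, th3_eq_add (τ := 2 * τ) (by simpa using hτ), thetaQ]
  ring_nf

theorem th4_eight {τ : ℂ} (hτ : 0 < τ.im) : th4 (8 * τ) = 2 * thetaQ (16 * τ) - thetaQ (4 * τ) := by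
  have h : 0 < (8 * τ).im := by simpa using hτ
  have h1 := th3_eq_add h
  have h2 := th4_eq_sub h
  rw [th3_eight] at h1
  rw [h2, h1, thetaQ]
  ring_nf

theorem coe_SL_smul (γ : SL(2, ℤ)) (τ : ℍ) : ((γ • τ : ℍ) : ℂ) =
    ((γ 0 0 : ℤ) * τ + (γ 0 1 : ℤ)) / ((γ 1 0 : ℤ) * τ + (γ 1 1 : ℤ)) := by
  rw [UpperHalfPlane.coe_specialLinearGroup_apply]
  simp

/-- The matrix with the given entries. -/
def slOfDet (a b c d : ℤ) (h : a * d - b * c = 1) : SL(2, ℤ) :=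
  ⟨!![a, b; c, d], by rw [Matrix.det_fin_two_of, h]⟩

theorem coe_slOfDet_smul {a b c d : ℤ} (h : a * d - b * c = 1) (τ : ℍ) :
    ((slOfDet a b c d h • τ : ℍ) : ℂ) = (a * τ + b) / (c * τ + d) := by
  rw [coe_SL_smul]
  simp [slOfDet]

theorem moebius_im_pos {a b c d : ℤ} (h : a * d - b * c = 1) {τ : ℂ} (hτ : 0 < τ.im) :
    0 < ((a * τ + b) / (c * τ + d)).im := by
  have := (slOfDet a b c d h • (⟨τ, hτ⟩ : ℍ)).im_pos
  rwa [← UpperHalfPlane.coe_im, coe_slOfDet_smul h] at this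

theorem denom_slOfDet {a b c d : ℤ} (h : a * d - b * c = 1) (τ : ℍ) :
    UpperHalfPlane.denom (slOfDet a b c d h) τ = c * τ + d := by
  rw [ModularGroup.denom_apply]
  simp [slOfDet]

theorem moebius_denom_ne_zero {a b c d : ℤ} (h : a * d - b * c = 1) {τ : ℂ} (hτ : 0 < τ.im) :
    (c * τ + d : ℂ) ≠ 0 := fun h0 => by
  have := moebius_im_pos h hτ
  rw [h0] at this
  simp at this

theorem apply_moebius_of_ST {k : ℤ} {F : ℂ → ℂ}
    (hS : ∀ τ : ℂ, 0 < τ.im → F (-1 / τ) = τ ^ k * F τ)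
    (hT : ∀ τ : ℂ, 0 < τ.im → F (τ + 1) = F τ) {a b c d : ℤ} (h : a * d - b * c = 1) {τ : ℂ}
    (hτ : 0 < τ.im) : F ((a * τ + b) / (c * τ + d)) = (c * τ + d) ^ k * F τ := by
  have := apply_SL_of_ST hS hT (slOfDet a b c d h) ⟨τ, hτ⟩
  rwa [coe_slOfDet_smul h, denom_slOfDet h] at this

theorem mul_moebius {a b c d : ℤ} (N : ℤ) (τ : ℂ) :
    (N : ℂ) * ((a * τ + b) / (((N * c : ℤ) : ℂ) * τ + d)) =
      (a * (N * τ) + ((N * b : ℤ) : ℂ)) / (c * (N * τ) + d) := by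
  rw [mul_div_assoc']
  congr 1
  · push_cast; ring
  · push_cast; ring

/-- Transformation with the theta multiplier under the matrices congruent to `(* *; 0 1)`
modulo `64`. -/
def HasThetaMultiplier (F : ℂ → ℂ) : Prop :=
  ∀ {a b c d : ℤ}, a * d - b * c = 1 → 64 ∣ c → d % 4 = 1 → ∀ {τ : ℂ}, 0 < τ.im →
    F ((a * τ + b) / (c * τ + d)) = thetaFactor c d τ * F τ

theorem hasThetaMultiplier_thetaQ : HasThetaMultiplier thetaQ :=
  fun h hc hd _ hτ => thetaQ_moebius _ (Nat.lt_succ_self _) h (Dvd.dvd.trans ⟨16, by norm_num⟩ hc) hd hτ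

theorem thetaFactor_four_mul (c : ℤ) {d : ℤ} (hd : Odd d) (τ : ℂ) :
    thetaFactor (4 * c) d τ = thetaFactor c d (4 * τ) := by
  rw [thetaFactor, thetaFactor, extLegendre_four_mul c hd]
  congr 3
  push_cast
  ring

theorem hasThetaMultiplier_thetaQ_four : HasThetaMultiplier fun τ => thetaQ (4 * τ) := by
  intro a b c d h hc hd τ hτ
  obtain ⟨c, rfl⟩ := hc
  have e := mul_moebius (a := a) (b := b) (c := 16 * c) (d := d) 4 τ
  rw [← mul_assoc, show (4 : ℤ) * 16 = 64 by norm_num] at e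
  push_cast at e ⊢
  rw [e]
  have := thetaQ_moebius _ (Nat.lt_succ_self _) (a := a) (b := 4 * b) (c := 16 * c) (d := d)
    (by linear_combination h) ⟨4 * c, by ring⟩ hd (τ := 4 * τ) (by simpa using hτ)
  rw [← thetaFactor_four_mul _ ⟨d / 2, by omega⟩, show (4 : ℤ) * (16 * c) = 64 * c by ring] at this
  rw [← this]
  push_cast
  rfl

theorem hasThetaMultiplier_thetaQ_sixteen : HasThetaMultiplier fun τ => thetaQ (16 * τ) := by
  intro a b c d h hc hd τ hτ
  obtain ⟨c, rfl⟩ := hc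
  have e := mul_moebius (a := a) (b := b) (c := 4 * c) (d := d) 16 τ
  rw [← mul_assoc, show (16 : ℤ) * 4 = 64 by norm_num] at e
  push_cast at e ⊢
  rw [e]
  have hodd : Odd d := ⟨d / 2, by omega⟩
  have := thetaQ_moebius _ (Nat.lt_succ_self _) (a := a) (b := 16 * b) (c := 4 * c) (d := d)
    (by linear_combination h) ⟨c, by ring⟩ hd (τ := 16 * τ) (by simpa using hτ)
  rw [show (16 : ℂ) * τ = 4 * (4 * τ) by ring, ← thetaFactor_four_mul _ hodd,
    ← thetaFactor_four_mul _ hodd, show (4 : ℤ) * (4 * (4 * c)) = 64 * c by ring,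
    show 4 * (4 * τ) = (16 : ℂ) * τ by ring] at this
  rw [← this]
  push_cast
  rfl

theorem hasThetaMultiplier_th3 : HasThetaMultiplier fun τ => th3 (8 * τ) := by
  intro a b c d h hc hd τ hτ
  simp only [th3_eight]
  exact hasThetaMultiplier_thetaQ_four h hc hd hτ

theorem hasThetaMultiplier_th2 : HasThetaMultiplier fun τ => th2 (8 * τ) := by
  intro a b c d h hc hd τ hτ
  simp only [th2_eight hτ, th2_eight (moebius_im_pos h hτ)]
  have h1 := hasThetaMultiplier_thetaQ_four h hc hd hτ
  have h2 := hasThetaMultiplier_thetaQ h hc hd hτ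
  simp only at h1 h2
  rw [h1, h2]
  ring

theorem hasThetaMultiplier_th4 : HasThetaMultiplier fun τ => th4 (8 * τ) := by
  intro a b c d h hc hd τ hτ
  simp only [th4_eight hτ, th4_eight (moebius_im_pos h hτ)]
  have h1 := hasThetaMultiplier_thetaQ_four h hc hd hτ
  have h2 := hasThetaMultiplier_thetaQ_sixteen h hc hd hτ
  simp only at h1 h2
  rw [h1, h2]
  ring

/-- The fourth power erases the quadratic symbol and the choice of root. Hence level-one forms of
weight two transform exactly like fourth powers of thetas. -/
theorem thetaFactor_pow_four {a b c d : ℤ} (h : a * d - b * c = 1) (τ : ℂ) :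
    thetaFactor c d τ ^ 4 = (c * τ + d) ^ 2 := by
  have hg : c.gcd d.natAbs = 1 := by
    have := Int.isCoprime_iff_gcd_eq_one.mp (⟨-b, a, by linarith⟩ : IsCoprime c d)
    simpa only [Int.gcd, Int.natAbs_natCast] using this
  have hJ := jacobiSym.sq_one hg
  have he : extLegendre c d ^ 4 = 1 := by
    rw [extLegendre, show ∀ x : ℤ, x ^ 4 = (x ^ 2) ^ 2 from fun x => by ring, mul_pow, hJ]
    split_ifs <;> norm_num
  have he' : (extLegendre c d : ℂ) ^ 4 = 1 := by exact_mod_cast he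
  rw [thetaFactor, mul_pow, he', show ∀ x : ℂ, x ^ 4 = (x ^ 2) ^ 2 from fun x => by ring,
    cpow_half_sq, one_mul]

/-! ### Quartic forms in the theta functions -/

/-- The quadratic form with coefficients `p` in the squares of the theta functions. -/
noncomputable def thetaQuartic (p : Fin 6 → ℂ) (τ : ℂ) : ℂ :=
  p 0 * th2 τ ^ 4 + p 1 * th3 τ ^ 4 + p 2 * th4 τ ^ 4 + p 3 * (th2 τ ^ 2 * th3 τ ^ 2) +
    p 4 * (th2 τ ^ 2 * th4 τ ^ 2) + p 5 * (th3 τ ^ 2 * th4 τ ^ 2)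

theorem thetaQuartic_S (p : Fin 6 → ℂ) {τ : ℂ} (hτ : 0 < τ.im) : thetaQuartic p (-1 / τ) =
    τ ^ 2 * thetaQuartic ![-p 2, -p 1, -p 0, -p 5, -p 4, -p 3] τ := by
  have h := rootS_pow_four τ
  simp only [thetaQuartic, th2_S hτ, th3_S hτ, th4_S hτ, mul_pow, h, Matrix.cons_val]
  linear_combination (p 3 * th4 τ ^ 2 * th3 τ ^ 2 + p 4 * th4 τ ^ 2 * th2 τ ^ 2 +
    p 5 * th3 τ ^ 2 * th2 τ ^ 2) * h

theorem cexp_pi_I_div_four_sq : cexp (π * I / 4) ^ 2 = I := by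
  rw [← Complex.exp_nat_mul, show ((2 : ℕ) : ℂ) * (π * I / 4) = π / 2 * I by push_cast; ring,
    Complex.exp_pi_div_two_mul_I]

theorem thetaQuartic_add_one (p : Fin 6 → ℂ) (τ : ℂ) : thetaQuartic p (τ + 1) =
    thetaQuartic ![-p 0, p 2, p 1, I * p 4, I * p 3, p 5] τ := by
  simp only [thetaQuartic, th2_add_one, th3_add_one, th4_add_one, mul_pow,
    cexp_pi_I_div_four_pow_four, cexp_pi_I_div_four_sq, Matrix.cons_val]
  ring

theorem thetaQuartic_sub_one (p : Fin 6 → ℂ) (τ : ℂ) : thetaQuartic p (τ - 1) =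
    thetaQuartic ![-p 0, p 2, p 1, -I * p 4, -I * p 3, p 5] τ := by
  rw [← sub_add_cancel τ 1, thetaQuartic_add_one, add_sub_cancel_right]
  congr 1
  ext i
  fin_cases i <;> simp [← mul_assoc]

/-! ### Behaviour at the cusps -/

theorem exists_sub_isBigO_of_isBigO_one {h : ℝ} (hh : 0 < h) {F : ℂ → ℂ}
    (hol : ∀ τ : ℂ, 0 < τ.im → DifferentiableAt ℂ F τ)
    (per : ∀ τ : ℂ, 0 < τ.im → F (τ + h) = F τ)
    (bd : (fun τ : ℍ => F τ) =O[atImInfty] (fun _ => (1 : ℝ))) :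
    ∃ l : ℂ, (fun τ : ℍ => F τ - l) =O[atImInfty] fun τ => Real.exp (-(2 * π / h) * τ.im) := by
  classical
  -- Extension by zero outside the half-plane makes the function periodic on all of ℂ without
  -- changing it near i∞.
  set F' : ℂ → ℂ := fun z => if 0 < z.im then F z else 0 with hF'
  have hper : Function.Periodic F' h := fun z => by
    have e : (z + h).im = z.im := by simp
    simp only [hF', e]
    split_ifs with h0
    · exact per z h0
    · rfl
  have hev : ∀ᶠ z in Filter.comap Complex.im atTop, 0 < z.im :=
    Filter.tendsto_comap.eventually (eventually_gt_atTop 0)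
  have hhol : ∀ᶠ z in Filter.comap Complex.im atTop, DifferentiableAt ℂ F' z := by
    filter_upwards [hev] with z hz
    refine (hol z hz).congr_of_eventuallyEq ?_
    filter_upwards [UpperHalfPlane.isOpen_upperHalfPlaneSet.mem_nhds hz] with w hw
    exact if_pos hw
  have hbd : BoundedAtFilter (Filter.comap Complex.im atTop) F' := by
    have := bd.comp_tendsto UpperHalfPlane.tendsto_comap_im_ofComplex
    refine this.congr' ?_ (EventuallyEq.rfl)
    filter_upwards [hev] with z hz
    simp only [Function.comp, hF', if_pos hz]
    rw [UpperHalfPlane.ofComplex_apply_of_im_pos hz]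
  refine ⟨Function.Periodic.cuspFunction h F' 0, ((Function.Periodic.exp_decay_sub_of_bounded_at_inf hh hper hhol hbd).comp_tendsto
    UpperHalfPlane.tendsto_coe_atImInfty).congr (fun τ => ?_) (fun τ => ?_)⟩
  · have : F' τ = F τ := if_pos τ.im_pos
    simp only [Function.comp, this]
  · simp only [Function.comp, UpperHalfPlane.coe_im]
    congr 1
    ring

theorem norm_qpow (τ : ℂ) (n : ℤ) : ‖qpow τ n‖ = Real.exp (-(2 * π * n) * τ.im) := by
  rw [qpow, ← norm_cexp_mul_I]
  congr 2
  push_cast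
  ring

theorem qpow_mul_qpow_neg (τ : ℂ) (n : ℤ) : qpow τ n * qpow τ (-n) = 1 := by
  rw [qpow_eq, qpow_eq, ← zpow_add₀ (Complex.exp_ne_zero _), add_neg_cancel, zpow_zero]

theorem qpow_div_add {N : ℕ} (hN : 0 < N) (τ : ℂ) (n : ℤ) :
    qpow ((τ + N) / N) n = qpow (τ / N) n := by
  have : (N : ℂ) ≠ 0 := by exact_mod_cast hN.ne'
  rw [add_div, div_self this, qpow_eq, qpow_eq]
  congr 1
  rw [mul_add, mul_one, Complex.exp_add, Complex.exp_two_pi_mul_I, mul_one]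

theorem differentiableAt_qpow_div (N : ℕ) (n : ℤ) (τ : ℂ) :
    DifferentiableAt ℂ (fun τ => qpow (τ / N) n) τ := by
  unfold qpow
  fun_prop

/-- The pole in q^{1/N} has order at most one. Removing the limit of F·q^{1/N} and then the limit of
what remains after dividing by q^{1/N} leaves an exponentially small error, so P is linear. -/
theorem exists_polynomial_isBigO {N : ℕ} (hN : 0 < N) {F : ℂ → ℂ}
    (hol : ∀ τ : ℂ, 0 < τ.im → DifferentiableAt ℂ F τ)
    (per : ∀ τ : ℂ, 0 < τ.im → F (τ + N) = F τ)
    (bd : (fun τ : ℍ => F τ * qpow (τ / N) 1) =O[atImInfty] (fun _ => (1 : ℝ))) :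
    ∃ P : Polynomial ℂ, (fun τ : ℍ => F τ - P.eval (qpow (τ / N) (-1))) =O[atImInfty]
      fun τ => Real.exp (-(2 * π / N) * τ.im) := by
  have hN' : (0 : ℝ) < N := by exact_mod_cast hN
  obtain ⟨l, hl⟩ := exists_sub_isBigO_of_isBigO_one hN' (F := fun τ => F τ * qpow (τ / N) 1)
    (fun τ hτ => (hol τ hτ).mul (differentiableAt_qpow_div N 1 τ))
    (fun τ hτ => by
      have := per τ hτ
      simp only [ofReal_natCast]
      rw [this, qpow_div_add hN]) bd
  have hnorm : ∀ τ : ℍ, ‖qpow (τ / N) (-1)‖ = Real.exp (2 * π / N * τ.im) := fun τ => by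
    rw [norm_qpow, div_natCast_im, UpperHalfPlane.coe_im]
    congr 1
    push_cast
    ring
  obtain ⟨l', hl'⟩ := exists_sub_isBigO_of_isBigO_one hN'
    (F := fun τ => (F τ * qpow (τ / N) 1 - l) * qpow (τ / N) (-1))
    (fun τ hτ => (((hol τ hτ).mul (differentiableAt_qpow_div N 1 τ)).sub_const l).mul
      (differentiableAt_qpow_div N (-1) τ))
    (fun τ hτ => by
      have := per τ hτ
      simp only [ofReal_natCast]
      rw [this, qpow_div_add hN, qpow_div_add hN])
    ((hl.mul (Asymptotics.isBigO_refl (fun τ : ℍ => qpow (τ / N) (-1)) atImInfty).norm_right).congr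
      (fun τ => rfl) (fun τ => by
        rw [hnorm, ← Real.exp_add]
        ring_nf
        exact Real.exp_zero))
  refine ⟨Polynomial.C l * Polynomial.X + Polynomial.C l', hl'.congr_left fun τ => ?_⟩
  have := qpow_mul_qpow_neg ((τ : ℂ) / N) 1
  simp only [Polynomial.eval_add, Polynomial.eval_mul, Polynomial.eval_C, Polynomial.eval_X]
  linear_combination (F τ) * this

theorem etaPeriod_isBigO : ∃ c : ℝ, 0 < c ∧
    (fun τ : ℍ => etaPeriod τ) =O[atImInfty] fun τ => Real.exp (-c * τ.im) := by
  obtain ⟨C, c, hc, h⟩ := isRapid_eta_pow_three.decay 1 one_pos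
  refine ⟨c, hc, Asymptotics.IsBigO.of_bound
    (∫ t in Ioi (0 : ℝ), C * (2 * 1) ^ (-(1 / 2) : ℝ) * Real.exp (-c * t)) ?_⟩
  have h1 : ∀ᶠ τ : ℍ in atImInfty, 1 ≤ τ.im := tendsto_comap.eventually (eventually_ge_atTop 1)
  filter_upwards [h1] with τ hτ
  have hτ' : 1 ≤ (τ : ℂ).im := hτ
  have hC : 0 ≤ C := by
    have h1 := (norm_nonneg _).trans (h I (by simp))
    exact nonneg_of_mul_nonneg_left h1 (Real.exp_pos _)
  rw [etaPeriod, period, Real.norm_of_nonneg (Real.exp_pos _).le, ← integral_mul_const]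
  refine norm_integral_le_of_norm_le
    (((exp_neg_integrableOn_Ioi 0 hc).const_mul _).mul_const _) ?_
  refine (ae_restrict_iff' measurableSet_Ioi).mpr (ae_of_all _ fun t ht => ?_)
  have ht' : (0 : ℝ) < t := ht
  have h2 := h (ray τ t) (by rw [ray_im]; linarith)
  have h3 := rpow_neg_le (s := 1 / 2) one_pos hτ' ht'.le (by norm_num)
  have h0 : 0 ≤ (2 * (τ : ℂ).im + t) ^ (-(1 / 2) : ℝ) := Real.rpow_nonneg (by positivity) _
  rw [norm_mul, norm_real, Real.norm_of_nonneg h0]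
  refine (mul_le_mul h2 h3 h0 (by positivity)).trans (le_of_eq ?_)
  rw [ray_im, mul_add, Real.exp_add, UpperHalfPlane.coe_im]
  ring

/-! ### Action of the full modular group on theta quartics -/

theorem S_inv_eq : ModularGroup.S⁻¹ = slOfDet 0 1 (-1) 0 (by norm_num) := by
  rw [inv_eq_iff_mul_eq_one]
  ext i j
  rw [Matrix.SpecialLinearGroup.coe_mul, Matrix.mul_apply, Fin.sum_univ_two]
  fin_cases i <;> fin_cases j <;> simp [ModularGroup.S, slOfDet]

theorem T_inv_eq : ModularGroup.T⁻¹ = slOfDet 1 (-1) 0 1 (by norm_num) := by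
  rw [inv_eq_iff_mul_eq_one]
  ext i j
  rw [Matrix.SpecialLinearGroup.coe_mul, Matrix.mul_apply, Fin.sum_univ_two]
  fin_cases i <;> fin_cases j <;> simp [ModularGroup.T, slOfDet]

/-- S and T permute the six monomials up to fourth roots of unity; the rest is induction on words in
the generators. -/
theorem exists_thetaQuartic_SL (γ : SL(2, ℤ)) : ∀ p : Fin 6 → ℂ, ∃ p' : Fin 6 → ℂ,
    ∀ τ : ℍ, thetaQuartic p (γ • τ : ℍ) = UpperHalfPlane.denom γ τ ^ 2 * thetaQuartic p' τ := by
  have hγ : γ ∈ Subgroup.closure {ModularGroup.S, ModularGroup.T} := by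
    simp [SpecialLinearGroup.SL2Z_generators]
  induction hγ using Subgroup.closure_induction'' with
  | mem g hg =>
    intro p
    rcases hg with rfl | rfl
    · refine ⟨![-p 2, -p 1, -p 0, -p 5, -p 4, -p 3], fun τ => ?_⟩
      rw [coe_S_smul, thetaQuartic_S p τ.im_pos, ModularGroup.denom_S]
    · refine ⟨![-p 0, p 2, p 1, I * p 4, I * p 3, p 5], fun τ => ?_⟩
      rw [coe_T_smul, thetaQuartic_add_one, ModularGroup.denom_apply]
      simp [ModularGroup.T]
  | inv_mem g hg =>
    intro p
    rcases hg with rfl | rfl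
    · refine ⟨![-p 2, -p 1, -p 0, -p 5, -p 4, -p 3], fun τ => ?_⟩
      rw [S_inv_eq, coe_slOfDet_smul, denom_slOfDet]
      have e : (((0 : ℤ) : ℂ) * τ + ((1 : ℤ) : ℂ)) / (((-1 : ℤ) : ℂ) * τ + ((0 : ℤ) : ℂ)) =
          -1 / τ := by
        push_cast
        rw [zero_mul, zero_add, add_zero, neg_one_mul, div_neg, neg_div]
      rw [e, thetaQuartic_S p τ.im_pos]
      push_cast
      ring
    · refine ⟨![-p 0, p 2, p 1, -I * p 4, -I * p 3, p 5], fun τ => ?_⟩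
      rw [T_inv_eq, coe_slOfDet_smul, denom_slOfDet]
      have e : (((1 : ℤ) : ℂ) * τ + ((-1 : ℤ) : ℂ)) / (((0 : ℤ) : ℂ) * τ + ((1 : ℤ) : ℂ)) =
          τ - 1 := by
        push_cast
        ring
      rw [e, thetaQuartic_sub_one p]
      push_cast
      ring
  | one => exact fun p => ⟨p, fun τ => by simp⟩
  | mul x y _ _ hx hy =>
    intro p
    obtain ⟨p', hp'⟩ := hx p
    obtain ⟨p'', hp''⟩ := hy p'
    refine ⟨p'', fun τ => ?_⟩
    rw [mul_smul, hp', hp'', ← mul_assoc, ← mul_pow]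
    congr 2
    have hne := UpperHalfPlane.denom_ne_zero (y : GL (Fin 2) ℝ) τ
    rw [ModularGroup.denom_apply] at hne
    rw [ModularGroup.denom_apply, ModularGroup.denom_apply, ModularGroup.denom_apply, coe_SL_smul,
      Matrix.SpecialLinearGroup.coe_mul, Matrix.mul_apply, Matrix.mul_apply, Fin.sum_univ_two,
      Fin.sum_univ_two]
    push_cast
    rw [add_mul, mul_assoc, div_mul_cancel₀ _ hne]
    ring

/-- The weight two form `p(θ₂, θ₃, θ₄) + k (M̂₂ + M̂₃ + M̂₄)`. -/
noncomputable def mixedForm (p : Fin 6 → ℂ) (k : ℂ) (τ : ℂ) : ℂ := thetaQuartic p τ + k * compSum τ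

/-- The quotient of a weight two form by `η³`, at `8τ`. -/
noncomputable def quotForm (p : Fin 6 → ℂ) (k : ℂ) (τ : ℂ) : ℂ :=
  mixedForm p k (8 * τ) / η (8 * τ) ^ 3

/-! ### Weight one half: transformation law and cusp expansions of quotients by η³ -/

theorem eta_pow_three_moebius {a b c d : ℤ} (h : a * d - b * c = 1) (hc : 64 ∣ c) (hd : d % 4 = 1)
    {τ : ℂ} (hτ : 0 < τ.im) : η (8 * ((a * τ + b) / (c * τ + d))) ^ 3 =
      thetaFactor c d τ ^ 3 * η (8 * τ) ^ 3 := by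
  have h1 := two_mul_eta_pow_three (τ := 8 * τ) (by simpa using hτ)
  have h2 := two_mul_eta_pow_three (τ := 8 * ((a * τ + b) / (c * τ + d)))
    (by simpa using moebius_im_pos h hτ)
  have e2 := hasThetaMultiplier_th2 h hc hd hτ
  have e3 := hasThetaMultiplier_th3 h hc hd hτ
  have e4 := hasThetaMultiplier_th4 h hc hd hτ
  simp only at e2 e3 e4
  rw [e2, e3, e4] at h2
  linear_combination (1 / 2) * h2 - (1 / 2) * thetaFactor c d τ ^ 3 * h1

theorem mixedForm_moebius (p : Fin 6 → ℂ) (k : ℂ) {a b c d : ℤ} (h : a * d - b * c = 1)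
    (hc : 64 ∣ c) (hd : d % 4 = 1) {τ : ℂ} (hτ : 0 < τ.im) :
    mixedForm p k (8 * ((a * τ + b) / (c * τ + d))) =
      thetaFactor c d τ ^ 4 * mixedForm p k (8 * τ) := by
  have e2 := hasThetaMultiplier_th2 h hc hd hτ
  have e3 := hasThetaMultiplier_th3 h hc hd hτ
  have e4 := hasThetaMultiplier_th4 h hc hd hτ
  simp only at e2 e3 e4
  have e5 : compSum (8 * ((a * τ + b) / (c * τ + d))) =
      thetaFactor c d τ ^ 4 * compSum (8 * τ) := by
    obtain ⟨c, rfl⟩ := hc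
    have e := mul_moebius (a := a) (b := b) (c := 8 * c) (d := d) 8 τ
    have h' := apply_moebius_of_ST compSum_S compSum_add_one (a := a) (b := 8 * b) (c := 8 * c)
      (d := d) (by linear_combination h) (τ := 8 * τ) (by simpa using hτ)
    rw [thetaFactor_pow_four h]
    rw [← mul_assoc, show (8 : ℤ) * 8 = 64 by norm_num] at e
    push_cast at e h' ⊢
    rw [e, h', ← mul_assoc, show (8 : ℂ) * c * 8 = 64 * c by ring]
    norm_cast
    push_cast
    rfl
  rw [mixedForm, mixedForm, e5, thetaQuartic, thetaQuartic, e2, e3, e4]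
  ring

theorem gamma1_entries {γ : SL(2, ℤ)} (hγ : γ ∈ CongruenceSubgroup.Gamma1 64) :
    γ 0 0 * γ 1 1 - γ 0 1 * γ 1 0 = 1 ∧ 64 ∣ γ 1 0 ∧ γ 1 1 % 4 = 1 := by
  obtain ⟨-, h2, h3⟩ := (CongruenceSubgroup.Gamma1_mem 64 γ).mp hγ
  refine ⟨?_, ?_, ?_⟩
  · have := γ.det_coe
    rwa [Matrix.det_fin_two] at this
  · exact (ZMod.intCast_zmod_eq_zero_iff_dvd _ 64).mp h3
  · have : (γ 1 1 : ZMod 64) = ((1 : ℤ) : ZMod 64) := by rw [h2]; simp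
    have h := (ZMod.intCast_eq_intCast_iff_dvd_sub _ _ 64).mp this
    omega

/-- The numerator carries the fourth power of the theta factor and η(8τ)³ its cube, so one factor
remains. On the group d ≡ 1 mod 4, so ε_d = 1. -/
theorem transformsHalf_quotForm (p : Fin 6 → ℂ) (k : ℂ) :
    TransformsHalf 64 fun τ : ℍ => quotForm p k τ := by
  intro γ hγ τ
  obtain ⟨h1, h2, h3⟩ := gamma1_entries hγ
  have hj : thetaFactor (γ 1 0) (γ 1 1) τ ≠ 0 := fun h0 => by
    have h4 := thetaFactor_pow_four h1 (τ : ℂ)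
    rw [h0] at h4
    exact moebius_denom_ne_zero h1 τ.im_pos (by simpa using h4.symm)
  have he := eta_ne_zero (τ := 8 * (τ : ℂ)) (by simpa using τ.im_pos)
  rw [epsOdd, if_pos h3, inv_one, mul_one]
  change quotForm p k (γ • τ : ℍ) = thetaFactor (γ 1 0) (γ 1 1) τ * quotForm p k τ
  rw [quotForm, quotForm, coe_SL_smul, mixedForm_moebius p k h1 h2 h3 τ.im_pos,
    eta_pow_three_moebius h1 h2 h3 τ.im_pos]
  field_simp

theorem exists_thetaQuartic_moebius (p : Fin 6 → ℂ) {a b c d : ℤ} (h : a * d - b * c = 1) :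
    ∃ p' : Fin 6 → ℂ, ∀ τ : ℂ, 0 < τ.im →
      thetaQuartic p ((a * τ + b) / (c * τ + d)) = (c * τ + d) ^ 2 * thetaQuartic p' τ := by
  obtain ⟨p', hp'⟩ := exists_thetaQuartic_SL (slOfDet a b c d h) p
  refine ⟨p', fun τ hτ => ?_⟩
  have := hp' ⟨τ, hτ⟩
  rwa [coe_slOfDet_smul, denom_slOfDet] at this

theorem eta_pow_24_moebius {a b c d : ℤ} (h : a * d - b * c = 1) {τ : ℂ} (hτ : 0 < τ.im) :
    η ((a * τ + b) / (c * τ + d)) ^ 24 = (c * τ + d) ^ 12 * η τ ^ 24 :=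
  apply_moebius_of_ST (k := 12) (F := fun τ => η τ ^ 24) (fun _ hτ => eta_pow_24_S hτ)
    (fun _ _ => eta_pow_24_add_one _) h hτ

/-- The integral matrix diag(8, 1)γ is a unimodular matrix times an upper triangular one: A is the
gcd of its first column, Bézout coefficients complete that column, and AD = 8. -/
theorem exists_hermite_decomposition {a b c d : ℤ} (h : a * d - b * c = 1) :
    ∃ a' b' c' d' A B D : ℤ, a' * d' - b' * c' = 1 ∧ 0 < A ∧ 0 < D ∧ 8 * a = a' * A ∧
      c = c' * A ∧ 8 * b = a' * B + b' * D ∧ d = c' * B + d' * D := by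
  set A : ℤ := ((Int.gcd (8 * a) c : ℕ) : ℤ) with hA
  have hA0 : 0 < A := by
    have : (Int.gcd (8 * a) c) ≠ 0 := by
      rw [Ne, Int.gcd_eq_zero_iff]
      rintro ⟨h1, rfl⟩
      have : a = 0 := by omega
      subst this
      simp at h
    omega
  obtain ⟨a', ha'⟩ : A ∣ 8 * a := Int.gcd_dvd_left ..
  obtain ⟨c', hc'⟩ : A ∣ c := Int.gcd_dvd_right ..
  have hcop : a' * Int.gcdA (8 * a) c + c' * Int.gcdB (8 * a) c = 1 := by
    have hab : A = 8 * a * Int.gcdA (8 * a) c + c * Int.gcdB (8 * a) c := Int.gcd_eq_gcd_ab _ _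
    refine mul_left_cancel₀ hA0.ne' ?_
    linear_combination -hab + (-Int.gcdA (8 * a) c) * ha' - Int.gcdB (8 * a) c * hc'
  have hDA : (-c' * (8 * b) + a' * d) * A = 8 := by
    linear_combination 8 * h - d * ha' + 8 * b * hc'
  refine ⟨a', -Int.gcdB (8 * a) c, c', Int.gcdA (8 * a) c, A,
    Int.gcdA (8 * a) c * (8 * b) + Int.gcdB (8 * a) c * d, -c' * (8 * b) + a' * d,
    by linear_combination hcop, hA0, ?_, by rw [ha']; ring, by rw [hc']; ring,
    by linear_combination (-8 * b) * hcop, by linear_combination (-d) * hcop⟩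
  exact pos_of_mul_pos_left (by rw [hDA]; norm_num) hA0.le

/-- The unimodular part preserves the family of mixed forms. The remaining scalar, which combines
the root of cτ + d with the unknown multiplier of η³, has eighth power D^{−4}, hence is constant and
may be evaluated at i. -/
theorem exists_slashHalf_quotForm (p : Fin 6 → ℂ) (k : ℂ) (γ : SL(2, ℤ)) :
    ∃ (p' : Fin 6 → ℂ) (K : ℂ) (A B D : ℤ), 0 < A ∧ 0 < D ∧ ∀ τ : ℍ,
      slashHalf (fun τ : ℍ => quotForm p k τ) γ τ =
        K * (mixedForm p' k ((A * τ + B) / D) / η ((A * τ + B) / D) ^ 3) := by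
  have hdet : γ 0 0 * γ 1 1 - γ 0 1 * γ 1 0 = 1 := by
    have := γ.det_coe
    rwa [Matrix.det_fin_two] at this
  obtain ⟨a', b', c', d', A, B, D, h', hA, hD, e1, e2, e3, e4⟩ := exists_hermite_decomposition hdet
  obtain ⟨p', hp'⟩ := exists_thetaQuartic_moebius p h'
  have hD0 : (D : ℂ) ≠ 0 := by exact_mod_cast hD.ne'
  set w : ℂ → ℂ := fun τ => (A * τ + B) / D with hw
  have hwim : ∀ τ : ℂ, 0 < τ.im → 0 < (w τ).im := fun τ hτ => by
    have : (w τ).im = A * τ.im / D := by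
      rw [hw]
      simp only [div_intCast_im]
      simp
    rw [this]
    have hA' : (0 : ℝ) < A := by exact_mod_cast hA
    have hD' : (0 : ℝ) < D := by exact_mod_cast hD
    positivity
  have f1 : (8 : ℂ) * (γ 0 0 : ℤ) = a' * A := by exact_mod_cast e1
  have f2 : ((γ 1 0 : ℤ) : ℂ) = c' * A := by exact_mod_cast e2
  have f3 : (8 : ℂ) * (γ 0 1 : ℤ) = a' * B + b' * D := by exact_mod_cast e3
  have f4 : ((γ 1 1 : ℤ) : ℂ) = c' * B + d' * D := by exact_mod_cast e4
  have hden : ∀ τ : ℂ, ((γ 1 0 : ℤ) * τ + (γ 1 1 : ℤ) : ℂ) = D * (c' * w τ + d') := fun τ => by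
    rw [hw, f2, f4]
    field_simp
    ring
  have hmob : ∀ τ : ℂ, 0 < τ.im → 8 * (((γ 0 0 : ℤ) * τ + (γ 0 1 : ℤ)) /
      ((γ 1 0 : ℤ) * τ + (γ 1 1 : ℤ))) = (a' * w τ + b') / (c' * w τ + d') := fun τ hτ => by
    have hne := moebius_denom_ne_zero h' (hwim τ hτ)
    rw [hden, mul_div_assoc', div_eq_div_iff (mul_ne_zero hD0 hne) hne]
    have : (8 : ℂ) * ((γ 0 0 : ℤ) * τ + (γ 0 1 : ℤ)) = D * (a' * w τ + b') := by
      rw [mul_add, ← mul_assoc, f1, f3, hw]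
      field_simp
      ring
    rw [this]
    ring
  set κ : ℂ → ℂ := fun τ => ((γ 1 0 : ℤ) * τ + (γ 1 1 : ℤ) : ℂ) ^ (-(1 / 2) : ℂ) *
    (c' * w τ + d') ^ 2 * η (w τ) ^ 3 / η ((a' * w τ + b') / (c' * w τ + d')) ^ 3 with hκ
  have hκpow : ∀ τ : ℂ, 0 < τ.im → κ τ ^ 8 = ((D : ℂ) ^ 4)⁻¹ := fun τ hτ => by
    have hne := moebius_denom_ne_zero h' (hwim τ hτ)
    have hη := eta_ne_zero (hwim τ hτ)
    have h1 : (((γ 1 0 : ℤ) * τ + (γ 1 1 : ℤ) : ℂ) ^ (-(1 / 2) : ℂ)) ^ 8 =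
        ((D : ℂ) ^ 4)⁻¹ * ((c' * w τ + d') ^ 4)⁻¹ := by
      rw [cpow_neg, inv_pow, show ∀ x : ℂ, x ^ 8 = (x ^ 2) ^ 4 from fun x => by ring, cpow_half_sq,
        hden, mul_pow, mul_inv]
    rw [hκ]
    simp only
    rw [div_pow, mul_pow, mul_pow, h1, ← pow_mul (η _), ← pow_mul (η _),
      eta_pow_24_moebius h' (hwim τ hτ)]
    field_simp
  have hκcont : ContinuousOn κ ℍₒ := by
    intro τ hτ
    have hne := moebius_denom_ne_zero h' (hwim τ hτ)
    have hwd : DifferentiableAt ℂ w τ := by rw [hw]; fun_prop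
    have c1 : ContinuousWithinAt (fun τ : ℂ =>
        ((γ 1 0 : ℤ) * τ + (γ 1 1 : ℤ) : ℂ) ^ (-(1 / 2) : ℂ)) ℍₒ τ := by
      rcases eq_or_ne (γ 1 0) 0 with h0 | h0
      · simp only [h0, Int.cast_zero, zero_mul]
        exact continuousWithinAt_const
      · refine (ContinuousAt.cpow (by fun_prop) continuousAt_const (Or.inr ?_)).continuousWithinAt
        have : (τ : ℂ).im ≠ 0 := ne_of_gt hτ
        simpa using ⟨h0, this⟩
    have hη1 : ContinuousAt (fun τ => η (w τ) ^ 3) τ :=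
      (((differentiableAt_eta (hwim τ hτ)).comp τ hwd).pow 3).continuousAt
    have hv : DifferentiableAt ℂ (fun τ => (a' * w τ + b') / (c' * w τ + d')) τ :=
      ((hwd.const_mul _).add_const _).div ((hwd.const_mul _).add_const _) hne
    have hη2 : ContinuousAt (fun τ => η ((a' * w τ + b') / (c' * w τ + d')) ^ 3) τ :=
      (((differentiableAt_eta (moebius_im_pos h' (hwim τ hτ))).comp τ hv).pow 3).continuousAt
    have hc : ContinuousAt (fun τ => (c' * w τ + d') ^ 2) τ :=
      (((hwd.const_mul _).add_const _).pow 2).continuousAt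
    exact ((c1.mul hc.continuousWithinAt).mul hη1.continuousWithinAt).div hη2.continuousWithinAt
      (pow_ne_zero 3 (eta_ne_zero (moebius_im_pos h' (hwim τ hτ))))
  refine ⟨p', κ I, A, B, D, hA, hD, fun τ => ?_⟩
  have hκτ : κ I = κ τ := eq_of_pow_eq_const hκcont (by norm_num) hκpow (by simp) τ.im_pos
  have hη := eta_ne_zero (hwim τ τ.im_pos)
  rw [hκτ, slashHalf, coe_SL_smul, quotForm, hmob τ τ.im_pos]
  have e5 : mixedForm p k ((a' * w τ + b') / (c' * w τ + d')) =
      (c' * w τ + d') ^ 2 * mixedForm p' k (w τ) := by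
    have := apply_moebius_of_ST compSum_S compSum_add_one h' (hwim τ τ.im_pos)
    rw [mixedForm, mixedForm, hp' _ (hwim τ τ.im_pos), this]
    norm_cast
    ring
  rw [e5, hκ]
  change _ = _ * (mixedForm p' k (w τ) / η (w τ) ^ 3)
  field_simp

/-- The holomorphic part of `M̂₂ + M̂₃ + M̂₄`. -/
noncomputable def holSum (τ : ℂ) : ℂ := holTwo τ + holFour τ + holFour (τ + 1)

theorem compSum_eq (τ : ℂ) : compSum τ = holSum τ - 3 / 2 * (η τ ^ 3 * etaPeriod τ) := by
  have := eta_mul_period_add_one τ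
  rw [compSum, holSum, compTwo, compFour, compFour, holTwo, holFour, holFour, this]
  ring

theorem holSum_add_one {τ : ℂ} (hτ : 0 < τ.im) : holSum (τ + 1) = holSum τ := by
  have h1 := compSum_eq τ
  have h2 := compSum_eq (τ + 1)
  rw [compSum_add_one τ hτ, eta_mul_period_add_one τ] at h2
  linear_combination h1 - h2

theorem differentiableAt_holSum {τ : ℂ} (hτ : 0 < τ.im) : DifferentiableAt ℂ holSum τ :=
  ((differentiableAt_holTwo hτ).add (differentiableAt_holFour hτ)).add
    ((differentiableAt_holFour (τ := τ + 1) (by simpa using hτ)).comp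
      (f := fun τ : ℂ => τ + 1) τ (by fun_prop))

theorem tendsto_holSum : Tendsto (fun τ : ℍ => holSum τ) atImInfty (𝓝 (1 / 4)) := by
  have := (tendsto_holTwo.add tendsto_holFour).add (tendsto_add_one_atImInfty tendsto_holFour)
  simp only [add_zero] at this
  exact this

/-- The holomorphic part of a quotient of a weight two form by `η³`. -/
noncomputable def polarForm (p : Fin 6 → ℂ) (k : ℂ) (τ : ℂ) : ℂ :=
  (thetaQuartic p τ + k * holSum τ) / η τ ^ 3

/-- Each of the three completions contributes −η³·`etaPeriod`/2, whence the factor 3/2. -/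
theorem mixedForm_div_eq (p : Fin 6 → ℂ) (k : ℂ) {τ : ℂ} (hτ : 0 < τ.im) :
    mixedForm p k τ / η τ ^ 3 = polarForm p k τ - 3 / 2 * k * etaPeriod τ := by
  have := eta_ne_zero hτ
  rw [mixedForm, polarForm, compSum_eq]
  field_simp
  ring

theorem differentiableAt_thetaQuartic (p : Fin 6 → ℂ) {τ : ℂ} (hτ : 0 < τ.im) :
    DifferentiableAt ℂ (thetaQuartic p) τ := by
  have h2 := differentiableAt_th2 hτ
  have h3 := differentiableAt_th3 hτ
  have h4 := differentiableAt_th4 hτ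
  unfold thetaQuartic
  fun_prop

theorem differentiableAt_polarForm (p : Fin 6 → ℂ) (k : ℂ) {τ : ℂ} (hτ : 0 < τ.im) :
    DifferentiableAt ℂ (polarForm p k) τ :=
  ((differentiableAt_thetaQuartic p hτ).add ((differentiableAt_holSum hτ).const_mul k)).div
    ((differentiableAt_eta hτ).pow 3) (pow_ne_zero 3 (eta_ne_zero hτ))

theorem tendsto_thetaQuartic (p : Fin 6 → ℂ) :
    Tendsto (fun τ : ℍ => thetaQuartic p τ) atImInfty (𝓝 (p 1 + p 2 + p 5)) := by
  have h2 := tendsto_th2_atImInfty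
  have h3 := tendsto_th3_atImInfty
  have h4 := tendsto_th4_atImInfty
  have := ((((((h2.pow 4).const_mul (p 0)).add ((h3.pow 4).const_mul (p 1))).add
    ((h4.pow 4).const_mul (p 2))).add (((h2.pow 2).mul (h3.pow 2)).const_mul (p 3))).add
    (((h2.pow 2).mul (h4.pow 2)).const_mul (p 4))).add (((h3.pow 2).mul (h4.pow 2)).const_mul (p 5))
  convert! this using 2
  ring

theorem tendsto_polarForm_mul (p : Fin 6 → ℂ) (k : ℂ) : ∃ l : ℂ,
    Tendsto (fun τ : ℍ => polarForm p k τ * qpow (τ / 8) 1) atImInfty (𝓝 l) := by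
  have h := ((tendsto_thetaQuartic p).add (tendsto_holSum.const_mul k)).mul
    (tendsto_thEta_mul_atImInfty.inv₀ one_ne_zero)
  refine ⟨_, h.congr fun τ => ?_⟩
  have e : qpow (τ / 8) 1 = cexp (π / 4 * I * τ) := by
    rw [qpow]; congr 1; push_cast; ring
  rw [← eta_pow_three_eq τ.im_pos, polarForm, e, Complex.exp_neg, mul_inv, inv_inv]
  ring

theorem eta_pow_three_add_eight (τ : ℂ) : η (τ + 8) ^ 3 = η τ ^ 3 := by
  have e : τ + 8 = τ + 1 + 1 + 1 + 1 + 1 + 1 + 1 + 1 := by ring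
  have h : cexp (π * I / 12) ^ 24 = 1 := cexp_pow_eq_one 1 (by push_cast; ring)
  rw [e]
  simp only [eta_add_one]
  linear_combination η τ ^ 3 * h

theorem polarForm_add_eight (p : Fin 6 → ℂ) (k : ℂ) {τ : ℂ} (hτ : 0 < τ.im) :
    polarForm p k (τ + 8) = polarForm p k τ := by
  have e : τ + 8 = τ + 1 + 1 + 1 + 1 + 1 + 1 + 1 + 1 := by ring
  have h : ∀ n : ℕ, holSum (τ + n) = holSum τ := fun n => by
    induction n with
    | zero => simp
    | succ n ih =>
      rw [Nat.cast_succ, ← add_assoc, holSum_add_one (by simpa using hτ), ih]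
  have h8 := h 8
  have hI : cexp (π * I / 4) ^ 8 = 1 := by linear_combination (cexp (π * I / 4) ^ 4 - 1) *
    cexp_pi_I_div_four_pow_four
  have h3 : th3 (τ + 8) = th3 τ := by rw [e]; simp only [th3_add_one, th4_add_one]
  have h4 : th4 (τ + 8) = th4 τ := by rw [e]; simp only [th3_add_one, th4_add_one]
  have h2 : th2 (τ + 8) = th2 τ := by
    rw [e]
    simp only [th2_add_one]
    linear_combination th2 τ * hI
  rw [polarForm, polarForm, thetaQuartic, thetaQuartic, eta_pow_three_add_eight, h3, h4, h2]
  push_cast at h8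
  rw [h8]

theorem exists_polynomial_polarForm (p : Fin 6 → ℂ) (k : ℂ) :
    ∃ P : Polynomial ℂ, ∃ ε : ℝ, 0 < ε ∧
      (fun τ : ℍ => polarForm p k τ - P.eval (qpow (τ / 8) (-1))) =O[atImInfty]
        fun τ => Real.exp (-ε * τ.im) := by
  obtain ⟨l, hl⟩ := tendsto_polarForm_mul p k
  obtain ⟨P, hP⟩ := exists_polynomial_isBigO (N := 8) (by norm_num)
    (fun τ hτ => differentiableAt_polarForm p k hτ)
    (fun τ hτ => by push_cast; exact polarForm_add_eight p k hτ)
    (by push_cast; exact hl.isBigO_one ℝ)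
  push_cast at hP
  exact ⟨P, 2 * π / 8, by positivity, hP⟩

theorem exists_polynomial_polarForm_eight (p : Fin 6 → ℂ) (k : ℂ) :
    ∃ P : Polynomial ℂ, ∃ ε : ℝ, 0 < ε ∧
      (fun τ : ℍ => polarForm p k (8 * τ) - P.eval (qpow τ (-1))) =O[atImInfty]
        fun τ => Real.exp (-ε * τ.im) := by
  obtain ⟨l, hl⟩ := tendsto_polarForm_mul p k
  have hl' := tendsto_mul_atImInfty (c := 8) (by norm_num)
    (F := fun τ => polarForm p k τ * qpow (τ / 8) 1) hl
  obtain ⟨P, hP⟩ := exists_polynomial_isBigO (N := 1) one_pos (F := fun τ => polarForm p k (8 * τ))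
    (fun τ hτ => (differentiableAt_polarForm p k (by simpa using hτ)).comp
      (f := fun τ : ℂ => 8 * τ) τ (by fun_prop))
    (fun τ hτ => by
      rw [Nat.cast_one, mul_add, mul_one]
      exact polarForm_add_eight p k (by simpa using hτ))
    ((hl'.isBigO_one ℝ).congr_left fun τ => by
      push_cast
      rw [mul_div_cancel_left₀ _ (by norm_num : (8 : ℂ) ≠ 0), div_one])
  simp only [Nat.cast_one, div_one] at hP
  exact ⟨P, 2 * π, by positivity, hP⟩

/-- The map `τ ↦ (Aτ + B)/D`. -/
noncomputable def affineMap {A D : ℤ} (hA : 0 < A) (hD : 0 < D) (B : ℤ) (τ : ℍ) : ℍ :=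
  ⟨(A * τ + B) / D, by
    have h1 : (0 : ℝ) < A := by exact_mod_cast hA
    have h2 : (0 : ℝ) < D := by exact_mod_cast hD
    have h3 := τ.im_pos
    simp only [div_intCast_im]
    simp
    positivity⟩

theorem affineMap_im {A D : ℤ} (hA : 0 < A) (hD : 0 < D) (B : ℤ) (τ : ℍ) :
    (affineMap hA hD B τ).im = A / D * τ.im := by
  change ((A * (τ : ℂ) + B) / D : ℂ).im = _
  simp only [div_intCast_im]
  simp
  ring

theorem tendsto_affineMap {A D : ℤ} (hA : 0 < A) (hD : 0 < D) (B : ℤ) :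
    Tendsto (affineMap hA hD B) atImInfty atImInfty := by
  have h1 : (0 : ℝ) < A := by exact_mod_cast hA
  have h2 : (0 : ℝ) < D := by exact_mod_cast hD
  simp only [atImInfty, tendsto_comap_iff]
  have h : Tendsto (fun τ : ℍ => τ.im) atImInfty atTop := tendsto_comap
  exact (h.const_mul_atTop (div_pos h1 h2)).congr fun τ => (affineMap_im hA hD B τ).symm

theorem isBigO_exp_of_le {a b : ℝ} (h : a ≤ b) :
    (fun τ : ℍ => Real.exp (-b * τ.im)) =O[atImInfty] fun τ => Real.exp (-a * τ.im) := by
  refine Asymptotics.isBigO_of_le _ fun τ => ?_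
  rw [Real.norm_of_nonneg (Real.exp_pos _).le, Real.norm_of_nonneg (Real.exp_pos _).le]
  exact Real.exp_le_exp.mpr (by nlinarith [τ.im_pos])

theorem IsBigO_exp_sub {f g : ℍ → ℂ} {a b : ℝ} (hf : f =O[atImInfty] fun τ => Real.exp (-a * τ.im))
    (hg : g =O[atImInfty] fun τ => Real.exp (-b * τ.im)) :
    (fun τ => f τ - g τ) =O[atImInfty] fun τ => Real.exp (-(min a b) * τ.im) :=
  (hf.trans (isBigO_exp_of_le (min_le_left a b))).sub (hg.trans (isBigO_exp_of_le (min_le_right a b)))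

theorem cusp_expansion_quotForm (p : Fin 6 → ℂ) (k : ℂ) (γ : SL(2, ℤ)) :
    ∃ w : ℕ, 0 < w ∧ ∃ P : Polynomial ℂ, ∃ ε : ℝ, 0 < ε ∧
      (fun τ : ℍ => slashHalf (fun τ : ℍ => quotForm p k τ) γ τ - P.eval (qpow ((τ : ℂ) / w) (-1)))
        =O[atImInfty] fun τ => Real.exp (-ε * τ.im) := by
  obtain ⟨p', K, A, B, D, hA, hD, h⟩ := exists_slashHalf_quotForm p k γ
  obtain ⟨P, ε, hε, hP⟩ := exists_polynomial_polarForm p' k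
  obtain ⟨c, hc, hE⟩ := etaPeriod_isBigO
  have h1 : (0 : ℝ) < A := by exact_mod_cast hA
  have h2 : (0 : ℝ) < D := by exact_mod_cast hD
  have key := IsBigO_exp_sub hP (hE.const_mul_left (3 / 2 * k))
  have key' := (key.comp_tendsto (tendsto_affineMap hA hD B)).const_mul_left K
  lift A to ℕ using hA.le
  lift D to ℕ using hD.le
  have hD0 : (D : ℂ) ≠ 0 := by exact_mod_cast hD.ne'
  -- At (Aτ + B)/D the variable q^{−1/8} is a constant times the A-th power of q^{−1/(8D)}, so width
  -- 8D works and P is composed with that monomial.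
  refine ⟨8 * D, by omega, Polynomial.C K * P.comp (Polynomial.C (qpow (B / (8 * D)) (-1)) *
    Polynomial.X ^ A), min ε c * (A / D), mul_pos (lt_min hε hc) (div_pos h1 h2),
    key'.congr (fun τ => ?_) fun τ => ?_⟩
  · have he := mixedForm_div_eq p' k (affineMap hA hD B τ).im_pos
    have hs : slashHalf (fun τ : ℍ => quotForm p k τ) γ τ = K * (mixedForm p' k
        (affineMap hA hD B τ) / η (affineMap hA hD B τ) ^ 3) := h τ
    have hq : qpow (B / (8 * D)) (-1) * qpow ((τ : ℂ) / (8 * D : ℕ)) (-1) ^ A =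
        qpow ((affineMap hA hD B τ : ℂ) / 8) (-1) := by
      have hw : (affineMap hA hD B τ : ℂ) = (A * τ + B) / D := by
        change ((((A : ℤ) : ℂ) * τ + B) / ((D : ℤ) : ℂ)) = _
        push_cast
        rfl
      rw [hw, qpow, qpow, qpow, ← Complex.exp_nat_mul, ← Complex.exp_add]
      congr 1
      push_cast
      field_simp
      ring
    rw [hs, he]
    simp only [Function.comp, Polynomial.eval_mul, Polynomial.eval_C, Polynomial.eval_comp,
      Polynomial.eval_pow, Polynomial.eval_X, hq]
    ring
  · simp only [Function.comp, affineMap_im]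
    congr 1
    push_cast
    ring

theorem quotForm_eq (p : Fin 6 → ℂ) (k : ℂ) {τ : ℂ} (hτ : 0 < τ.im) :
    quotForm p k τ = polarForm p k (8 * τ) - 3 / 2 * k * etaPeriod (8 * τ) :=
  mixedForm_div_eq p k (by simpa using hτ)

theorem differentiableOn_polarForm_eight (p : Fin 6 → ℂ) (k : ℂ) :
    DifferentiableOn ℂ (fun τ => polarForm p k (8 * τ)) ℍₒ := fun τ hτ => by
  have hτ' : 0 < τ.im := hτ
  exact ((differentiableAt_polarForm p k (by simpa using hτ')).comp (f := fun τ : ℂ => 8 * τ) τ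
    (by fun_prop)).differentiableWithinAt

theorem isRapid_eta_eight : IsRapid fun z => η (8 * z) ^ 3 :=
  isRapid_eta_pow_three.comp_mul (a := 8) (by norm_num)

theorem isHarmonicWeakMaassFormHalf_quotForm (p : Fin 6 → ℂ) (k : ℂ) :
    IsHarmonicWeakMaassFormHalf 64 fun τ : ℍ => quotForm p k τ := by
  have hf : ∀ τ : ℍ, quotForm p k τ = polarForm p k (8 * τ) +
      (-(3 * √2 * k)) * period (1 / 2) (fun z => η (8 * z) ^ 3) τ := fun τ => by
    rw [quotForm_eq p k τ.im_pos, etaPeriod_eight τ.im_pos]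
    ring
  refine ⟨by norm_num, by norm_num, contDiffOn_add_period (differentiableOn_polarForm_eight p k)
    isRapid_eta_eight hf, transformsHalf_quotForm p k, fun τ => hypLaplacian_eq_zero
    (differentiableOn_polarForm_eight p k) isRapid_eta_eight hf τ, ?_, fun γ => ?_⟩
  · obtain ⟨P, ε, hε, hP⟩ := exists_polynomial_polarForm_eight p k
    obtain ⟨c, hc, hE⟩ := etaPeriod_isBigO
    have hE' := hE.comp_tendsto (tendsto_affineMap (A := 8) (D := 1) (by norm_num) (by norm_num) 0)
    have hE2 : (fun τ : ℍ => 3 / 2 * k * etaPeriod (8 * τ)) =O[atImInfty]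
        fun τ => Real.exp (-(8 * c) * τ.im) := by
      refine (hE'.congr (fun τ => ?_) fun τ => ?_).const_mul_left _
      · change etaPeriod ((((8 : ℤ) : ℂ) * τ + ((0 : ℤ) : ℂ)) / ((1 : ℤ) : ℂ)) = _
        push_cast
        rw [add_zero, div_one]
      · simp only [Function.comp, affineMap_im]
        push_cast
        ring_nf
    refine ⟨P, _, lt_min hε (by positivity : 0 < 8 * c), (IsBigO_exp_sub hP hE2).congr_left
      fun τ => ?_⟩
    rw [quotForm_eq p k τ.im_pos]
    ring
  · exact cusp_expansion_quotForm p k γ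

theorem eval_isBigO_exp (P : Polynomial ℂ) (w : ℕ) : ∃ C : ℝ, 0 ≤ C ∧
    (fun τ : ℍ => P.eval (qpow ((τ : ℂ) / w) (-1))) =O[atImInfty]
      fun τ => Real.exp (C * τ.im) := by
  have hn : ∀ τ : ℍ, ‖qpow ((τ : ℂ) / w) (-1)‖ = Real.exp (2 * π / w * τ.im) := fun τ => by
    rw [norm_qpow, div_natCast_im, UpperHalfPlane.coe_im]
    congr 1
    push_cast
    ring
  refine ⟨P.natDegree * (2 * π / w), by positivity,
    Asymptotics.IsBigO.of_bound (∑ i ∈ Finset.range (P.natDegree + 1), ‖P.coeff i‖) ?_⟩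
  refine Eventually.of_forall fun τ => ?_
  rw [Polynomial.eval_eq_sum_range, Finset.sum_mul, Real.norm_of_nonneg (Real.exp_pos _).le]
  refine norm_sum_le_of_le _ fun i hi => ?_
  rw [norm_mul, norm_pow, hn, ← Real.exp_nat_mul]
  refine mul_le_mul_of_nonneg_left (Real.exp_le_exp.mpr ?_) (norm_nonneg _)
  have h1 : (i : ℝ) ≤ P.natDegree := by exact_mod_cast Finset.mem_range_succ_iff.mp hi
  have h2 : 0 ≤ 2 * π / w * τ.im := mul_nonneg (by positivity) τ.im_pos.le
  rw [mul_assoc]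
  exact mul_le_mul_of_nonneg_right h1 h2

/-- With k = 0 the period integral disappears, so the form is holomorphic, and the cusp expansions
already bound its growth. -/
theorem isWeaklyHolomorphicHalf_quotForm (p : Fin 6 → ℂ) :
    IsWeaklyHolomorphicHalf 64 fun τ : ℍ => quotForm p 0 τ := by
  refine ⟨by norm_num, by norm_num, ?_, transformsHalf_quotForm p 0, fun γ => ?_⟩
  · refine (differentiableOn_polarForm_eight p 0).congr (eqOn_comp_ofComplex
      (F := fun z => polarForm p 0 (8 * z)) fun τ => ?_)
    rw [quotForm_eq p 0 τ.im_pos]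
    ring
  · obtain ⟨w, hw, P, ε, hε, h⟩ := cusp_expansion_quotForm p 0 γ
    obtain ⟨C, hC, hP⟩ := eval_isBigO_exp P w
    have h' : (fun τ : ℍ => slashHalf (fun τ : ℍ => quotForm p 0 τ) γ τ -
        P.eval (qpow ((τ : ℂ) / w) (-1))) =O[atImInfty] fun τ => Real.exp (C * τ.im) := by
      refine (h.trans (isBigO_exp_of_le (a := -C) (by linarith))).congr_right fun τ => ?_
      rw [neg_neg]
    refine ⟨C, (h'.add hP).congr_left fun τ => ?_⟩
    ring

/-! ### Closed forms -/

theorem eight_mul_im_pos {τ : ℂ} (hτ : 0 < τ.im) : 0 < (8 * τ).im := by simpa using hτ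

theorem theta4_eq {τ : ℂ} (hτ : 0 < τ.im) : theta4 τ = th4 (8 * τ) := by
  have h := th4_mul_eta (eight_mul_im_pos hτ)
  rw [show 8 * τ / 2 = 4 * τ by ring] at h
  rw [theta4, ← h, mul_div_cancel_right₀ _ (eta_ne_zero (eight_mul_im_pos hτ))]

theorem eisenStar_four {τ : ℂ} (hτ : 0 < τ.im) :
    eisenStar (4 * τ) = 2 * th3 (8 * τ) ^ 4 - th4 (8 * τ) ^ 4 := by
  rw [← eisenStar_half (eight_mul_im_pos hτ), show 8 * τ / 2 = 4 * τ by ring]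

theorem seriesF0_eq {τ : ℂ} (hτ : 0 < τ.im) : seriesF0 τ = appellFour (8 * τ) / 2 := by
  have h := hasSum_indefinite (eight_mul_im_pos hτ)
  rw [← h.tsum_eq, h.summable.tsum_prod, seriesF0]
  refine tsum_congr fun β => tsum_congr fun k => ?_
  congr 1
  · rw [show β + 1 + k + β = 2 * β + (k + 1) by ring, pow_add, pow_mul]
    norm_num
  · rw [qpow]
    congr 1
    push_cast
    ring

/-- By the theta product for η³, 4ℱ₀/Θ₄ = 2·appellFour/θ₄ equals 2·`holFour`/η³ at 8τ. -/
theorem calQ_eq {τ : ℂ} (hτ : 0 < τ.im) :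
    calQ τ = (2 * th3 (8 * τ) ^ 4 - th4 (8 * τ) ^ 4 - 2 * holFour (8 * τ)) / η (8 * τ) ^ 3 := by
  have h8 := eight_mul_im_pos hτ
  have h := two_mul_eta_pow_three h8
  have n4 := th4_ne_zero h8
  have n3 := pow_ne_zero 3 (eta_ne_zero h8)
  rw [calQ, eisenStar_four hτ, seriesF0_eq hτ, theta4_eq hτ, holFour, sub_div _ (2 * _)]
  congr 1
  rw [div_eq_div_iff n4 n3]
  linear_combination appellFour (8 * τ) * h

theorem formA_eq {τ : ℂ} (hτ : 0 < τ.im) : formA τ = th4 (8 * τ) ^ 4 / η (8 * τ) ^ 3 := by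
  have h8 := eight_mul_im_pos hτ
  have h := th4_mul_eta h8
  have n := eta_ne_zero h8
  rw [show 8 * τ / 2 = 4 * τ by ring] at h
  rw [formA, show η (4 * τ) ^ 8 = (η (4 * τ) ^ 2) ^ 4 by ring, ← h]
  field_simp

theorem formB_eq {τ : ℂ} (hτ : 0 < τ.im) :
    formB τ = th3 (8 * τ) ^ 2 * th4 (8 * τ) ^ 2 / η (8 * τ) ^ 3 := by
  have h8 := eight_mul_im_pos hτ
  have h := th2_mul_eta h8
  have h3 := two_mul_eta_pow_three h8
  have n := eta_ne_zero h8
  have n2 := eta_ne_zero (τ := 16 * τ) (by simpa using hτ)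
  rw [show 2 * (8 * τ) = 16 * τ by ring] at h
  rw [formB, div_eq_div_iff (pow_ne_zero _ n2) (pow_ne_zero _ n)]
  have n' := th2_ne_zero h8
  have h4 : η (16 * τ) ^ 4 = (th2 (8 * τ) * η (8 * τ)) ^ 2 / 4 := by rw [h]; ring
  have h5 : (2 * η (8 * τ) ^ 3) ^ 2 = (th2 (8 * τ) * th3 (8 * τ) * th4 (8 * τ)) ^ 2 := by rw [h3]
  rw [h4]
  linear_combination η (8 * τ) ^ 2 / 4 * h5

/-- The coefficients of the completion of `calQ` as a quotient form. -/
noncomputable def completionCoeff : Fin 6 → ℂ := ![0, 7 / 3, -7 / 6, 0, 0, 0]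

/-- Adding the period to 𝒬 replaces `holFour` by `compFour`, and the latter is `compSum`/3 − (2θ₃⁴ −
θ₄⁴)/12. The numerator becomes (7/6)(2θ₃⁴ − θ₄⁴) − (2/3)`compSum`, which explains the coefficients.
-/
theorem quotForm_completion {τ : ℂ} (hτ : 0 < τ.im) :
    quotForm completionCoeff (-2 / 3) τ = calQ τ + etaPeriod (8 * τ) := by
  have h8 := eight_mul_im_pos hτ
  have n3 := pow_ne_zero 3 (eta_ne_zero h8)
  have h := (comp_pair h8).2
  rw [compFour] at h
  rw [calQ_eq hτ, div_add' _ _ _ n3, quotForm, mixedForm, thetaQuartic, holFour]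
  congr 1
  simp only [completionCoeff, Matrix.cons_val]
  linear_combination 2 * h

theorem polarForm_completion {τ : ℂ} (hτ : 0 < τ.im) :
    polarForm completionCoeff (-2 / 3) (8 * τ) = calQ τ := by
  linear_combination quotForm_completion hτ - quotForm_eq completionCoeff (-2 / 3) hτ

theorem xiOp_completion (τ : ℍ) :
    xiOp (1 / 2) (fun τ : ℍ => quotForm completionCoeff (-2 / 3) τ) τ = -4 * η (8 * τ) ^ 3 := by
  have h2 : (√2 : ℂ) * √2 = 2 := by rw [← ofReal_mul, Real.mul_self_sqrt (by norm_num)]; norm_num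
  -- The coefficient 2√2 comes from rescaling the period; the factor −√2 of the ξ-operator then
  -- produces −4.
  rw [xiOp_eq (H := fun z => polarForm completionCoeff (-2 / 3) (8 * z)) (c := 2 * √2)
    (differentiableOn_polarForm_eight _ _) isRapid_eta_eight fun τ => ?_, map_mul,
    eta_eight_neg_conj τ.im_pos, map_mul, conj_ofReal, map_ofNat]
  · linear_combination -2 * η (8 * τ) ^ 3 * h2
  · rw [quotForm_eq _ _ τ.im_pos, etaPeriod_eight τ.im_pos]
    ring

theorem hasParts_completion {H : ℕ → ℤ} (hH : ∀ τ : ℍ,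
    HasSum (fun α : ℕ => (H α : ℂ) * qpow τ (4 * (α : ℤ) - 1)) (calQ τ)) :
    HasParts (fun τ : ℍ => quotForm completionCoeff (-2 / 3) τ) (fun τ => calQ τ)
      fun τ => etaPeriod (8 * τ) := by
  have hinj : Function.Injective fun α : ℕ => 4 * (α : ℤ) - 1 := fun a b h => by
    have : 4 * (a : ℤ) - 1 = 4 * b - 1 := h
    omega
  refine ⟨fun τ => quotForm_completion τ.im_pos,
    ⟨Function.extend (fun α : ℕ => 4 * (α : ℤ) - 1) (fun α => (H α : ℂ)) 0, ⟨-1, fun n hn => ?_⟩,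
      fun τ => hasSum_int_of_nat hinj _ (hH τ)⟩,
    ⟨Function.extend (fun n : ℕ => -(2 * (n : ℤ) + 1) ^ 2)
      (fun n => 2 * √2 * ((-1) ^ n * (√(2 * π) : ℂ)⁻¹)) 0, fun n hn => ?_, fun τ => ?_⟩⟩
  · refine Function.extend_apply' _ _ _ ?_
    rintro ⟨a, rfl⟩
    omega
  · refine Function.extend_apply' _ _ _ ?_
    rintro ⟨a, rfl⟩
    have : (0 : ℤ) < (2 * a + 1) ^ 2 := by positivity
    omega
  · beta_reduce
    rw [etaPeriod_eight τ.im_pos]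
    have h := hasSum_int_of_nat neg_odd_sq_injective (fun n => 2 * √2 * ((-1) ^ n * (√(2 * π) : ℂ)⁻¹))
      (F := fun n : ℤ => (incGamma (1 / 2) (4 * π * |(n : ℝ)| * τ.im) : ℂ) * qpow τ n)
      (((hasSum_period_eta_eight τ.im_pos).mul_left (2 * √2 : ℂ)).congr_fun fun n => by
        rw [UpperHalfPlane.coe_im]; ring)
    exact h.congr_fun fun n => by rw [mul_assoc]

theorem etaPeriod_eight_eq (τ : ℍ) : etaPeriod (8 * τ) =
    -(2 * (√2 : ℂ) * I) * periodIntegral (fun z => η (8 * z) ^ 3) τ := by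
  rw [periodIntegral_eq, etaPeriod_eight τ.im_pos]
  linear_combination (2 * √2 * period (1 / 2) (fun z => η (8 * z) ^ 3) τ : ℂ) * I_mul_I

/-! ### Finite partial fractions -/

/-- The finite product `(q; q)_n`. -/
noncomputable def qFac (q : ℂ) (n : ℕ) : ℂ := ∏ k ∈ Finset.range n, (1 - q ^ (k + 1))

/-- The reciprocal of `(q; q)_m`, zero for negative `m`. -/
noncomputable def rFac (q : ℂ) (m : ℤ) : ℂ := if m < 0 then 0 else (qFac q m.toNat)⁻¹

theorem rFac_natCast (q : ℂ) (n : ℕ) : rFac q n = (qFac q n)⁻¹ := by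
  simp [rFac]

theorem rFac_of_neg (q : ℂ) {m : ℤ} (h : m < 0) : rFac q m = 0 := if_pos h

theorem one_sub_pow_ne_zero {q : ℂ} (hq : ‖q‖ < 1) {n : ℕ} (hn : n ≠ 0) : 1 - q ^ n ≠ 0 := fun h => by
  have h1 := congrArg norm (sub_eq_zero.mp h)
  rw [norm_one, norm_pow] at h1
  exact absurd h1 (pow_lt_one₀ (norm_nonneg _) hq hn).ne'

theorem one_add_pow_ne_zero {q : ℂ} (hq : ‖q‖ < 1) {n : ℕ} (hn : n ≠ 0) : 1 + q ^ n ≠ 0 := fun h => by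
  have h1 := congrArg norm (eq_neg_of_add_eq_zero_left h)
  rw [norm_one, norm_neg, norm_pow] at h1
  exact absurd h1 (pow_lt_one₀ (norm_nonneg _) hq hn).ne'

theorem qFac_ne_zero {q : ℂ} (hq : ‖q‖ < 1) (n : ℕ) : qFac q n ≠ 0 :=
  Finset.prod_ne_zero_iff.mpr fun _ _ => one_sub_pow_ne_zero hq (Nat.succ_ne_zero _)

/-- The recurrence holds through m = 0, where both sides vanish, thanks to the value 0 for negative
indices. Finite sums may thus be extended beyond their support. -/
theorem rFac_sub_one {q : ℂ} (hq : ‖q‖ < 1) (m : ℤ) : rFac q (m - 1) = (1 - q ^ m) * rFac q m := by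
  rcases lt_trichotomy m 0 with h | rfl | h
  · rw [rFac_of_neg q h, rFac_of_neg q (by omega), mul_zero]
  · simp [rFac]
  · obtain ⟨n, rfl⟩ : ∃ n : ℕ, m = n + 1 := ⟨(m - 1).toNat, by omega⟩
    rw [add_sub_cancel_right, show (n : ℤ) + 1 = ((n + 1 : ℕ) : ℤ) by push_cast; ring, rFac_natCast,
      rFac_natCast, zpow_natCast, qFac, qFac, Finset.prod_range_succ, mul_inv]
    rw [mul_comm _⁻¹ (_⁻¹ : ℂ), mul_inv_cancel_left₀ (one_sub_pow_ne_zero hq (Nat.succ_ne_zero _))]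

section Finite

variable {x : ℂ} (hx : ‖x‖ < 1) (hx0 : x ≠ 0)
include hx

theorem norm_sq_lt_one : ‖x ^ 2‖ < 1 := by
  rw [norm_pow]; exact pow_lt_one₀ (norm_nonneg _) hx two_ne_zero

include hx0

theorem sum_even_telescope {N : ℕ} (hN : N ≠ 0) {L : ℕ} (hL : N ≤ L) :
    ∑ j ∈ Finset.range L, (-1) ^ (j + 1) * x ^ ((j + 1) * j) * (1 + x ^ (2 * (j + 1))) *
      (rFac (x ^ 2) (N - (j + 1)) * rFac (x ^ 2) (N + (j + 1))) = -rFac (x ^ 2) N ^ 2 := by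
  have hq := norm_sq_lt_one hx
  have h1 : 1 - (x ^ 2) ^ N ≠ 0 := one_sub_pow_ne_zero hq hN
  set R := rFac (x ^ 2) with hR
  -- G is a telescoping certificate: 1 − x^{2N} times each summand is G(j) − G(j + 1), and G
  -- vanishes for j ≥ N.
  set G : ℕ → ℂ := fun j => (-1) ^ (j + 1) * x ^ ((j + 1) * j) * (R (N - (j + 1)) * R (N + j)) with hG
  have hstep : ∀ j : ℕ, (1 - (x ^ 2) ^ N) * ((-1) ^ (j + 1) * x ^ ((j + 1) * j) *
      (1 + x ^ (2 * (j + 1))) * (R (N - (j + 1)) * R (N + (j + 1)))) = G j - G (j + 1) := fun j => by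
    have e1 := rFac_sub_one hq ((N : ℤ) - (j + 1))
    have e2 := rFac_sub_one hq ((N : ℤ) + (j + 1))
    rw [show (N : ℤ) - (j + 1) - 1 = N - (j + 1 + 1) by ring] at e1
    rw [show (N : ℤ) + (j + 1) - 1 = N + j by ring] at e2
    simp only [hG]
    push_cast
    rw [← hR] at e1 e2
    rw [e1, e2, zpow_sub₀ (pow_ne_zero 2 hx0), zpow_add₀ (pow_ne_zero 2 hx0), zpow_natCast,
      show ((j : ℤ) + 1) = ((j + 1 : ℕ) : ℤ) by push_cast; ring, zpow_natCast, ← pow_mul x 2 (j + 1),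
      show (j + 1 + 1) * (j + 1) = (j + 1) * j + 2 * (j + 1) by ring, pow_add x]
    have hw : x ^ (2 * (j + 1)) ≠ 0 := pow_ne_zero _ hx0
    generalize x ^ (2 * (j + 1)) = w at *
    generalize (x ^ 2) ^ N = u at *
    generalize x ^ ((j + 1) * j) = v at *
    rw [pow_succ _ (j + 1)]
    field_simp
    ring
  have hsum := Finset.sum_range_sub' G L
  rw [← Finset.sum_congr rfl fun j _ => hstep j, ← Finset.mul_sum] at hsum
  refine mul_left_cancel₀ h1 (hsum.trans ?_)
  have e1 := rFac_sub_one hq (N : ℤ)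
  simp only [hG]
  rw [show R ((N : ℤ) - ((L : ℕ) + 1)) = 0 from rFac_of_neg _ (by omega)]
  simp only [Nat.cast_zero, zero_add, add_zero, ← hR] at e1 ⊢
  rw [e1, zpow_natCast]
  ring

/-- Induction on N. With u = x^{2(N+1)} and w = x^{2(j+1)}, (1 + u)² = (1 − u/w)(1 − uw) + u(1 +
w)²/w. The first part recovers the sum at N and the second is the telescoping sum. -/
theorem even_partial_fractions {L N : ℕ} (hN : N ≤ L) :
    rFac (x ^ 2) N ^ 2 / 2 + 2 * ∑ j ∈ Finset.range L, (-1) ^ (j + 1) * x ^ ((j + 1) * (j + 2)) /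
      (1 + x ^ (2 * (j + 1))) * (rFac (x ^ 2) (N - (j + 1)) * rFac (x ^ 2) (N + (j + 1))) =
    (∏ k ∈ Finset.range N, (1 + x ^ (2 * (k + 1))))⁻¹ ^ 2 / 2 := by
  have hq := norm_sq_lt_one hx
  induction N with
  | zero =>
    rw [Finset.sum_eq_zero fun j _ => by rw [rFac_of_neg _ (by push_cast; omega)]; ring]
    simp [rFac, qFac]
  | succ N ih =>
    specialize ih (by omega)
    have hT := sum_even_telescope hx hx0 (Nat.succ_ne_zero N) hN
    have h1 : (1 + x ^ (2 * (N + 1))) ≠ 0 := one_add_pow_ne_zero hx (by omega)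
    rw [Finset.prod_range_succ, mul_inv, mul_pow, mul_comm (_ ^ 2), mul_div_assoc, ← ih, inv_pow,
      eq_inv_mul_iff_mul_eq₀ (pow_ne_zero 2 h1)]
    set R := rFac (x ^ 2) with hR
    have hstep : ∀ j ∈ Finset.range L, (1 + x ^ (2 * (N + 1))) ^ 2 *
        ((-1) ^ (j + 1) * x ^ ((j + 1) * (j + 2)) /
          (1 + x ^ (2 * (j + 1))) * (R ((N + 1 : ℕ) - (j + 1)) * R ((N + 1 : ℕ) + (j + 1)))) =
        (-1) ^ (j + 1) * x ^ ((j + 1) * (j + 2)) / (1 + x ^ (2 * (j + 1))) *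
          (R (N - (j + 1)) * R (N + (j + 1))) + x ^ (2 * (N + 1)) *
        ((-1) ^ (j + 1) * x ^ ((j + 1) * j) * (1 + x ^ (2 * (j + 1))) *
          (R ((N + 1 : ℕ) - (j + 1)) * R ((N + 1 : ℕ) + (j + 1)))) := fun j _ => by
      have e1 := rFac_sub_one hq (((N + 1 : ℕ) : ℤ) - (j + 1))
      have e2 := rFac_sub_one hq (((N + 1 : ℕ) : ℤ) + (j + 1))
      rw [show ((N + 1 : ℕ) : ℤ) - (j + 1) - 1 = N - (j + 1) by push_cast; ring] at e1
      rw [show ((N + 1 : ℕ) : ℤ) + (j + 1) - 1 = N + (j + 1) by push_cast; ring] at e2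
      rw [← hR] at e1 e2
      have h2 : (1 + x ^ (2 * (j + 1))) ≠ 0 := one_add_pow_ne_zero hx (by omega)
      rw [e1, e2, show ((j : ℤ) + 1) = ((j + 1 : ℕ) : ℤ) by push_cast; ring,
        zpow_sub₀ (pow_ne_zero 2 hx0), zpow_add₀ (pow_ne_zero 2 hx0), zpow_natCast, zpow_natCast, ← pow_mul x 2,
        ← pow_mul x 2, show (j + 1) * (j + 2) = (j + 1) * j + 2 * (j + 1) by ring,
        pow_add x ((j + 1) * j)]
      have hw : x ^ (2 * (j + 1)) ≠ 0 := pow_ne_zero _ hx0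
      generalize x ^ (2 * (j + 1)) = w at *
      generalize x ^ (2 * (N + 1)) = u at *
      generalize x ^ ((j + 1) * j) = v at *
      field_simp
      ring
    have e1 := rFac_sub_one hq ((N + 1 : ℕ) : ℤ)
    rw [show ((N + 1 : ℕ) : ℤ) - 1 = N by push_cast; ring, zpow_natCast, ← pow_mul, ← hR] at e1
    have hS := Finset.sum_congr rfl hstep
    rw [Finset.sum_add_distrib, ← Finset.mul_sum, ← Finset.mul_sum, hT] at hS
    rw [e1]
    linear_combination 2 * hS

theorem sum_odd_telescope {N : ℕ} (hN : N ≠ 0) {L : ℕ} (hL : N < L) :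
    ∑ j ∈ Finset.range L, (-1) ^ j * x ^ (j * j) * (1 - x ^ (2 * (2 * j + 1))) / x ^ j *
      (rFac (x ^ 2) (N - j) * rFac (x ^ 2) (N + 1 + j)) = 0 := by
  have hq := norm_sq_lt_one hx
  have h1 : 1 - (x ^ 2) ^ N ≠ 0 := one_sub_pow_ne_zero hq hN
  set R := rFac (x ^ 2) with hR
  set G : ℕ → ℂ := fun j => (-1) ^ j * x ^ (j * j) * ((1 - x ^ (2 * j)) / x ^ j) *
    (R (N - j) * R (N + j)) with hG
  have hstep : ∀ j : ℕ, (1 - (x ^ 2) ^ N) * ((-1) ^ j * x ^ (j * j) * (1 - x ^ (2 * (2 * j + 1))) /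
      x ^ j * (R (N - j) * R (N + 1 + j))) = G j - G (j + 1) := fun j => by
    have e1 := rFac_sub_one hq ((N : ℤ) - j)
    have e2 := rFac_sub_one hq ((N : ℤ) + 1 + j)
    rw [show (N : ℤ) - j - 1 = N - (j + 1) by ring] at e1
    rw [show (N : ℤ) + 1 + j - 1 = N + j by ring] at e2
    simp only [hG]
    push_cast
    rw [← hR] at e1 e2
    rw [show (N : ℤ) + (j + 1) = N + 1 + j by ring, e1, e2, zpow_sub₀ (pow_ne_zero 2 hx0),
      zpow_add₀ (pow_ne_zero 2 hx0), zpow_add₀ (pow_ne_zero 2 hx0), zpow_natCast, zpow_one, zpow_natCast,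
      ← pow_mul x 2 j, show x ^ (2 * (2 * j + 1)) = x ^ j * x ^ j * (x ^ j * x ^ j) * x * x by ring,
      show x ^ (2 * j) = x ^ j * x ^ j by ring,
      show x ^ ((j + 1) * (j + 1)) = x ^ (j * j) * (x ^ j * x ^ j) * x by ring,
      show x ^ (2 * (j + 1)) = x ^ j * x ^ j * x * x by ring, pow_succ x j]
    have hw : x ^ j ≠ 0 := pow_ne_zero _ hx0
    generalize x ^ j = w at *
    generalize (x ^ 2) ^ N = u at *
    generalize x ^ (j * j) = v at *
    rw [pow_succ _ j]
    field_simp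
    ring
  have hsum := Finset.sum_range_sub' G L
  rw [← Finset.sum_congr rfl fun j _ => hstep j, ← Finset.mul_sum] at hsum
  refine mul_left_cancel₀ h1 (hsum.trans ?_)
  simp only [hG]
  rw [show R ((N : ℤ) - (L : ℕ)) = 0 from rFac_of_neg _ (by omega)]
  simp

/-- The same induction with ux in place of u and x^{2j+1} in place of w; here the correction sum
telescopes to zero. -/
theorem odd_partial_fractions {L N : ℕ} (hN : N < L) :
    ∑ j ∈ Finset.range L, (-1) ^ j * x ^ (j * j + j) * ((1 - x ^ (2 * j + 1)) / (1 + x ^ (2 * j + 1))) *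
      (rFac (x ^ 2) (N - j) * rFac (x ^ 2) (N + 1 + j)) =
    (∏ k ∈ Finset.range (N + 1), (1 + x ^ (2 * k + 1)))⁻¹ ^ 2 := by
  have hq := norm_sq_lt_one hx
  induction N with
  | zero =>
    obtain ⟨L, rfl⟩ : ∃ M, L = M + 1 := ⟨L - 1, by omega⟩
    rw [Finset.sum_range_succ', Finset.sum_eq_zero fun j _ => by
      rw [rFac_of_neg _ (by push_cast; omega)]; ring]
    have h1 := one_sub_pow_ne_zero hx (n := 1) (by norm_num)
    have h2 := one_add_pow_ne_zero hx (n := 1) (by norm_num)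
    have h3 : 1 - x ^ 2 = (1 - x) * (1 + x) := by ring
    simp only [pow_one] at h1 h2
    simp [rFac, qFac]
    rw [h3]
    field_simp
  | succ N ih =>
    specialize ih (by omega)
    have hT := sum_odd_telescope hx hx0 (Nat.succ_ne_zero N) hN
    have h1 : (1 + x ^ (2 * (N + 1) + 1)) ≠ 0 := one_add_pow_ne_zero hx (by omega)
    rw [Finset.prod_range_succ, mul_inv, mul_pow, mul_comm (_ ^ 2), ← ih, inv_pow,
      eq_inv_mul_iff_mul_eq₀ (pow_ne_zero 2 h1), Finset.mul_sum]
    set R := rFac (x ^ 2) with hR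
    rw [← sub_eq_zero, ← Finset.sum_sub_distrib, ← mul_zero (x ^ (2 * (N + 1))), ← hT, Finset.mul_sum]
    refine Finset.sum_congr rfl fun j _ => ?_
    have e1 := rFac_sub_one hq (((N + 1 : ℕ) : ℤ) - j)
    have e2 := rFac_sub_one hq (((N + 1 : ℕ) : ℤ) + 1 + j)
    rw [show ((N + 1 : ℕ) : ℤ) - j - 1 = N - j by push_cast; ring] at e1
    rw [show ((N + 1 : ℕ) : ℤ) + 1 + j - 1 = N + 1 + j by push_cast; ring] at e2
    rw [← hR] at e1 e2
    have h2 : (1 + x ^ (2 * j + 1)) ≠ 0 := one_add_pow_ne_zero hx (by omega)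
    rw [e1, e2, zpow_sub₀ (pow_ne_zero 2 hx0), zpow_add₀ (pow_ne_zero 2 hx0),
      zpow_add₀ (pow_ne_zero 2 hx0), zpow_natCast, zpow_one, zpow_natCast, ← pow_mul x 2,
      ← pow_mul x 2, show x ^ (2 * (2 * j + 1)) = x ^ (2 * j + 1) * x ^ (2 * j + 1) by ring,
      show x ^ (2 * (N + 1) + 1) = x ^ (2 * (N + 1)) * x by ring, pow_add x (j * j)]
    have hw : x ^ j ≠ 0 := pow_ne_zero _ hx0
    have h3 : x ^ (2 * j + 1) = x ^ (2 * j) * x := by ring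
    rw [h3] at h2 ⊢
    rw [show x ^ (2 * j) = x ^ j * x ^ j by ring] at h2 ⊢
    generalize x ^ j = w at *
    generalize x ^ (2 * (N + 1)) = u at *
    generalize x ^ (j * j) = v at *
    have h4 : 1 + x * w ^ 2 ≠ 0 := by rwa [sq, mul_comm]
    rw [mul_comm (w * w) x, ← sq]
    field_simp
    ring

end Finite

/-! ### Limits of partial fractions -/

/-- The infinite product `(q; q)_∞`. -/
noncomputable def eulerProd (q : ℂ) : ℂ := ∏' n : ℕ, (1 - q ^ (n + 1))

theorem tendsto_qFac {q : ℂ} (hq : ‖q‖ < 1) : Tendsto (qFac q) atTop (𝓝 (eulerProd q)) :=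
  (ModularForm.multipliable_one_sub_pow hq).hasProd.tendsto_prod_nat

theorem eulerProd_ne_zero {q : ℂ} (hq : ‖q‖ < 1) : eulerProd q ≠ 0 := by
  have := tprod_one_add_ne_zero_of_summable (f := fun n : ℕ => -q ^ (n + 1))
    (fun n => by simpa [← sub_eq_add_neg] using one_sub_pow_ne_zero hq (Nat.succ_ne_zero n))
    (by simpa [pow_succ] using (summable_geometric_of_lt_one (norm_nonneg _) hq).mul_right _)
  simpa [eulerProd, sub_eq_add_neg] using this

theorem eta_eq_eulerProd (τ : ℂ) : η τ = cexp (π / 12 * I * τ) * eulerProd (cexp (2 * π * I * τ)) :=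
  eta_eq τ

theorem exists_norm_le_of_tendsto {f : ℕ → ℂ} {l : ℂ} (h : Tendsto f atTop (𝓝 l)) :
    ∃ C : ℝ, 0 < C ∧ ∀ n, ‖f n‖ ≤ C := by
  obtain ⟨C, hC⟩ := h.norm.bddAbove_range
  exact ⟨max C 1, by positivity, fun n => (hC ⟨n, rfl⟩).trans (le_max_left _ _)⟩

theorem exists_norm_rFac_le {q : ℂ} (hq : ‖q‖ < 1) : ∃ C : ℝ, 0 < C ∧ ∀ m : ℤ, ‖rFac q m‖ ≤ C := by
  obtain ⟨C, hC, h⟩ := exists_norm_le_of_tendsto ((tendsto_qFac hq).inv₀ (eulerProd_ne_zero hq))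
  refine ⟨C, hC, fun m => ?_⟩
  rw [rFac]
  split_ifs
  · simpa using hC.le
  · exact h _

theorem tendsto_rFac {q : ℂ} (hq : ‖q‖ < 1) {e : ℕ → ℤ} (he : Tendsto e atTop atTop) :
    Tendsto (fun n => rFac q (e n)) atTop (𝓝 (eulerProd q)⁻¹) := by
  have h1 : Tendsto (fun n => (e n).toNat) atTop atTop :=
    tendsto_atTop.mpr fun b => (he.eventually_ge_atTop (b : ℤ)).mono fun n hn => by omega
  refine (((tendsto_qFac hq).comp h1).inv₀ (eulerProd_ne_zero hq)).congr' ?_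
  filter_upwards [he.eventually_ge_atTop 0] with n hn
  rw [rFac, if_neg (not_lt.mpr hn)]
  rfl

theorem tendsto_intCast_add (c : ℤ) : Tendsto (fun n : ℕ => (n : ℤ) + c) atTop atTop :=
  tendsto_atTop_add_const_right _ _ tendsto_natCast_atTop_atTop

/-- The finite product `(x; x²)_n`. -/
noncomputable def oddFac (x : ℂ) (n : ℕ) : ℂ := ∏ k ∈ Finset.range n, (1 - x ^ (2 * k + 1))

theorem oddFac_succ (x : ℂ) (n : ℕ) : oddFac x (n + 1) = oddFac x n * (1 - x ^ (2 * n + 1)) :=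
  Finset.prod_range_succ _ _

theorem qFac_succ (x : ℂ) (n : ℕ) : qFac x (n + 1) = qFac x n * (1 - x ^ (n + 1)) :=
  Finset.prod_range_succ _ _

theorem oddFac_mul (x : ℂ) (n : ℕ) : oddFac x n * qFac (x ^ 2) n = qFac x (2 * n) := by
  induction n with
  | zero => simp [oddFac, qFac]
  | succ n ih =>
    rw [show 2 * (n + 1) = 2 * n + 1 + 1 by ring, oddFac_succ, qFac_succ, qFac_succ, qFac_succ, ← ih,
      ← pow_mul]
    ring

section

variable {x : ℂ} (hx : ‖x‖ < 1)
include hx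

theorem tendsto_oddFac : Tendsto (oddFac x) atTop (𝓝 (eulerProd x / eulerProd (x ^ 2))) := by
  have hq := norm_sq_lt_one hx
  have h2 : Tendsto (fun n : ℕ => 2 * n) atTop atTop :=
    tendsto_atTop.mpr fun b => (eventually_ge_atTop b).mono fun n hn => by omega
  refine (((tendsto_qFac hx).comp h2).div (tendsto_qFac hq) (eulerProd_ne_zero hq)).congr fun n => ?_
  simp only [Function.comp, Pi.div_apply]
  rw [← oddFac_mul, mul_div_cancel_right₀ _ (qFac_ne_zero hq n)]

theorem tendsto_even_product : Tendsto (fun N => ∏ k ∈ Finset.range N, (1 + x ^ (2 * (k + 1)))) atTop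
    (𝓝 (eulerProd (x ^ 4) / eulerProd (x ^ 2))) := by
  have hq := norm_sq_lt_one hx
  have h4 : ‖x ^ 4‖ < 1 := by rw [show x ^ 4 = (x ^ 2) ^ 2 by ring]; exact norm_sq_lt_one hq
  refine ((tendsto_qFac h4).div (tendsto_qFac hq) (eulerProd_ne_zero hq)).congr fun n => ?_
  rw [Pi.div_apply, div_eq_iff (qFac_ne_zero hq n), qFac, qFac, ← Finset.prod_mul_distrib]
  refine Finset.prod_congr rfl fun k _ => ?_
  ring

theorem summable_norm_pow_mul {g : ℕ → ℂ} {C : ℝ} (hg : ∀ n, ‖g n‖ ≤ C) (e : ℕ → ℕ) (he : ∀ n, n ≤ e n) :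
    ∀ n, ‖x ^ e n * g n‖ ≤ C * ‖x‖ ^ n := fun n => by
  rw [norm_mul, norm_pow, mul_comm]
  exact mul_le_mul (hg n) (pow_le_pow_of_le_one (norm_nonneg _) hx.le (he n)) (by positivity)
    ((norm_nonneg _).trans (hg n))

theorem norm_inv_one_add_pow_le {n : ℕ} (hn : n ≠ 0) : ‖(1 + x ^ n)⁻¹‖ ≤ (1 - ‖x‖)⁻¹ := by
  rw [norm_inv]
  refine inv_anti₀ (by linarith) ?_
  have h1 : ‖x ^ n‖ ≤ ‖x‖ := by
    rw [norm_pow]; exact pow_le_of_le_one (norm_nonneg _) hx.le hn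
  have h2 := norm_sub_le (1 + x ^ n) (x ^ n)
  rw [add_sub_cancel_right, norm_one] at h2
  linarith

/-- The limit of `even_partial_fractions`. -/
theorem hasSum_even_limit (hx0 : x ≠ 0) :
    HasSum (fun j : ℕ => (-1) ^ (j + 1) * x ^ ((j + 1) * (j + 2)) / (1 + x ^ (2 * (j + 1))))
      (((eulerProd (x ^ 2) ^ 2 / eulerProd (x ^ 4)) ^ 2 - 1) / 4) := by
  have hq := norm_sq_lt_one hx
  have hE := eulerProd_ne_zero hq
  have h4 : eulerProd (x ^ 4) ≠ 0 := eulerProd_ne_zero (by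
    rw [show x ^ 4 = (x ^ 2) ^ 2 by ring]; exact norm_sq_lt_one hq)
  obtain ⟨C, hC, hR⟩ := exists_norm_rFac_le hq
  obtain ⟨D, hD, hF⟩ := exists_norm_le_of_tendsto (tendsto_qFac hq)
  have hb : ∀ j, ‖(-1) ^ (j + 1) * x ^ ((j + 1) * (j + 2)) / (1 + x ^ (2 * (j + 1)))‖ ≤
      (1 - ‖x‖)⁻¹ * ‖x‖ ^ j := fun j => by
    have := summable_norm_pow_mul hx (g := fun j => (-1) ^ (j + 1) * (1 + x ^ (2 * (j + 1)))⁻¹)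
      (fun j => by
        rw [norm_mul, norm_pow, norm_neg, norm_one, one_pow, one_mul]
        exact norm_inv_one_add_pow_le hx (by omega)) (fun j => (j + 1) * (j + 2)) (fun j => by nlinarith) j
    convert! this using 2
    ring
  have hs : Summable fun j : ℕ => (-1) ^ (j + 1) * x ^ ((j + 1) * (j + 2)) / (1 + x ^ (2 * (j + 1))) :=
    .of_norm_bounded ((summable_geometric_of_lt_one (norm_nonneg _) hx).mul_left _) hb
  convert! hs.hasSum using 1
  -- After multiplication by the square of (x²; x²)_N the weight of each term tends to 1 and is
  -- uniformly bounded, so dominated convergence applies to the finite identity.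
  have hlim : Tendsto (fun N : ℕ => ∑' j : ℕ, (-1) ^ (j + 1) * x ^ ((j + 1) * (j + 2)) /
      (1 + x ^ (2 * (j + 1))) * (qFac (x ^ 2) N ^ 2 *
        (rFac (x ^ 2) (N - (j + 1)) * rFac (x ^ 2) (N + (j + 1))))) atTop
      (𝓝 (∑' j : ℕ, (-1) ^ (j + 1) * x ^ ((j + 1) * (j + 2)) / (1 + x ^ (2 * (j + 1))))) := by
    refine tendsto_tsum_of_dominated_convergence (bound := fun j => (1 - ‖x‖)⁻¹ * ‖x‖ ^ j *
      (D ^ 2 * (C * C))) (((summable_geometric_of_lt_one (norm_nonneg _) hx).mul_left _).mul_right _)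
      (fun j => ?_) (Eventually.of_forall fun N j => ?_)
    · have h1 := tendsto_rFac hq (tendsto_intCast_add (-(j + 1)))
      have h2 := tendsto_rFac hq (tendsto_intCast_add (j + 1))
      have := (((tendsto_qFac hq).pow 2).mul (h1.mul h2)).const_mul
        ((-1) ^ (j + 1) * x ^ ((j + 1) * (j + 2)) / (1 + x ^ (2 * (j + 1))))
      rwa [show eulerProd (x ^ 2) ^ 2 * ((eulerProd (x ^ 2))⁻¹ * (eulerProd (x ^ 2))⁻¹) = 1 by
        field_simp, mul_one] at this
    · rw [norm_mul _ (qFac _ _ ^ 2 * _), norm_mul (qFac _ _ ^ 2), norm_pow, norm_mul (rFac _ _)]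
      have h1 := hF N
      have h2 := hR (N - (j + 1))
      have h3 := hR (N + (j + 1))
      have := hb j
      gcongr
  have hlim2 : Tendsto (fun N : ℕ => ((qFac (x ^ 2) N *
      (∏ k ∈ Finset.range N, (1 + x ^ (2 * (k + 1))))⁻¹) ^ 2 - 1) / 4) atTop
      (𝓝 (((eulerProd (x ^ 2) * (eulerProd (x ^ 4) / eulerProd (x ^ 2))⁻¹) ^ 2 - 1) / 4)) :=
    ((((tendsto_qFac hq).mul ((tendsto_even_product hx).inv₀ (div_ne_zero h4 hE))).pow 2).sub_const
      1).div_const 4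
  rw [show (eulerProd (x ^ 2) ^ 2 / eulerProd (x ^ 4)) ^ 2 =
    (eulerProd (x ^ 2) * (eulerProd (x ^ 4) / eulerProd (x ^ 2))⁻¹) ^ 2 by field_simp]
  refine tendsto_nhds_unique hlim2 (hlim.congr fun N => ?_)
  have hp := even_partial_fractions hx hx0 (le_refl N)
  rw [tsum_eq_sum (s := Finset.range N) fun j hj => by
    rw [rFac_of_neg _ (by rw [Finset.mem_range] at hj; omega)]; ring]
  have hf := qFac_ne_zero hq N
  rw [rFac_natCast] at hp
  have h1 : qFac (x ^ 2) N * (qFac (x ^ 2) N)⁻¹ = 1 := mul_inv_cancel₀ hf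
  have h2 : ∑ j ∈ Finset.range N, (-1) ^ (j + 1) * x ^ ((j + 1) * (j + 2)) /
      (1 + x ^ (2 * (j + 1))) * (qFac (x ^ 2) N ^ 2 *
        (rFac (x ^ 2) (N - (j + 1)) * rFac (x ^ 2) (N + (j + 1)))) = qFac (x ^ 2) N ^ 2 *
      ∑ j ∈ Finset.range N, (-1) ^ (j + 1) * x ^ ((j + 1) * (j + 2)) /
      (1 + x ^ (2 * (j + 1))) * (rFac (x ^ 2) (N - (j + 1)) * rFac (x ^ 2) (N + (j + 1))) := by
    rw [Finset.mul_sum]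
    exact Finset.sum_congr rfl fun j _ => by ring
  rw [h2]
  linear_combination qFac (x ^ 2) N ^ 2 / 2 * hp -
    (qFac (x ^ 2) N * (qFac (x ^ 2) N)⁻¹ + 1) / 4 * h1

end

/-! ### The Bailey sum of the mock theta function -/

section

variable {x : ℂ} (hx : ‖x‖ < 1)

/-- The terms of a confluent `₁φ₁` series. -/
noncomputable def confluentTerm (x : ℂ) (j k : ℕ) : ℂ :=
  x ^ (k * k + 2 * k * (j + 1)) *
    ((-1) ^ k * oddFac x (j + k) * (rFac (x ^ 2) k * rFac (x ^ 2) (2 * j + 1 + k)))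

include hx

theorem exists_norm_confluentTerm_le : ∃ C : ℝ, 0 < C ∧ ∀ j k : ℕ,
    ‖confluentTerm x j k‖ ≤ C * ‖x‖ ^ (k * k + 2 * k * (j + 1)) := by
  obtain ⟨C, hC, hR⟩ := exists_norm_rFac_le (norm_sq_lt_one hx)
  obtain ⟨D, hD, hF⟩ := exists_norm_le_of_tendsto (tendsto_oddFac hx)
  refine ⟨D * (C * C), by positivity, fun j k => ?_⟩
  rw [confluentTerm, norm_mul, norm_pow, mul_comm, norm_mul, norm_mul, norm_mul, norm_pow, norm_neg,
    norm_one, one_pow, one_mul]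
  have h1 := hF (j + k)
  have h2 := hR k
  have h3 := hR (2 * j + 1 + k)
  gcongr

theorem exists_norm_confluentTerm_le_geometric : ∃ C : ℝ, 0 < C ∧ ∀ j k : ℕ,
    ‖confluentTerm x j k‖ ≤ C * ‖x‖ ^ k := by
  obtain ⟨C, hC, h⟩ := exists_norm_confluentTerm_le hx
  refine ⟨C, hC, fun j k => (h j k).trans ?_⟩
  exact mul_le_mul_of_nonneg_left (pow_le_pow_of_le_one (norm_nonneg _) hx.le (by nlinarith)) hC.le

theorem summable_confluentTerm (j : ℕ) : Summable (confluentTerm x j) := by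
  obtain ⟨C, hC, h⟩ := exists_norm_confluentTerm_le_geometric hx
  exact .of_norm_bounded ((summable_geometric_of_lt_one (norm_nonneg _) hx).mul_left _) (h j)

theorem tsum_confluentTerm_succ (j : ℕ) :
    (1 - x ^ (2 * (j + 1) + 1)) * ∑' k, confluentTerm x (j + 1) k =
      (1 - x ^ (2 * j + 1)) * ∑' k, confluentTerm x j k := by
  have hq := norm_sq_lt_one hx
  set R := rFac (x ^ 2) with hR
  -- A telescoping certificate in k for the contiguous relation. It vanishes at k = 0 through the
  -- reciprocal factorial of −1, and tends to 0.
  set G : ℕ → ℂ := fun k => x ^ (k * k + 2 * k * (j + 1)) * ((-1) ^ k * oddFac x (j + k) *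
    (R (k - 1) * R (2 * j + 2 + k)) * ((x ^ (2 * j) * x - x ^ (2 * j) * x ^ (4 * j) * x ^ 5) *
      x ^ (2 * k) - (1 - x ^ (2 * j) * x))) with hG
  have hstep : ∀ k : ℕ, (1 - x ^ (2 * j + 1)) * confluentTerm x j k -
      (1 - x ^ (2 * (j + 1) + 1)) * confluentTerm x (j + 1) k = G (k + 1) - G k := fun k => by
    have e0 := rFac_sub_one hq (k : ℤ)
    have e1 := rFac_sub_one hq ((2 * j + 2 + k : ℕ) : ℤ)
    have e2 := rFac_sub_one hq ((2 * j + 3 + k : ℕ) : ℤ)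
    have eo := oddFac_succ x (j + k)
    rw [zpow_natCast] at e0 e1 e2
    push_cast at e1 e2
    rw [show (2 * (j : ℤ) + 2 + k - 1) = 2 * j + 1 + k by ring, ← hR] at e1
    rw [show (2 * (j : ℤ) + 3 + k - 1) = 2 * j + 2 + k by ring, ← hR] at e2
    rw [← hR] at e0
    simp only [hG, confluentTerm, ← hR]
    push_cast
    rw [show j + (k + 1) = j + k + 1 by ring, show j + 1 + k = j + k + 1 by ring,
      show (2 * ((j : ℤ) + 1) + 1 + k) = 2 * j + 3 + k by ring,
      show (2 * (j : ℤ) + 2 + (k + 1)) = 2 * j + 3 + k by ring, add_sub_cancel_right, eo, e0, e1, e2]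
    ring
  have hu := (summable_confluentTerm hx j).hasSum.mul_left (1 - x ^ (2 * j + 1))
  have hv := (summable_confluentTerm hx (j + 1)).hasSum.mul_left (1 - x ^ (2 * (j + 1) + 1))
  have h1 := (hu.sub hv).tendsto_sum_nat
  have hG0 : G 0 = 0 := by
    simp only [hG]
    rw [show R ((0 : ℕ) - 1) = 0 from rFac_of_neg _ (by norm_num)]
    ring
  have h2 : Tendsto G atTop (𝓝 0) := by
    obtain ⟨C, hC, hR'⟩ := exists_norm_rFac_le hq
    obtain ⟨D, hD, hF⟩ := exists_norm_le_of_tendsto (tendsto_oddFac hx)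
    have hg := (tendsto_pow_atTop_nhds_zero_of_lt_one (norm_nonneg _) hx).const_mul
      (D * (C * C) * (‖x ^ (2 * j) * x - x ^ (2 * j) * x ^ (4 * j) * x ^ 5‖ * 1 +
        ‖1 - x ^ (2 * j) * x‖))
    rw [mul_zero] at hg
    refine squeeze_zero_norm (fun k => ?_) hg
    refine summable_norm_pow_mul hx (g := fun k => (-1) ^ k * oddFac x (j + k) *
      (R (k - 1) * R (2 * j + 2 + k)) * ((x ^ (2 * j) * x - x ^ (2 * j) * x ^ (4 * j) * x ^ 5) *
      x ^ (2 * k) - (1 - x ^ (2 * j) * x))) (fun k => ?_)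
      (fun k => k * k + 2 * k * (j + 1)) (fun k => by nlinarith) k
    rw [norm_mul, norm_mul, norm_mul, norm_mul, norm_pow, norm_neg, norm_one, one_pow, one_mul]
    have h1 := hF (j + k)
    have h2 := hR' (k - 1)
    have h3 := hR' (2 * j + 2 + k)
    have h4 : ‖x ^ (2 * k)‖ ≤ 1 := by rw [norm_pow]; exact pow_le_one₀ (norm_nonneg _) hx.le
    have h5 := norm_sub_le ((x ^ (2 * j) * x - x ^ (2 * j) * x ^ (4 * j) * x ^ 5) * x ^ (2 * k))
      (1 - x ^ (2 * j) * x)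
    rw [norm_mul] at h5
    have h6 := h5.trans (add_le_add_left (mul_le_mul_of_nonneg_left h4 (norm_nonneg _)) _)
    gcongr
  have h3 := h1.congr fun n => by rw [Finset.sum_congr rfl fun k _ => hstep k, Finset.sum_range_sub]
  rw [hG0] at h3
  have h4 := tendsto_nhds_unique h3 (h2.sub_const 0)
  linear_combination -h4

/-- The left side does not depend on j. As j → ∞ only the k = 0 term survives, with limit (x;
x²)_∞/(x²; x²)_∞. -/
theorem tsum_confluentTerm (j : ℕ) : (1 - x ^ (2 * j + 1)) * ∑' k, confluentTerm x j k =
    eulerProd x / eulerProd (x ^ 2) ^ 2 := by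
  have hq := norm_sq_lt_one hx
  have hE := eulerProd_ne_zero hq
  have hconst : ∀ i : ℕ, (1 - x ^ (2 * (j + i) + 1)) * ∑' k, confluentTerm x (j + i) k =
      (1 - x ^ (2 * j + 1)) * ∑' k, confluentTerm x j k := fun i => by
    induction i with
    | zero => rfl
    | succ i ih => rw [← ih, ← add_assoc, tsum_confluentTerm_succ hx]
  obtain ⟨C, hC, hbd⟩ := exists_norm_confluentTerm_le_geometric hx
  obtain ⟨D, hD, hbd'⟩ := exists_norm_confluentTerm_le hx
  have hadd : Tendsto (fun i => j + i) atTop atTop :=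
    tendsto_atTop.mpr fun b => (eventually_ge_atTop b).mono fun n hn => by omega
  have hodd : Tendsto (fun i => 2 * (j + i) + 1) atTop atTop :=
    tendsto_atTop.mpr fun b => (eventually_ge_atTop b).mono fun n hn => by omega
  have h1 : Tendsto (fun i => 1 - x ^ (2 * (j + i) + 1)) atTop (𝓝 1) := by
    simpa using ((tendsto_pow_atTop_nhds_zero_of_norm_lt_one hx).comp hodd).const_sub 1
  have h2 : Tendsto (fun i => ∑' k, confluentTerm x (j + i) k) atTop
      (𝓝 (∑' k : ℕ, if k = 0 then eulerProd x / eulerProd (x ^ 2) ^ 2 else 0)) := by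
    refine tendsto_tsum_of_dominated_convergence
      ((summable_geometric_of_lt_one (norm_nonneg _) hx).mul_left C) (fun k => ?_)
      (Eventually.of_forall fun i k => hbd _ k)
    rcases eq_or_ne k 0 with rfl | hk
    · have h3 : Tendsto (fun i : ℕ => (2 * (j + i : ℕ) + 1 : ℤ)) atTop atTop :=
        tendsto_atTop.mpr fun b => (eventually_ge_atTop b.toNat).mono fun n hn => by omega
      have := ((tendsto_oddFac hx).comp hadd).mul (tendsto_rFac hq h3)
      rw [if_pos rfl, show eulerProd x / eulerProd (x ^ 2) ^ 2 =
        eulerProd x / eulerProd (x ^ 2) * (eulerProd (x ^ 2))⁻¹ by field_simp]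
      refine this.congr fun i => ?_
      simp [confluentTerm, rFac, qFac]
    · rw [if_neg hk]
      have := ((tendsto_pow_atTop_nhds_zero_of_lt_one (norm_nonneg _) hx).comp hadd).const_mul D
      rw [mul_zero] at this
      refine squeeze_zero_norm (fun i => (hbd' _ k).trans (mul_le_mul_of_nonneg_left
        (pow_le_pow_of_le_one (norm_nonneg _) hx.le ?_) hD.le)) this
      have : 1 ≤ k := Nat.one_le_iff_ne_zero.mpr hk
      nlinarith
  rw [tsum_ite_eq] at h2
  have h3 := (h1.mul h2).congr hconst
  rw [one_mul] at h3
  exact tendsto_nhds_unique tendsto_const_nhds h3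

/-- The inverse square product is expanded by `odd_partial_fractions` and n = j + k is split. The
identity (j + k + 1)² + j² + j = (2j + 1)(j + 1) + k² + 2k(j + 1) separates the exponents, and the
inner sum over k is the confluent series, equal to a constant over 1 − x^{2j+1}. -/
theorem hasSum_mock (hx0 : x ≠ 0) {s : ℂ}
    (hs : HasSum (fun j : ℕ => x ^ ((2 * j + 1) * (j + 1)) / (1 + x ^ (2 * j + 1))) s) :
    HasSum (fun n : ℕ => (-1) ^ (n + 1) * x ^ ((n + 1) ^ 2) * oddFac x n /
      (∏ k ∈ Finset.range (n + 1), (1 + x ^ (2 * k + 1))) ^ 2)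
      (-(eulerProd x / eulerProd (x ^ 2) ^ 2) * s) := by
  set κ := eulerProd x / eulerProd (x ^ 2) ^ 2 with hκ
  set w : ℕ → ℂ := fun j => x ^ ((2 * j + 1) * (j + 1)) *
    (-(1 - x ^ (2 * j + 1)) * (1 + x ^ (2 * j + 1))⁻¹) with hw
  obtain ⟨C, hC, hbd⟩ := exists_norm_confluentTerm_le_geometric hx
  have hwbd : ∀ j, ‖w j‖ ≤ 2 * (1 - ‖x‖)⁻¹ * ‖x‖ ^ j := by
    refine summable_norm_pow_mul hx (g := fun j => -(1 - x ^ (2 * j + 1)) * (1 + x ^ (2 * j + 1))⁻¹)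
      (fun j => ?_) (fun j => (2 * j + 1) * (j + 1)) (fun j => by nlinarith)
    rw [norm_mul, norm_neg]
    have h1 := norm_inv_one_add_pow_le hx (n := 2 * j + 1) (by omega)
    have h2 := norm_sub_le 1 (x ^ (2 * j + 1))
    have h3 : ‖x ^ (2 * j + 1)‖ ≤ 1 := by rw [norm_pow]; exact pow_le_one₀ (norm_nonneg _) hx.le
    rw [norm_one] at h2
    have h4 : ‖1 - x ^ (2 * j + 1)‖ ≤ 2 := by linarith
    gcongr
  have hgeo := summable_geometric_of_lt_one (norm_nonneg _) hx
  have hsum : Summable fun p : ℕ × ℕ => w p.1 * confluentTerm x p.1 p.2 := by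
    refine .of_norm_bounded (g := fun p : ℕ × ℕ => (2 * (1 - ‖x‖)⁻¹ * ‖x‖ ^ p.1) * (C * ‖x‖ ^ p.2))
      ((hgeo.mul_left _).mul_of_nonneg (hgeo.mul_left _) (fun j => ?_) fun k => ?_) fun p => ?_
    · have : 0 < 1 - ‖x‖ := by linarith
      positivity
    · positivity
    · rw [norm_mul]
      exact mul_le_mul (hwbd _) (hbd _ _) (norm_nonneg _) ((norm_nonneg _).trans (hwbd _))
  have htot : ∑' p : ℕ × ℕ, w p.1 * confluentTerm x p.1 p.2 = -κ * s := by
    rw [hsum.tsum_prod, ← (hs.mul_left (-κ)).tsum_eq]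
    refine tsum_congr fun j => ?_
    dsimp only
    rw [tsum_mul_left, hκ, ← tsum_confluentTerm hx j, hw]
    ring
  have hanti := (Finset.HasAntidiagonal.sigmaAntidiagonalEquivProd (A := ℕ)).hasSum_iff.mpr hsum.hasSum
  have := hanti.sigma fun n => hasSum_fintype _
  rw [htot] at this
  refine this.congr_fun fun n => ?_
  rw [div_eq_mul_inv, ← inv_pow, ← odd_partial_fractions hx hx0 (Nat.lt_succ_self n), Finset.mul_sum]
  simp only [Function.comp, Finset.HasAntidiagonal.sigmaAntidiagonalEquivProd_apply]
  refine Eq.trans ?_ (Finset.sum_coe_sort (Finset.HasAntidiagonal.antidiagonal n)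
    fun p : ℕ × ℕ => w p.1 * confluentTerm x p.1 p.2).symm
  rw [Finset.Nat.sum_antidiagonal_eq_sum_range_succ_mk]
  refine Finset.sum_congr rfl fun j hj => ?_
  obtain ⟨k, rfl⟩ := Nat.exists_eq_add_of_le (Finset.mem_range_succ_iff.mp hj)
  rw [add_tsub_cancel_left, hw, confluentTerm, show ((j + k : ℕ) : ℤ) - j = k by push_cast; ring,
    show ((j + k : ℕ) : ℤ) + 1 + j = 2 * j + 1 + k by push_cast; ring]
  have h1 : ((-1 : ℂ) ^ j) ^ 2 = 1 := by rw [← pow_mul, mul_comm, pow_mul]; norm_num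
  dsimp only
  linear_combination (-(-1) ^ k * x ^ ((j + k + 1) ^ 2) * oddFac x (j + k) * x ^ (j * j + j) *
    ((1 - x ^ (2 * j + 1)) / (1 + x ^ (2 * j + 1))) *
    (rFac (x ^ 2) k * rFac (x ^ 2) (2 * j + 1 + k))) * h1

end

/-! ### The mock theta function as an Appell sum -/

/-- The terms of `appellTwo`. -/
noncomputable def appellTerm (τ : ℂ) (n : ℤ) : ℂ :=
  cexp (π * I * n ^ 2 * τ) / (cexp (π * I * n * τ) + cexp (-(π * I * n * τ)))

theorem appellTerm_neg (τ : ℂ) (n : ℤ) : appellTerm τ (-n) = appellTerm τ n := by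
  rw [appellTerm, appellTerm, add_comm]
  push_cast
  rw [neg_sq, show (π : ℂ) * I * -n * τ = -(π * I * n * τ) by ring, neg_neg]

theorem summable_appellTerm {τ : ℂ} (hτ : 0 < τ.im) : Summable (appellTerm τ) :=
  .of_norm_bounded ((summable_exp_neg_quadratic (mul_pos Real.pi_pos hτ) 0).mul_left _)
    (norm_appellTwo_term_le hτ le_rfl)

theorem appellTerm_natCast (τ : ℂ) (n : ℕ) : appellTerm τ n =
    cexp (π * I * τ) ^ (n * (n + 1)) / (1 + cexp (π * I * τ) ^ (2 * n)) := by
  have h : cexp (π * I * τ) ^ (n * (n + 1)) / (1 + cexp (π * I * τ) ^ (2 * n)) =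
      (cexp (π * I * n ^ 2 * τ) * cexp (π * I * n * τ)) /
        ((cexp (π * I * n * τ) + cexp (-(π * I * n * τ))) * cexp (π * I * n * τ)) := by
    rw [← Complex.exp_nat_mul, ← Complex.exp_nat_mul, ← Complex.exp_add, add_mul, ← Complex.exp_add,
      ← Complex.exp_add, neg_add_cancel, Complex.exp_zero, add_comm (1 : ℂ)]
    push_cast
    ring_nf
  rw [h, mul_div_mul_right _ _ (Complex.exp_ne_zero _), appellTerm]
  push_cast
  rfl

/-- The part of `appellTwo` of odd index. -/
noncomputable def oddAppell (τ : ℂ) : ℂ := ∑' n : ℤ, appellTerm τ (2 * n + 1)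

theorem hasSum_oddAppell {τ : ℂ} (hτ : 0 < τ.im) :
    HasSum (fun n : ℤ => appellTerm τ (2 * n + 1)) (oddAppell τ) :=
  ((summable_appellTerm hτ).comp_injective (i := fun n : ℤ => 2 * n + 1) fun a b h => by
    have : 2 * a + 1 = 2 * b + 1 := h
    omega).hasSum

theorem norm_nome_lt_one {τ : ℂ} (hτ : 0 < τ.im) : ‖cexp (π * I * τ)‖ < 1 := by
  rw [norm_cexp_mul_I, Real.exp_lt_one_iff, neg_mul, neg_lt_zero]
  exact mul_pos Real.pi_pos hτ

theorem nome_sq (τ : ℂ) : cexp (π * I * τ) ^ 2 = cexp (2 * π * I * τ) := by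
  rw [← Complex.exp_nat_mul]; push_cast; ring_nf

/-- The alternating sum is modular: the even partial fractions evaluate it as θ₄(2τ)²/2, and θ₃θ₄ =
θ₄(2·)². -/
theorem hasSum_alternating_appellTerm {τ : ℂ} (hτ : 0 < τ.im) :
    HasSum (fun n : ℤ => (-1) ^ n * appellTerm τ n) (th3 τ * th4 τ / 2) := by
  have h2τ : 0 < (2 * τ).im := by simpa using hτ
  have hs : Summable fun n : ℤ => (-1) ^ n * appellTerm τ n :=
    .of_norm_bounded (summable_appellTerm hτ).norm fun n => by simp
  convert! hs.hasSum using 1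
  have hlim := hasSum_even_limit (norm_nome_lt_one hτ) (Complex.exp_ne_zero _)
  have hE : eulerProd (cexp (π * I * τ) ^ 2) ^ 2 / eulerProd (cexp (π * I * τ) ^ 4) = th4 (2 * τ) := by
    have h := th4_mul_eta h2τ
    rw [mul_div_cancel_left₀ _ two_ne_zero, eta_eq_eulerProd, eta_eq_eulerProd τ, ← nome_sq τ,
      show 2 * π * I * (2 * τ) = (4 : ℕ) * (π * I * τ) by push_cast; ring, Complex.exp_nat_mul,
      show π / 12 * I * (2 * τ) = (2 : ℕ) * (π / 12 * I * τ) by push_cast; ring, Complex.exp_nat_mul] at h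
    have h4 : eulerProd (cexp (π * I * τ) ^ 4) ≠ 0 := eulerProd_ne_zero (by
      rw [norm_pow]; exact pow_lt_one₀ (norm_nonneg _) (norm_nome_lt_one hτ) (by norm_num))
    rw [div_eq_iff h4]
    refine mul_left_cancel₀ (pow_ne_zero 2 (Complex.exp_ne_zero (π / 12 * I * τ))) ?_
    linear_combination -h
  rw [hE, ← th3_mul_th4 hτ] at hlim
  have hnat := hs.hasSum.nat_add_neg
  rw [hasSum_nat_add_iff' 1 |>.symm] at hnat
  have h2 := (hlim.mul_left 2).unique (hnat.congr_fun fun n => ?_)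
  · have h0 : appellTerm τ 0 = 1 / 2 := by simp [appellTerm]; norm_num
    simp only [Finset.sum_range_one, Nat.cast_zero, neg_zero, zpow_zero, one_mul, h0] at h2
    linear_combination h2
  · rw [appellTerm_neg, zpow_neg, ← inv_zpow, show (-1 : ℂ)⁻¹ = -1 by norm_num, zpow_natCast,
      appellTerm_natCast]
    ring

/-- Half the difference of the full and the alternating sum isolates the odd indices, so M differs
from an `appellTwo` quotient by a modular form. -/
theorem oddAppell_eq {τ : ℂ} (hτ : 0 < τ.im) : oddAppell τ = (appellTwo τ - th3 τ * th4 τ / 2) / 2 := by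
  have he := ((summable_appellTerm hτ).comp_injective (i := fun n : ℤ => 2 * n) fun a b h => by
    have : 2 * a = 2 * b := h
    omega).hasSum
  have h1 := (hasSum_int_even_add_odd he (hasSum_oddAppell hτ)).unique (summable_appellTerm hτ).hasSum
  have h2 := (hasSum_int_even_add_odd (f := fun n : ℤ => (-1) ^ n * appellTerm τ n)
    (he.congr_fun fun n => by
      rw [zpow_mul]; norm_num) ((hasSum_oddAppell hτ).neg.congr_fun fun n => by
      rw [zpow_add₀ (by norm_num), zpow_mul]; norm_num)).unique (hasSum_alternating_appellTerm hτ)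
  have h3 : appellTwo τ = ∑' n : ℤ, appellTerm τ n := rfl
  linear_combination (h1 - h2 - h3) / 2

theorem hasSum_nat_oddAppell {τ : ℂ} (hτ : 0 < τ.im) :
    HasSum (fun j : ℕ => cexp (2 * π * I * τ) ^ ((2 * j + 1) * (j + 1)) /
      (1 + cexp (2 * π * I * τ) ^ (2 * j + 1))) (oddAppell τ / 2) := by
  have h := ((hasSum_oddAppell hτ).nat_add_neg_add_one).div_const 2
  refine h.congr_fun fun n => ?_
  rw [show 2 * (-((n : ℤ) + 1)) + 1 = -((2 * n + 1 : ℕ) : ℤ) by push_cast; ring, appellTerm_neg,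
    show 2 * (n : ℤ) + 1 = ((2 * n + 1 : ℕ) : ℤ) by push_cast; ring, appellTerm_natCast, ← nome_sq,
    ← pow_mul, ← pow_mul]
  ring

theorem prod_Icc_one (f : ℕ → ℂ) (n : ℕ) :
    ∏ k ∈ Finset.Icc 1 n, f k = ∏ k ∈ Finset.range n, f (k + 1) := by
  rw [Finset.range_eq_Ico, Finset.prod_Ico_add' f 0 n 1, zero_add]
  rfl

theorem mockM_eq {τ : ℂ} (hτ : 0 < τ.im) : mockM τ = -oddAppell (8 * τ) / th2 (8 * τ) := by
  have h8 := eight_mul_im_pos hτ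
  have hx := norm_cexp_two_pi_I_lt_one h8
  have h := hasSum_mock hx (Complex.exp_ne_zero _) (hasSum_nat_oddAppell h8)
  have hq : ∀ (m : ℤ) (k : ℕ), m = 8 * k → qpow τ m = cexp (2 * π * I * (8 * τ)) ^ k := fun m k hm => by
    rw [← Complex.exp_nat_mul, qpow, hm]
    push_cast
    ring_nf
  have hM : mockM τ = qpow τ (-1) * (-(eulerProd (cexp (2 * π * I * (8 * τ))) /
      eulerProd (cexp (2 * π * I * (8 * τ)) ^ 2) ^ 2) * (oddAppell (8 * τ) / 2)) := by
    rw [mockM, ← h.tsum_eq]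
    congr 1
    refine tsum_congr fun n => ?_
    rw [hq _ ((n + 1) ^ 2) (by push_cast; ring), ← Finset.prod_pow, oddFac]
    rw [prod_Icc_one, prod_Icc_one]
    congr 1
    · congr 1
      exact Finset.prod_congr rfl fun k _ => by rw [hq _ (2 * k + 1) (by push_cast; ring)]
    · exact Finset.prod_congr rfl fun k _ => by rw [hq _ (2 * k + 1) (by push_cast; ring)]
  have h2 := th2_mul_eta h8
  rw [eta_eq_eulerProd, eta_eq_eulerProd, show 2 * π * I * (2 * (8 * τ)) = (2 : ℕ) * (2 * π * I * (8 * τ))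
    by push_cast; ring, Complex.exp_nat_mul,
    show cexp (π / 12 * I * (2 * (8 * τ))) = cexp (π / 12 * I * (8 * τ)) ^ 2 by
      rw [← Complex.exp_nat_mul]; push_cast; ring_nf] at h2
  have hE := eulerProd_ne_zero (norm_sq_lt_one hx)
  have hc : qpow τ 1 = cexp (π / 12 * I * (8 * τ)) ^ 3 := by
    rw [← Complex.exp_nat_mul, qpow]; push_cast; ring_nf
  have hq1 := qpow_mul_qpow_neg τ 1
  have n0 := Complex.exp_ne_zero (π / 12 * I * (8 * τ))
  -- This is the product formula for θ₂ at 8τ; its leading factor 2q cancels the prefactor q^{−1} of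
  -- M and the half in the one-sided sum.
  have h3 : th2 (8 * τ) * eulerProd (cexp (2 * π * I * (8 * τ))) =
      2 * qpow τ 1 * eulerProd (cexp (2 * π * I * (8 * τ)) ^ 2) ^ 2 := by
    refine mul_left_cancel₀ n0 ?_
    rw [hc]
    linear_combination h2
  rw [hM, eq_div_iff (th2_ne_zero h8)]
  have h4 : eulerProd (cexp (2 * π * I * (8 * τ))) / eulerProd (cexp (2 * π * I * (8 * τ)) ^ 2) ^ 2 *
      th2 (8 * τ) = 2 * qpow τ 1 := by
    rw [div_mul_eq_mul_div, div_eq_iff (pow_ne_zero 2 hE)]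
    linear_combination h3
  linear_combination -qpow τ (-1) * oddAppell (8 * τ) / 2 * h4 - oddAppell (8 * τ) * hq1

/-! ### The Appell–Lerch functions -/

theorem qpow_add (τ : ℂ) (m n : ℤ) : qpow τ (m + n) = qpow τ m * qpow τ n := by
  rw [qpow, qpow, qpow, ← Complex.exp_add]
  push_cast
  ring_nf

theorem qpow_ne_zero (τ : ℂ) (n : ℤ) : qpow τ n ≠ 0 := Complex.exp_ne_zero _

theorem lerch_denom_norm {τ : ℂ} (hτ : 0 < τ.im) (n : ℤ) :
    32 * π * τ.im * ‖qpow τ (16 * n - 8)‖ ≤ ‖1 - qpow τ (32 * n - 16)‖ := by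
  set w : ℂ := 2 * π * I * ((16 * n - 8 : ℤ) : ℂ) * τ with hw
  have h := two_mul_abs_re_le_norm_sub w
  have hre : w.re = -(2 * π * ((16 * n - 8 : ℤ) : ℝ) * τ.im) := by
    rw [hw, ← ofReal_intCast]
    simp
  have h1 : (1 : ℂ) - qpow τ (32 * n - 16) = qpow τ (16 * n - 8) * (cexp (-w) - cexp w) := by
    rw [show (32 * n - 16 : ℤ) = (16 * n - 8) + (16 * n - 8) by ring, qpow_add, mul_sub,
      show qpow τ (16 * n - 8) = cexp w from rfl, ← Complex.exp_add, ← Complex.exp_add,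
      add_neg_cancel, Complex.exp_zero]
  have h2 : (8 : ℝ) ≤ |((16 * n - 8 : ℤ) : ℝ)| := by
    rw [← Int.cast_abs]
    exact_mod_cast le_abs'.mpr (by omega)
  rw [h1, norm_mul, mul_comm]
  refine mul_le_mul_of_nonneg_left (le_trans ?_ h) (norm_nonneg _)
  rw [hre, abs_neg, abs_mul, abs_of_pos hτ, abs_mul, abs_of_pos (by positivity : (0 : ℝ) < 2 * π)]
  have := mul_le_mul_of_nonneg_left h2 (by positivity : 0 ≤ 4 * π * τ.im)
  linarith

theorem lerch_denom_ne_zero {τ : ℂ} (hτ : 0 < τ.im) (n : ℤ) : 1 - qpow τ (32 * n - 16) ≠ 0 :=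
  norm_pos_iff.mp (lt_of_lt_of_le (mul_pos (by positivity) (norm_pos_iff.mpr (qpow_ne_zero _ _)))
    (lerch_denom_norm hτ n))

theorem summable_lerch {τ : ℂ} (hτ : 0 < τ.im) (a : ℤ) :
    Summable fun n : ℤ => qpow τ (16 * n ^ 2 + a * n) / (1 - qpow τ (32 * n - 16)) := by
  have hπ := Real.pi_pos
  refine .of_norm_bounded (((summable_exp_neg_quadratic (c := 32 * π * τ.im) (by positivity)
    (-(2 * π * τ.im) * (a - 16))).mul_left (Real.exp (-(16 * π * τ.im)))).mul_left
      (32 * π * τ.im)⁻¹) fun n => ?_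
  have h := lerch_denom_norm hτ n
  have hpos : 0 < 32 * π * τ.im * ‖qpow τ (16 * n - 8)‖ :=
    mul_pos (by positivity) (norm_pos_iff.mpr (qpow_ne_zero _ _))
  rw [norm_div]
  refine (div_le_div_of_nonneg_left (norm_nonneg _) hpos h).trans (le_of_eq ?_)
  rw [norm_qpow, norm_qpow, div_eq_mul_inv, mul_inv, ← Real.exp_neg, ← Real.exp_add, mul_left_comm,
    ← Real.exp_add]
  push_cast
  ring_nf

/-- Reflection n ↦ −1 − n exchanges even and odd indices in the series of θ₂, so each parity gives
half. -/
theorem hasSum_halfPeriod {τ : ℂ} (hτ : 0 < τ.im) :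
    HasSum (fun n : ℤ => cexp (π * I * (2 * n + 1 / 2) ^ 2 * τ)) (th2 τ / 2) := by
  set f : ℤ → ℂ := fun n => cexp (π * I * (n + 1 / 2) ^ 2 * τ) with hf
  have h : HasSum f (th2 τ) := hasSum_th2 hτ
  have he : HasSum (fun n : ℤ => f (2 * n)) (∑' n : ℤ, f (2 * n)) :=
    (h.summable.comp_injective (i := fun n : ℤ => 2 * n) fun a b h => by
      have : 2 * a = 2 * b := h
      omega).hasSum
  have hr : ∀ n : ℤ, f (2 * n + 1) = f (2 * (-1 - n)) := fun n => by
    simp only [hf]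
    push_cast
    ring_nf
  have ho : HasSum (fun n : ℤ => f (2 * n + 1)) (∑' n : ℤ, f (2 * n)) :=
    ((Equiv.subLeft (-1 : ℤ)).hasSum_iff.mpr he).congr_fun hr
  have h1 := (hasSum_int_even_add_odd he ho).unique h
  rw [← h1, add_self_div_two]
  refine he.congr_fun fun n => ?_
  simp only [hf]
  push_cast
  rfl

theorem cexp_neg_pi_half (n : ℤ) : cexp (-(π * I * (n + 1 / 2))) = (-1) ^ n * -I := by
  rw [show -(π * I * ((n : ℂ) + 1 / 2)) = π * I * ((-n : ℤ) : ℂ) + -(π / 2 * I) by push_cast; ring,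
    Complex.exp_add, cexp_int_mul_pi_I, Complex.exp_neg, Complex.exp_pi_div_two_mul_I, Complex.inv_I,
    zpow_neg, ← inv_zpow]
  norm_num

theorem theta_sub_half {τ : ℂ} (c : ℂ) (T : ℂ) {s : ℂ}
    (h : HasSum (fun n : ℤ => cexp (π * I * (n + 1 / 2) ^ 2 * T + 2 * π * I * (n + 1 / 2) * (c * τ))) s) :
    theta (c * τ - 1 / 2) T = -I * s := by
  rw [theta, ← h.tsum_eq, ← tsum_mul_left]
  refine tsum_congr fun n => ?_
  rw [show 2 * π * I * ((n : ℂ) + 1 / 2) * (c * τ - 1 / 2) =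
    2 * π * I * (n + 1 / 2) * (c * τ) + -(π * I * (n + 1 / 2)) by ring, Complex.exp_add,
    cexp_neg_pi_half, Complex.exp_add]
  linear_combination -I * cexp (2 * π * I * (n + 1 / 2) * (c * τ)) *
    cexp (π * I * (n + 1 / 2) ^ 2 * T) * neg_one_zpow_mul_self n

/-- Completing the square identifies this theta value, like the next one, with a power of q times
θ₂(8τ)/2. The two μ-values therefore share a denominator. -/
theorem theta_first {τ : ℂ} (hτ : 0 < τ.im) :
    theta (-8 * τ - 1 / 2) (32 * τ) = -I * (qpow τ (-1) * (th2 (8 * τ) / 2)) := by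
  refine theta_sub_half (-8) _ (((hasSum_halfPeriod (eight_mul_im_pos hτ)).mul_left _).congr_fun fun n => ?_)
  rw [qpow, ← Complex.exp_add]
  push_cast
  ring_nf

theorem theta_second {τ : ℂ} (hτ : 0 < τ.im) :
    theta (-24 * τ - 1 / 2) (32 * τ) = -I * (qpow τ (-9) * (th2 (8 * τ) / 2)) := by
  refine theta_sub_half (-24) _ ((((Equiv.neg ℤ).hasSum_iff.mpr
    (hasSum_halfPeriod (eight_mul_im_pos hτ))).mul_left _).congr_fun fun n => ?_)
  simp only [Function.comp, Equiv.neg_apply]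
  rw [qpow, ← Complex.exp_add]
  push_cast
  ring_nf

theorem mu_eq (τ : ℂ) (b : ℤ) (w : ℂ) (hw : w = b * τ - 1 / 2) :
    mu (-16 * τ) w (32 * τ) = qpow τ (-8) / theta w (32 * τ) *
      ∑' n : ℤ, qpow τ (16 * n ^ 2 + (16 + b) * n) / (1 - qpow τ (32 * n - 16)) := by
  rw [mu]
  have hb : -cexp (2 * π * I * w) = cexp (2 * π * I * b * τ) := by
    rw [hw, show 2 * π * I * (b * τ - 1 / 2) = 2 * π * I * b * τ - π * I by ring, Complex.exp_sub,
      Complex.exp_pi_mul_I, div_neg, neg_neg, div_one]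
  congr 1
  · congr 1
    rw [qpow]
    push_cast
    ring_nf
  · refine tsum_congr fun n => ?_
    rw [hb, ← Complex.exp_int_mul, ← Complex.exp_add, qpow, qpow, qpow, ← Complex.exp_add]
    push_cast
    ring_nf

/-- With X = q^{16n−8}, the combined numerators give q^{16n²−8n}(X − 1) over 1 − X² = (1 − X)(1 +
X). The quotient −q^{16n²−8n}/(1 + X) is, after a shift of n, the odd-index Appell term at 8τ. -/
theorem mu_difference {τ : ℂ} (hτ : 0 < τ.im) :
    -(2 * I * qpow τ (-1) * mu (-16 * τ) (-8 * τ - 1 / 2) (32 * τ)) +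
      2 * I * qpow τ (-1) * mu (-16 * τ) (-24 * τ - 1 / 2) (32 * τ) = 4 * mockM τ := by
  have h8 := eight_mul_im_pos hτ
  have n2 := th2_ne_zero h8
  have s1 := (summable_lerch hτ (16 + -8)).hasSum
  have s2 := (summable_lerch hτ (16 + -24)).hasSum
  have hE : HasSum (fun n : ℤ => qpow τ (16 * n ^ 2 + -8 * n) / (1 + qpow τ (16 * n - 8)))
      (oddAppell (8 * τ)) := by
    refine ((Equiv.subRight (1 : ℤ)).hasSum_iff.mpr (hasSum_oddAppell h8)).congr_fun fun n => ?_
    simp only [Function.comp, Equiv.subRight_apply]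
    have hd : (1 : ℂ) + qpow τ (16 * n - 8) = (cexp (π * I * ((2 * (n - 1) + 1 : ℤ) : ℂ) * (8 * τ)) +
      cexp (-(π * I * ((2 * (n - 1) + 1 : ℤ) : ℂ) * (8 * τ)))) *
        cexp (π * I * ((2 * (n - 1) + 1 : ℤ) : ℂ) * (8 * τ)) := by
      rw [add_mul, ← Complex.exp_add, ← Complex.exp_add, neg_add_cancel, Complex.exp_zero, add_comm, qpow]
      push_cast
      ring_nf
    rw [hd, appellTerm, eq_comm, ← mul_div_mul_right _ _
      (Complex.exp_ne_zero (π * I * ((2 * (n - 1) + 1 : ℤ) : ℂ) * (8 * τ))), ← Complex.exp_add, qpow]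
    push_cast
    ring_nf
  have hcomb := ((s1.mul_left (qpow τ (-8))).sub s2).unique (hE.neg.congr_fun fun n => ?_)
  · rw [mu_eq τ (-8) _ (by push_cast; ring), mu_eq τ (-24) _ (by push_cast; ring), theta_first hτ,
      theta_second hτ, mockM_eq hτ]
    have q8 : qpow τ (-8) = (qpow τ (-1)) ^ 8 := by rw [qpow, qpow, ← Complex.exp_nat_mul]; push_cast; ring_nf
    have q9 : qpow τ (-9) = (qpow τ (-1)) ^ 9 := by rw [qpow, qpow, ← Complex.exp_nat_mul]; push_cast; ring_nf
    have q0 := qpow_ne_zero τ (-1)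
    rw [eq_comm] at hcomb
    rw [hcomb, q8, q9]
    field_simp
    ring
  · have d1 := lerch_denom_ne_zero hτ n
    have hd : (1 : ℂ) - qpow τ (32 * n - 16) = (1 - qpow τ (16 * n - 8)) * (1 + qpow τ (16 * n - 8)) := by
      rw [show (32 * n - 16 : ℤ) = (16 * n - 8) + (16 * n - 8) by ring, qpow_add]
      ring
    rw [hd] at d1
    have hA : qpow τ (-8) * qpow τ (16 * n ^ 2 + (16 + -8) * n) =
        qpow τ (16 * n ^ 2 + -8 * n) * qpow τ (16 * n - 8) := by
      rw [← qpow_add, ← qpow_add]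
      ring_nf
    rw [hd, ← mul_div_assoc, hA, ← sub_div, ← neg_div, div_eq_div_iff d1 (right_ne_zero_of_mul d1),
      show (16 + -24 : ℤ) = -8 by norm_num]
    ring

/-! ### Fourier coefficients and sieved forms -/

theorem exists_hasSum_of_periodic {h : ℝ} (hh : 0 < h) {F : ℂ → ℂ}
    (hol : ∀ τ : ℂ, 0 < τ.im → DifferentiableAt ℂ F τ)
    (per : ∀ τ : ℂ, 0 < τ.im → F (τ + h) = F τ) {l : ℂ}
    (bd : Tendsto (fun τ : ℍ => F τ) atImInfty (𝓝 l)) :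
    ∃ b : ℕ → ℂ, ∀ τ : ℂ, 0 < τ.im → HasSum (fun n => b n * cexp (2 * π * I * τ / h) ^ n) (F τ) := by
  have hE := eqOn_comp_ofComplex (f := fun τ : ℍ => F τ) (F := F) fun _ => rfl
  refine ⟨_, fun τ hτ => UpperHalfPlane.hasSum_qExpansion (f := fun τ : ℍ => F τ) hh (fun z => ?_)
    (UpperHalfPlane.mdifferentiable_iff.mpr (DifferentiableOn.congr (fun z hz =>
      (hol z hz).differentiableWithinAt) hE)) (bd.isBigO_one ℝ) ⟨τ, hτ⟩⟩
  -- Off the upper half-plane `ofComplex` takes a default value, which is the same at z and z + h.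
  by_cases hz : 0 < z.im
  · have hz' : 0 < (z + h).im := by simpa using hz
    rw [hE hz, hE hz', per z hz]
  · have hz' : ¬ 0 < (z + h).im := by simpa using hz
    simp only [Function.comp]
    rw [UpperHalfPlane.ofComplex_apply_of_im_nonpos (not_lt.mp hz),
      UpperHalfPlane.ofComplex_apply_of_im_nonpos (not_lt.mp hz')]

theorem integral_qpow_mul (n m : ℤ) :
    ∫ u in (0 : ℝ)..1, qpow (u + I) n * qpow (u + I) (-m) = if n = m then 1 else 0 := by
  split_ifs with h
  · subst h
    simp [qpow_mul_qpow_neg]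
  · have hnm : ((n : ℂ) - m) ≠ 0 := sub_ne_zero.mpr (by exact_mod_cast h)
    have hc : 2 * π * I * ((n : ℂ) - m) ≠ 0 := mul_ne_zero Complex.two_pi_I_ne_zero hnm
    have e : ∀ u : ℝ, qpow (u + I) n * qpow (u + I) (-m) =
        qpow I (n - m) * cexp (2 * π * I * ((n : ℂ) - m) * u) := fun u => by
      rw [qpow, qpow, qpow, ← Complex.exp_add, ← Complex.exp_add]
      push_cast
      ring_nf
    simp only [e]
    rw [intervalIntegral.integral_const_mul, integral_exp_mul_complex hc]
    have h1 : cexp (2 * π * I * ((n : ℂ) - m)) = 1 := by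
      rw [show 2 * π * I * ((n : ℂ) - m) = ((n - m : ℤ) : ℂ) * (2 * π * I) by push_cast; ring]
      exact Complex.exp_int_mul_two_pi_mul_I _
    simp [h1]

/-- Fourier orthogonality on the line Im τ = 1. It evaluates `coeffA` and also gives uniqueness of
expansions. -/
theorem integral_eq_coeff {c : ℤ → ℂ} {F : ℂ → ℂ}
    (hF : ∀ τ : ℂ, 0 < τ.im → HasSum (fun n : ℤ => c n * qpow τ n) (F τ)) (m : ℤ) :
    ∫ u in (0 : ℝ)..1, F (u + I) * qpow (u + I) (-m) = c m := by
  have him : ∀ u : ℝ, ((u : ℂ) + I).im = 1 := fun u => by simp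
  have hs := (hF I (by simp)).summable.norm.mul_right ‖qpow I (-m)‖
  have hn : ∀ (u : ℝ) (n : ℤ), ‖qpow (u + I) n‖ = ‖qpow I n‖ := fun u n => by
    rw [norm_qpow, norm_qpow, him, I_im]
  have h := intervalIntegral.hasSum_integral_of_dominated_convergence (μ := volume) (a := 0) (b := 1)
    (F := fun (n : ℤ) (u : ℝ) => c n * qpow (u + I) n * qpow (u + I) (-m))
    (f := fun u : ℝ => F (u + I) * qpow (u + I) (-m))
    (fun n _ => ‖c n * qpow I n‖ * ‖qpow I (-m)‖)
    (fun n => by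
      have : Continuous fun u : ℝ => c n * qpow (u + I) n * qpow (u + I) (-m) := by
        unfold qpow; fun_prop
      exact this.aestronglyMeasurable)
    (fun n => Eventually.of_forall fun u _ => by
      rw [norm_mul, norm_mul, hn, hn, ← norm_mul])
    (Eventually.of_forall fun u _ => hs) intervalIntegrable_const
    (Eventually.of_forall fun u _ => (hF _ (by rw [him]; exact one_pos)).mul_right _)
  refine h.unique ?_
  refine (hasSum_ite_eq m (c m)).congr_fun fun n => ?_
  simp only [mul_assoc]
  rw [intervalIntegral.integral_const_mul, integral_qpow_mul]
  split_ifs with h <;> simp [h]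

/-- A T-eigenvector divided by η³ is again a T-eigenvector, so at 8τ its exponents lie in one class
modulo 8; the hypothesis on s and m selects −(m + 1). -/
theorem exists_hasSum_polarForm {p : Fin 6 → ℂ} {s : ℂ} {m : ℕ}
    (hp : ∀ τ : ℂ, 0 < τ.im → thetaQuartic p (τ + 1) = s * thetaQuartic p τ)
    (hs : s * cexp (π * I / 4) ^ m = 1) :
    ∃ b : ℕ → ℂ, ∀ τ : ℂ, 0 < τ.im →
      HasSum (fun n : ℕ => b n * qpow τ (8 * n - (m + 1))) (polarForm p 0 (8 * τ)) := by
  obtain ⟨l, hl⟩ := tendsto_polarForm_mul p 0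
  have hm : ∃ l' : ℂ, Tendsto (fun τ : ℍ => cexp (π * I / 4 * τ) ^ m) atImInfty (𝓝 l') := by
    rcases Nat.eq_zero_or_pos m with rfl | h0
    · exact ⟨1, by simp⟩
    · have := (tendsto_cexp_atImInfty (a := π / 4) (by positivity)).pow m
      refine ⟨_, this.congr fun τ => ?_⟩
      push_cast
      ring_nf
  obtain ⟨l', hl'⟩ := hm
  have hq : ∀ τ : ℂ, qpow (τ / 8) 1 = cexp (π * I / 4 * τ) := fun τ => by
    rw [qpow]; push_cast; ring_nf
  have hadd : ∀ τ : ℂ, cexp (π * I / 4 * (τ + 1)) = cexp (π * I / 4) * cexp (π * I / 4 * τ) := fun τ => by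
    rw [← Complex.exp_add]; ring_nf
  have heta : ∀ τ : ℂ, η (τ + 1) ^ 3 = cexp (π * I / 4) * η τ ^ 3 := fun τ => by
    rw [eta_add_one, mul_pow, ← Complex.exp_nat_mul]
    push_cast
    ring_nf
  obtain ⟨b, hb⟩ := exists_hasSum_of_periodic one_pos
    (F := fun τ => polarForm p 0 τ * qpow (τ / 8) 1 * cexp (π * I / 4 * τ) ^ m)
    (fun τ hτ => by
      have := differentiableAt_polarForm p 0 hτ
      simp only [hq]
      fun_prop)
    (fun τ hτ => by
      have hc := Complex.exp_ne_zero (π * I / 4)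
      have hη := eta_ne_zero hτ
      rw [hq, hq, polarForm, polarForm, ofReal_one, hp τ hτ, hadd, heta, mul_pow]
      simp only [zero_mul, add_zero]
      field_simp
      linear_combination thetaQuartic p τ * hs)
    (hl.mul hl')
  refine ⟨b, fun τ hτ => ?_⟩
  have h := (hb (8 * τ) (eight_mul_im_pos hτ)).mul_right (qpow τ (-(m + 1)))
  have h1 : qpow (8 * τ / 8) 1 * cexp (π * I / 4 * (8 * τ)) ^ m * qpow τ (-(m + 1)) = 1 := by
    rw [mul_div_cancel_left₀ _ (by norm_num : (8 : ℂ) ≠ 0), qpow, qpow, ← Complex.exp_nat_mul,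
      ← Complex.exp_add, ← Complex.exp_add, ← Complex.exp_zero]
    push_cast
    ring_nf
  rw [show polarForm p 0 (8 * τ) * qpow (8 * τ / 8) 1 * cexp (π * I / 4 * (8 * τ)) ^ m *
    qpow τ (-(m + 1)) = polarForm p 0 (8 * τ) by linear_combination polarForm p 0 (8 * τ) * h1] at h
  refine h.congr_fun fun n => ?_
  rw [sub_eq_add_neg, qpow_add, mul_assoc, ← Complex.exp_nat_mul]
  congr 2
  rw [qpow]
  push_cast
  ring_nf

theorem sieveA_eq_of_hasSum {a b : ℕ → ℂ} {k l : ℕ} {r : ℤ} {G : ℂ → ℂ}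
    (ha : ∀ τ : ℂ, 0 < τ.im → HasSum (fun n : ℕ => a n * qpow τ (8 * n - k)) (G τ))
    (hA : ∀ τ : ℂ, 0 < τ.im → HasSum (fun n : ℕ => b n * qpow τ (8 * n - l)) (formA τ - G τ))
    (hr : -k ≡ r [ZMOD 8]) (hr' : ¬ -l ≡ r [ZMOD 8]) {τ : ℂ} (hτ : 0 < τ.im) : sieveA r τ = G τ := by
  have hinj : ∀ m : ℕ, Function.Injective fun n : ℕ => 8 * (n : ℤ) - m := fun m x y h => by
    have : 8 * (x : ℤ) - m = 8 * y - m := h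
    omega
  have h1 := fun τ hτ => hasSum_int_of_nat (hinj k) a (ha τ hτ)
  have h2 := fun τ hτ => hasSum_int_of_nat (hinj l) b (hA τ hτ)
  have hc : ∀ n : ℤ, coeffA n = Function.extend (fun n : ℕ => 8 * (n : ℤ) - k) a 0 n +
      Function.extend (fun n : ℕ => 8 * (n : ℤ) - l) b 0 n := fun n => by
    rw [coeffA]
    refine integral_eq_coeff (F := formA) (c := fun n => Function.extend (fun n : ℕ => 8 * (n : ℤ) - k) a 0 n +
      Function.extend (fun n : ℕ => 8 * (n : ℤ) - l) b 0 n) (fun τ hτ => ?_) n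
    · have := (h1 τ hτ).add (h2 τ hτ)
      rw [add_sub_cancel] at this
      exact this.congr_fun fun n => add_mul _ _ _
  rw [sieveA, ← (h1 τ hτ).tsum_eq]
  refine tsum_congr fun n => ?_
  rw [Int.ModEq] at hr hr'
  split_ifs with h
  · rw [Int.ModEq] at h
    rw [hc, Function.extend_apply' b, Pi.zero_apply, add_zero]
    rintro ⟨j, rfl⟩
    omega
  · rw [Int.ModEq] at h
    rw [Function.extend_apply', Pi.zero_apply, zero_mul]
    rintro ⟨j, rfl⟩
    omega

/-- T exchanges θ₃⁴ and θ₄⁴. The symmetric and antisymmetric halves of θ₄⁴ have eigenvalues 1 and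
−1, hence exponents −1 and −5 modulo 8. -/
theorem sieveA_three_seven {τ : ℂ} (hτ : 0 < τ.im) :
    sieveA 7 τ = (th4 (8 * τ) ^ 4 + th3 (8 * τ) ^ 4) / (2 * η (8 * τ) ^ 3) ∧
      sieveA 3 τ = (th4 (8 * τ) ^ 4 - th3 (8 * τ) ^ 4) / (2 * η (8 * τ) ^ 3) := by
  have hz : cexp (π * I / 4) ^ 4 = -1 := cexp_pi_I_div_four_pow_four
  obtain ⟨a, ha⟩ := exists_hasSum_polarForm (p := ![0, 1 / 2, 1 / 2, 0, 0, 0]) (s := 1) (m := 0)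
    (fun τ _ => by
      simp only [thetaQuartic, Matrix.cons_val, th3_add_one, th4_add_one]
      ring) (by simp)
  obtain ⟨b, hb⟩ := exists_hasSum_polarForm (p := ![0, -1 / 2, 1 / 2, 0, 0, 0]) (s := -1) (m := 4)
    (fun τ _ => by
      simp only [thetaQuartic, Matrix.cons_val, th3_add_one, th4_add_one]
      ring) (by rw [hz]; norm_num)
  have hsum : ∀ τ : ℂ, 0 < τ.im → formA τ = polarForm ![0, 1 / 2, 1 / 2, 0, 0, 0] 0 (8 * τ) +
      polarForm ![0, -1 / 2, 1 / 2, 0, 0, 0] 0 (8 * τ) := fun τ hτ => by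
    rw [formA_eq hτ, polarForm, polarForm, ← add_div]
    simp only [thetaQuartic, Matrix.cons_val]
    ring
  rw [sieveA_eq_of_hasSum (k := 1) (l := 5) (a := a) (b := b)
      (G := fun τ => polarForm ![0, 1 / 2, 1 / 2, 0, 0, 0] 0 (8 * τ))
      (fun τ hτ => (ha τ hτ).congr_fun fun n => by norm_num)
      (fun τ hτ => by
        rw [hsum τ hτ, add_sub_cancel_left]
        exact (hb τ hτ).congr_fun fun n => by norm_num) (by decide) (by decide) hτ,
    sieveA_eq_of_hasSum (k := 5) (l := 1) (a := b) (b := a)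
      (G := fun τ => polarForm ![0, -1 / 2, 1 / 2, 0, 0, 0] 0 (8 * τ))
      (fun τ hτ => (hb τ hτ).congr_fun fun n => by norm_num)
      (fun τ hτ => by
        rw [hsum τ hτ, add_sub_cancel_right]
        exact (ha τ hτ).congr_fun fun n => by norm_num) (by decide) (by decide) hτ]
  simp only [polarForm, thetaQuartic, Matrix.cons_val]
  constructor <;> ring

/-! ### Integral power series in the nome -/

/-- The power series `p`, evaluated at the nome, converges to `F`. -/
def HasNomeSeries (p : PowerSeries ℂ) (F : ℂ → ℂ) : Prop :=
  ∀ τ : ℂ, 0 < τ.im → HasSum (fun n => PowerSeries.coeff n p * cexp (π * I * τ) ^ n) (F τ)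

namespace HasNomeSeries

variable {p q : PowerSeries ℂ} {F G : ℂ → ℂ}

theorem sub (hp : HasNomeSeries p F) (hq : HasNomeSeries q G) :
    HasNomeSeries (p - q) fun τ => F τ - G τ := fun τ hτ =>
  ((hp τ hτ).sub (hq τ hτ)).congr_fun fun n => by rw [map_sub, sub_mul]

theorem const_mul (c : ℂ) (hp : HasNomeSeries p F) :
    HasNomeSeries (PowerSeries.C c * p) fun τ => c * F τ := fun τ hτ =>
  ((hp τ hτ).mul_left c).congr_fun fun n => by rw [PowerSeries.coeff_C_mul, mul_assoc]

theorem mul (hp : HasNomeSeries p F) (hq : HasNomeSeries q G) :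
    HasNomeSeries (p * q) fun τ => F τ * G τ := fun τ hτ => by
  have h1 := (hp τ hτ).summable.norm
  have h2 := (hq τ hτ).summable.norm
  have h3 := (summable_norm_sum_mul_antidiagonal_of_summable_norm h1 h2).of_norm.hasSum
  rw [← tsum_mul_tsum_eq_tsum_sum_antidiagonal_of_summable_norm h1 h2, (hp τ hτ).tsum_eq,
    (hq τ hτ).tsum_eq] at h3
  refine h3.congr_fun fun n => ?_
  rw [PowerSeries.coeff_mul, Finset.sum_mul]
  refine Finset.sum_congr rfl fun k hk => ?_
  rw [← Finset.HasAntidiagonal.mem_antidiagonal.mp hk, pow_add]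
  ring

theorem congr (hp : HasNomeSeries p F) (h : ∀ τ : ℂ, 0 < τ.im → F τ = G τ) : HasNomeSeries p G :=
  fun τ hτ => h τ hτ ▸ hp τ hτ

theorem int_expansion (hp : HasNomeSeries p F) {τ : ℂ} (hτ : 0 < τ.im) :
    HasSum (fun n : ℕ => PowerSeries.coeff n p * qpow τ n) (F (2 * τ)) := by
  refine (hp (2 * τ) (by simpa using hτ)).congr_fun fun n => ?_
  rw [qpow, ← Complex.exp_nat_mul]
  push_cast
  ring_nf

theorem unique (hp : HasNomeSeries p F) (hq : HasNomeSeries q F) : p = q := by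
  ext n
  have he : Function.Injective fun n : ℕ => (n : ℤ) := fun a b h => by simpa using h
  have h := fun (r : PowerSeries ℂ) (hr : HasNomeSeries r F) => integral_eq_coeff
    (fun τ hτ => hasSum_int_of_nat he (fun n => PowerSeries.coeff n r) (hr.int_expansion hτ)) n
  have h1 := (h p hp).symm.trans (h q hq)
  rwa [he.extend_apply, he.extend_apply] at h1

end HasNomeSeries

/-- Grouping a series by exponent gives a power series with integral coefficients as soon as each
exponent occurs finitely often. -/
theorem hasNomeSeries_of_fibers {ι : Type*} {F : ℂ → ℂ} {a : ι → ℤ} {e : ι → ℕ} {S : ℕ → Finset ι}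
    (hS : ∀ i n, i ∈ S n ↔ e i = n) (h : ∀ τ : ℂ, 0 < τ.im →
      HasSum (fun i => (a i : ℂ) * cexp (π * I * τ) ^ e i) (F τ)) :
    HasNomeSeries (PowerSeries.map (Int.castRingHom ℂ) (.mk fun n => ∑ i ∈ S n, a i)) F := fun τ hτ => by
  have h1 := ((Equiv.sigmaFiberEquiv e).hasSum_iff.mpr (h τ hτ)).sigma (g := fun n =>
    (∑ i ∈ S n, (a i : ℂ)) * cexp (π * I * τ) ^ n) fun n => by
      have h2 := Finset.hasSum (S n) fun i => (a i : ℂ) * cexp (π * I * τ) ^ e i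
      have h3 : ∑ i ∈ S n, (a i : ℂ) * cexp (π * I * τ) ^ e i =
          (∑ i ∈ S n, (a i : ℂ)) * cexp (π * I * τ) ^ n := by
        rw [Finset.sum_mul]
        exact Finset.sum_congr rfl fun i hi => by rw [(hS i n).mp hi]
      rw [h3] at h2
      exact (Equiv.subtypeEquivRight fun i => (hS i n).symm).hasSum_iff.mpr h2
  refine h1.congr_fun fun n => ?_
  simp

/-- The integral power series of `η³`. -/
noncomputable def etaSeries : PowerSeries ℤ :=
  .mk fun n => ∑ k ∈ Finset.range (n + 1) with k * (k + 1) = n, (-1) ^ k * (2 * k + 1)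

/-- The integral power series of `θ₄`. -/
noncomputable def thetaSeries : PowerSeries ℤ :=
  .mk fun n => ∑ k ∈ Finset.Icc (-(n : ℤ)) n with k.natAbs ^ 2 = n, (-1) ^ k.natAbs

/-- The integral power series of `appellFour`. -/
noncomputable def appellSeries : PowerSeries ℤ :=
  .mk fun n => ∑ p ∈ Finset.range (n + 1) ×ˢ Finset.range (n + 1) with
    (p.1 + 1) * (2 * p.2 + 1) + p.2 ^ 2 = n, (-1) ^ (p.2 + 1)

/-- The integral power series of `eisenStar`. -/
noncomputable def eisenSeries : PowerSeries ℤ :=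
  .mk fun n => (if n = 0 then 1 else 0) + 24 * (∑ d ∈ n.divisors with Odd d, d : ℕ)

theorem hasNomeSeries_eta : HasNomeSeries (etaSeries.map (Int.castRingHom ℂ))
    fun τ => η τ ^ 3 * cexp (-(π * I * τ / 4)) := by
  refine hasNomeSeries_of_fibers (a := fun k : ℕ => (-1) ^ k * (2 * k + 1)) (e := fun k => k * (k + 1))
    (S := fun n => {k ∈ Finset.range (n + 1) | k * (k + 1) = n}) (fun k n => ?_) fun τ hτ => ?_
  · simp only [Finset.mem_filter, Finset.mem_range, and_iff_right_iff_imp]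
    intro h
    nlinarith
  · refine ((hasSum_eta_pow_three hτ).mul_right _).congr_fun fun k => ?_
    rw [mul_assoc _ (cexp _) (cexp _), ← Complex.exp_add, ← Complex.exp_nat_mul]
    push_cast
    ring_nf

theorem hasNomeSeries_th4 : HasNomeSeries (thetaSeries.map (Int.castRingHom ℂ)) th4 := by
  refine hasNomeSeries_of_fibers (a := fun k : ℤ => (-1) ^ k.natAbs) (e := fun k => k.natAbs ^ 2)
    (S := fun n => {k ∈ Finset.Icc (-(n : ℤ)) n | k.natAbs ^ 2 = n}) (fun k n => ?_) fun τ hτ => ?_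
  · simp only [Finset.mem_filter, Finset.mem_Icc, and_iff_right_iff_imp]
    intro h
    have : k.natAbs ≤ n := by nlinarith
    omega
  · refine (hasSum_jacobiTheta₂_term (1 / 2) hτ).congr_fun fun k => ?_
    have h1 : ((k.natAbs : ℂ)) ^ 2 = (k : ℂ) ^ 2 := by
      rw [← Int.cast_natCast, ← Int.cast_pow, Int.natAbs_sq, Int.cast_pow]
    have h2 : ((-1 : ℂ)) ^ k.natAbs = (-1) ^ k := by
      rcases Int.natAbs_eq k with h | h
      · conv_rhs => rw [h, zpow_natCast]
      · conv_rhs => rw [h, zpow_neg, zpow_natCast, ← inv_pow]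
        norm_num
    rw [jacobiTheta₂_term, Complex.exp_add, ← Complex.exp_nat_mul]
    push_cast
    rw [h1, h2, ← cexp_int_mul_pi_I]
    ring_nf

theorem hasNomeSeries_appell : HasNomeSeries (appellSeries.map (Int.castRingHom ℂ))
    fun τ => appellFour τ / 2 * cexp (π * I * τ / 4) := by
  refine hasNomeSeries_of_fibers (a := fun p : ℕ × ℕ => (-1) ^ (p.2 + 1))
    (e := fun p => (p.1 + 1) * (2 * p.2 + 1) + p.2 ^ 2)
    (S := fun n => {p ∈ Finset.range (n + 1) ×ˢ Finset.range (n + 1) |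
      (p.1 + 1) * (2 * p.2 + 1) + p.2 ^ 2 = n}) (fun p n => ?_) fun τ hτ => ?_
  · simp only [Finset.mem_filter, Finset.mem_product, Finset.mem_range, and_iff_right_iff_imp]
    intro h
    constructor <;> nlinarith [Nat.zero_le (p.1 * p.2), Nat.zero_le (p.2 ^ 2)]
  · refine ((hasSum_indefinite hτ).mul_right _).congr_fun fun p => ?_
    rw [mul_assoc _ (cexp _) (cexp _), ← Complex.exp_add, ← Complex.exp_nat_mul]
    push_cast
    ring_nf

theorem hasNomeSeries_eisenStar : HasNomeSeries (eisenSeries.map (Int.castRingHom ℂ))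
    fun τ => eisenStar (τ / 2) := fun τ hτ => by
  have hx := norm_nome_lt_one hτ
  have hbd : ∀ n : ℕ, ‖((∑ d ∈ n.divisors with Odd d, d : ℕ) : ℂ) * cexp (π * I * τ) ^ n‖ ≤
      (n : ℝ) ^ 2 * ‖cexp (π * I * τ)‖ ^ n := fun n => by
    rw [norm_mul, norm_pow, Complex.norm_natCast]
    refine mul_le_mul_of_nonneg_right ?_ (by positivity)
    have h1 : ∑ d ∈ n.divisors with Odd d, d ≤ n * n := by
      refine (Finset.sum_le_sum_of_subset (Finset.filter_subset _ _)).trans ?_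
      refine (Finset.sum_le_card_nsmul _ _ n fun d hd => Nat.divisor_le hd).trans ?_
      exact Nat.mul_le_mul_right n (Nat.card_divisors_le_self n)
    rw [sq]
    exact_mod_cast h1
  have hs : Summable fun n : ℕ => ((∑ d ∈ n.divisors with Odd d, d : ℕ) : ℂ) * cexp (π * I * τ) ^ n :=
    .of_norm_bounded (summable_pow_mul_geometric_of_norm_lt_one 2 (by simpa using hx)) hbd
  have h0 : eisenStar (τ / 2) = 1 + 24 * ∑' n : ℕ, ((∑ d ∈ n.divisors with Odd d, d : ℕ) : ℂ) *
      cexp (π * I * τ) ^ n := by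
    rw [eisenStar]
    congr 2
    refine tsum_congr fun n => ?_
    rw [qpow, ← Complex.exp_nat_mul]
    push_cast
    ring_nf
  beta_reduce
  rw [h0]
  refine ((hasSum_ite_eq (0 : ℕ) (1 : ℂ)).add (hs.hasSum.mul_left 24)).congr_fun fun n => ?_
  rw [eisenSeries, PowerSeries.coeff_map, PowerSeries.coeff_mk]
  rcases eq_or_ne n 0 with rfl | hn
  · simp
  · simp [hn, mul_assoc]

/-- The integral power series `H` of `q 𝒬(q)` in the variable `q⁴`. -/
noncomputable def calQSeries : PowerSeries ℤ :=
  (eisenSeries * thetaSeries - 4 * (etaSeries * appellSeries)) *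
    PowerSeries.invOfUnit (etaSeries * thetaSeries) 1

theorem constantCoeff_eta_mul_theta : PowerSeries.constantCoeff (etaSeries * thetaSeries) = (1 : ℤˣ) := by
  rw [map_mul, ← PowerSeries.coeff_zero_eq_constantCoeff_apply,
    ← PowerSeries.coeff_zero_eq_constantCoeff_apply, etaSeries, thetaSeries, PowerSeries.coeff_mk,
    PowerSeries.coeff_mk]
  decide

theorem mul_calQSeries : etaSeries * thetaSeries * calQSeries =
    eisenSeries * thetaSeries - 4 * (etaSeries * appellSeries) := by
  rw [calQSeries, mul_left_comm, PowerSeries.mul_invOfUnit _ _ constantCoeff_eta_mul_theta, mul_one]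

theorem calQSeries_coeff : PowerSeries.coeff 0 calQSeries = 1 ∧ PowerSeries.coeff 1 calQSeries = 28 ∧
    PowerSeries.coeff 2 calQSeries = 39 ∧ PowerSeries.coeff 3 calQSeries = 196 ∧
    PowerSeries.coeff 4 calQSeries = 161 ∧ PowerSeries.coeff 5 calQSeries = 756 := by
  have hJ : ∀ n, PowerSeries.coeff n etaSeries =
    ∑ k ∈ Finset.range (n + 1) with k * (k + 1) = n, (-1) ^ k * (2 * (k : ℤ) + 1) :=
    fun n => PowerSeries.coeff_mk _ _
  have hT : ∀ n, PowerSeries.coeff n thetaSeries =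
    ∑ k ∈ Finset.Icc (-(n : ℤ)) n with k.natAbs ^ 2 = n, (-1) ^ k.natAbs :=
    fun n => PowerSeries.coeff_mk _ _
  have hG : ∀ n, PowerSeries.coeff n appellSeries =
    ∑ p ∈ Finset.range (n + 1) ×ˢ Finset.range (n + 1) with
      (p.1 + 1) * (2 * p.2 + 1) + p.2 ^ 2 = n, (-1) ^ (p.2 + 1) := fun n => PowerSeries.coeff_mk _ _
  have hE : ∀ n, PowerSeries.coeff n eisenSeries =
    (if n = 0 then 1 else 0) + 24 * ((∑ d ∈ n.divisors with Odd d, d : ℕ) : ℤ) :=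
    fun n => PowerSeries.coeff_mk _ _
  have J0 : PowerSeries.coeff 0 etaSeries = 1 := by rw [hJ]; decide
  have J1 : PowerSeries.coeff 1 etaSeries = 0 := by rw [hJ]; decide
  have J2 : PowerSeries.coeff 2 etaSeries = -3 := by rw [hJ]; decide
  have J3 : PowerSeries.coeff 3 etaSeries = 0 := by rw [hJ]; decide
  have J4 : PowerSeries.coeff 4 etaSeries = 0 := by rw [hJ]; decide
  have J5 : PowerSeries.coeff 5 etaSeries = 0 := by rw [hJ]; decide
  have T0 : PowerSeries.coeff 0 thetaSeries = 1 := by rw [hT]; decide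
  have T1 : PowerSeries.coeff 1 thetaSeries = -2 := by rw [hT]; decide
  have T2 : PowerSeries.coeff 2 thetaSeries = 0 := by rw [hT]; decide
  have T3 : PowerSeries.coeff 3 thetaSeries = 0 := by rw [hT]; decide
  have T4 : PowerSeries.coeff 4 thetaSeries = 2 := by rw [hT]; decide
  have T5 : PowerSeries.coeff 5 thetaSeries = 0 := by rw [hT]; decide
  have G0 : PowerSeries.coeff 0 appellSeries = 0 := by rw [hG]; decide
  have G1 : PowerSeries.coeff 1 appellSeries = -1 := by rw [hG]; decide
  have G2 : PowerSeries.coeff 2 appellSeries = -1 := by rw [hG]; decide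
  have G3 : PowerSeries.coeff 3 appellSeries = -1 := by rw [hG]; decide
  have G4 : PowerSeries.coeff 4 appellSeries = 0 := by rw [hG]; decide
  have G5 : PowerSeries.coeff 5 appellSeries = -1 := by rw [hG]; decide
  have E0 : PowerSeries.coeff 0 eisenSeries = 1 := by rw [hE]; decide
  have E1 : PowerSeries.coeff 1 eisenSeries = 24 := by rw [hE]; decide
  have E2 : PowerSeries.coeff 2 eisenSeries = 24 := by rw [hE]; decide
  have E3 : PowerSeries.coeff 3 eisenSeries = 96 := by rw [hE]; decide
  have E4 : PowerSeries.coeff 4 eisenSeries = 24 := by rw [hE]; decide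
  have E5 : PowerSeries.coeff 5 eisenSeries = 144 := by rw [hE]; decide
  have h4 : (4 : PowerSeries ℤ) = PowerSeries.C 4 := by simp
  -- Comparing coefficients in the product identity gives a triangular linear system for the first
  -- six coefficients, with unit diagonal.
  have h := fun n => congrArg (PowerSeries.coeff n) mul_calQSeries
  simp only [map_sub, h4, PowerSeries.coeff_C_mul] at h
  have e0 := h 0
  have e1 := h 1
  have e2 := h 2
  have e3 := h 3
  have e4 := h 4
  have e5 := h 5
  simp only [PowerSeries.coeff_mul, Finset.Nat.sum_antidiagonal_eq_sum_range_succ_mk,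
    Finset.sum_range_succ, Finset.sum_range_zero, Nat.reduceSub, Nat.sub_zero, zero_add,
    J0, J1, J2, J3, J4, J5, T0, T1, T2, T3, T4, T5, G0, G1, G2, G3, G4, G5, E0, E1, E2, E3, E4, E5]
    at e0 e1 e2 e3 e4 e5
  refine ⟨?_, ?_, ?_, ?_, ?_, ?_⟩ <;> linarith

/-- The polar form times q^{1/8} has period 2 and a limit at i∞, hence a power series in the nome.
Clearing denominators gives the identity defining `calQSeries`, and cancellation in the power series
domain transfers integrality. At 8τ the nome is q⁴. -/
theorem calQ_hasSum {τ : ℂ} (hτ : 0 < τ.im) :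
    HasSum (fun α : ℕ => ((PowerSeries.coeff α calQSeries : ℤ) : ℂ) * qpow τ (4 * α - 1)) (calQ τ) := by
  obtain ⟨l, hl⟩ := tendsto_polarForm_mul completionCoeff (-2 / 3)
  have hadd : ∀ τ : ℂ, qpow ((τ + 1) / 8) 1 = cexp (π * I / 4) * qpow (τ / 8) 1 := fun τ => by
    rw [qpow, qpow, ← Complex.exp_add]
    push_cast
    ring_nf
  have heta : ∀ τ : ℂ, η (τ + 1) ^ 3 = cexp (π * I / 4) * η τ ^ 3 := fun τ => by
    rw [eta_add_one, mul_pow, ← Complex.exp_nat_mul]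
    push_cast
    ring_nf
  obtain ⟨b, hb⟩ := exists_hasSum_of_periodic two_pos
    (F := fun τ => polarForm completionCoeff (-2 / 3) τ * qpow (τ / 8) 1)
    (fun τ hτ => by
      have := differentiableAt_polarForm completionCoeff (-2 / 3) hτ
      unfold qpow
      fun_prop)
    (fun τ hτ => by
      have hτ1 : 0 < (τ + 1).im := by simpa using hτ
      have hc := Complex.exp_ne_zero (π * I / 4)
      have hη := eta_ne_zero hτ
      rw [ofReal_ofNat, show τ + 2 = τ + 1 + 1 by ring, hadd, hadd, polarForm, polarForm, thetaQuartic,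
        thetaQuartic, heta, heta, holSum_add_one hτ1, holSum_add_one hτ]
      simp only [completionCoeff, Matrix.cons_val, th3_add_one, th4_add_one, zero_mul, zero_add, add_zero]
      field_simp) hl
  have hB : HasNomeSeries (.mk b) fun τ => calQ (τ / 8) * qpow (τ / 8) 1 := fun τ hτ => by
    have hc := polarForm_completion (τ := τ / 8) (by
      rw [show (τ / 8).im = τ.im / 8 by simp]; positivity)
    rw [mul_div_cancel₀ _ (by norm_num)] at hc
    beta_reduce
    rw [← hc]
    refine (hb τ hτ).congr_fun fun n => ?_
    rw [PowerSeries.coeff_mk, ofReal_ofNat]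
    ring_nf
  have h1 := (hasNomeSeries_eta.mul hasNomeSeries_th4).mul hB
  have h2 := (hasNomeSeries_eisenStar.mul hasNomeSeries_th4).sub
    ((hasNomeSeries_eta.mul hasNomeSeries_appell).const_mul 4)
  have heq := h1.unique (h2.congr fun τ hτ => by
    have h8 : 0 < (τ / 8).im := by rw [show (τ / 8).im = τ.im / 8 by simp]; positivity
    have e8 : 8 * (τ / 8) = τ := by ring
    have n3 := pow_ne_zero 3 (eta_ne_zero hτ)
    have n4 := th4_ne_zero hτ
    have hx : cexp (-(π * I * τ / 4)) * qpow (τ / 8) 1 = 1 := by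
      rw [qpow, ← Complex.exp_add, ← Complex.exp_zero]
      push_cast
      ring_nf
    have hy : cexp (-(π * I * τ / 4)) * cexp (π * I * τ / 4) = 1 := by
      rw [← Complex.exp_add, neg_add_cancel, Complex.exp_zero]
    rw [calQ, seriesF0_eq h8, theta4_eq h8, e8, show 4 * (τ / 8) = τ / 2 by ring]
    have hQ : (eisenStar (τ / 2) / η τ ^ 3 - 4 * (appellFour τ / 2) / th4 τ) * (η τ ^ 3 * th4 τ) =
        eisenStar (τ / 2) * th4 τ - 4 * (appellFour τ / 2) * η τ ^ 3 := by
      generalize η τ ^ 3 = e at n3 ⊢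
      field_simp
    linear_combination (-4 * (appellFour τ / 2) * η τ ^ 3) * hy - hQ -
      (eisenStar (τ / 2) / η τ ^ 3 - 4 * (appellFour τ / 2) / th4 τ) * (η τ ^ 3 * th4 τ) * hx)
  have hN := congrArg (PowerSeries.map (Int.castRingHom ℂ)) mul_calQSeries
  have h4 : (4 : PowerSeries ℤ) = PowerSeries.C 4 := by simp
  rw [map_mul, map_mul, map_sub, map_mul, h4, map_mul, map_mul, PowerSeries.map_C] at hN
  simp only [map_ofNat] at hN heq
  have h0 : etaSeries.map (Int.castRingHom ℂ) * thetaSeries.map (Int.castRingHom ℂ) ≠ 0 := fun h => by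
    have hc := congrArg (Int.castRingHom ℂ) constantCoeff_eta_mul_theta
    rw [← PowerSeries.coeff_zero_eq_constantCoeff_apply, ← PowerSeries.coeff_map, map_mul, h] at hc
    simp at hc
  have hmk := mul_left_cancel₀ h0 (heq.trans hN.symm)
  have h := (hB (8 * τ) (eight_mul_im_pos hτ)).mul_right (qpow τ (-1))
  beta_reduce at h
  rw [mul_div_cancel_left₀ _ (by norm_num : (8 : ℂ) ≠ 0), mul_assoc (calQ τ), qpow_mul_qpow_neg,
    mul_one, hmk] at h
  refine h.congr_fun fun n => ?_
  rw [PowerSeries.coeff_map, sub_eq_add_neg, qpow_add, ← Complex.exp_nat_mul, qpow, ← mul_assoc]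
  congr 2
  push_cast
  ring_nf

/-! ### The final identities -/

/-- The Appell sums enter as −2(`holFour` − `holTwo`) = θ₃⁴/2. Added to 2θ₃⁴ − θ₄⁴ − θ₃²θ₄²/2 this
gives the stated coefficients. -/
theorem calQ_sub_mockM {τ : ℂ} (hτ : 0 < τ.im) : calQ τ - 4 * mockM τ =
    quotForm ![0, 5 / 2, -1, 0, 0, -1 / 2] 0 τ := by
  have h8 := eight_mul_im_pos hτ
  have h := two_mul_eta_pow_three h8
  have n3 := pow_ne_zero 3 (eta_ne_zero h8)
  have n2 := th2_ne_zero h8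
  have hM : mockM τ * η (8 * τ) ^ 3 =
      -(holTwo (8 * τ) - th3 (8 * τ) ^ 2 * th4 (8 * τ) ^ 2 / 4) / 2 := by
    rw [mockM_eq hτ, oddAppell_eq h8, div_mul_eq_mul_div, div_eq_iff n2, holTwo]
    linear_combination -(appellTwo (8 * τ) - th3 (8 * τ) * th4 (8 * τ) / 2) / 4 * h
  rw [calQ_eq hτ, quotForm, mixedForm, thetaQuartic, sub_eq_iff_eq_add, div_eq_iff n3, add_mul,
    div_mul_cancel₀ _ n3, mul_assoc, hM]
  simp only [Matrix.cons_val]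
  linear_combination -2 * holFour_sub_holTwo h8

/-- The quartic 5/2·θ₃⁴ − θ₄⁴ is −7/2 times (θ₄⁴ − θ₃⁴)/2 plus 3/2 times (θ₄⁴ + θ₃⁴)/2; the term
θ₃²θ₄² is B. -/
theorem calQ_eq_sieve {τ : ℂ} (hτ : 0 < τ.im) : calQ τ =
    -(7 / 2) * sieveA 3 τ + 3 / 2 * sieveA 7 τ - 1 / 2 * formB τ + 4 * mockM τ := by
  have n3 := pow_ne_zero 3 (eta_ne_zero (eight_mul_im_pos hτ))
  rw [← sub_eq_iff_eq_add, calQ_sub_mockM hτ, (sieveA_three_seven hτ).1, (sieveA_three_seven hτ).2,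
    formB_eq hτ, quotForm, mixedForm, thetaQuartic]
  simp only [Matrix.cons_val]
  generalize η (8 * τ) ^ 3 = e at n3 ⊢
  field_simp
  ring

end MockQ

/-! ### Assembly of the four assertions -/

theorem theorem7 :
    -- the expansion `𝒬 = q⁻¹ + 28 q³ + 39 q⁷ + 196 q¹¹ + 161 q¹⁵ + 756 q¹⁹ + ⋯`
    (∃ H : ℕ → ℤ,
      (H 0 = 1 ∧ H 1 = 28 ∧ H 2 = 39 ∧ H 3 = 196 ∧ H 4 = 161 ∧ H 5 = 756) ∧
      ∀ τ : UpperHalfPlane,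
        HasSum (fun α : ℕ => (H α : ℂ) * MockQ.qpow τ (4 * (α : ℤ) - 1)) (MockQ.calQ τ)) ∧
    -- the identity
    (∀ τ : UpperHalfPlane,
      MockQ.calQ τ =
        -(7 / 2) * MockQ.sieveA 3 τ + 3 / 2 * MockQ.sieveA 7 τ - 1 / 2 * MockQ.formB τ
        - 2 * Complex.I * MockQ.qpow τ (-1) *
            MockQ.mu (-16 * (τ : ℂ)) (-8 * (τ : ℂ) - 1 / 2) (32 * (τ : ℂ))
        + 2 * Complex.I * MockQ.qpow τ (-1) *
            MockQ.mu (-16 * (τ : ℂ)) (-24 * (τ : ℂ) - 1 / 2) (32 * (τ : ℂ))) ∧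
    -- `𝒬` is the holomorphic part of a harmonic weak Maass form whose non-holomorphic part is
    -- the period integral of `η(8τ)³`, and whose shadow is `η(8τ)³`, with explicit constants
    (∃ (N : ℕ) (f fMinus : UpperHalfPlane → ℂ),
      MockQ.IsHarmonicWeakMaassFormHalf N f ∧
      MockQ.HasParts f (fun τ => MockQ.calQ τ) fMinus ∧
      (∀ τ : UpperHalfPlane,
        fMinus τ = -(2 * (Real.sqrt 2 : ℂ) * Complex.I) *
          MockQ.periodIntegral (fun z => ModularForm.eta (8 * z) ^ 3) τ) ∧
      (∀ τ : UpperHalfPlane,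
        MockQ.xiOp (1 / 2) f τ = -4 * ModularForm.eta (8 * (τ : ℂ)) ^ 3)) ∧
    -- `𝒬 - 4 M` is a weakly holomorphic modular form
    (∃ N : ℕ, MockQ.IsWeaklyHolomorphicHalf N
      (fun τ => MockQ.calQ τ - 4 * MockQ.mockM τ)) := by
  refine ⟨⟨fun n => PowerSeries.coeff n MockQ.calQSeries, MockQ.calQSeries_coeff, fun τ => MockQ.calQ_hasSum τ.im_pos⟩,
    -- Level 64 = 4·16 accommodates ∑ q^{16n²}, which enters through θ₄(8τ).
    fun τ => ?_, ⟨64, _, _, MockQ.isHarmonicWeakMaassFormHalf_quotForm MockQ.completionCoeff (-2 / 3),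
      MockQ.hasParts_completion fun τ => MockQ.calQ_hasSum τ.im_pos, MockQ.etaPeriod_eight_eq, MockQ.xiOp_completion⟩,
    ⟨64, ?_⟩⟩
  · rw [MockQ.calQ_eq_sieve τ.im_pos, ← MockQ.mu_difference τ.im_pos]
    ring
  · simp only [MockQ.calQ_sub_mockM (UpperHalfPlane.im_pos _)]
    exact MockQ.isWeaklyHolomorphicHalf_quotForm _
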